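/- **Setting.** Let $N\ge 1$, $p>1$ with $p<1+\frac{4}{N-1}$ if $N\ge2$, $0\le q<p$ and $M>0$. Let $f,g:\mathbb R\to\mathbb R$ be locally Lipschitz with $|f(x)|\le M(1+|x|^q)$ and $|g(x)|\le M(1+|x|)$ for all $x$, and put $F(a)=\int_0^a f$. Let $T:\mathbb R^N\to(0,\infty)$ be $1$-Lipschitz (for instance the blow-up graph of $u$), let $(u_0,u_1)\in H^1_{loc,u}(\mathbb R^N)\times L^2_{loc,u}(\mathbb R^N)$ (uniformly local spaces: $\sup_a\int_{|x-a|\le1}|u_0|^2+|\nabla u_0|^2+|u_1|^2\,dx<\infty$), and let $u$ be a solution of $$u_{tt}=\Delta u+|u|^{p-1}u+f(u)+g(u_t),\qquad (u,u_t)(0)=(u_0,u_1),$$ defined on $D=\{(x,t): 0\le t<T(x)\}$. Solution means finite energy solution: locally in $D$, $(u,u_t)$ is continuous in time, up to $t=0$, with values in $H^1\times L^2$, $u$ is $C^1$ in time with values in $L^2$, the right-hand side $|u|^{p-1}u+f(u)+g(u_t)$ belongs to $L^1_tL^2_x$, and the equation holds in the sense of distributions for $0<t<T(x)$. Let $x_0\in\mathbb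 R^N$ be non-characteristic: for some $\delta_0\in(0,1)$ the cone $\{(\xi,\tau)\ne(x_0,T(x_0)):0\le\tau\le T(x_0)-\delta_0|\xi-x_0|\}$ is contained in $D$. For $0<T_0\le T(x_0)$ define $w=w_{x_0,T_0}$ by $$u(x,t)=(T_0-t)^{-\frac2{p-1}}w(y,s),\qquad y=\frac{x-x_0}{T_0-t},\quad s=-\log(T_0-t).$$ Let $B$ be the unit ball of $\mathbb R^N$, $\alpha=\frac2{p-1}-\frac{N-1}2>0$, $\rho(y)=(1-|y|^2)^\alpha$, $\gamma=\min\left(\frac12,\frac{p-q}{p-1}\right)$, and $$E(w(s))=\int_B\Big(\tfrac12w_s^2+\tfrac12|\nabla w|^2-\tfrac12(y\cdot\nabla w)^2+\tfrac{p+1}{(p-1)^2}w^2-\tfrac1{p+1}|w|^{p+1}\Big)\rho\,dy-e^{-\frac{2(p+1)s}{p-1}}\int_BF\big(e^{\frac{2s}{p-1}}w\big)\rho\,dy-e^{-\gamma s}\int_Bww_s\,\rho\,dy .$$ **Corollary 3.1 (Bounds on $E$).** There are constants $S_3$ and $C$ depending only on $N,p,q,M$, and a function $M_0(\cdot,\cdot)$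 depending only on $N,p,q,M$, such that the following holds for all $f,g,T,u_0,u_1,u,x_0,\delta_0,T_0$ as above. Put $$\hat s_3=\max(S_3,-\log T_0),\qquad t_3=T_0-e^{-\hat s_3},\qquad M_0=M_0\Big(\hat s_3,\ \|(u(t_3),u_t(t_3))\|_{H^1\times L^2\left(B\left(x_0,\,e^{-\hat s_3}/\delta_0\right)\right)}\Big).$$ Then for all $s\ge\hat s_3$ the integrals in $E(w(s))$ converge absolutely and $$-C\le E(w(s))\le M_0,$$ and for all $s_2\ge s_1\ge\hat s_3$, $$\int_{s_1}^{s_2}\int_Bw_s^2(y,s)\,\frac{\rho(y)}{1-|y|^2}\,dy\,ds\le M_0 .$$ -/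

import Mathlib

open MeasureTheory Filter Topology

open scoped ContDiff

noncomputable section

namespace PerturbedWave

/-- The space `ℝ^N` with its Euclidean norm. -/
abbrev Sp (N : ℕ) : Type := EuclideanSpace ℝ (Fin N)

/-! ### Function spaces -/

/-- `ζ` is the weak gradient of `φ` on the open set `U`: for every test function `χ` supported in
`U` and every direction `e`, `∫ φ ∂ₑχ = - ∫ (ζ · e) χ`. -/
def IsWeakGradientOn {N : ℕ} (U : Set (Sp N)) (φ : Sp N → ℝ) (ζ : Sp N → Sp N) : Prop :=
  ∀ χ : Sp N → ℝ, ContDiff ℝ ∞ χ → HasCompactSupport χ → tsupport χ ⊆ U →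
    ∀ e : Sp N, ∫ x, φ x * fderiv ℝ χ x e = - ∫ x, inner ℝ (ζ x) e * χ x

/-- The uniformly local space `L²_{loc,u}(ℝ^N)` (for scalar or vector valued functions). -/
def MemL2LocUnif {N : ℕ} {F : Type*} [NormedAddCommGroup F] (φ : Sp N → F) : Prop :=
  AEStronglyMeasurable φ volume ∧
    (⨆ a : Sp N, ∫⁻ x in Metric.closedBall a 1, ‖φ x‖ₑ ^ 2) < ⊤

/-- The uniformly local space `H¹_{loc,u}(ℝ^N)`. -/
def MemH1LocUnif {N : ℕ} (φ : Sp N → ℝ) : Prop :=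
  MemL2LocUnif φ ∧ ∃ ζ : Sp N → Sp N, IsWeakGradientOn Set.univ φ ζ ∧ MemL2LocUnif ζ

/-! ### The wave equation `u_tt = Δu + |u|^{p-1} u + f(u) + g(u_t)`

Points of space-time are written `(t, x)`, and functions of space-time are curried with the time
first. -/

/-- The part `{(t, x) | 0 ≤ t < T x}` of the domain below the graph of `T`. -/
def influenceDomain {N : ℕ} (T : Sp N → ℝ) : Set (ℝ × Sp N) :=
  {z | 0 ≤ z.1 ∧ z.1 < T z.2}

/-- The cone `C_{x,t,δ} = {(ξ, τ) ≠ (x, t) | 0 ≤ τ ≤ t - δ |ξ - x|}`. -/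
def cone {N : ℕ} (x : Sp N) (t δ : ℝ) : Set (ℝ × Sp N) :=
  {z | z ≠ (t, x) ∧ 0 ≤ z.1 ∧ z.1 ≤ t - δ * ‖z.2 - x‖}

/-- The right-hand side `|u|^{p-1} u + f(u) + g(u_t)`, as a function of the values of `u`
and `u_t`. -/
def source (p : ℝ) (f g : ℝ → ℝ) (a b : ℝ) : ℝ :=
  |a| ^ (p - 1) * a + f a + g b

/-- `u` is a finite energy solution of `u_tt = Δu + |u|^{p-1} u + f(u) + g(u_t)` below the graph
of `T`, with initial data `(u₀, u₁)`, with time derivative `v = u_t` and spatial gradient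
`G = ∇u`. That is, locally in space, `u` is continuous in time with values in `H¹` and `C¹` in time
with values in `L²` (up to the time `t = 0`), the right-hand side is locally in `L¹_t L²_x`, and
the equation holds in the sense of distributions. -/
structure IsSolution {N : ℕ} (p : ℝ) (f g : ℝ → ℝ) (T : Sp N → ℝ) (u₀ u₁ : Sp N → ℝ)
    (u v : ℝ → Sp N → ℝ) (G : ℝ → Sp N → Sp N) : Prop where
  meas_u : AEStronglyMeasurable (fun z : ℝ × Sp N => u z.1 z.2)
    (volume.restrict (influenceDomain T))
  meas_v : AEStronglyMeasurable (fun z : ℝ × Sp N => v z.1 z.2)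
    (volume.restrict (influenceDomain T))
  meas_G : AEStronglyMeasurable (fun z : ℝ × Sp N => G z.1 z.2)
    (volume.restrict (influenceDomain T))
  /-- `u(t)`, `∇u(t)` and `u_t(t)` are locally square integrable for every `t`. -/
  memLp : ∀ t : ℝ, 0 ≤ t → ∀ K : Set (Sp N), IsCompact K → (∀ x ∈ K, t < T x) →
    MemLp (u t) 2 (volume.restrict K) ∧ MemLp (G t) 2 (volume.restrict K) ∧
      MemLp (v t) 2 (volume.restrict K)
  /-- `G = ∇u`. -/
  gradient : ∀ t : ℝ, 0 ≤ t → IsWeakGradientOn {x | t < T x} (u t) (G t)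
  /-- `t ↦ (u(t), u_t(t))` is continuous with values in `H¹ × L²`, locally in space. -/
  continuous : ∀ t : ℝ, 0 ≤ t → ∀ K : Set (Sp N), IsCompact K → (∀ x ∈ K, t < T x) →
    Tendsto (fun τ => eLpNorm (fun x => u τ x - u t x) 2 (volume.restrict K))
        (𝓝[Set.Ici 0] t) (𝓝 0) ∧
      Tendsto (fun τ => eLpNorm (fun x => G τ x - G t x) 2 (volume.restrict K))
        (𝓝[Set.Ici 0] t) (𝓝 0) ∧
      Tendsto (fun τ => eLpNorm (fun x => v τ x - v t x) 2 (volume.restrict K))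
        (𝓝[Set.Ici 0] t) (𝓝 0)
  /-- `v = u_t`: the derivative of `t ↦ u(t)` with values in `L²`, locally in space. -/
  time_deriv : ∀ t : ℝ, 0 ≤ t → ∀ K : Set (Sp N), IsCompact K → (∀ x ∈ K, t < T x) →
    Tendsto (fun τ => eLpNorm (fun x => (u τ x - u t x) / (τ - t) - v t x) 2 (volume.restrict K))
      (𝓝[Set.Ici 0 \ {t}] t) (𝓝 0)
  /-- The right-hand side of the equation is locally in `L¹_t L²_x`. -/
  source_mem : ∀ b : ℝ, 0 ≤ b → ∀ K : Set (Sp N), IsCompact K → (∀ x ∈ K, b < T x) →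
    ∫⁻ t in Set.Icc 0 b, eLpNorm (fun x => source p f g (u t x) (v t x)) 2 (volume.restrict K) < ⊤
  /-- The equation, tested against smooth functions with compact support in `0 < t < T x`. -/
  equation : ∀ φ : ℝ × Sp N → ℝ, ContDiff ℝ ∞ φ → HasCompactSupport φ →
    tsupport φ ⊆ {z | 0 < z.1 ∧ z.1 < T z.2} →
    ∫ z, (- (v z.1 z.2 * fderiv ℝ φ z (1, 0)) + fderiv ℝ φ z (0, G z.1 z.2)) =
      ∫ z, source p f g (u z.1 z.2) (v z.1 z.2) * φ z
  initial_u : u 0 =ᵐ[volume] u₀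
  initial_v : v 0 =ᵐ[volume] u₁

/-- The norm of `(u(t), u_t(t))` in `H¹ × L²(B(x, r))`. -/
def localNorm {N : ℕ} (u v : ℝ → Sp N → ℝ) (G : ℝ → Sp N → Sp N) (t : ℝ) (x : Sp N) (r : ℝ) : ℝ :=
  Real.sqrt (∫ ξ in Metric.ball x r, (u t ξ ^ 2 + ‖G t ξ‖ ^ 2 + v t ξ ^ 2))

/-! ### Similarity variables `y = (x - x₀) / (T₀ - t)`, `s = - log (T₀ - t)` -/

/-- `w(y, s)`, defined by `u(x, t) = (T₀ - t)^{-2/(p-1)} w(y, s)`. -/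
def simW {N : ℕ} (p : ℝ) (x₀ : Sp N) (T₀ : ℝ) (u : ℝ → Sp N → ℝ) (s : ℝ) (y : Sp N) : ℝ :=
  Real.exp (-(2 * s / (p - 1))) * u (T₀ - Real.exp (-s)) (x₀ + Real.exp (-s) • y)

/-- The gradient `∇w(y, s)` with respect to `y`, given by the chain rule in terms of `G = ∇u`. -/
def simGrad {N : ℕ} (p : ℝ) (x₀ : Sp N) (T₀ : ℝ) (G : ℝ → Sp N → Sp N) (s : ℝ) (y : Sp N) :
    Sp N :=
  (Real.exp (-(2 * s / (p - 1))) * Real.exp (-s)) •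
    G (T₀ - Real.exp (-s)) (x₀ + Real.exp (-s) • y)

/-- The derivative `w_s(y, s)`, given by the chain rule in terms of `u`, `v = u_t`, `G = ∇u`. -/
def simWs {N : ℕ} (p : ℝ) (x₀ : Sp N) (T₀ : ℝ) (u v : ℝ → Sp N → ℝ) (G : ℝ → Sp N → Sp N)
    (s : ℝ) (y : Sp N) : ℝ :=
  Real.exp (-(2 * s / (p - 1))) *
    (-(2 / (p - 1)) * u (T₀ - Real.exp (-s)) (x₀ + Real.exp (-s) • y)
      - Real.exp (-s) * inner ℝ y (G (T₀ - Real.exp (-s)) (x₀ + Real.exp (-s) • y))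
      + Real.exp (-s) * v (T₀ - Real.exp (-s)) (x₀ + Real.exp (-s) • y))

/-! ### The energy

In the following definitions `w`, `ws`, `gw` are functions on the unit ball, which stand for
`w(s)`, `w_s(s)`, `∇w(s)`. -/

/-- The exponent `α = 2/(p-1) - (N-1)/2`. -/
def alpha (N : ℕ) (p : ℝ) : ℝ := 2 / (p - 1) - ((N : ℝ) - 1) / 2

/-- The weight `ρ(y) = (1 - |y|²)^α`. -/
def rho {N : ℕ} (p : ℝ) (y : Sp N) : ℝ := (1 - ‖y‖ ^ 2) ^ alpha N p

/-- The exponent `γ = min(1/2, (p-q)/(p-1))`. -/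
def gam (p q : ℝ) : ℝ := min (1 / 2) ((p - q) / (p - 1))

/-- The primitive `F(a) = ∫₀ᵃ f`. -/
def primitive (f : ℝ → ℝ) (a : ℝ) : ℝ := ∫ x in (0 : ℝ)..a, f x

/-- The integrand of `E₀`. -/
def density₀ {N : ℕ} (p : ℝ) (w ws : Sp N → ℝ) (gw : Sp N → Sp N) (y : Sp N) : ℝ :=
  (1 / 2 * ws y ^ 2 + 1 / 2 * ‖gw y‖ ^ 2 - 1 / 2 * inner ℝ y (gw y) ^ 2
    + (p + 1) / (p - 1) ^ 2 * w y ^ 2 - 1 / (p + 1) * |w y| ^ (p + 1)) * rho p y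

/-- The energy `E₀` of the unperturbed equation. -/
def energy₀ {N : ℕ} (p : ℝ) (w ws : Sp N → ℝ) (gw : Sp N → Sp N) : ℝ :=
  ∫ y in Metric.ball (0 : Sp N) 1, density₀ p w ws gw y

/-- The term `I = - e^{-2(p+1)s/(p-1)} ∫_B F(e^{2s/(p-1)} w) ρ`. -/
def termI {N : ℕ} (p : ℝ) (f : ℝ → ℝ) (s : ℝ) (w : Sp N → ℝ) : ℝ :=
  - Real.exp (-(2 * (p + 1) * s / (p - 1))) *
    ∫ y in Metric.ball (0 : Sp N) 1, primitive f (Real.exp (2 * s / (p - 1)) * w y) * rho p y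

/-- The term `J = - e^{-γ s} ∫_B w w_s ρ`. -/
def termJ {N : ℕ} (p q : ℝ) (s : ℝ) (w ws : Sp N → ℝ) : ℝ :=
  - Real.exp (-(gam p q * s)) * ∫ y in Metric.ball (0 : Sp N) 1, w y * ws y * rho p y

/-- The energy `E = E₀ + I + J`. -/
def energy {N : ℕ} (p q : ℝ) (f : ℝ → ℝ) (s : ℝ) (w ws : Sp N → ℝ) (gw : Sp N → Sp N) : ℝ :=
  energy₀ p w ws gw + termI p f s w + termJ p q s w ws

/-- The three integrals in the definition of `E` converge absolutely. -/
def EnergyConverges {N : ℕ} (p : ℝ) (f : ℝ → ℝ) (s : ℝ) (w ws : Sp N → ℝ) (gw : Sp N → Sp N) :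
    Prop :=
  IntegrableOn (density₀ p w ws gw) (Metric.ball 0 1) ∧
    IntegrableOn (fun y => primitive f (Real.exp (2 * s / (p - 1)) * w y) * rho p y)
      (Metric.ball 0 1) ∧
    IntegrableOn (fun y => w y * ws y * rho p y) (Metric.ball 0 1)

end PerturbedWave

end

open MeasureTheory Filter Topology Metric

open ENNReal (ofReal)

open Set (Icc Ici Ioo)

open Real (exp norm_eq_abs norm_of_nonneg smoothTransition)

open scoped ContDiff ENNReal Pointwise

noncomputable section

set_option linter.unusedSectionVars false

namespace PerturbedWave

local notation "𝓛" => Measure.restrict volume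

section Mollification

variable {E F : Type*} [NormedAddCommGroup E] [NormedSpace ℝ E] [FiniteDimensional ℝ E]
  [MeasurableSpace E] [BorelSpace E] [NormedAddCommGroup F] [NormedSpace ℝ F]

/-- The mollification of `f` by the normalized bump function `φ`. -/
def moll (μ : Measure E) (φ : ContDiffBump (0 : E)) (f : E → F) : E → F :=
  convolution (φ.normed μ) f (ContinuousLinearMap.lsmul ℝ ℝ) μ

/-- A sequence of bump functions whose supports shrink to `0`. -/
def bump (E : Type*) [NormedAddCommGroup E] (n : ℕ) : ContDiffBump (0 : E) where
  rIn := 1 / ((n : ℝ) + 1)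
  rOut := 2 / ((n : ℝ) + 1)
  rIn_pos := by positivity
  rIn_lt_rOut := by gcongr; norm_num

theorem bump_rOut_tendsto : Tendsto (fun n => (bump E n).rOut) atTop (𝓝 0) := by
  have := (tendsto_one_div_add_atTop_nhds_zero_nat (𝕜 := ℝ)).const_mul 2
  simp only [mul_zero] at this
  refine this.congr fun n => ?_
  simp [bump, div_eq_mul_inv]

variable {μ : Measure E} [μ.IsAddHaarMeasure]

theorem moll_apply (φ : ContDiffBump (0 : E)) (f : E → F) (z : E) :
    moll μ φ f z = ∫ ζ, φ.normed μ ζ • f (z - ζ) ∂μ := rfl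

theorem moll_swap (φ : ContDiffBump (0 : E)) (f : E → F) (z : E) :
    moll μ φ f z = ∫ ζ, φ.normed μ (z - ζ) • f ζ ∂μ :=
  convolution_lsmul_swap

theorem integrable_moll_integrand (φ : ContDiffBump (0 : E)) {f : E → F}
    (hf : LocallyIntegrable f μ) (z : E) : Integrable (fun ζ => φ.normed μ ζ • f (z - ζ)) μ :=
  φ.hasCompactSupport_normed.convolutionExists_left (ContinuousLinearMap.lsmul ℝ ℝ)
    φ.continuous_normed hf z

theorem integrable_moll_integrand_swap (φ : ContDiffBump (0 : E)) {f : E → F}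
    (hf : LocallyIntegrable f μ) (z : E) : Integrable (fun ζ => φ.normed μ (z - ζ) • f ζ) μ :=
  ConvolutionExistsAt.integrable_swap (L := ContinuousLinearMap.lsmul ℝ ℝ)
    (integrable_moll_integrand φ hf z)

theorem continuous_moll (φ : ContDiffBump (0 : E)) {f : E → F} (hf : LocallyIntegrable f μ) :
    Continuous (moll μ φ f) :=
  φ.hasCompactSupport_normed.continuous_convolution_left _ φ.continuous_normed hf

theorem contDiff_moll (φ : ContDiffBump (0 : E)) {f : E → F} (hf : LocallyIntegrable f μ) :
    ContDiff ℝ ∞ (moll μ φ f) :=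
  φ.hasCompactSupport_normed.contDiff_convolution_left _ φ.contDiff_normed hf

theorem lintegral_normed (φ : ContDiffBump (0 : E)) :
    ∫⁻ ζ, ofReal (φ.normed μ ζ) ∂μ = 1 := by
  rw [← ofReal_integral_eq_lintegral_ofReal φ.integrable_normed
    (.of_forall φ.nonneg_normed), φ.integral_normed, ENNReal.ofReal_one]

/-- Jensen's inequality for the square of a mean value. -/
theorem lintegral_mul_sq_le {X : Type*} [MeasurableSpace X] {m : Measure X} {w g : X → ℝ≥0∞}
    (hw : AEMeasurable w m) (hg : AEMeasurable g m) (h1 : ∫⁻ x, w x ∂m = 1) :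
    (∫⁻ x, w x * g x ∂m) ^ 2 ≤ ∫⁻ x, w x * g x ^ 2 ∂m := by
  have h := ENNReal.lintegral_mul_le_Lp_mul_Lq m (p := 2) (q := 2)
    ⟨by norm_num, by norm_num, by norm_num⟩
    (f := fun x => w x ^ (1 / 2 : ℝ)) (g := fun x => w x ^ (1 / 2 : ℝ) * g x)
    (hw.pow_const _) ((hw.pow_const _).mul hg)
  have e1 : ∀ x, w x ^ (1 / 2 : ℝ) * (w x ^ (1 / 2 : ℝ) * g x) = w x * g x := fun x => by
    rw [← mul_assoc, ← ENNReal.rpow_add_of_nonneg _ _ (by norm_num) (by norm_num)]; norm_num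
  have e2 : ∀ x, (w x ^ (1 / 2 : ℝ)) ^ (2 : ℝ) = w x := fun x => by
    rw [← ENNReal.rpow_mul]; norm_num
  have e3 : ∀ x, (w x ^ (1 / 2 : ℝ) * g x) ^ (2 : ℝ) = w x * g x ^ 2 := fun x => by
    rw [ENNReal.mul_rpow_of_nonneg _ _ (by norm_num), e2, ENNReal.rpow_two]
  simp only [Pi.mul_apply, e1, e2, e3, h1, ENNReal.one_rpow, one_mul] at h
  calc (∫⁻ x, w x * g x ∂m) ^ 2 ≤ ((∫⁻ x, w x * g x ^ 2 ∂m) ^ (1 / 2 : ℝ)) ^ 2 := by gcongr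
    _ = _ := by rw [← ENNReal.rpow_two, ← ENNReal.rpow_mul]; norm_num

theorem moll_sub_eq (φ : ContDiffBump (0 : E)) [CompleteSpace F] {f : E → F}
    (hf : LocallyIntegrable f μ) (z : E) :
    moll μ φ f z - f z = ∫ ζ, φ.normed μ ζ • (f (z - ζ) - f z) ∂μ := by
  simp only [smul_sub]
  rw [integral_sub (integrable_moll_integrand φ hf z) (φ.integrable_normed.smul_const _),
    integral_smul_const, φ.integral_normed, one_smul, moll_apply]

theorem lintegral_sq_eq_eLpNorm {X : Type*} [MeasurableSpace X] {m : Measure X} (f : X → F) :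
    ∫⁻ x, ‖f x‖ₑ ^ 2 ∂m = eLpNorm f 2 m ^ 2 := by
  rw [eLpNorm_eq_lintegral_rpow_enorm_toReal (by norm_num) (by norm_num), ← ENNReal.rpow_two,
    ← ENNReal.rpow_mul]
  norm_num

theorem tendsto_eLpNorm_translate {f : E → F} (hf : MemLp f 2 μ) :
    Tendsto (fun ζ : E => eLpNorm (fun z => f (z - ζ) - f z) 2 μ) (𝓝 0) (𝓝 0) := by
  let g : E → C(E, E) := fun ζ => ⟨fun z => z - ζ, by fun_prop⟩
  have hg : Continuous g :=
    ContinuousMap.continuous_of_continuous_uncurry _ (by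
      change Continuous fun p : E × E => p.2 - p.1; fun_prop)
  have hm : ∀ ζ, MeasurePreserving (g ζ) μ μ := fun ζ => measurePreserving_sub_right μ ζ
  have h := (continuous_const (y := hf.toLp f)).compMeasurePreservingLp hg hm (by norm_num)
  have h0 := h.tendsto 0
  rw [tendsto_iff_edist_tendsto_0] at h0
  refine h0.congr fun ζ => ?_
  rw [Lp.edist_def]
  refine eLpNorm_congr_ae ?_
  filter_upwards [Lp.coeFn_compMeasurePreserving (hf.toLp f) (hm ζ),
    Lp.coeFn_compMeasurePreserving (hf.toLp f) (hm 0), hf.coeFn_toLp,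
    (hm ζ).quasiMeasurePreserving.ae hf.coeFn_toLp] with z h1 h2 h3 h4
  simp only [Pi.sub_apply, h1, h2, Function.comp_apply]
  rw [h4]
  simp [g, h3]

theorem tendsto_eLpNorm_moll_sub [CompleteSpace F] {f : E → F} (hf : MemLp f 2 μ) :
    Tendsto (fun n => eLpNorm (moll μ (bump E n) f - f) 2 μ) atTop (𝓝 0) := by
  have hl : LocallyIntegrable f μ := hf.locallyIntegrable (by norm_num)
  rw [ENNReal.tendsto_nhds_zero]
  intro ε hε
  have h1 := (ENNReal.tendsto_nhds_zero.1 (tendsto_eLpNorm_translate hf)) ε hε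
  obtain ⟨δ, hδ, h2⟩ := Metric.eventually_nhds_iff.1 h1
  filter_upwards [(bump_rOut_tendsto (E := E)).eventually_lt_const hδ] with n hn
  set φ := bump E n
  have hmeas : AEMeasurable (fun q : E × E => ‖f (q.1 - q.2) - f q.1‖ₑ) (μ.prod μ) := by
    have a1 : AEStronglyMeasurable (fun q : E × E => f (q.1 - q.2)) (μ.prod μ) :=
      hf.1.comp_quasiMeasurePreserving (quasiMeasurePreserving_sub_of_right_invariant μ μ)
    have a2 : AEStronglyMeasurable (fun q : E × E => f q.1) (μ.prod μ) := hf.1.comp_fst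
    exact (a1.sub a2).enorm
  have hφm : Measurable fun ζ => ofReal (φ.normed μ ζ) :=
    (φ.continuous_normed (μ := μ)).measurable.ennreal_ofReal
  have key : ∫⁻ z, ‖(moll μ φ f - f) z‖ₑ ^ 2 ∂μ ≤ ε ^ 2 := by
    calc ∫⁻ z, ‖(moll μ φ f - f) z‖ₑ ^ 2 ∂μ
        ≤ ∫⁻ z, ∫⁻ ζ, ofReal (φ.normed μ ζ) * ‖f (z - ζ) - f z‖ₑ ^ 2 ∂μ ∂μ := by
          refine lintegral_mono fun z => ?_
          refine le_trans ?_ (lintegral_mul_sq_le hφm.aemeasurable ?_ (lintegral_normed φ))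
          · rw [Pi.sub_apply, moll_sub_eq φ hl]
            gcongr
            refine (enorm_integral_le_lintegral_enorm _).trans (lintegral_mono fun ζ => ?_)
            rw [enorm_smul, Real.enorm_of_nonneg (φ.nonneg_normed ζ)]
          · exact ((hf.1.comp_quasiMeasurePreserving
              (quasiMeasurePreserving_sub_left_of_right_invariant μ z)).sub
              aestronglyMeasurable_const).enorm
      _ = ∫⁻ ζ, ofReal (φ.normed μ ζ) * ∫⁻ z, ‖f (z - ζ) - f z‖ₑ ^ 2 ∂μ ∂μ := by
          rw [lintegral_lintegral_swap
            ((hφm.comp measurable_snd).aemeasurable.mul (hmeas.pow_const 2))]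
          refine lintegral_congr fun ζ => ?_
          rw [lintegral_const_mul' _ _ ENNReal.ofReal_ne_top]
      _ ≤ ∫⁻ ζ, ofReal (φ.normed μ ζ) * ε ^ 2 ∂μ := by
          refine lintegral_mono fun ζ => ?_
          by_cases hζ : ζ ∈ ball (0 : E) φ.rOut
          · rw [lintegral_sq_eq_eLpNorm (fun z => f (z - ζ) - f z)]
            have := h2 ((mem_ball.1 hζ).trans hn)
            dsimp only
            gcongr
          · have : φ.normed μ ζ = 0 := by
              rw [← Function.notMem_support, φ.support_normed_eq]; exact hζ
            simp [this]
      _ = ε ^ 2 := by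
          rw [lintegral_mul_const _ hφm, lintegral_normed, one_mul]
  rw [lintegral_sq_eq_eLpNorm] at key
  exact (ENNReal.pow_right_strictMono two_ne_zero).le_iff_le.1 key

theorem moll_congr_ae (φ : ContDiffBump (0 : E)) {f g : E → F}
    (h : f =ᵐ[μ] g) : moll μ φ f = moll μ φ g := by
  funext z
  rw [moll_swap, moll_swap]
  refine integral_congr_ae ?_
  filter_upwards [h] with ζ hζ
  rw [hζ]

theorem enorm_moll_le (φ : ContDiffBump (0 : E)) (f : E → F) (z : E) :
    ‖moll μ φ f z‖ₑ ≤ ∫⁻ ζ, ofReal (φ.normed μ ζ) * ‖f (z - ζ)‖ₑ ∂μ := by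
  rw [moll_apply]
  refine (enorm_integral_le_lintegral_enorm _).trans (le_of_eq (lintegral_congr fun ζ => ?_))
  rw [enorm_smul, Real.enorm_of_nonneg (φ.nonneg_normed ζ)]

end Mollification

section BilinearLimit

variable {X ι F G : Type*} [MeasurableSpace X] {m : Measure X} [NormedAddCommGroup F]
  [NormedAddCommGroup G]

/-- A measurable family of biadditive forms, bounded by `C`. -/
structure IsBilinFamily (m : Measure X) (B : X → F → G → ℝ) (C : ℝ) : Prop where
  sub_left : ∀ x a a' b, B x (a - a') b = B x a b - B x a' b
  sub_right : ∀ x a b b', B x a (b - b') = B x a b - B x a b'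
  bound : ∀ᵐ x ∂m, ∀ a b, |B x a b| ≤ C * (‖a‖ * ‖b‖)
  meas : ∀ f g, AEStronglyMeasurable f m → AEStronglyMeasurable g m →
    AEStronglyMeasurable (fun x => B x (f x) (g x)) m

theorem IsBilinFamily.integrable {B : X → F → G → ℝ} {C : ℝ} (hB : IsBilinFamily m B C)
    {f : X → F} {g : X → G} (hf : MemLp f 2 m) (hg : MemLp g 2 m) :
    Integrable (fun x => B x (f x) (g x)) m := by
  refine ((hf.norm.integrable_mul (q := 2) hg.norm).const_mul C).mono' (hB.meas f g hf.1 hg.1) ?_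
  filter_upwards [hB.bound] with x hx
  exact hx _ _

theorem IsBilinFamily.norm_integral_le {B : X → F → G → ℝ} {C : ℝ} (hB : IsBilinFamily m B C)
    (hC0 : 0 ≤ C) {f : X → F} {g : X → G} (hf : MemLp f 2 m) (hg : MemLp g 2 m) :
    ‖∫ x, B x (f x) (g x) ∂m‖ ≤ C * ((eLpNorm f 2 m).toReal * (eLpNorm g 2 m).toReal) := by
  have h1 : ∫⁻ x, ‖f x‖ₑ * ‖g x‖ₑ ∂m ≤ eLpNorm f 2 m * eLpNorm g 2 m := by
    have h := ENNReal.lintegral_mul_le_Lp_mul_Lq m (p := 2) (q := 2)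
      ⟨by norm_num, by norm_num, by norm_num⟩ hf.1.enorm hg.1.enorm
    rw [eLpNorm_eq_lintegral_rpow_enorm_toReal (by norm_num) (by norm_num),
      eLpNorm_eq_lintegral_rpow_enorm_toReal (by norm_num) (by norm_num)]
    simpa using h
  have h2 : ‖∫ x, B x (f x) (g x) ∂m‖ₑ ≤ ofReal C * (eLpNorm f 2 m * eLpNorm g 2 m) := by
    calc ‖∫ x, B x (f x) (g x) ∂m‖ₑ ≤ ∫⁻ x, ‖B x (f x) (g x)‖ₑ ∂m :=
          enorm_integral_le_lintegral_enorm _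
      _ ≤ ∫⁻ x, ofReal C * (‖f x‖ₑ * ‖g x‖ₑ) ∂m := by
          refine lintegral_mono_ae ?_
          filter_upwards [hB.bound] with x hx
          rw [← ofReal_norm, ← ofReal_norm, ← ofReal_norm, ← ENNReal.ofReal_mul (norm_nonneg _),
            ← ENNReal.ofReal_mul hC0]
          exact ENNReal.ofReal_le_ofReal (hx _ _)
      _ = ofReal C * ∫⁻ x, ‖f x‖ₑ * ‖g x‖ₑ ∂m :=
          lintegral_const_mul' _ _ ENNReal.ofReal_ne_top
      _ ≤ _ := by gcongr
  have h3 := ENNReal.toReal_mono (ENNReal.mul_ne_top ENNReal.ofReal_ne_top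
    (ENNReal.mul_ne_top hf.2.ne hg.2.ne)) h2
  simpa [ENNReal.toReal_mul, ENNReal.toReal_ofReal hC0] using h3

/-- Convergence of integrals of bilinear expressions in `L²` functions, with varying bounded
coefficients. -/
theorem tendsto_integral_bilin {l : Filter ι} [l.IsCountablyGenerated]
    {B : ι → X → F → G → ℝ} {B₀ : X → F → G → ℝ} {f : ι → X → F} {f₀ : X → F}
    {g : ι → X → G} {g₀ : X → G} {C : ℝ} (hC0 : 0 ≤ C)
    (hBm : ∀ᶠ i in l, IsBilinFamily m (B i) C)
    (hB : ∀ᵐ x ∂m, Tendsto (fun i => B i x (f₀ x) (g₀ x)) l (𝓝 (B₀ x (f₀ x) (g₀ x))))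
    (hf : ∀ᶠ i in l, MemLp (f i) 2 m) (hf₀ : MemLp f₀ 2 m)
    (hg : ∀ᶠ i in l, MemLp (g i) 2 m) (hg₀ : MemLp g₀ 2 m)
    (hfl : Tendsto (fun i => eLpNorm (f i - f₀) 2 m) l (𝓝 0))
    (hgl : Tendsto (fun i => eLpNorm (g i - g₀) 2 m) l (𝓝 0)) :
    Tendsto (fun i => ∫ x, B i x (f i x) (g i x) ∂m) l (𝓝 (∫ x, B₀ x (f₀ x) (g₀ x) ∂m)) := by
  have e1 : Tendsto (fun i => ∫ x, B i x (f₀ x) (g₀ x) ∂m) l (𝓝 (∫ x, B₀ x (f₀ x) (g₀ x) ∂m)) := by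
    refine tendsto_integral_filter_of_dominated_convergence (fun x => C * (‖f₀ x‖ * ‖g₀ x‖)) ?_ ?_
      ((hf₀.norm.integrable_mul (q := 2) hg₀.norm).const_mul C) hB
    · filter_upwards [hBm] with i h1
      exact (h1.integrable hf₀ hg₀).1
    · filter_upwards [hBm] with i h2
      filter_upwards [h2.bound] with x hx
      exact hx _ _
  have toR : ∀ {a : ι → ℝ≥0∞}, Tendsto a l (𝓝 0) → Tendsto (fun i => (a i).toReal) l (𝓝 0) :=
    fun h => by simpa [Function.comp_def] using (ENNReal.tendsto_toReal ENNReal.zero_ne_top).comp h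
  have e2 : Tendsto (fun i => C * ((eLpNorm (f i - f₀) 2 m).toReal * (eLpNorm (g i - g₀) 2 m).toReal)
      + C * ((eLpNorm (f i - f₀) 2 m).toReal * (eLpNorm g₀ 2 m).toReal)
      + C * ((eLpNorm f₀ 2 m).toReal * (eLpNorm (g i - g₀) 2 m).toReal)) l (𝓝 0) := by
    have a := toR hfl
    have b := toR hgl
    simpa using (((a.mul b).const_mul C).add ((a.mul_const _).const_mul C)).add
      ((b.const_mul (eLpNorm f₀ 2 m).toReal).const_mul C)
  have e3 : Tendsto (fun i => ∫ x, B i x (f i x) (g i x) ∂m - ∫ x, B i x (f₀ x) (g₀ x) ∂m) l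
      (𝓝 0) := by
    refine squeeze_zero_norm' ?_ e2
    filter_upwards [hBm, hf, hg] with i h1 h3 h4
    have d : ∫ x, B i x (f i x) (g i x) ∂m - ∫ x, B i x (f₀ x) (g₀ x) ∂m
        = ∫ x, B i x ((f i - f₀) x) ((g i - g₀) x) ∂m + ∫ x, B i x ((f i - f₀) x) (g₀ x) ∂m
          + ∫ x, B i x (f₀ x) ((g i - g₀) x) ∂m := by
      rw [← integral_add (h1.integrable (h3.sub hf₀) (h4.sub hg₀))
        (h1.integrable (h3.sub hf₀) hg₀), ← integral_add _
        (h1.integrable hf₀ (h4.sub hg₀)), ← integral_sub (h1.integrable h3 h4)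
        (h1.integrable hf₀ hg₀)]
      · congr 1; ext x; simp only [Pi.sub_apply, h1.sub_left, h1.sub_right]; ring
      · exact (h1.integrable (h3.sub hf₀) (h4.sub hg₀)).add (h1.integrable (h3.sub hf₀) hg₀)
    rw [d]
    refine (norm_add₃_le).trans ?_
    gcongr
    · exact h1.norm_integral_le hC0 (h3.sub hf₀) (h4.sub hg₀)
    · exact h1.norm_integral_le hC0 (h3.sub hf₀) hg₀
    · exact h1.norm_integral_le hC0 hf₀ (h4.sub hg₀)
  simpa using e3.add e1

end BilinearLimit

section WeakDerivatives

variable {E F : Type*} [NormedAddCommGroup E] [NormedSpace ℝ E] [FiniteDimensional ℝ E]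
  [MeasurableSpace E] [BorelSpace E] [NormedAddCommGroup F] [NormedSpace ℝ F]

/-- Smooth functions with compact support in `Ω`. -/
structure IsTest (Ω : Set E) (φ : E → ℝ) : Prop where
  smooth : ContDiff ℝ ∞ φ
  compact : HasCompactSupport φ
  supp : tsupport φ ⊆ Ω

/-- `D` is the weak derivative of `u` on `Ω`. -/
def IsWeakDeriv (μ : Measure E) (Ω : Set E) (u : E → ℝ) (D : E → E →L[ℝ] ℝ) : Prop :=
  ∀ φ : E → ℝ, IsTest Ω φ → ∀ e : E, ∫ z, u z * fderiv ℝ φ z e ∂μ = - ∫ z, D z e * φ z ∂μ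

/-- `div (m D) = h` in the sense of distributions on `Ω`. -/
def IsWeakDiv (μ : Measure E) (Ω : Set E) (m : (E →L[ℝ] ℝ) →L[ℝ] (E →L[ℝ] ℝ) →L[ℝ] ℝ)
    (D : E → E →L[ℝ] ℝ) (h : E → ℝ) : Prop :=
  ∀ φ : E → ℝ, IsTest Ω φ → ∫ z, m (D z) (fderiv ℝ φ z) ∂μ = - ∫ z, h z * φ z ∂μ

variable {μ : Measure E} [μ.IsAddHaarMeasure] {Ω : Set E}

theorem tsupport_normed_sub_subset (φ : ContDiffBump (0 : E)) (z : E) :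
    tsupport (fun ζ => φ.normed μ (z - ζ)) ⊆ closedBall z φ.rOut := by
  refine closure_minimal (fun ζ hζ => ?_) isClosed_closedBall
  have h : z - ζ ∈ Function.support (φ.normed μ) := hζ
  rw [φ.support_normed_eq, mem_ball_zero_iff] at h
  rw [mem_closedBall, dist_comm, dist_eq_norm]
  exact h.le

theorem isTest_normed_sub (φ : ContDiffBump (0 : E)) {z : E}
    (hz : closedBall z φ.rOut ⊆ Ω) : IsTest Ω (fun ζ => φ.normed μ (z - ζ)) where
  smooth := φ.contDiff_normed.comp (contDiff_const.sub contDiff_id)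
  compact := HasCompactSupport.of_support_subset_isCompact (isCompact_closedBall z φ.rOut)
    ((subset_tsupport _).trans (tsupport_normed_sub_subset φ z))
  supp := (tsupport_normed_sub_subset φ z).trans hz

theorem fderiv_moll_eq (φ : ContDiffBump (0 : E)) {u : E → ℝ} {D : E → E →L[ℝ] ℝ}
    (hu : LocallyIntegrable u μ) (hD : LocallyIntegrable D μ) (hw : IsWeakDeriv μ Ω u D) {z : E}
    (hz : closedBall z φ.rOut ⊆ Ω) :
    fderiv ℝ (moll μ φ u) z = moll μ φ D z := by
  have h1 := (φ.hasCompactSupport_normed (μ := μ)).hasFDerivAt_convolution_left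
    (ContinuousLinearMap.lsmul ℝ ℝ) (φ.contDiff_normed (n := 1)) hu z
  have h2 : fderiv ℝ (moll μ φ u) z = _ := h1.fderiv
  have hc : Continuous (fderiv ℝ (φ.normed μ)) :=
    (φ.contDiff_normed (n := 1)).continuous_fderiv one_ne_zero
  have hi := ((φ.hasCompactSupport_normed (μ := μ)).fderiv ℝ).convolutionExists_left
    ((ContinuousLinearMap.lsmul ℝ ℝ).precompL E) hc hu z
  ext e
  rw [h2, convolution_eq_swap, ContinuousLinearMap.integral_apply hi.integrable_swap, moll_swap,
    ContinuousLinearMap.integral_apply (integrable_moll_integrand_swap φ hD z)]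
  have h3 := hw _ (isTest_normed_sub (μ := μ) φ hz) e
  have h4 : ∀ ζ, fderiv ℝ (fun ζ => φ.normed μ (z - ζ)) ζ e = - fderiv ℝ (φ.normed μ) (z - ζ) e := by
    intro ζ
    have hd : HasFDerivAt (φ.normed μ) (fderiv ℝ (φ.normed μ) (z - ζ)) (z - ζ) :=
      ((φ.contDiff_normed (n := 1)).differentiable one_ne_zero _).hasFDerivAt
    have := hd.comp ζ ((hasFDerivAt_id ζ).const_sub z)
    have := this.fderiv
    simp only [Function.comp_def] at this
    rw [this]; simp
  simp only [h4, mul_neg, integral_neg, neg_inj] at h3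
  simpa [ContinuousLinearMap.precompL, mul_comm] using h3

theorem fderiv_moll_smooth (φ : ContDiffBump (0 : E)) {ψ : E → ℝ} (hψ : ContDiff ℝ 1 ψ)
    (hc : HasCompactSupport ψ) (z : E) :
    fderiv ℝ (moll μ φ ψ) z = moll μ φ (fderiv ℝ ψ) z := by
  have h1 := hc.hasFDerivAt_convolution_right (μ := μ) (f := φ.normed μ)
    (ContinuousLinearMap.lsmul ℝ ℝ) φ.integrable_normed.locallyIntegrable hψ z
  have h2 : fderiv ℝ (moll μ φ ψ) z = _ := h1.fderiv
  rw [h2, moll_apply, convolution_def]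
  refine integral_congr_ae (.of_forall fun ζ => ?_)
  ext e
  simp [ContinuousLinearMap.precompR]

theorem tsupport_moll_subset (φ : ContDiffBump (0 : E)) {ψ : E → ℝ} (hc : HasCompactSupport ψ) :
    tsupport (moll μ φ ψ) ⊆ closedBall (0 : E) φ.rOut + tsupport ψ := by
  refine closure_minimal ?_ ((isCompact_closedBall _ _).add hc).isClosed
  refine (support_convolution_subset _).trans (Set.add_subset_add ?_ (subset_tsupport _))
  rw [φ.support_normed_eq]; exact ball_subset_closedBall

theorem isTest_moll (φ : ContDiffBump (0 : E)) {ψ : E → ℝ} (hψ : ContDiff ℝ ∞ ψ)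
    (hc : HasCompactSupport ψ) (hs : ∀ z ∈ tsupport ψ, closedBall z φ.rOut ⊆ Ω) :
    IsTest Ω (moll μ φ ψ) where
  smooth := contDiff_moll φ (hψ.continuous.integrable_of_hasCompactSupport hc).locallyIntegrable
  compact := ((isCompact_closedBall _ _).add hc).of_isClosed_subset (isClosed_tsupport _)
    (tsupport_moll_subset φ hc)
  supp := by
    refine (tsupport_moll_subset φ hc).trans ?_
    rintro _ ⟨a, ha, b, hb, rfl⟩
    refine hs b hb ?_
    simpa [mem_closedBall, dist_eq_norm] using ha

/-- Mollification is symmetric. -/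
theorem integral_apply_moll [CompleteSpace F] (φ : ContDiffBump (0 : E)) {f : E → F}
    {g : E → F →L[ℝ] ℝ} (hf : Integrable f μ) (hg : Continuous g) (hc : HasCompactSupport g) :
    ∫ z, g z (moll μ φ f z) ∂μ = ∫ ζ, moll μ φ g ζ (f ζ) ∂μ := by
  have hgi : LocallyIntegrable g μ := hg.locallyIntegrable
  have hint : Integrable (fun q : E × E => φ.normed μ (q.1 - q.2) • g q.1 (f q.2)) (μ.prod μ) := by
    have h1 := (hf.convolution_integrand (ContinuousLinearMap.lsmul ℝ ℝ).flip
      (φ.integrable_normed (μ := μ)))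
    obtain ⟨C, hC⟩ := hc.exists_bound_of_continuous hg
    refine (h1.norm.const_mul C).mono' ?_ (.of_forall fun q => ?_)
    · have a : AEStronglyMeasurable (fun q : E × E => g q.1 (f q.2)) (μ.prod μ) :=
        isBoundedBilinearMap_apply.continuous.comp_aestronglyMeasurable
          ((hg.comp continuous_fst).aestronglyMeasurable.prodMk hf.1.comp_snd)
      have b : Continuous fun q : E × E => φ.normed μ (q.1 - q.2) :=
        φ.continuous_normed.comp (continuous_fst.sub continuous_snd)
      exact b.aestronglyMeasurable.smul a
    · have := (g q.1).le_of_opNorm_le (hC q.1) (f q.2)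
      simp only [norm_smul, ContinuousLinearMap.flip_apply, ContinuousLinearMap.lsmul_apply]
      calc ‖φ.normed μ (q.1 - q.2)‖ * ‖(g q.1) (f q.2)‖
          ≤ ‖φ.normed μ (q.1 - q.2)‖ * (C * ‖f q.2‖) := by gcongr
        _ = _ := by ring
  calc ∫ z, g z (moll μ φ f z) ∂μ
      = ∫ z, ∫ ζ, φ.normed μ (z - ζ) • g z (f ζ) ∂μ ∂μ := by
        refine integral_congr_ae (.of_forall fun z => ?_)
        dsimp only
        rw [moll_swap, ← ContinuousLinearMap.integral_comp_comm _
          (integrable_moll_integrand_swap φ hf.locallyIntegrable z)]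
        simp
    _ = ∫ ζ, ∫ z, φ.normed μ (z - ζ) • g z (f ζ) ∂μ ∂μ := integral_integral_swap hint
    _ = ∫ ζ, moll μ φ g ζ (f ζ) ∂μ := by
        refine integral_congr_ae (.of_forall fun ζ => ?_)
        dsimp only
        rw [moll_swap, ContinuousLinearMap.integral_apply (integrable_moll_integrand_swap φ hgi ζ)]
        refine integral_congr_ae (.of_forall fun z => ?_)
        have : φ.normed μ (ζ - z) = φ.normed μ (z - ζ) := by
          rw [← φ.normed_neg, neg_sub]
        simp [this]

theorem moll_comp_clm (φ : ContDiffBump (0 : E)) {G : Type*} [NormedAddCommGroup G]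
    [NormedSpace ℝ G] [CompleteSpace F] [CompleteSpace G] (T : F →L[ℝ] G) {f : E → F}
    (hf : LocallyIntegrable f μ) (z : E) :
    moll μ φ (fun z => T (f z)) z = T (moll μ φ f z) := by
  rw [moll_apply, moll_apply, ← T.integral_comp_comm (integrable_moll_integrand φ hf z)]
  simp

/-- The mollification of a solution of `div (m D) = h` is again a solution. -/
theorem integral_moll_weakDiv (φ : ContDiffBump (0 : E))
    {m : (E →L[ℝ] ℝ) →L[ℝ] (E →L[ℝ] ℝ) →L[ℝ] ℝ} {D : E → E →L[ℝ] ℝ} {h : E → ℝ}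
    (hD : Integrable D μ) (hh : Integrable h μ) (hw : IsWeakDiv μ Ω m D h) {ψ : E → ℝ}
    (hψ : ContDiff ℝ ∞ ψ) (hc : HasCompactSupport ψ)
    (hs : ∀ z ∈ tsupport ψ, closedBall z φ.rOut ⊆ Ω) :
    ∫ z, m (moll μ φ D z) (fderiv ℝ ψ z) ∂μ = - ∫ z, moll μ φ h z * ψ z ∂μ := by
  have h1 := hw _ (isTest_moll (μ := μ) φ hψ hc hs)
  have hψ1 : ContDiff ℝ 1 ψ := hψ.of_le (by simp)
  have hcf : Continuous (fderiv ℝ ψ) := hψ1.continuous_fderiv one_ne_zero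
  obtain ⟨T, hT⟩ : ∃ T : (E →L[ℝ] ℝ) →L[ℝ] (E →L[ℝ] ℝ) →L[ℝ] ℝ, ∀ a b, T a b = m b a :=
    ⟨m.flip, fun _ _ => rfl⟩
  obtain ⟨I, hI⟩ : ∃ I : ℝ →L[ℝ] ℝ →L[ℝ] ℝ, ∀ a b, I a b = a * b :=
    ⟨ContinuousLinearMap.mul ℝ ℝ, fun _ _ => rfl⟩
  have e1 := integral_apply_moll (μ := μ) φ (f := D) (g := fun z => T (fderiv ℝ ψ z)) hD
    (T.continuous.comp hcf) ((hc.fderiv ℝ).comp_left (map_zero _))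
  have e2 := integral_apply_moll (μ := μ) φ (f := h) (g := fun z => I (ψ z)) hh
    (I.continuous.comp hψ.continuous) (hc.comp_left (map_zero _))
  have e3 : ∀ z, moll μ φ (fun z => T (fderiv ℝ ψ z)) z = T (fderiv ℝ (moll μ φ ψ) z) := fun z => by
    rw [fderiv_moll_smooth (μ := μ) φ hψ1 hc]
    exact moll_comp_clm (μ := μ) (F := E →L[ℝ] ℝ) (G := (E →L[ℝ] ℝ) →L[ℝ] ℝ) φ (f := fderiv ℝ ψ) T hcf.locallyIntegrable z
  have e4 : ∀ z, moll μ φ (fun z => I (ψ z)) z = I (moll μ φ ψ z) := fun z =>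
    moll_comp_clm (μ := μ) φ (f := ψ) I hψ.continuous.locallyIntegrable z
  simp only [e3, hT] at e1
  simp only [e4, hI] at e2
  rw [e1, h1]
  simp only [mul_comm (moll μ φ h _), mul_comm (h _), e2]

/-- Integration by parts against the affine vector field `z ↦ L (z - c)`. -/
theorem integral_fderiv_affine (L : E →L[ℝ] E) (c : E) {A ψ : E → ℝ} (hA : ContDiff ℝ 1 A)
    (hψ : ContDiff ℝ 1 ψ) (hc : HasCompactSupport ψ) :
    ∫ z, fderiv ℝ A z (L (z - c)) * ψ z ∂μ
      = - ∫ z, A z * (fderiv ℝ ψ z (L (z - c)) + LinearMap.trace ℝ E L * ψ z) ∂μ := by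
  let b := Module.finBasis ℝ E
  let l : Fin (Module.finrank ℝ E) → E →L[ℝ] ℝ := fun k => (b.coord k).toContinuousLinearMap
  have hl : ∀ z, z = ∑ k, l k z • b k := fun z => (b.sum_repr z).symm
  have htr : LinearMap.trace ℝ E L = ∑ k, l k (L (b k)) := by
    rw [LinearMap.trace_eq_matrix_trace ℝ b]
    simp [Matrix.trace, LinearMap.toMatrix_apply, l]
  have hAc := hA.continuous_fderiv one_ne_zero
  have hψc := hψ.continuous_fderiv one_ne_zero
  let a : Fin (Module.finrank ℝ E) → E → ℝ := fun k z => l k (L (z - c))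
  have ha : ∀ k z, HasFDerivAt (a k) ((l k).comp L) z := fun k z =>
    ((l k).comp L).hasFDerivAt.comp z ((hasFDerivAt_id z).sub_const c)
  have hac : ∀ k, Continuous (a k) := fun k => by fun_prop
  have hd : ∀ k z, HasFDerivAt (fun z => a k z * ψ z) (a k z • fderiv ℝ ψ z + ψ z • (l k).comp L) z :=
    fun k z => (ha k z).mul ((hψ.differentiable one_ne_zero z).hasFDerivAt)
  have hab : ∀ k, ContDiff ℝ 1 fun z => a k z * ψ z := fun k =>
    ContDiff.mul (((l k).comp L).contDiff.comp (contDiff_id.sub contDiff_const)) hψ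
  have habc : ∀ k, HasCompactSupport fun z => a k z * ψ z := fun k => hc.mul_left
  have i1 : ∀ k, Integrable (fun z => fderiv ℝ A z (b k) * (a k z * ψ z)) μ := fun k =>
    ((hAc.clm_apply continuous_const).mul (hab k).continuous).integrable_of_hasCompactSupport
      (habc k).mul_left
  have i2 : ∀ k, Integrable (fun z => A z * fderiv ℝ (fun z => a k z * ψ z) z (b k)) μ := by
    intro k
    refine Continuous.integrable_of_hasCompactSupport (hA.continuous.mul
      (((hab k).continuous_fderiv one_ne_zero).clm_apply continuous_const)) ?_
    exact HasCompactSupport.mul_left (((habc k).fderiv ℝ).comp_left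
      (g := fun T : E →L[ℝ] ℝ => T (b k)) (by simp))
  have key : ∀ k, ∫ z, fderiv ℝ A z (b k) * (a k z * ψ z) ∂μ
      = - ∫ z, A z * fderiv ℝ (fun z => a k z * ψ z) z (b k) ∂μ := by
    intro k
    rw [integral_mul_fderiv_eq_neg_fderiv_mul_of_integrable (i1 k) (i2 k)
      ((hA.continuous.mul (hab k).continuous).integrable_of_hasCompactSupport (habc k).mul_left)
      (fun z _ => hA.differentiable one_ne_zero z)
      (fun z _ => (hab k).differentiable one_ne_zero z), neg_neg]
  have s1 : ∀ z, fderiv ℝ A z (L (z - c)) * ψ z = ∑ k, fderiv ℝ A z (b k) * (a k z * ψ z) := by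
    intro z
    conv_lhs => rw [hl (L (z - c))]
    simp only [map_sum, map_smul, smul_eq_mul, Finset.sum_mul]
    exact Finset.sum_congr rfl fun k _ => by simp only [a]; ring
  have s2 : ∀ z, A z * (fderiv ℝ ψ z (L (z - c)) + LinearMap.trace ℝ E L * ψ z)
      = ∑ k, A z * fderiv ℝ (fun z => a k z * ψ z) z (b k) := by
    intro z
    simp only [fun k => (hd k z).fderiv]
    rw [← Finset.mul_sum, htr]
    congr 1
    conv_lhs => rw [hl (L (z - c))]
    simp only [map_sum, map_smul, smul_eq_mul, Finset.sum_mul, add_apply,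
      smul_apply, ContinuousLinearMap.comp_apply, ← Finset.sum_add_distrib]
    exact Finset.sum_congr rfl fun k _ => by simp only [a]; ring
  simp only [s1, s2]
  rw [integral_finsetSum _ fun k _ => i1 k, integral_finsetSum _ fun k _ => i2 k,
    ← Finset.sum_neg_distrib]
  exact Finset.sum_congr rfl fun k _ => key k

end WeakDerivatives

section SmoothIdentities

variable {E : Type*} [NormedAddCommGroup E] [NormedSpace ℝ E] [FiniteDimensional ℝ E]
  [MeasurableSpace E] [BorelSpace E] {μ : Measure E} [μ.IsAddHaarMeasure]

/-- The multiplier identity for the scaling vector field `c - z`, for smooth functions. -/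
theorem smooth_scaling_identity {m : (E →L[ℝ] ℝ) →L[ℝ] (E →L[ℝ] ℝ) →L[ℝ] ℝ}
    (hm : ∀ a b, m a b = m b a) {U H ψ : E → ℝ} (hU : ContDiff ℝ ∞ U) (hψ : ContDiff ℝ ∞ ψ)
    (hc : HasCompactSupport ψ)
    (hw : ∀ φ : E → ℝ, ContDiff ℝ ∞ φ → HasCompactSupport φ → tsupport φ ⊆ tsupport ψ →
      ∫ z, m (fderiv ℝ U z) (fderiv ℝ φ z) ∂μ = - ∫ z, H z * φ z ∂μ) (c : E) :
    ∫ z, H z * (ψ z * fderiv ℝ U z (c - z)) ∂μ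
      = ∫ z, (-(fderiv ℝ U z (c - z) * m (fderiv ℝ U z) (fderiv ℝ ψ z))
        + 1 / 2 * (fderiv ℝ ψ z (c - z) - (Module.finrank ℝ E - 2) * ψ z)
          * m (fderiv ℝ U z) (fderiv ℝ U z)) ∂μ := by
  have hdU : ContDiff ℝ ∞ (fderiv ℝ U) := hU.fderiv_right (by simp)
  have hX : ContDiff ℝ ∞ fun z => fderiv ℝ U z (c - z) :=
    hdU.clm_apply (contDiff_const.sub contDiff_id)
  have hφ : ContDiff ℝ ∞ fun z => ψ z * fderiv ℝ U z (c - z) := hψ.mul hX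
  have h1 := hw _ hφ hc.mul_right (closure_mono (Function.support_mul_subset_left _ _))
  set D2 : E → E →L[ℝ] E →L[ℝ] ℝ := fun z => fderiv ℝ (fderiv ℝ U) z with hD2
  have hd2 : ∀ z, HasFDerivAt (fderiv ℝ U) (D2 z) z := fun z =>
    (hdU.differentiable (by simp) z).hasFDerivAt
  have hsymm : ∀ z a b, D2 z a b = D2 z b a := fun z a b =>
    ((contDiff_infty.1 hU 2).contDiffAt.isSymmSndFDerivAt (by simp)).eq a b
  have hdX : ∀ z, fderiv ℝ (fun z => ψ z * fderiv ℝ U z (c - z)) z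
      = ψ z • (D2 z (c - z) - fderiv ℝ U z) + fderiv ℝ U z (c - z) • fderiv ℝ ψ z := by
    intro z
    have a1 := (hd2 z).clm_apply ((hasFDerivAt_id z).const_sub c)
    have a2 := ((hψ.differentiable (by simp) z).hasFDerivAt).mul a1
    refine a2.fderiv.trans ?_
    ext e
    simp [hsymm z e c, hsymm z e z]
    ring
  have hA : ContDiff ℝ 1 fun z => m (fderiv ℝ U z) (fderiv ℝ U z) := by
    have : ContDiff ℝ ∞ fun z => m (fderiv ℝ U z) (fderiv ℝ U z) :=
      m.isBoundedBilinearMap.contDiff.comp (hdU.prodMk hdU)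
    exact this.of_le (by simp)
  have hdA : ∀ z v, fderiv ℝ (fun z => m (fderiv ℝ U z) (fderiv ℝ U z)) z v
      = 2 * m (fderiv ℝ U z) (D2 z v) := by
    intro z v
    have a1 := m.hasFDerivAt_of_bilinear (hd2 z) (hd2 z)
    have a2 : fderiv ℝ (fun z => m (fderiv ℝ U z) (fderiv ℝ U z)) z = _ := a1.fderiv
    rw [a2]
    simp [hm (D2 z v)]
    ring
  have hI := integral_fderiv_affine (μ := μ) (-ContinuousLinearMap.id ℝ E) c hA
    (hψ.of_le (by simp)) hc
  have htr : LinearMap.trace ℝ E ((-ContinuousLinearMap.id ℝ E : E →L[ℝ] E) : E →ₗ[ℝ] E)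
      = -(Module.finrank ℝ E : ℝ) := by simp
  rw [htr] at hI
  simp only [neg_apply, ContinuousLinearMap.id_apply, neg_sub, hdA] at hI
  have hcU := hU.continuous_fderiv (by simp)
  have hcψ := hψ.continuous_fderiv (by simp)
  have hcX := hX.continuous
  have hcm : ∀ {a b : E → E →L[ℝ] ℝ}, Continuous a → Continuous b →
      Continuous fun z => m (a z) (b z) := fun ha hb => (m.continuous.comp ha).clm_apply hb
  have hcD : Continuous fun z => D2 z (c - z) :=
    (hdU.continuous_fderiv (by simp)).clm_apply (continuous_const.sub continuous_id)
  have i1 : Integrable (fun z => fderiv ℝ U z (c - z) * m (fderiv ℝ U z) (fderiv ℝ ψ z)) μ :=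
    (hcX.mul (hcm hcU hcψ)).integrable_of_hasCompactSupport
      (HasCompactSupport.mul_left ((hc.fderiv ℝ).mono fun z hz => fun h => hz (by
        simp only [h, map_zero])))
  have i2 : Integrable (fun z => ψ z * m (fderiv ℝ U z) (D2 z (c - z))) μ :=
    (hψ.continuous.mul (hcm hcU hcD)).integrable_of_hasCompactSupport hc.mul_right
  have i3 : Integrable (fun z => ψ z * m (fderiv ℝ U z) (fderiv ℝ U z)) μ :=
    (hψ.continuous.mul (hcm hcU hcU)).integrable_of_hasCompactSupport hc.mul_right
  have i4 : Integrable (fun z => fderiv ℝ ψ z (c - z) * m (fderiv ℝ U z) (fderiv ℝ U z)) μ :=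
    ((hcψ.clm_apply (continuous_const.sub continuous_id)).mul
      (hcm hcU hcU)).integrable_of_hasCompactSupport
      (HasCompactSupport.mul_right ((hc.fderiv ℝ).mono fun z hz => fun h => hz (by
        simp only [h, zero_apply])))
  have e1 : ∫ z, m (fderiv ℝ U z) (fderiv ℝ (fun z => ψ z * fderiv ℝ U z (c - z)) z) ∂μ
      = ∫ z, ψ z * m (fderiv ℝ U z) (D2 z (c - z)) ∂μ
        - ∫ z, ψ z * m (fderiv ℝ U z) (fderiv ℝ U z) ∂μ
        + ∫ z, fderiv ℝ U z (c - z) * m (fderiv ℝ U z) (fderiv ℝ ψ z) ∂μ := by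
    rw [← integral_sub i2 i3, ← integral_add _ i1]
    · refine integral_congr_ae (.of_forall fun z => ?_)
      dsimp only
      rw [hdX]
      simp only [map_add, map_smul, map_sub, smul_eq_mul]
      ring
    · exact i2.sub i3
  have e2 : 2 * ∫ z, ψ z * m (fderiv ℝ U z) (D2 z (c - z)) ∂μ
      = -(∫ z, fderiv ℝ ψ z (c - z) * m (fderiv ℝ U z) (fderiv ℝ U z) ∂μ
        - Module.finrank ℝ E * ∫ z, ψ z * m (fderiv ℝ U z) (fderiv ℝ U z) ∂μ) := by
    rw [← integral_const_mul, ← integral_const_mul, ← integral_sub i4 (i3.const_mul _)]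
    convert hI using 1
    · exact integral_congr_ae (.of_forall fun z => by ring)
    · congr 1
      exact integral_congr_ae (.of_forall fun z => by ring)
  have e3 : ∫ z, (-(fderiv ℝ U z (c - z) * m (fderiv ℝ U z) (fderiv ℝ ψ z))
        + 1 / 2 * (fderiv ℝ ψ z (c - z) - (Module.finrank ℝ E - 2) * ψ z)
          * m (fderiv ℝ U z) (fderiv ℝ U z)) ∂μ
      = - ∫ z, fderiv ℝ U z (c - z) * m (fderiv ℝ U z) (fderiv ℝ ψ z) ∂μ
        + (1 / 2 * ∫ z, fderiv ℝ ψ z (c - z) * m (fderiv ℝ U z) (fderiv ℝ U z) ∂μ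
        - 1 / 2 * (Module.finrank ℝ E - 2) * ∫ z, ψ z * m (fderiv ℝ U z) (fderiv ℝ U z) ∂μ) := by
    rw [← integral_const_mul, ← integral_const_mul, ← integral_neg,
      ← integral_sub (i4.const_mul _) (i3.const_mul _),
      ← integral_add _ _]
    · exact integral_congr_ae (.of_forall fun z => by ring)
    · exact i1.neg
    · exact (i4.const_mul _).sub (i3.const_mul _)
  rw [e3]
  linarith

/-- The multiplier identity with multiplier `U`, for smooth functions. -/
theorem smooth_mul_identity {m : (E →L[ℝ] ℝ) →L[ℝ] (E →L[ℝ] ℝ) →L[ℝ] ℝ}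
    {U H ψ : E → ℝ} (hU : ContDiff ℝ ∞ U) (hψ : ContDiff ℝ ∞ ψ) (hc : HasCompactSupport ψ)
    (hw : ∀ φ : E → ℝ, ContDiff ℝ ∞ φ → HasCompactSupport φ → tsupport φ ⊆ tsupport ψ →
      ∫ z, m (fderiv ℝ U z) (fderiv ℝ φ z) ∂μ = - ∫ z, H z * φ z ∂μ) :
    ∫ z, H z * (ψ z * U z) ∂μ
      = ∫ z, (-(U z * m (fderiv ℝ U z) (fderiv ℝ ψ z))
        + -(ψ z * m (fderiv ℝ U z) (fderiv ℝ U z))) ∂μ := by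
  have h1 := hw _ (hψ.mul hU) hc.mul_right (closure_mono (Function.support_mul_subset_left _ _))
  rw [← neg_eq_iff_eq_neg] at h1
  rw [← h1, ← integral_neg]
  refine integral_congr_ae (.of_forall fun z => ?_)
  have := (((hψ.differentiable (by simp) z).hasFDerivAt).mul
    ((hU.differentiable (by simp) z).hasFDerivAt)).fderiv
  dsimp only
  erw [this]
  simp only [map_add, map_smul, smul_eq_mul]
  ring

end SmoothIdentities

section WeakIdentities

variable {E F G : Type*} [NormedAddCommGroup E] [NormedSpace ℝ E] [FiniteDimensional ℝ E]
  [MeasurableSpace E] [BorelSpace E] {μ : Measure E} [μ.IsAddHaarMeasure] {Ω : Set E}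
  [NormedAddCommGroup F] [NormedSpace ℝ F] [CompleteSpace F]
  [NormedAddCommGroup G] [NormedSpace ℝ G] [CompleteSpace G]

theorem eventually_memLp_moll {f : E → F} (hf : MemLp f 2 μ) :
    ∀ᶠ n in atTop, MemLp (moll μ (bump E n) f) 2 μ := by
  filter_upwards [(tendsto_eLpNorm_moll_sub hf).eventually_lt_const one_pos] with n hn
  have h1 : MemLp (moll μ (bump E n) f - f) 2 μ :=
    ⟨(continuous_moll _ (hf.locallyIntegrable (by norm_num))).aestronglyMeasurable.sub hf.1,
      hn.trans ENNReal.one_lt_top⟩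
  simpa using h1.add hf

theorem tendsto_integral_bilin_moll {B : E → F → G → ℝ} {C : ℝ} (hC : 0 ≤ C)
    (hB : IsBilinFamily μ B C) {f : E → F} {g : E → G} (hf : MemLp f 2 μ) (hg : MemLp g 2 μ) :
    Tendsto (fun n => ∫ z, B z (moll μ (bump E n) f z) (moll μ (bump E n) g z) ∂μ) atTop
      (𝓝 (∫ z, B z (f z) (g z) ∂μ)) :=
  tendsto_integral_bilin hC (.of_forall fun _ => hB)
    (.of_forall fun _ => tendsto_const_nhds) (eventually_memLp_moll hf) hf
    (eventually_memLp_moll hg) hg (tendsto_eLpNorm_moll_sub hf) (tendsto_eLpNorm_moll_sub hg)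

theorem exists_bilin_bound (m : F →L[ℝ] G →L[ℝ] ℝ) :
    ∃ C, 0 ≤ C ∧ ∀ a b, |m a b| ≤ C * (‖a‖ * ‖b‖) := by
  obtain ⟨C, hC, h⟩ := m.isBoundedBilinearMap.bound
  exact ⟨C, hC.le, fun a b => by rw [← mul_assoc]; exact h a b⟩

theorem isBilinFamily_smul {k : E → ℝ} (hk : Continuous k) (hc : HasCompactSupport k)
    (m : F →L[ℝ] G →L[ℝ] ℝ) :
    ∃ C, 0 ≤ C ∧ IsBilinFamily μ (fun z a b => k z * m a b) C := by
  obtain ⟨Ck, hCk⟩ := hc.exists_bound_of_continuous hk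
  obtain ⟨Cm, hCm, hm⟩ := exists_bilin_bound m
  have hk0 : 0 ≤ Ck := (norm_nonneg _).trans (hCk 0)
  refine ⟨Ck * Cm, by positivity, ⟨?_, ?_, ?_, ?_⟩⟩
  · intro x a a' b; simp; ring
  · intro x a b b'; simp; ring
  · refine .of_forall fun z a b => ?_
    rw [abs_mul, mul_assoc]
    gcongr
    · exact hCk z
    · exact hm a b
  · intro f g hf hg
    exact hk.aestronglyMeasurable.mul
      (m.isBoundedBilinearMap.continuous.comp_aestronglyMeasurable (hf.prodMk hg))

theorem isBilinFamily_mul {α : E → F →L[ℝ] ℝ} {β : E → G →L[ℝ] ℝ} (hα : Continuous α)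
    (hβ : Continuous β) {K : Set E} (hK : IsCompact K) (h0 : ∀ z, z ∉ K → β z = 0) :
    ∃ C, 0 ≤ C ∧ IsBilinFamily μ (fun z a b => α z a * β z b) C := by
  obtain ⟨Ca, hCa⟩ := hK.exists_bound_of_continuousOn hα.continuousOn
  obtain ⟨Cb, hCb⟩ := hK.exists_bound_of_continuousOn hβ.continuousOn
  refine ⟨|Ca| * |Cb|, by positivity, ⟨?_, ?_, ?_, ?_⟩⟩
  · intro x a a' b; simp; ring
  · intro x a b b'; simp; ring
  · refine .of_forall fun z a b => ?_
    by_cases hz : z ∈ K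
    · have h1 := (α z).le_of_opNorm_le (hCa z hz) a
      have h2 := (β z).le_of_opNorm_le (hCb z hz) b
      rw [abs_mul, mul_mul_mul_comm]
      gcongr
      · exact h1.trans (by gcongr; exact le_abs_self _)
      · exact h2.trans (by gcongr; exact le_abs_self _)
    · rw [h0 z hz]
      simp only [zero_apply, mul_zero, abs_zero]
      positivity
  · intro f g hf hg
    exact (isBoundedBilinearMap_apply.continuous.comp_aestronglyMeasurable
      (hα.aestronglyMeasurable.prodMk hf)).mul
      (isBoundedBilinearMap_apply.continuous.comp_aestronglyMeasurable
      (hβ.aestronglyMeasurable.prodMk hg))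

theorem eventually_closedBall_subset (hΩ : IsOpen Ω) {K : Set E} (hK : IsCompact K) (hKΩ : K ⊆ Ω) :
    ∀ᶠ n in atTop, ∀ z ∈ K, closedBall z (bump E n).rOut ⊆ Ω := by
  obtain ⟨δ, hδ, h⟩ := hK.exists_cthickening_subset_open hΩ hKΩ
  filter_upwards [(bump_rOut_tendsto (E := E)).eventually_lt_const hδ] with n hn z hz
  exact (closedBall_subset_closedBall hn.le).trans
    ((closedBall_subset_cthickening hz δ).trans h)

/-- Products of mollifications of `h` and `D` converge, in the sense of distributions. -/
def PairingLimit (μ : Measure E) (h : E → ℝ) (f : E → F) : Prop :=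
  ∀ α : E → F →L[ℝ] ℝ, Continuous α → HasCompactSupport α →
    Tendsto (fun n => ∫ z, moll μ (bump E n) h z * α z (moll μ (bump E n) f z) ∂μ) atTop
      (𝓝 (∫ z, h z * α z (f z) ∂μ))

theorem fderiv_moll_on_test (hΩ : IsOpen Ω) {u : E → ℝ} {D : E → E →L[ℝ] ℝ}
    (hu : MemLp u 2 μ) (hD : MemLp D 2 μ) (hw : IsWeakDeriv μ Ω u D) {ψ : E → ℝ}
    (hψ : IsTest Ω ψ) :
    ∀ᶠ n in atTop, ∀ z ∈ tsupport ψ,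
      fderiv ℝ (moll μ (bump E n) u) z = moll μ (bump E n) D z := by
  filter_upwards [eventually_closedBall_subset hΩ hψ.compact hψ.supp] with n hn z hz
  exact fderiv_moll_eq _ (hu.locallyIntegrable (by norm_num)) (hD.locallyIntegrable (by norm_num))
    hw (hn z hz)

theorem moll_weak_equation (hΩ : IsOpen Ω) {m : (E →L[ℝ] ℝ) →L[ℝ] (E →L[ℝ] ℝ) →L[ℝ] ℝ}
    {u h : E → ℝ} {D : E → E →L[ℝ] ℝ} (hu : MemLp u 2 μ) (hD : MemLp D 2 μ) (hDi : Integrable D μ)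
    (hh : Integrable h μ) (hw : IsWeakDeriv μ Ω u D) (he : IsWeakDiv μ Ω m D h) {ψ : E → ℝ}
    (hψ : IsTest Ω ψ) :
    ∀ᶠ n in atTop, ∀ φ : E → ℝ, ContDiff ℝ ∞ φ → HasCompactSupport φ → tsupport φ ⊆ tsupport ψ →
      ∫ z, m (fderiv ℝ (moll μ (bump E n) u) z) (fderiv ℝ φ z) ∂μ
        = - ∫ z, moll μ (bump E n) h z * φ z ∂μ := by
  filter_upwards [fderiv_moll_on_test hΩ hu hD hw hψ,
    eventually_closedBall_subset hΩ hψ.compact hψ.supp] with n h1 h2 φ hφ hφc hφs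
  rw [← integral_moll_weakDiv _ hDi hh he hφ hφc fun z hz => h2 z (hφs hz)]
  refine integral_congr_ae (.of_forall fun z => ?_)
  by_cases hz : z ∈ tsupport φ
  · dsimp only; rw [h1 z (hφs hz)]
  · have : fderiv ℝ φ z = 0 := fderiv_of_notMem_tsupport ℝ hz
    simp only [this, map_zero]

/-- The multiplier identity for the scaling vector field `c - z`. -/
theorem scaling_identity (hΩ : IsOpen Ω) {m : (E →L[ℝ] ℝ) →L[ℝ] (E →L[ℝ] ℝ) →L[ℝ] ℝ}
    (hm : ∀ a b, m a b = m b a) {u h : E → ℝ} {D : E → E →L[ℝ] ℝ} (hu : MemLp u 2 μ)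
    (hD : MemLp D 2 μ) (hDi : Integrable D μ) (hh : Integrable h μ) (hw : IsWeakDeriv μ Ω u D)
    (he : IsWeakDiv μ Ω m D h) (hp : PairingLimit μ h D) {ψ : E → ℝ} (hψ : IsTest Ω ψ) (c : E) :
    ∫ z, h z * (ψ z * D z (c - z)) ∂μ
      = ∫ z, (-(D z (c - z) * m (D z) (fderiv ℝ ψ z))
        + 1 / 2 * (fderiv ℝ ψ z (c - z) - (Module.finrank ℝ E - 2) * ψ z) * m (D z) (D z)) ∂μ := by
  have hψc := hψ.smooth.continuous
  have hψd := hψ.smooth.continuous_fderiv (by simp)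
  have hev : Continuous fun z : E => ContinuousLinearMap.apply ℝ ℝ (c - z) := by fun_prop
  set k : E → ℝ := fun z => 1 / 2 * (fderiv ℝ ψ z (c - z) - (Module.finrank ℝ E - 2) * ψ z) with hk
  have hkc : Continuous k := by
    have : Continuous fun z => fderiv ℝ ψ z (c - z) :=
      hψd.clm_apply (continuous_const.sub continuous_id)
    exact continuous_const.mul (this.sub (continuous_const.mul hψc))
  have hks : HasCompactSupport k := by
    refine hψ.compact.mono' fun z hz => ?_
    by_contra hn
    exact hz (by simp [hk, fderiv_of_notMem_tsupport ℝ hn, image_eq_zero_of_notMem_tsupport hn])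
  have l1 := hp (fun z => ψ z • ContinuousLinearMap.apply ℝ ℝ (c - z)) (hψc.smul hev)
    hψ.compact.smul_right
  have hβ : Continuous fun z => m.flip (fderiv ℝ ψ z) := m.flip.continuous.comp hψd
  obtain ⟨C₁, hC₁, hB₁⟩ := isBilinFamily_mul (μ := μ) hev hβ hψ.compact fun z hz => by
    rw [fderiv_of_notMem_tsupport ℝ hz, map_zero]
  obtain ⟨C₂, hC₂, hB₂⟩ := isBilinFamily_smul (μ := μ) hkc hks m
  have l2 := tendsto_integral_bilin_moll hC₁ hB₁ hD hD
  have l3 := tendsto_integral_bilin_moll hC₂ hB₂ hD hD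
  simp only [smul_apply, ContinuousLinearMap.apply_apply, smul_eq_mul,
    ContinuousLinearMap.flip_apply] at l1 l2 l3
  have hI : ∀ {f : E → E →L[ℝ] ℝ}, MemLp f 2 μ →
      Integrable (fun z => -(f z (c - z) * m (f z) (fderiv ℝ ψ z))) μ
      ∧ Integrable (fun z => k z * m (f z) (f z)) μ := fun hf =>
    ⟨(hB₁.integrable hf hf).neg, hB₂.integrable hf hf⟩
  have l4 := l2.neg.add l3
  rw [← integral_neg, ← integral_add (hI hD).1 (hI hD).2] at l4
  refine tendsto_nhds_unique l1 (l4.congr' ?_)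
  filter_upwards [moll_weak_equation hΩ hu hD hDi hh hw he hψ, fderiv_moll_on_test hΩ hu hD hw hψ,
    eventually_memLp_moll hD] with n h1 h2 h3
  have h4 := smooth_scaling_identity hm (contDiff_moll (μ := μ) (bump E n)
    (hu.locallyIntegrable (by norm_num))) hψ.smooth hψ.compact h1 c
  rw [← integral_neg, ← integral_add (hI h3).1 (hI h3).2]
  have h5 : ∀ z, z ∉ tsupport ψ → ψ z = 0 ∧ fderiv ℝ ψ z = 0 ∧ k z = 0 := fun z hn =>
    ⟨image_eq_zero_of_notMem_tsupport hn, fderiv_of_notMem_tsupport ℝ hn, by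
      simp [hk, fderiv_of_notMem_tsupport ℝ hn, image_eq_zero_of_notMem_tsupport hn]⟩
  refine Eq.trans ?_ (h4.symm.trans ?_)
  · refine integral_congr_ae (.of_forall fun z => ?_)
    dsimp only
    change _ = _ + k z * _
    by_cases hz : z ∈ tsupport ψ
    · rw [h2 z hz]
    · simp [h5 z hz]
  · refine integral_congr_ae (.of_forall fun z => ?_)
    dsimp only
    by_cases hz : z ∈ tsupport ψ
    · rw [h2 z hz]
    · simp [h5 z hz]

/-- The multiplier identity with multiplier `u`. -/
theorem mul_identity (hΩ : IsOpen Ω) {m : (E →L[ℝ] ℝ) →L[ℝ] (E →L[ℝ] ℝ) →L[ℝ] ℝ}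
    {u h : E → ℝ} {D : E → E →L[ℝ] ℝ} (hu : MemLp u 2 μ)
    (hD : MemLp D 2 μ) (hDi : Integrable D μ) (hh : Integrable h μ) (hw : IsWeakDeriv μ Ω u D)
    (he : IsWeakDiv μ Ω m D h) (hp : PairingLimit μ h u) {ψ : E → ℝ} (hψ : IsTest Ω ψ) :
    ∫ z, h z * (ψ z * u z) ∂μ
      = ∫ z, (-(u z * m (D z) (fderiv ℝ ψ z)) + -(ψ z * m (D z) (D z))) ∂μ := by
  have hψc := hψ.smooth.continuous
  have hψd := hψ.smooth.continuous_fderiv (by simp)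
  have l1 := hp (fun z => ψ z • ContinuousLinearMap.id ℝ ℝ) (hψc.smul continuous_const)
    hψ.compact.smul_right
  have hβ : Continuous fun z => m.flip (fderiv ℝ ψ z) := m.flip.continuous.comp hψd
  obtain ⟨C₁, hC₁, hB₁⟩ := isBilinFamily_mul (μ := μ) (α := fun _ => ContinuousLinearMap.id ℝ ℝ)
    continuous_const hβ hψ.compact fun z hz => by rw [fderiv_of_notMem_tsupport ℝ hz, map_zero]
  obtain ⟨C₂, hC₂, hB₂⟩ := isBilinFamily_smul (μ := μ) hψc hψ.compact m
  have l2 := tendsto_integral_bilin_moll hC₁ hB₁ hu hD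
  have l3 := tendsto_integral_bilin_moll hC₂ hB₂ hD hD
  simp only [smul_apply, ContinuousLinearMap.id_apply, smul_eq_mul,
    ContinuousLinearMap.flip_apply] at l1 l2 l3
  have hI : ∀ {f : E → E →L[ℝ] ℝ} {g : E → ℝ}, MemLp f 2 μ → MemLp g 2 μ →
      Integrable (fun z => -(g z * m (f z) (fderiv ℝ ψ z))) μ
      ∧ Integrable (fun z => -(ψ z * m (f z) (f z))) μ := fun hf hg =>
    ⟨(hB₁.integrable hg hf).neg, (hB₂.integrable hf hf).neg⟩
  have l4 := l2.neg.add l3.neg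
  rw [← integral_neg, ← integral_neg, ← integral_add (hI hD hu).1 (hI hD hu).2] at l4
  refine tendsto_nhds_unique l1 (l4.congr' ?_)
  filter_upwards [moll_weak_equation hΩ hu hD hDi hh hw he hψ, fderiv_moll_on_test hΩ hu hD hw hψ,
    eventually_memLp_moll hD, eventually_memLp_moll hu] with n h1 h2 h3 h6
  have h4 := smooth_mul_identity (contDiff_moll (μ := μ) (bump E n)
    (hu.locallyIntegrable (by norm_num))) hψ.smooth hψ.compact h1
  rw [← integral_neg, ← integral_neg, ← integral_add (hI h3 h6).1 (hI h3 h6).2]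
  have h5 : ∀ z, z ∉ tsupport ψ → ψ z = 0 ∧ fderiv ℝ ψ z = 0 := fun z hn =>
    ⟨image_eq_zero_of_notMem_tsupport hn, fderiv_of_notMem_tsupport ℝ hn⟩
  refine Eq.trans ?_ h4.symm
  refine integral_congr_ae (.of_forall fun z => ?_)
  dsimp only
  by_cases hz : z ∈ tsupport ψ
  · rw [h2 z hz]
  · simp [h5 z hz]

theorem pairingLimit_of_memLp {h : E → ℝ} {f : E → F}
    (hh : MemLp h 2 μ) (hf : MemLp f 2 μ) : PairingLimit μ h f := by
  intro α hα hc
  obtain ⟨C, hC, hB⟩ := isBilinFamily_mul (μ := μ) (α := fun _ => ContinuousLinearMap.id ℝ ℝ)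
    continuous_const hα hc (fun z hz => image_eq_zero_of_notMem_tsupport hz)
  exact tendsto_integral_bilin_moll hC hB hh hf

end WeakIdentities

section Truncation

/-- The projection of `a` to `[-k, k]`. -/
def clamp (k a : ℝ) : ℝ := max (-k) (min k a)

theorem continuous_clamp (k : ℝ) : Continuous (clamp k) := by
  unfold clamp; fun_prop

theorem abs_clamp_le {k : ℝ} (hk : 0 ≤ k) (a : ℝ) : |clamp k a| ≤ |a| ∧ |clamp k a| ≤ k := by
  unfold clamp
  constructor <;> rw [abs_le] <;>
    constructor <;> rcases abs_cases a with h | h <;> rcases max_cases (-k) (min k a) with h1 | h1 <;>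
    rcases min_cases k a with h2 | h2 <;> linarith

theorem clamp_of_abs_le {k a : ℝ} (h : |a| ≤ k) : clamp k a = a := by
  rw [abs_le] at h
  rw [clamp, min_eq_right h.2, max_eq_right h.1]

/-- The primitive of `φ ∘ clamp k` vanishing at `0`. -/
def truncPrim (φ : ℝ → ℝ) (k a : ℝ) : ℝ := ∫ x in (0 : ℝ)..a, φ (clamp k x)

theorem truncPrim_zero (φ : ℝ → ℝ) (k : ℝ) : truncPrim φ k 0 = 0 := by simp [truncPrim]

theorem hasDerivAt_truncPrim {φ : ℝ → ℝ} (hφ : Continuous φ) (k a : ℝ) :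
    HasDerivAt (truncPrim φ k) (φ (clamp k a)) a := by
  have h : Continuous fun x => φ (clamp k x) := hφ.comp (continuous_clamp k)
  exact intervalIntegral.integral_hasDerivAt_right (h.intervalIntegrable _ _)
    (h.stronglyMeasurableAtFilter _ _) h.continuousAt

theorem truncPrim_eq {Φ φ : ℝ → ℝ} (hΦ : ∀ a, HasDerivAt Φ (φ a) a) (hφ : Continuous φ)
    (h0 : Φ 0 = 0) {k a : ℝ} (h : |a| ≤ k) : truncPrim φ k a = Φ a := by
  have h1 : truncPrim φ k a = ∫ x in (0 : ℝ)..a, φ x := by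
    refine intervalIntegral.integral_congr fun x hx => ?_
    have hx' : |x| ≤ |a| := by
      rcases Set.mem_uIcc.1 hx with hx | hx
      · rw [abs_of_nonneg hx.1]; exact hx.2.trans (le_abs_self a)
      · rw [abs_of_nonpos hx.2]; exact (neg_le_neg hx.1).trans (neg_le_abs a)
    simp only [clamp_of_abs_le (hx'.trans h)]
  rw [h1, intervalIntegral.integral_eq_sub_of_hasDerivAt (fun x _ => hΦ x)
    (hφ.intervalIntegrable _ _), h0, sub_zero]

variable {φ : ℝ → ℝ} {C p : ℝ}

theorem abs_trunc_le (hp : 0 ≤ p) (hC : 0 ≤ C) (hb : ∀ a, |φ a| ≤ C * (1 + |a| ^ p)) {k : ℝ}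
    (hk : 0 ≤ k) (a : ℝ) : |φ (clamp k a)| ≤ C * (1 + |a| ^ p) := by
  exact (hb _).trans (mul_le_mul_of_nonneg_left
    (by linarith [Real.rpow_le_rpow (abs_nonneg _) (abs_clamp_le hk a).1 hp]) hC)

theorem abs_trunc_le_const (hp : 0 ≤ p) (hC : 0 ≤ C) (hb : ∀ a, |φ a| ≤ C * (1 + |a| ^ p)) {k : ℝ}
    (hk : 0 ≤ k) (a : ℝ) : |φ (clamp k a)| ≤ C * (1 + k ^ p) := by
  exact (hb _).trans (mul_le_mul_of_nonneg_left
    (by linarith [Real.rpow_le_rpow (abs_nonneg _) (abs_clamp_le hk a).2 hp]) hC)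

theorem abs_truncPrim_le (hp : 0 ≤ p) (hC : 0 ≤ C) (hb : ∀ a, |φ a| ≤ C * (1 + |a| ^ p)) {k : ℝ}
    (hk : 0 ≤ k) (a : ℝ) : |truncPrim φ k a| ≤ C * ((1 + |a| ^ p) * |a|) := by
  have h := intervalIntegral.norm_integral_le_of_norm_le_const (a := 0) (b := a)
    (f := fun x => φ (clamp k x)) (C := C * (1 + |a| ^ p)) fun x hx => by
      refine (abs_trunc_le hp hC hb hk x).trans ?_
      have hx' : |x| ≤ |a| := by
        rcases Set.mem_uIoc.1 hx with hx | hx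
        · rw [abs_of_nonneg hx.1.le]; exact hx.2.trans (le_abs_self a)
        · rw [abs_of_nonpos hx.2]; exact (neg_le_neg hx.1.le).trans (neg_le_abs a)
      gcongr
  simpa [truncPrim, mul_assoc] using h

theorem lipschitz_truncPrim (hφ : Continuous φ) {K : ℝ} {k : ℝ}
    (hK : ∀ a, |φ (clamp k a)| ≤ K) (a b : ℝ) :
    |truncPrim φ k a - truncPrim φ k b| ≤ K * |a - b| :=
  Convex.norm_image_sub_le_of_norm_hasDerivWithin_le (s := Set.univ)
    (fun x _ => (hasDerivAt_truncPrim hφ k x).hasDerivWithinAt) (fun x _ => hK x) convex_univ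
    (Set.mem_univ b) (Set.mem_univ a)

end Truncation

section ChainRule

variable {E : Type*} [NormedAddCommGroup E] [NormedSpace ℝ E] [FiniteDimensional ℝ E]
  [MeasurableSpace E] [BorelSpace E] {μ : Measure E} [μ.IsAddHaarMeasure] {Ω : Set E}

theorem chain_identity_of_bounded (hΩ : IsOpen Ω) {u : E → ℝ} {D : E → E →L[ℝ] ℝ}
    (hu : MemLp u 2 μ) (hD : MemLp D 2 μ) (hw : IsWeakDeriv μ Ω u D) {Φ φ : ℝ → ℝ}
    (hΦ : ∀ a, HasDerivAt Φ (φ a) a) (hφ : Continuous φ) (h0 : Φ 0 = 0) {K : ℝ}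
    (hK : ∀ a, |φ a| ≤ K) {ψ : E → ℝ} (hψ : IsTest Ω ψ) (L : E →L[ℝ] E) (c : E) :
    ∫ z, φ (u z) * D z (L (z - c)) * ψ z ∂μ
      = - ∫ z, Φ (u z) * (fderiv ℝ ψ z (L (z - c)) + LinearMap.trace ℝ E L * ψ z) ∂μ := by
  have hK0 : 0 ≤ K := (abs_nonneg _).trans (hK 0)
  have hlip : ∀ a b, |Φ a - Φ b| ≤ K * |a - b| := fun a b =>
    Convex.norm_image_sub_le_of_norm_hasDerivWithin_le (s := Set.univ)
      (fun x _ => (hΦ x).hasDerivWithinAt) (fun x _ => hK x) convex_univ (Set.mem_univ b)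
      (Set.mem_univ a)
  have hΦc : Continuous Φ := continuous_iff_continuousAt.2 fun a => (hΦ a).continuousAt
  have hΦ1 : ContDiff ℝ 1 Φ := by
    rw [contDiff_one_iff_deriv]
    exact ⟨fun a => (hΦ a).differentiableAt, by rw [funext fun a => (hΦ a).deriv]; exact hφ⟩
  have hψc := hψ.smooth.continuous
  have hψd := hψ.smooth.continuous_fderiv (by simp)
  have hLc : Continuous fun z : E => L (z - c) := by fun_prop
  set k : E → ℝ := fun z => fderiv ℝ ψ z (L (z - c)) + LinearMap.trace ℝ E L * ψ z with hk
  have hkc : Continuous k := (hψd.clm_apply hLc).add (continuous_const.mul hψc)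
  have hks : HasCompactSupport k := by
    refine hψ.compact.mono' fun z hz => ?_
    by_contra hn
    exact hz (by simp [hk, fderiv_of_notMem_tsupport ℝ hn, image_eq_zero_of_notMem_tsupport hn])
  have hk2 : MemLp k 2 μ := hkc.memLp_of_hasCompactSupport hks
  have hul : LocallyIntegrable u μ := hu.locallyIntegrable (by norm_num)
  have hUc : ∀ n, Continuous (moll μ (bump E n) u) := fun n => continuous_moll _ hul
  have hmem : ∀ {f : E → ℝ}, MemLp f 2 μ → MemLp (fun z => Φ (f z)) 2 μ := fun {f} hf =>
    (hf.const_mul K).mono (hΦc.comp_aestronglyMeasurable hf.1) (.of_forall fun z => by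
      have := hlip (f z) 0
      rw [h0, sub_zero, sub_zero] at this
      rw [norm_eq_abs, norm_mul, norm_eq_abs, norm_eq_abs, abs_of_nonneg hK0]
      exact this)
  have l1 : Tendsto (fun n => ∫ z, Φ (moll μ (bump E n) u z) * k z ∂μ) atTop
      (𝓝 (∫ z, Φ (u z) * k z ∂μ)) := by
    refine tendsto_integral_bilin (B := fun _ _ (a b : ℝ) => a * b) (B₀ := fun _ a b => a * b)
      (C := 1) (f := fun n z => Φ (moll μ (bump E n) u z)) (f₀ := fun z => Φ (u z))
      (g := fun _ => k) zero_le_one (.of_forall fun n => ⟨?_, ?_, ?_, ?_⟩)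
      (.of_forall fun _ => tendsto_const_nhds) ?_ (hmem hu)
      (.of_forall fun _ => hk2) hk2 ?_ (by simp)
    · intro x a a' b; ring
    · intro x a b b'; ring
    · exact .of_forall fun z a b => by simp [abs_mul]
    · exact fun f g hf hg => hf.mul hg
    · filter_upwards [eventually_memLp_moll hu] with n hn
      exact hmem hn
    · have hlim := ENNReal.Tendsto.const_mul (tendsto_eLpNorm_moll_sub hu)
        (Or.inr (ENNReal.ofReal_ne_top (r := K)))
      rw [mul_zero] at hlim
      refine tendsto_of_tendsto_of_tendsto_of_le_of_le tendsto_const_nhds hlim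
        (fun _ => zero_le) fun n => ?_
      have h1 : eLpNorm ((fun z => Φ (moll μ (bump E n) u z)) - fun z => Φ (u z)) 2 μ
          ≤ eLpNorm (fun z => K * (moll μ (bump E n) u - u) z) 2 μ :=
        eLpNorm_mono fun z => by
          rw [Pi.sub_apply, norm_eq_abs, norm_mul, norm_eq_abs, norm_eq_abs,
            abs_of_nonneg hK0]
          exact hlip _ _
      refine h1.trans (le_of_eq ?_)
      have := eLpNorm_const_smul K (moll μ (bump E n) u - u) 2 μ
      rw [Real.enorm_of_nonneg hK0] at this
      exact this
  have hae := ContDiffBump.ae_convolution_tendsto_right_of_locallyIntegrable (μ := μ)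
    (φ := bump E) (l := atTop) (K := 2) bump_rOut_tendsto
    (.of_forall fun n => by simp [bump]; ring_nf; rfl) hul
  set S := tsupport ψ with hS
  have hSm : MeasurableSet S := (isClosed_tsupport ψ).measurableSet
  have h1S : MemLp (S.indicator fun _ => (1 : ℝ)) 2 μ :=
    memLp_indicator_const 2 hSm 1 (Or.inr hψ.compact.isCompact.measure_lt_top.ne)
  obtain ⟨M, hM⟩ := hψ.compact.isCompact.exists_bound_of_continuousOn
    (f := fun z => ψ z * ‖L (z - c)‖) (hψc.mul hLc.norm).continuousOn
  have hM' : ∀ z, |ψ z| * ‖L (z - c)‖ ≤ |M| := fun z => by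
    by_cases hz : z ∈ S
    · have := hM z hz
      rw [norm_mul, norm_norm, norm_eq_abs] at this
      exact this.trans (le_abs_self M)
    · rw [image_eq_zero_of_notMem_tsupport hz]; simp
  have l2 : Tendsto (fun n => ∫ z, φ (moll μ (bump E n) u z) * ψ z
        * (moll μ (bump E n) D z) (L (z - c)) * S.indicator (fun _ => (1 : ℝ)) z ∂μ) atTop
      (𝓝 (∫ z, φ (u z) * ψ z * D z (L (z - c)) * S.indicator (fun _ => (1 : ℝ)) z ∂μ)) := by
    refine tendsto_integral_bilin (B := fun n z (a : E →L[ℝ] ℝ) (b : ℝ) =>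
      φ (moll μ (bump E n) u z) * ψ z * a (L (z - c)) * b)
      (B₀ := fun z a b => φ (u z) * ψ z * a (L (z - c)) * b)
      (C := K * |M|) (f := fun n => moll μ (bump E n) D)
      (g := fun _ => S.indicator fun _ => (1 : ℝ)) (by positivity)
      (.of_forall fun n => ⟨?_, ?_, ?_, ?_⟩) ?_ (eventually_memLp_moll hD) hD
      (.of_forall fun _ => h1S) h1S (tendsto_eLpNorm_moll_sub hD) (by simp)
    · intro x a a' b; simp only [sub_apply]; ring
    · intro x a b b'; ring
    · refine .of_forall fun z a b => ?_
      calc |φ (moll μ (bump E n) u z) * ψ z * a (L (z - c)) * b|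
          = |φ (moll μ (bump E n) u z)| * |ψ z| * |a (L (z - c))| * |b| := by
            simp only [abs_mul]
        _ ≤ K * |ψ z| * (‖a‖ * ‖L (z - c)‖) * |b| := by
            gcongr
            · exact hK _
            · exact a.le_opNorm _
        _ = K * (|ψ z| * ‖L (z - c)‖) * (‖a‖ * ‖b‖) := by rw [norm_eq_abs]; ring
        _ ≤ K * |M| * (‖a‖ * ‖b‖) := by gcongr; exact hM' z
    · intro f g hf hg
      have h1 : AEStronglyMeasurable (fun z => f z (L (z - c))) μ :=
        isBoundedBilinearMap_apply.continuous.comp_aestronglyMeasurable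
          (hf.prodMk hLc.aestronglyMeasurable)
      exact (((hφ.comp (hUc n)).mul hψc).aestronglyMeasurable.mul h1).mul hg
    · filter_upwards [hae] with z hz
      have hz' : Tendsto (fun n => moll μ (bump E n) u z) atTop (𝓝 (u z)) := hz
      exact ((((hφ.tendsto _).comp hz').mul_const _).mul_const _).mul_const _
  have hdrop : ∀ (a : ℝ → ℝ) (b : E → ℝ) (d : E → E →L[ℝ] ℝ),
      ∫ z, a (b z) * ψ z * d z (L (z - c)) * S.indicator (fun _ => (1 : ℝ)) z ∂μ
        = ∫ z, a (b z) * d z (L (z - c)) * ψ z ∂μ := by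
    intro a b d
    refine integral_congr_ae (.of_forall fun z => ?_)
    by_cases hz : z ∈ S
    · simp [hz]; ring
    · simp [hz, image_eq_zero_of_notMem_tsupport hz]
  simp only [hdrop] at l2
  refine tendsto_nhds_unique l2 (l1.neg.congr' ?_)
  filter_upwards [fderiv_moll_on_test hΩ hu hD hw hψ] with n hn
  have hU : ContDiff ℝ 1 (moll μ (bump E n) u) :=
    (contDiff_moll (μ := μ) (bump E n) hul).of_le (by simp)
  have h3 := integral_fderiv_affine (μ := μ) L c (hΦ1.comp hU) (hψ.smooth.of_le (by simp))
    hψ.compact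
  simp only [Function.comp_apply] at h3
  rw [← h3]
  refine integral_congr_ae (.of_forall fun z => ?_)
  by_cases hz : z ∈ S
  · have h4 : fderiv ℝ (Φ ∘ moll μ (bump E n) u) z
        = φ (moll μ (bump E n) u z) • fderiv ℝ (moll μ (bump E n) u) z :=
      ((hΦ _).comp_hasFDerivAt z (hU.differentiable one_ne_zero z).hasFDerivAt).fderiv
    simp only [h4, hn z hz, smul_apply, smul_eq_mul]
  · simp [image_eq_zero_of_notMem_tsupport hz]

/-- The chain rule for weak derivatives, tested against affine vector fields. -/
theorem chain_identity (hΩ : IsOpen Ω) {u : E → ℝ} {D : E → E →L[ℝ] ℝ}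
    (hu : MemLp u 2 μ) (hD : MemLp D 2 μ) (hw : IsWeakDeriv μ Ω u D) {Φ φ : ℝ → ℝ}
    (hΦ : ∀ a, HasDerivAt Φ (φ a) a) (hφ : Continuous φ) (h0 : Φ 0 = 0) {C p : ℝ} (hp : 0 ≤ p)
    (hC : 0 ≤ C) (hb : ∀ a, |φ a| ≤ C * (1 + |a| ^ p)) {ψ : E → ℝ} (hψ : IsTest Ω ψ)
    (hI1 : IntegrableOn (fun z => (1 + |u z| ^ p) * |u z|) (tsupport ψ) μ)
    (hI2 : IntegrableOn (fun z => (1 + |u z| ^ p) * ‖D z‖) (tsupport ψ) μ)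
    (L : E →L[ℝ] E) (c : E) :
    ∫ z, φ (u z) * D z (L (z - c)) * ψ z ∂μ
      = - ∫ z, Φ (u z) * (fderiv ℝ ψ z (L (z - c)) + LinearMap.trace ℝ E L * ψ z) ∂μ := by
  have hψc := hψ.smooth.continuous
  have hψd := hψ.smooth.continuous_fderiv (by simp)
  have hLc : Continuous fun z : E => L (z - c) := by fun_prop
  set S := tsupport ψ with hS
  have hSm : MeasurableSet S := (isClosed_tsupport ψ).measurableSet
  set k : E → ℝ := fun z => fderiv ℝ ψ z (L (z - c)) + LinearMap.trace ℝ E L * ψ z with hk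
  have hkc : Continuous k := (hψd.clm_apply hLc).add (continuous_const.mul hψc)
  have hk0 : ∀ z, z ∉ S → k z = 0 := fun z hn => by
    simp [hk, fderiv_of_notMem_tsupport ℝ hn, image_eq_zero_of_notMem_tsupport hn]
  obtain ⟨M1, hM1⟩ := hψ.compact.isCompact.exists_bound_of_continuousOn hkc.continuousOn
  obtain ⟨M2, hM2⟩ := hψ.compact.isCompact.exists_bound_of_continuousOn
    (f := fun z => ψ z * ‖L (z - c)‖) (hψc.mul hLc.norm).continuousOn
  have key : ∀ n : ℕ, ∫ z, φ (clamp n (u z)) * D z (L (z - c)) * ψ z ∂μ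
      = - ∫ z, truncPrim φ n (u z) * k z ∂μ := fun n =>
    chain_identity_of_bounded hΩ hu hD hw (hasDerivAt_truncPrim hφ n)
      (hφ.comp (continuous_clamp n)) (truncPrim_zero φ n)
      (abs_trunc_le_const hp hC hb n.cast_nonneg) hψ L c
  have hDm : AEStronglyMeasurable (fun z => D z (L (z - c))) μ :=
    isBoundedBilinearMap_apply.continuous.comp_aestronglyMeasurable
      (hD.1.prodMk hLc.aestronglyMeasurable)
  have l1 : Tendsto (fun n : ℕ => ∫ z, φ (clamp n (u z)) * D z (L (z - c)) * ψ z ∂μ) atTop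
      (𝓝 (∫ z, φ (u z) * D z (L (z - c)) * ψ z ∂μ)) := by
    refine tendsto_integral_of_dominated_convergence
      (S.indicator fun z => C * |M2| * ((1 + |u z| ^ p) * ‖D z‖)) (fun n => ?_)
      ((integrable_indicator_iff hSm).2 (hI2.const_mul _))
      (fun n => .of_forall fun z => ?_) (.of_forall fun z => ?_)
    · exact (((hφ.comp (continuous_clamp n)).comp_aestronglyMeasurable hu.1).mul hDm).mul
        hψc.aestronglyMeasurable
    · by_cases hz : z ∈ S
      · rw [Set.indicator_of_mem hz]
        have h2 := hM2 z hz
        simp only [norm_mul, norm_norm] at h2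
        calc ‖φ (clamp n (u z)) * D z (L (z - c)) * ψ z‖
            = |φ (clamp n (u z))| * ‖D z (L (z - c))‖ * ‖ψ z‖ := by
              simp only [norm_mul, norm_eq_abs]
          _ ≤ C * (1 + |u z| ^ p) * (‖D z‖ * ‖L (z - c)‖) * ‖ψ z‖ := by
              gcongr
              · exact abs_trunc_le hp hC hb n.cast_nonneg _
              · exact (D z).le_opNorm _
          _ = C * (1 + |u z| ^ p) * ‖D z‖ * (‖ψ z‖ * ‖L (z - c)‖) := by ring
          _ ≤ C * (1 + |u z| ^ p) * ‖D z‖ * |M2| := by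
              gcongr
              exact h2.trans (le_abs_self _)
          _ = _ := by ring
      · rw [Set.indicator_of_notMem hz, image_eq_zero_of_notMem_tsupport hz]; simp
    · refine tendsto_const_nhds.congr' ?_
      obtain ⟨N, hN⟩ := exists_nat_ge |u z|
      filter_upwards [eventually_ge_atTop N] with n hn
      rw [clamp_of_abs_le (hN.trans (by exact_mod_cast hn))]
  have l2 : Tendsto (fun n : ℕ => ∫ z, truncPrim φ n (u z) * k z ∂μ) atTop
      (𝓝 (∫ z, Φ (u z) * k z ∂μ)) := by
    refine tendsto_integral_of_dominated_convergence
      (S.indicator fun z => C * |M1| * ((1 + |u z| ^ p) * |u z|)) (fun n => ?_)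
      ((integrable_indicator_iff hSm).2 (hI1.const_mul _))
      (fun n => .of_forall fun z => ?_) (.of_forall fun z => ?_)
    · have : Continuous (truncPrim φ n) :=
        continuous_iff_continuousAt.2 fun a => (hasDerivAt_truncPrim hφ n a).continuousAt
      exact (this.comp_aestronglyMeasurable hu.1).mul hkc.aestronglyMeasurable
    · by_cases hz : z ∈ S
      · rw [Set.indicator_of_mem hz, norm_mul]
        have h2 := hM1 z hz
        calc ‖truncPrim φ n (u z)‖ * ‖k z‖ ≤ C * ((1 + |u z| ^ p) * |u z|) * |M1| := by
              gcongr
              · exact abs_truncPrim_le hp hC hb n.cast_nonneg _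
              · exact h2.trans (le_abs_self _)
          _ = _ := by ring
      · rw [Set.indicator_of_notMem hz, hk0 z hz]; simp
    · refine tendsto_const_nhds.congr' ?_
      obtain ⟨N, hN⟩ := exists_nat_ge |u z|
      filter_upwards [eventually_ge_atTop N] with n hn
      rw [truncPrim_eq hΦ hφ h0 (hN.trans (by exact_mod_cast hn))]
  simp only [key] at l1
  exact tendsto_nhds_unique l1 l2.neg

end ChainRule

section MixedNorm

variable {A S F : Type*} [NormedAddCommGroup A] [MeasurableSpace A] [BorelSpace A]
  [NormedAddCommGroup S] [MeasurableSpace S] [BorelSpace S] [SecondCountableTopology A]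
  [SecondCountableTopology S] {μ : Measure A} {ν : Measure S} [μ.IsAddLeftInvariant]
  [ν.IsAddLeftInvariant] [SFinite μ] [SFinite ν]

/-- The norm of `L¹_t L²_x`. -/
def mixedNorm (μ : Measure A) (ν : Measure S) (a : A × S → ℝ≥0∞) : ℝ≥0∞ :=
  ∫⁻ t, (∫⁻ x, a (t, x) ^ 2 ∂ν) ^ (1 / 2 : ℝ) ∂μ

theorem lintegral_mul_le_sqrt {X : Type*} [MeasurableSpace X] {m : Measure X} {a b : X → ℝ≥0∞}
    (ha : AEMeasurable a m) (hb : AEMeasurable b m) :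
    ∫⁻ x, a x * b x ∂m ≤ (∫⁻ x, a x ^ 2 ∂m) ^ (1 / 2 : ℝ) * (∫⁻ x, b x ^ 2 ∂m) ^ (1 / 2 : ℝ) := by
  have h := ENNReal.lintegral_mul_le_Lp_mul_Lq m (p := 2) (q := 2)
    ⟨by norm_num, by norm_num, by norm_num⟩ ha hb
  simpa using h

theorem lintegral_translate_mul_le {a b : A × S → ℝ≥0∞} (ha : Measurable a) (hb : Measurable b)
    {K : ℝ≥0∞} (hK : ∀ᵐ t ∂μ, (∫⁻ x, b (t, x) ^ 2 ∂ν) ^ (1 / 2 : ℝ) ≤ K) (ζ ζ' : A × S) :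
    ∫⁻ z, a (z - ζ) * b (z - ζ') ∂(μ.prod ν) ≤ mixedNorm μ ν a * K := by
  rw [lintegral_prod _ (by fun_prop)]
  have h1 : ∀ᵐ t ∂μ, (∫⁻ x, b (t - ζ'.1, x) ^ 2 ∂ν) ^ (1 / 2 : ℝ) ≤ K :=
    (measurePreserving_sub_right μ ζ'.1).quasiMeasurePreserving.ae hK
  have h2 : ∀ᵐ t ∂μ, ∫⁻ x, a ((t, x) - ζ) * b ((t, x) - ζ') ∂ν
      ≤ (∫⁻ x, a (t - ζ.1, x) ^ 2 ∂ν) ^ (1 / 2 : ℝ) * K := by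
    filter_upwards [h1] with t ht
    refine (lintegral_mul_le_sqrt (by fun_prop) (by fun_prop)).trans (mul_le_mul' (le_of_eq ?_) ?_)
    · rw [← lintegral_sub_right_eq_self (fun x => a (t - ζ.1, x) ^ 2) ζ.2]; rfl
    · refine le_trans (le_of_eq ?_) ht
      rw [← lintegral_sub_right_eq_self (fun x => b (t - ζ'.1, x) ^ 2) ζ'.2]; rfl
  refine (lintegral_mono_ae h2).trans (le_of_eq ?_)
  have hm : Measurable fun t => (∫⁻ x, a (t, x) ^ 2 ∂ν) ^ (1 / 2 : ℝ) :=
    ((ha.pow_const 2).lintegral_prod_right').pow_const _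
  have hm' : Measurable fun t => (∫⁻ x, a (t - ζ.1, x) ^ 2 ∂ν) ^ (1 / 2 : ℝ) :=
    hm.comp (measurable_id.sub_const _)
  rw [lintegral_mul_const _ hm', mixedNorm,
    ← lintegral_sub_right_eq_self (fun t => (∫⁻ x, a (t, x) ^ 2 ∂ν) ^ (1 / 2 : ℝ)) ζ.1]

theorem lintegral_convolution_mul_le {a b w : A × S → ℝ≥0∞} (ha : Measurable a)
    (hb : Measurable b) (hw : Measurable w) (hw1 : ∫⁻ z, w z ∂(μ.prod ν) = 1)
    {K : ℝ≥0∞} (hK : ∀ᵐ t ∂μ, (∫⁻ x, b (t, x) ^ 2 ∂ν) ^ (1 / 2 : ℝ) ≤ K) :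
    ∫⁻ z, (∫⁻ ζ, w ζ * a (z - ζ) ∂(μ.prod ν)) * (∫⁻ ζ, w ζ * b (z - ζ) ∂(μ.prod ν)) ∂(μ.prod ν)
      ≤ mixedNorm μ ν a * K := by
  have hma : Measurable fun q : (A × S) × (A × S) => w q.2 * a (q.1 - q.2) := by fun_prop
  have hmb : Measurable fun q : (A × S) × (A × S) => w q.2 * b (q.1 - q.2) := by fun_prop
  set Bz : A × S → ℝ≥0∞ := fun z => ∫⁻ ζ, w ζ * b (z - ζ) ∂(μ.prod ν) with hBz
  have hBm : Measurable Bz := hmb.lintegral_prod_right'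
  have key : ∀ ζ, ∫⁻ z, a (z - ζ) * Bz z ∂(μ.prod ν) ≤ mixedNorm μ ν a * K := by
    intro ζ
    calc ∫⁻ z, a (z - ζ) * Bz z ∂(μ.prod ν)
        = ∫⁻ z, ∫⁻ ζ', w ζ' * (a (z - ζ) * b (z - ζ')) ∂(μ.prod ν) ∂(μ.prod ν) := by
          refine lintegral_congr fun z => ?_
          rw [hBz, ← lintegral_const_mul _ (by fun_prop)]
          refine lintegral_congr fun ζ' => ?_
          ring
      _ = ∫⁻ ζ', ∫⁻ z, w ζ' * (a (z - ζ) * b (z - ζ')) ∂(μ.prod ν) ∂(μ.prod ν) :=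
          lintegral_lintegral_swap (by fun_prop)
      _ ≤ ∫⁻ ζ', w ζ' * (mixedNorm μ ν a * K) ∂(μ.prod ν) := by
          refine lintegral_mono fun ζ' => ?_
          rw [lintegral_const_mul _ (by fun_prop)]
          exact mul_le_mul' le_rfl (lintegral_translate_mul_le ha hb hK ζ ζ')
      _ = mixedNorm μ ν a * K := by rw [lintegral_mul_const _ hw, hw1, one_mul]
  calc _ = ∫⁻ z, ∫⁻ ζ, w ζ * (a (z - ζ) * Bz z) ∂(μ.prod ν) ∂(μ.prod ν) := by
        refine lintegral_congr fun z => ?_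
        rw [← lintegral_mul_const _ (by fun_prop)]
        refine lintegral_congr fun ζ' => ?_
        ring
    _ = ∫⁻ ζ, ∫⁻ z, w ζ * (a (z - ζ) * Bz z) ∂(μ.prod ν) ∂(μ.prod ν) :=
        lintegral_lintegral_swap (by fun_prop)
    _ ≤ ∫⁻ ζ, w ζ * (mixedNorm μ ν a * K) ∂(μ.prod ν) := by
        refine lintegral_mono fun ζ => ?_
        rw [lintegral_const_mul _ (by fun_prop)]
        exact mul_le_mul' le_rfl (key ζ)
    _ = mixedNorm μ ν a * K := by rw [lintegral_mul_const _ hw, hw1, one_mul]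

theorem lintegral_mul_le_mixedNorm {a b : A × S → ℝ≥0∞} (ha : Measurable a) (hb : Measurable b)
    {K : ℝ≥0∞} (hK : ∀ᵐ t ∂μ, (∫⁻ x, b (t, x) ^ 2 ∂ν) ^ (1 / 2 : ℝ) ≤ K) :
    ∫⁻ z, a z * b z ∂(μ.prod ν) ≤ mixedNorm μ ν a * K := by
  simpa using lintegral_translate_mul_le ha hb hK 0 0

/-- Truncation converges in the mixed norm. -/
theorem tendsto_mixedNorm_truncation {h : A × S → ℝ} (hm : Measurable h)
    (hfin : mixedNorm μ ν (fun z => ‖h z‖ₑ) ≠ ⊤) :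
    Tendsto (fun k : ℕ => mixedNorm μ ν fun z => ‖{z | (k : ℝ) < |h z|}.indicator h z‖ₑ) atTop
      (𝓝 0) := by
  have hset : ∀ k : ℕ, MeasurableSet {z | (k : ℝ) < |h z|} := fun k =>
    measurableSet_lt measurable_const hm.abs
  have hle : ∀ (k : ℕ) z, ‖{z | (k : ℝ) < |h z|}.indicator h z‖ₑ ≤ ‖h z‖ₑ := fun k z =>
    enorm_indicator_le_enorm_self _ _
  have hmeas : Measurable fun t => ∫⁻ x, ‖h (t, x)‖ₑ ^ 2 ∂ν :=
    (hm.enorm.pow_const 2).lintegral_prod_right'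
  have hae : ∀ᵐ t ∂μ, ∫⁻ x, ‖h (t, x)‖ₑ ^ 2 ∂ν < ⊤ := by
    filter_upwards [ae_lt_top (hmeas.pow_const _) hfin] with t ht
    exact (ENNReal.rpow_lt_top_iff_of_pos (by norm_num)).1 ht
  have := tendsto_lintegral_of_dominated_convergence (μ := μ)
    (F := fun (k : ℕ) t => (∫⁻ x, ‖{z | (k : ℝ) < |h z|}.indicator h (t, x)‖ₑ ^ 2 ∂ν) ^ (1 / 2 : ℝ))
    (f := fun _ => 0) (fun t => (∫⁻ x, ‖h (t, x)‖ₑ ^ 2 ∂ν) ^ (1 / 2 : ℝ))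
    (fun k => ((((hm.indicator (hset k)).enorm.pow_const 2).lintegral_prod_right').pow_const _))
    (fun k => .of_forall fun t => by
      dsimp only
      gcongr
      exact hle k _) hfin ?_
  · simpa [mixedNorm] using this
  · filter_upwards [hae] with t ht
    have h1 := tendsto_lintegral_of_dominated_convergence (μ := ν)
      (F := fun (k : ℕ) x => ‖{z | (k : ℝ) < |h z|}.indicator h (t, x)‖ₑ ^ 2)
      (f := fun _ => 0) (fun x => ‖h (t, x)‖ₑ ^ 2)
      (fun k => ((hm.indicator (hset k)).enorm.pow_const 2).comp (measurable_const.prodMk measurable_id))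
      (fun k => .of_forall fun x => by
        dsimp only
        gcongr
        exact hle k _) ht.ne ?_
    · have h2 := (ENNReal.continuous_rpow_const (y := (1 / 2 : ℝ))).tendsto 0
      rw [lintegral_zero] at h1
      simpa [Function.comp_def] using h2.comp h1
    · refine .of_forall fun x => tendsto_const_nhds.congr' ?_
      obtain ⟨N, hN⟩ := exists_nat_ge |h (t, x)|
      filter_upwards [eventually_ge_atTop N] with k hk
      have : (t, x) ∉ {z | (k : ℝ) < |h z|} := by
        simp only [Set.mem_ofPred_eq, not_lt]
        exact hN.trans (by exact_mod_cast hk)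
      simp [this]

end MixedNorm

section Pairing

variable {A S F : Type*} [NormedAddCommGroup A] [MeasurableSpace A] [BorelSpace A]
  [NormedSpace ℝ A] [FiniteDimensional ℝ A]
  [NormedAddCommGroup S] [MeasurableSpace S] [BorelSpace S]
  [NormedSpace ℝ S] [FiniteDimensional ℝ S] {μ : Measure A} {ν : Measure S} [μ.IsAddHaarMeasure]
  [ν.IsAddHaarMeasure] [NormedAddCommGroup F] [NormedSpace ℝ F] [CompleteSpace F]

theorem pairingLimit_of_measurable {h : A × S → ℝ} {f : A × S → F} (hm : Measurable h)
    (hfm : StronglyMeasurable f) (hh : Integrable h (μ.prod ν)) (hf : MemLp f 2 (μ.prod ν))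
    (hfin : mixedNorm μ ν (fun z => ‖h z‖ₑ) ≠ ⊤) {K : ℝ≥0∞} (hK0 : K ≠ ⊤)
    (hK : ∀ᵐ t ∂μ, (∫⁻ x, ‖f (t, x)‖ₑ ^ 2 ∂ν) ^ (1 / 2 : ℝ) ≤ K) :
    PairingLimit (μ.prod ν) h f := by
  intro α hα hc
  obtain ⟨C, hC⟩ := hc.exists_bound_of_continuous hα
  have hC0 : 0 ≤ C := (norm_nonneg _).trans (hC 0)
  have hfe : Measurable fun z => ‖f z‖ₑ := hfm.enorm
  set s : ℕ → Set (A × S) := fun k => {z | (k : ℝ) < |h z|} with hs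
  have hsm : ∀ k, MeasurableSet (s k) := fun k => measurableSet_lt measurable_const hm.abs
  set r : ℕ → A × S → ℝ := fun k => (s k).indicator h with hr
  set b : ℕ → A × S → ℝ := fun k => (s k)ᶜ.indicator h with hb
  have hrm : ∀ k, Measurable (r k) := fun k => hm.indicator (hsm k)
  have hri : ∀ k, Integrable (r k) (μ.prod ν) := fun k => hh.indicator (hsm k)
  have hbi : ∀ k, Integrable (b k) (μ.prod ν) := fun k => hh.indicator (hsm k).compl
  have hsum : ∀ k z, h z = b k z + r k z := fun k z => by
    simp only [hb, hr, Set.indicator_compl, Pi.sub_apply]; ring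
  have hb2 : ∀ k, MemLp (b k) 2 (μ.prod ν) := fun k => by
    refine (memLp_two_iff_integrable_sq (hbi k).1).2 ?_
    refine ((hbi k).norm.const_mul (k : ℝ)).mono' ((hbi k).1.pow 2) (.of_forall fun z => ?_)
    have : |b k z| ≤ k := by
      by_cases hz : z ∈ s k
      · simp [hb, hz]
      · simp only [hb, Set.indicator_of_mem (Set.mem_compl hz)]
        simpa [hs] using hz
    rw [norm_eq_abs, abs_pow, sq, norm_eq_abs]
    gcongr
  have hαb : ∀ z (y : F), ‖α z y‖ₑ ≤ ofReal C * ‖y‖ₑ := fun z y => by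
    rw [← ofReal_norm, ← ofReal_norm, ← ENNReal.ofReal_mul hC0]
    exact ENNReal.ofReal_le_ofReal ((α z).le_of_opNorm_le (hC z) y)
  set e : ℕ → ℝ≥0∞ := fun k => ofReal C * (mixedNorm μ ν (fun z => ‖r k z‖ₑ) * K) with he
  have hel : Tendsto e atTop (𝓝 0) := by
    have h1 := ENNReal.Tendsto.const_mul (ENNReal.Tendsto.mul_const
      (tendsto_mixedNorm_truncation hm hfin) (Or.inr hK0))
      (Or.inr (ENNReal.ofReal_ne_top (r := C)))
    simpa using h1
  have b1 : ∀ k n, ‖∫ z, moll (μ.prod ν) (bump (A × S) n) (r k) z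
      * α z (moll (μ.prod ν) (bump (A × S) n) f z) ∂(μ.prod ν)‖ₑ ≤ e k := by
    intro k n
    refine (enorm_integral_le_lintegral_enorm _).trans ?_
    have h2 := lintegral_convolution_mul_le (μ := μ) (ν := ν) (hrm k).enorm hfe
      (w := fun ζ => ofReal ((bump (A × S) n).normed (μ.prod ν) ζ))
      ((bump (A × S) n).continuous_normed.measurable.ennreal_ofReal)
      (lintegral_normed _) hK
    refine le_trans ?_ (mul_le_mul' le_rfl h2)
    rw [← lintegral_const_mul' _ _ ENNReal.ofReal_ne_top]
    refine lintegral_mono fun z => ?_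
    rw [enorm_mul]
    refine (mul_le_mul' (enorm_moll_le _ _ z) ((hαb z _).trans
      (mul_le_mul' le_rfl (enorm_moll_le _ _ z)))).trans (le_of_eq ?_)
    ring
  have b2 : ∀ k, ‖∫ z, r k z * α z (f z) ∂(μ.prod ν)‖ₑ ≤ e k := by
    intro k
    refine (enorm_integral_le_lintegral_enorm _).trans ?_
    refine le_trans ?_ (mul_le_mul' le_rfl (lintegral_mul_le_mixedNorm (hrm k).enorm hfe hK))
    rw [← lintegral_const_mul' _ _ ENNReal.ofReal_ne_top]
    refine lintegral_mono fun z => ?_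
    rw [enorm_mul]
    refine (mul_le_mul' le_rfl (hαb z _)).trans (le_of_eq ?_)
    ring
  have hαf : AEStronglyMeasurable (fun z => α z (f z)) (μ.prod ν) :=
    isBoundedBilinearMap_apply.continuous.comp_aestronglyMeasurable
      (hα.aestronglyMeasurable.prodMk hf.1)
  have hrint : ∀ k, mixedNorm μ ν (fun z => ‖r k z‖ₑ) ≠ ⊤ := fun k =>
    ne_top_of_le_ne_top hfin (lintegral_mono fun t => by
      have := fun x => enorm_indicator_le_enorm_self h (s := s k) (t, x)
      dsimp only [hr]
      gcongr
      exact this _)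
  have i1 : ∀ k, Integrable (fun z => r k z * α z (f z)) (μ.prod ν) := fun k => by
    refine ⟨(hri k).1.mul hαf, lt_of_le_of_lt ?_ (lt_top_iff_ne_top.2 (ENNReal.mul_ne_top
      (ENNReal.ofReal_ne_top (r := C)) (ENNReal.mul_ne_top (hrint k) hK0)))⟩
    refine le_trans ?_ (mul_le_mul' le_rfl (lintegral_mul_le_mixedNorm (hrm k).enorm hfe hK))
    rw [← lintegral_const_mul' _ _ ENNReal.ofReal_ne_top]
    refine lintegral_mono fun z => ?_
    rw [enorm_mul]
    refine (mul_le_mul' le_rfl (hαb z _)).trans (le_of_eq ?_)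
    ring
  have i2 : ∀ k, Integrable (fun z => b k z * α z (f z)) (μ.prod ν) := fun k => by
    have hα2 : MemLp (fun z => α z (f z)) 2 (μ.prod ν) :=
      (hf.norm.const_mul C).mono hαf (.of_forall fun z => by
        rw [norm_mul, norm_norm, norm_of_nonneg hC0]
        exact (α z).le_of_opNorm_le (hC z) _)
    exact (hb2 k).integrable_mul hα2
  have hfl : LocallyIntegrable f (μ.prod ν) := hf.locallyIntegrable (by norm_num)
  have hmc : ∀ n, Continuous fun z => α z (moll (μ.prod ν) (bump (A × S) n) f z) := fun n =>
    hα.clm_apply (continuous_moll _ hfl)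
  have hms : ∀ n, HasCompactSupport fun z => α z (moll (μ.prod ν) (bump (A × S) n) f z) :=
    fun n => hc.mono' fun z hz => subset_tsupport _ fun h0 => hz (by simp [h0])
  have i3 : ∀ n {h' : A × S → ℝ}, Integrable h' (μ.prod ν) →
      Integrable (fun z => moll (μ.prod ν) (bump (A × S) n) h' z
        * α z (moll (μ.prod ν) (bump (A × S) n) f z)) (μ.prod ν) := fun n h' hi =>
    ((continuous_moll _ hi.locallyIntegrable).mul (hmc n)).integrable_of_hasCompactSupport
      (hms n).mul_left
  have hsplit : ∀ k n, moll (μ.prod ν) (bump (A × S) n) h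
      = fun z => moll (μ.prod ν) (bump (A × S) n) (b k) z
        + moll (μ.prod ν) (bump (A × S) n) (r k) z := fun k n => by
    funext z
    rw [moll_apply, moll_apply, moll_apply,
      ← integral_add (integrable_moll_integrand _ (hbi k).locallyIntegrable z)
        (integrable_moll_integrand _ (hri k).locallyIntegrable z)]
    simp only [← smul_add, ← hsum]
  rw [EMetric.tendsto_atTop]
  intro ε hε
  have hε3 : 0 < ε / 3 := ENNReal.div_pos hε.ne' (by norm_num)
  obtain ⟨k, hk⟩ := (hel.eventually_lt_const hε3).exists
  obtain ⟨N, hN⟩ := (EMetric.tendsto_atTop.1 (pairingLimit_of_memLp (hb2 k) hf α hα hc)) _ hε3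
  refine ⟨N, fun n hn => ?_⟩
  have h3 := hN n hn
  rw [edist_eq_enorm_sub] at h3 ⊢
  have d1 : ∫ z, moll (μ.prod ν) (bump (A × S) n) h z
      * α z (moll (μ.prod ν) (bump (A × S) n) f z) ∂(μ.prod ν)
      = ∫ z, moll (μ.prod ν) (bump (A × S) n) (b k) z
        * α z (moll (μ.prod ν) (bump (A × S) n) f z) ∂(μ.prod ν)
      + ∫ z, moll (μ.prod ν) (bump (A × S) n) (r k) z
        * α z (moll (μ.prod ν) (bump (A × S) n) f z) ∂(μ.prod ν) := by
    rw [← integral_add (i3 n (hbi k)) (i3 n (hri k)), hsplit k n]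
    simp only [add_mul]
  have d2 : ∫ z, h z * α z (f z) ∂(μ.prod ν)
      = ∫ z, b k z * α z (f z) ∂(μ.prod ν) + ∫ z, r k z * α z (f z) ∂(μ.prod ν) := by
    rw [← integral_add (i2 k) (i1 k)]
    simp only [← add_mul, ← hsum]
  rw [d1, d2, add_sub_add_comm]
  calc _ ≤ _ := enorm_add_le _ _
    _ ≤ _ := add_le_add le_rfl (enorm_sub_le)
    _ < ε / 3 + (ε / 3 + ε / 3) :=
        ENNReal.add_lt_add h3 (ENNReal.add_lt_add ((b1 k n).trans_lt hk) ((b2 k).trans_lt hk))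
    _ = ε := by rw [← add_assoc, ENNReal.add_thirds]

/-- Products of a function in `L¹_t L²_x` and a function in `L^∞_t L²_x`. -/
theorem pairingLimit_of_mixedNorm {h : A × S → ℝ} {f : A × S → F}
    (hh : Integrable h (μ.prod ν)) (hf : MemLp f 2 (μ.prod ν))
    (hfin : mixedNorm μ ν (fun z => ‖h z‖ₑ) ≠ ⊤) {K : ℝ≥0∞} (hK0 : K ≠ ⊤)
    (hK : ∀ᵐ t ∂μ, (∫⁻ x, ‖f (t, x)‖ₑ ^ 2 ∂ν) ^ (1 / 2 : ℝ) ≤ K) :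
    PairingLimit (μ.prod ν) h f := by
  obtain ⟨h', hm', hh'⟩ := hh.1.aemeasurable
  obtain ⟨f', hfm', hf'⟩ := hf.1
  have h1 : ∀ᵐ t ∂μ, ∀ᵐ x ∂ν, h (t, x) = h' (t, x) := Measure.ae_ae_of_ae_prod hh'
  have h2 : ∀ᵐ t ∂μ, ∀ᵐ x ∂ν, f (t, x) = f' (t, x) := Measure.ae_ae_of_ae_prod hf'
  have key := pairingLimit_of_measurable (μ := μ) (ν := ν) hm' hfm' (hh.congr hh')
    ((memLp_congr_ae hf').1 hf) (K := K) ?_ hK0 ?_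
  · intro α hα hc
    have h4 := key α hα hc
    simp only [moll_congr_ae _ hh', moll_congr_ae _ hf']
    convert h4 using 2
    refine integral_congr_ae ?_
    filter_upwards [hh', hf'] with z h5 h6
    rw [h5, h6]
  · convert hfin using 1
    refine lintegral_congr_ae ?_
    filter_upwards [h1] with t ht
    congr 1
    refine lintegral_congr_ae ?_
    filter_upwards [ht] with x hx
    rw [hx]
  · filter_upwards [h2, hK] with t ht hk
    refine le_trans (le_of_eq ?_) hk
    congr 1
    refine lintegral_congr_ae ?_
    filter_upwards [ht] with x hx
    rw [hx]

end Pairing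

section Slices

variable {X F : Type*} [MeasurableSpace X] [NormedAddCommGroup F] [NormedSpace ℝ F] {ν : Measure X}

/-- A curve in `L²` that is continuous on a compact set of times is bounded there. -/
theorem exists_bound_of_continuous_L2 {f : ℝ → X → F} {a b : ℝ}
    (hm : ∀ t ∈ Icc a b, MemLp (f t) 2 ν)
    (hc : ∀ t ∈ Icc a b,
      Tendsto (fun s => eLpNorm (fun x => f s x - f t x) 2 ν) (𝓝[Icc a b] t) (𝓝 0)) :
    ∃ C : ℝ, 0 ≤ C ∧ ∀ t ∈ Icc a b, eLpNorm (f t) 2 ν ≤ ofReal C := by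
  have h : ∀ t ∈ Icc a b, ∃ U ∈ 𝓝[Icc a b] t, ∃ C : ℝ, 0 ≤ C ∧
      ∀ s ∈ U ∩ Icc a b, eLpNorm (f s) 2 ν ≤ ofReal C := by
    intro t ht
    refine ⟨_, (hc t ht).eventually_lt_const one_pos, 1 + (eLpNorm (f t) 2 ν).toReal,
      by positivity, fun s hs => ?_⟩
    have h1 : f s = (fun x => f s x - f t x) + f t := by ext x; simp
    rw [ENNReal.ofReal_add zero_le_one ENNReal.toReal_nonneg, ENNReal.ofReal_one,
      ENNReal.ofReal_toReal (hm t ht).2.ne, h1]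
    refine (eLpNorm_add_le ((hm s hs.2).1.sub (hm t ht).1) (hm t ht).1 (by norm_num)).trans ?_
    gcongr
    exact le_of_lt hs.1
  refine isCompact_Icc.induction_on (p := fun S => ∃ C : ℝ, 0 ≤ C ∧
      ∀ s ∈ S ∩ Icc a b, eLpNorm (f s) 2 ν ≤ ofReal C) ⟨0, le_rfl, by simp⟩ ?_ ?_ ?_
    |>.imp fun C hC => ⟨hC.1, fun t ht => hC.2 t ⟨ht, ht⟩⟩
  · rintro S S' hS ⟨C, hC, h⟩
    exact ⟨C, hC, fun s hs => h s ⟨hS hs.1, hs.2⟩⟩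
  · rintro S S' ⟨C, hC, h⟩ ⟨C', hC', h'⟩
    refine ⟨max C C', le_max_of_le_left hC, fun s hs => ?_⟩
    rcases hs.1 with h1 | h1
    · exact (h s ⟨h1, hs.2⟩).trans (ENNReal.ofReal_le_ofReal (le_max_left _ _))
    · exact (h' s ⟨h1, hs.2⟩).trans (ENNReal.ofReal_le_ofReal (le_max_right _ _))
  · intro t ht
    obtain ⟨U, hU, C, hC, h1⟩ := h t ht
    exact ⟨U, hU, C, hC, h1⟩

theorem eLpNorm_two_eq_sqrt (f : X → F) :
    eLpNorm f 2 ν = (∫⁻ x, ‖f x‖ₑ ^ 2 ∂ν) ^ (1 / 2 : ℝ) := by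
  rw [lintegral_sq_eq_eLpNorm, ← ENNReal.rpow_two, ← ENNReal.rpow_mul]; norm_num

theorem memLp_two_of_slices {a b : ℝ} {C : ℝ} {f : ℝ × X → F} [SFinite ν]
    (hm : AEStronglyMeasurable f ((𝓛 (Icc a b)).prod ν))
    (hC : ∀ t ∈ Icc a b, eLpNorm (fun x => f (t, x)) 2 ν ≤ ofReal C) :
    MemLp f 2 ((𝓛 (Icc a b)).prod ν) := by
  refine ⟨hm, ?_⟩
  rw [eLpNorm_two_eq_sqrt]
  refine ENNReal.rpow_lt_top_of_nonneg (by norm_num) (ne_of_lt ?_)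
  rw [lintegral_prod _ (hm.enorm.pow_const 2)]
  calc ∫⁻ t in Icc a b, ∫⁻ x, ‖f (t, x)‖ₑ ^ 2 ∂ν
      ≤ ∫⁻ _ in Icc a b, ofReal C ^ 2 := by
        refine setLIntegral_mono' measurableSet_Icc fun t ht => ?_
        rw [lintegral_sq_eq_eLpNorm (fun x => f (t, x))]
        gcongr
        exact hC t ht
    _ < ⊤ := by
        rw [setLIntegral_const]
        exact ENNReal.mul_lt_top (ENNReal.pow_lt_top ENNReal.ofReal_lt_top)
          (by rw [Real.volume_Icc]; exact ENNReal.ofReal_lt_top)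

theorem integrable_mul_of_slices {a b : ℝ} {C : ℝ} {h : ℝ × X → ℝ} {k : ℝ × X → ℝ} [SFinite ν]
    (hm : AEStronglyMeasurable h ((𝓛 (Icc a b)).prod ν))
    (hk : AEStronglyMeasurable k ((𝓛 (Icc a b)).prod ν))
    (hfin : ∫⁻ t in Icc a b, eLpNorm (fun x => h (t, x)) 2 ν < ⊤)
    (hC : ∀ t ∈ Icc a b, eLpNorm (fun x => k (t, x)) 2 ν ≤ ofReal C) :
    Integrable (fun z => h z * k z) ((𝓛 (Icc a b)).prod ν) := by
  have hmk : AEStronglyMeasurable (fun z => h z * k z) ((𝓛 (Icc a b)).prod ν) :=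
    hm.mul hk
  refine ⟨hmk, ?_⟩
  rw [HasFiniteIntegral, lintegral_prod _ hmk.enorm]
  have h1 : ∀ᵐ t ∂(𝓛 (Icc a b)), ∫⁻ x, ‖h (t, x) * k (t, x)‖ₑ ∂ν
      ≤ eLpNorm (fun x => h (t, x)) 2 ν * ofReal C := by
    filter_upwards [hm.prodMk_left, hk.prodMk_left, ae_restrict_mem measurableSet_Icc]
      with t h2 h3 ht
    simp only [enorm_mul]
    refine (lintegral_mul_le_sqrt h2.enorm h3.enorm).trans ?_
    rw [← eLpNorm_two_eq_sqrt (fun x => h (t, x)), ← eLpNorm_two_eq_sqrt (fun x => k (t, x))]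
    exact mul_le_mul' le_rfl (hC t ht)
  refine (lintegral_mono_ae h1).trans_lt ?_
  rw [lintegral_mul_const' _ _ ENNReal.ofReal_ne_top]
  exact ENNReal.mul_lt_top hfin ENNReal.ofReal_lt_top

end Slices

section Source

variable {p q M : ℝ}

theorem exists_absorb (hq : 0 ≤ q) (hqp : q < p) (hM : 0 < M) {ε : ℝ} (hε : 0 < ε) :
    ∃ C, 0 ≤ C ∧ ∀ x : ℝ, 0 ≤ x → M * x ^ q ≤ ε * x ^ p + C := by
  set R := (M / ε) ^ (1 / (p - q)) with hR
  have hR0 : 0 ≤ R := Real.rpow_nonneg (by positivity) _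
  refine ⟨M * R ^ q, by positivity, fun x hx => ?_⟩
  rcases le_total x R with h | h
  · have : x ^ q ≤ R ^ q := Real.rpow_le_rpow hx h hq
    nlinarith [mul_nonneg hε.le (Real.rpow_nonneg hx p)]
  · have hR1 : 0 < R := Real.rpow_pos_of_pos (by positivity) _
    have hx0 : 0 < x := hR1.trans_le h
    have h1 : M / ε ≤ x ^ (p - q) := by
      calc M / ε = R ^ (p - q) := by
            rw [hR, ← Real.rpow_mul (by positivity), one_div_mul_cancel (by linarith), Real.rpow_one]
        _ ≤ _ := Real.rpow_le_rpow hR0 h (by linarith)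
    have h2 : x ^ p = x ^ (p - q) * x ^ q := by rw [← Real.rpow_add hx0]; congr 1; ring
    have h3 : M ≤ ε * x ^ (p - q) := by rwa [div_le_iff₀' hε] at h1
    have h4 : 0 ≤ x ^ q := Real.rpow_nonneg hx _
    have h5 : 0 ≤ M * R ^ q := by positivity
    nlinarith

theorem continuous_source {f g : ℝ → ℝ} (hp : 1 < p) (hf : Continuous f) (hg : Continuous g) :
    Continuous fun z : ℝ × ℝ => source p f g z.1 z.2 := by
  unfold source
  have : Continuous fun z : ℝ × ℝ => |z.1| ^ (p - 1) :=
    (continuous_abs.comp continuous_fst).rpow_const fun _ => Or.inr (by linarith)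
  fun_prop

theorem abs_pow_sub_one_mul (hp : 1 < p) (a : ℝ) : |a| ^ (p - 1) * |a| = |a| ^ p := by
  rcases eq_or_ne a 0 with rfl | ha
  · simp [Real.zero_rpow (by linarith : p ≠ 0)]
  · conv_rhs => rw [show p = (p - 1) + 1 by ring]
    rw [Real.rpow_add (abs_pos.2 ha), Real.rpow_one]

/-- The power nonlinearity is controlled by the full right-hand side. -/
theorem exists_rpow_le_source (hp : 1 < p) (hq : 0 ≤ q) (hqp : q < p) (hM : 0 < M) :
    ∃ C, 0 ≤ C ∧ ∀ f g : ℝ → ℝ, (∀ a, |f a| ≤ M * (1 + |a| ^ q)) → (∀ a, |g a| ≤ M * (1 + |a|)) →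
      ∀ a b, |a| ^ p ≤ C * (1 + |source p f g a b| + |b|) := by
  obtain ⟨C, hC, h⟩ := exists_absorb hq hqp hM (ε := 1 / 2) (by norm_num)
  refine ⟨2 * (1 + C + 2 * M), by positivity, fun f g hf hg a b => ?_⟩
  have h1 : |a| ^ p ≤ |source p f g a b| + |f a| + |g b| := by
    have h2 : |(|a| ^ (p - 1) * a)| = |a| ^ p := by
      rw [abs_mul, abs_of_nonneg (Real.rpow_nonneg (abs_nonneg a) _), abs_pow_sub_one_mul hp]
    rw [← h2, show |a| ^ (p - 1) * a = source p f g a b + -f a + -g b by unfold source; ring]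
    refine (abs_add_three _ _ _).trans ?_
    rw [abs_neg, abs_neg]
  have h2 := h _ (abs_nonneg a)
  have h3 := hf a
  have h4 := hg b
  have h5 := abs_nonneg (source p f g a b)
  have h6 := abs_nonneg b
  nlinarith [mul_nonneg hC h5, mul_nonneg hC h6, mul_nonneg hM.le h5, mul_nonneg hM.le h6]

end Source

instance instIsAddHaarMeasureSpaceTime (N : ℕ) : (volume : Measure (ℝ × Sp N)).IsAddHaarMeasure :=
  Measure.prod.instIsAddHaarMeasure (volume : Measure ℝ) (volume : Measure (Sp N))

section Forms

variable {N : ℕ}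

/-- The derivative of a function of space-time with time derivative `a` and gradient `e`. -/
def dual (a : ℝ) (e : Sp N) : (ℝ × Sp N) →L[ℝ] ℝ :=
  a • ContinuousLinearMap.fst ℝ ℝ (Sp N) + (innerSL ℝ e).comp (ContinuousLinearMap.snd ℝ ℝ (Sp N))

theorem dual_apply (a : ℝ) (e : Sp N) (z : ℝ × Sp N) : dual a e z = a * z.1 + inner ℝ e z.2 := by
  simp [dual]

theorem continuous_dual : Continuous fun w : ℝ × Sp N => dual w.1 w.2 := by
  unfold dual; fun_prop

theorem norm_dual_le (a : ℝ) (e : Sp N) : ‖dual a e‖ ≤ |a| + ‖e‖ := by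
  refine ContinuousLinearMap.opNorm_le_bound _ (by positivity) fun z => ?_
  rw [dual_apply, add_mul]
  refine (norm_add_le _ _).trans (add_le_add ?_ ((norm_inner_le_norm _ _).trans ?_))
  · rw [norm_mul, norm_eq_abs]
    gcongr
    exact norm_fst_le z
  · gcongr
    exact norm_snd_le z

theorem smulRight_sub_sum_apply {ι F : Type*} [Fintype ι] [NormedAddCommGroup F] [NormedSpace ℝ F]
    (a : F →L[ℝ] ℝ) (b : ι → F →L[ℝ] ℝ) (x y : F) :
    (a.smulRight a - ∑ i, (b i).smulRight (b i)) x y = a x * a y - ∑ i, b i x * b i y := by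
  simp [sum_apply]

/-- The Lorentz form on covectors. -/
def lorentz (N : ℕ) : ((ℝ × Sp N) →L[ℝ] ℝ) →L[ℝ] ((ℝ × Sp N) →L[ℝ] ℝ) →L[ℝ] ℝ :=
  (ContinuousLinearMap.apply ℝ ℝ ((1, 0) : ℝ × Sp N)).smulRight
      (ContinuousLinearMap.apply ℝ ℝ ((1, 0) : ℝ × Sp N))
    - ∑ i : Fin N, (ContinuousLinearMap.apply ℝ ℝ
        ((0, EuclideanSpace.single i 1) : ℝ × Sp N)).smulRight
      (ContinuousLinearMap.apply ℝ ℝ ((0, EuclideanSpace.single i 1) : ℝ × Sp N))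

theorem lorentz_apply (D D' : (ℝ × Sp N) →L[ℝ] ℝ) :
    lorentz N D D' = D (1, 0) * D' (1, 0)
      - ∑ i : Fin N, D (0, EuclideanSpace.single i 1) * D' (0, EuclideanSpace.single i 1) := by
  exact smulRight_sub_sum_apply _ _ D D'

theorem lorentz_symm (D D' : (ℝ × Sp N) →L[ℝ] ℝ) : lorentz N D D' = lorentz N D' D := by
  simp only [lorentz_apply, mul_comm]

theorem lorentz_dual (a : ℝ) (e : Sp N) (D' : (ℝ × Sp N) →L[ℝ] ℝ) :
    lorentz N (dual a e) D' = a * D' (1, 0) - D' (0, e) := by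
  rw [lorentz_apply]
  congr 1
  · simp [dual_apply]
  · have h : ((0, e) : ℝ × Sp N) = ∑ i : Fin N, e i • ((0, EuclideanSpace.single i 1) : ℝ × Sp N) := by
      rw [Prod.ext_iff]
      constructor
      · rw [Prod.fst_sum]; simp
      · have h2 := (EuclideanSpace.basisFun (Fin N) ℝ).sum_repr e
        simp only [EuclideanSpace.basisFun_repr, EuclideanSpace.basisFun_apply] at h2
        rw [Prod.snd_sum]
        exact h2.symm
    rw [h, map_sum]
    refine Finset.sum_congr rfl fun i _ => ?_
    rw [map_smul, smul_eq_mul, dual_apply]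
    simp [EuclideanSpace.inner_single_right]

theorem lorentz_dual_dual (a a' : ℝ) (e e' : Sp N) :
    lorentz N (dual a e) (dual a' e') = a * a' - inner ℝ e e' := by
  rw [lorentz_dual, dual_apply, dual_apply]
  simp [real_inner_comm]

theorem finrank_spaceTime : Module.finrank ℝ (ℝ × Sp N) = N + 1 := by
  rw [Module.finrank_prod]; simp [add_comm]

end Forms

section TimeDerivative

variable {N : ℕ} {K : Set (Sp N)} {u v : ℝ → Sp N → ℝ} {a b : ℝ}

theorem isBilinFamily_coeff {X : Type*} [MeasurableSpace X] {m : Measure X} {k : X → ℝ} {C : ℝ}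
    (hk : AEStronglyMeasurable k m) (hC : ∀ x, |k x| ≤ C) :
    IsBilinFamily m (fun x (a b : ℝ) => k x * a * b) C where
  sub_left x a a' b := by ring
  sub_right x a b b' := by ring
  bound := .of_forall fun x a b => by
    rw [abs_mul, abs_mul, mul_assoc]
    exact mul_le_mul_of_nonneg_right (hC x) (by positivity)
  meas f g hf hg := (hk.mul hf).mul hg

theorem hasDerivAt_integral_mul (hK : IsCompact K) {t : ℝ} (ht : t ∈ Ioo a b)
    (hu : ∀ t ∈ Icc a b, MemLp (u t) 2 (volume.restrict K))
    (hv : MemLp (v t) 2 (volume.restrict K))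
    (hd : Tendsto (fun τ => eLpNorm (fun x => (u τ x - u t x) / (τ - t) - v t x) 2
      (volume.restrict K)) (𝓝[≠] t) (𝓝 0))
    {φ : ℝ × Sp N → ℝ} (hφ : ContDiff ℝ ∞ φ) (hc : HasCompactSupport φ) :
    HasDerivAt (fun τ => ∫ x in K, u τ x * φ (τ, x))
      (∫ x in K, (v t x * φ (t, x) + u t x * fderiv ℝ φ (t, x) (1, 0))) t := by
  have hφc := hφ.continuous
  have hφd := hφ.continuous_fderiv (by simp)
  obtain ⟨C, hC⟩ := hc.exists_bound_of_continuous hφc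
  obtain ⟨C', hC'⟩ := (hc.fderiv (𝕜 := ℝ)).exists_bound_of_continuous hφd
  have hC0 : 0 ≤ C := (norm_nonneg _).trans (hC 0)
  have hC0' : 0 ≤ C' := (norm_nonneg _).trans (hC' 0)
  have hfin : IsFiniteMeasure (volume.restrict K) :=
    ⟨by rw [Measure.restrict_apply_univ]; exact hK.measure_lt_top⟩
  have h1 : MemLp (fun _ : Sp N => (1 : ℝ)) 2 (volume.restrict K) := memLp_const 1
  have hev : ∀ᶠ τ in 𝓝[≠] t, τ ∈ Ioo a b :=
    eventually_nhdsWithin_of_eventually_nhds (Ioo_mem_nhds ht.1 ht.2)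
  have hne : ∀ᶠ τ in 𝓝[≠] t, τ ≠ t := eventually_mem_nhdsWithin
  have hslope : ∀ x, HasDerivAt (fun τ => φ (τ, x)) (fderiv ℝ φ (t, x) (1, 0)) t := fun x => by
    have h2 : HasDerivAt (fun τ : ℝ => (τ, x)) ((1 : ℝ), (0 : Sp N)) t :=
      (hasDerivAt_id t).prodMk (hasDerivAt_const t x)
    exact (hφ.differentiable (by simp) (t, x)).hasFDerivAt.comp_hasDerivAt t h2
  have hlip : ∀ τ x, |φ (τ, x) - φ (t, x)| ≤ C' * |τ - t| := fun τ x => by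
    have h2 := Convex.norm_image_sub_le_of_norm_fderiv_le (𝕜 := ℝ) (s := Set.univ) (C := C')
      (fun z _ => hφ.differentiable (by simp) z) (fun z _ => hC' z) convex_univ
      (Set.mem_univ (t, x)) (Set.mem_univ (τ, x))
    simpa [Prod.norm_def] using h2
  have hut : MemLp (u t) 2 (volume.restrict K) := hu t ⟨ht.1.le, ht.2.le⟩
  have l1 := tendsto_integral_bilin (m := volume.restrict K) (l := 𝓝[≠] t)
    (B := fun τ x (a b : ℝ) => φ (τ, x) * a * b) (B₀ := fun x a b => φ (t, x) * a * b)
    (C := C) (f := fun τ x => (u τ x - u t x) / (τ - t)) (f₀ := v t) (g := fun _ _ => (1 : ℝ))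
    (g₀ := fun _ => (1 : ℝ)) hC0
    (.of_forall fun τ => isBilinFamily_coeff (Continuous.aestronglyMeasurable (by fun_prop))
      fun x => hC (τ, x))
    (.of_forall fun x => by
      have : Tendsto (fun τ => φ (τ, x)) (𝓝[≠] t) (𝓝 (φ (t, x))) :=
        tendsto_nhdsWithin_of_tendsto_nhds (Continuous.tendsto (by fun_prop) t)
      exact (this.mul_const _).mul_const _)
    (by
      filter_upwards [hev] with τ hτ
      simp only [div_eq_inv_mul]
      exact ((hu τ ⟨hτ.1.le, hτ.2.le⟩).sub hut).const_mul _)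
    hv (.of_forall fun _ => h1) h1 hd (by simp)
  have l2 := tendsto_integral_bilin (m := volume.restrict K) (l := 𝓝[≠] t)
    (B := fun τ x (a b : ℝ) => ((φ (τ, x) - φ (t, x)) / (τ - t)) * a * b)
    (B₀ := fun x a b => fderiv ℝ φ (t, x) (1, 0) * a * b)
    (C := C') (f := fun _ => u t) (f₀ := u t) (g := fun _ _ => (1 : ℝ))
    (g₀ := fun _ => (1 : ℝ)) hC0'
    (by
      filter_upwards [hne] with τ hτ
      refine isBilinFamily_coeff (Continuous.aestronglyMeasurable (by fun_prop)) fun x => ?_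
      rw [abs_div, div_le_iff₀ (abs_pos.2 (sub_ne_zero.2 hτ))]
      exact hlip τ x)
    (.of_forall fun x => by
      have := hasDerivAt_iff_tendsto_slope.1 (hslope x)
      have h3 : slope (fun τ => φ (τ, x)) t = fun τ => (φ (τ, x) - φ (t, x)) / (τ - t) := by
        funext τ; rw [slope_def_field]
      rw [h3] at this
      exact (this.mul_const _).mul_const _)
    (.of_forall fun _ => hut) hut (.of_forall fun _ => h1) h1 (by simp)
    (by simp)
  rw [hasDerivAt_iff_tendsto_slope]
  have hI : ∀ {f : Sp N → ℝ} {k : Sp N → ℝ} {C : ℝ}, MemLp f 2 (volume.restrict K) →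
      Continuous k → (∀ x, |k x| ≤ C) → Integrable (fun x => f x * k x) (volume.restrict K) :=
    fun hf hk hb => (((hf.integrable (by norm_num)).bdd_mul (c := _) hk.aestronglyMeasurable
      (.of_forall hb))).congr (.of_forall fun x => mul_comm _ _)
  have hlim := l1.add l2
  have e0 : (∫ x in K, φ (t, x) * v t x * 1) + (∫ x in K, fderiv ℝ φ (t, x) (1, 0) * u t x * 1)
      = ∫ x in K, (v t x * φ (t, x) + u t x * fderiv ℝ φ (t, x) (1, 0)) := by
    rw [integral_add (hI hv (by fun_prop) fun x => hC (t, x)) (hI hut (by fun_prop) (C := C')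
      fun x => by
        refine ((fderiv ℝ φ (t, x)).le_of_opNorm_le (hC' (t, x)) _).trans ?_
        simp [Prod.norm_def])]
    congr 1 <;> exact integral_congr_ae (.of_forall fun x => by ring)
  rw [e0] at hlim
  refine hlim.congr' ?_
  filter_upwards [hev, hne] with τ hτ hn
  have hτ0 : τ - t ≠ 0 := sub_ne_zero.2 hn
  have huτ := hu τ ⟨hτ.1.le, hτ.2.le⟩
  have i1 := hI huτ (k := fun x => φ (τ, x)) (by fun_prop) fun x => hC (τ, x)
  have i2 := hI hut (k := fun x => φ (t, x)) (by fun_prop) fun x => hC (t, x)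
  have i3 := hI hut (k := fun x => φ (τ, x)) (by fun_prop) fun x => hC (τ, x)
  have a1 : ∫ x in K, φ (τ, x) * ((u τ x - u t x) / (τ - t)) * 1
      = (τ - t)⁻¹ * ((∫ x in K, u τ x * φ (τ, x)) - ∫ x in K, u t x * φ (τ, x)) := by
    rw [← integral_sub i1 i3, ← integral_const_mul]
    refine integral_congr_ae (.of_forall fun x => ?_)
    field_simp
  have a2 : ∫ x in K, (φ (τ, x) - φ (t, x)) / (τ - t) * u t x * 1
      = (τ - t)⁻¹ * ((∫ x in K, u t x * φ (τ, x)) - ∫ x in K, u t x * φ (t, x)) := by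
    rw [← integral_sub i3 i2, ← integral_const_mul]
    refine integral_congr_ae (.of_forall fun x => ?_)
    field_simp
  rw [a1, a2, slope_def_field]
  field_simp
  ring

end TimeDerivative

section Wave

variable {N : ℕ} {p q M : ℝ} {f g : ℝ → ℝ} {T u₀ u₁ : Sp N → ℝ} {u v : ℝ → Sp N → ℝ}
  {G : ℝ → Sp N → Sp N} {a b r t T₀ α β γ C τ₀ δ δ₀ τ s K : ℝ} {x₀ : Sp N}

/-- A closed cylinder in space-time. -/
def cyl (a b : ℝ) (x₀ : Sp N) (r : ℝ) : Set (ℝ × Sp N) := Icc a b ×ˢ closedBall x₀ r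

/-- The interior of `cyl`. -/
def cylInt (a b : ℝ) (x₀ : Sp N) (r : ℝ) : Set (ℝ × Sp N) := Ioo a b ×ˢ ball x₀ r

/-- The cylinder `cyl a b x₀ r` lies below the graph of `T`. -/
structure CylBelow (T : Sp N → ℝ) (a b : ℝ) (x₀ : Sp N) (r : ℝ) : Prop where
  nonneg : 0 ≤ a
  below : ∀ x ∈ closedBall x₀ r, b < T x

theorem isOpen_cylInt (a b : ℝ) (x₀ : Sp N) (r : ℝ) : IsOpen (cylInt a b x₀ r) :=
  isOpen_Ioo.prod isOpen_ball

theorem cylInt_subset (a b : ℝ) (x₀ : Sp N) (r : ℝ) : cylInt a b x₀ r ⊆ cyl a b x₀ r :=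
  Set.prod_mono Set.Ioo_subset_Icc_self ball_subset_closedBall

theorem measurableSet_cyl (a b : ℝ) (x₀ : Sp N) (r : ℝ) : MeasurableSet (cyl a b x₀ r) :=
  measurableSet_Icc.prod isClosed_closedBall.measurableSet

theorem isCompact_cyl (a b : ℝ) (x₀ : Sp N) (r : ℝ) : IsCompact (cyl a b x₀ r) :=
  isCompact_Icc.prod (isCompact_closedBall _ _)

theorem restrict_cyl (a b : ℝ) (x₀ : Sp N) (r : ℝ) :
    (volume : Measure (ℝ × Sp N)).restrict (cyl a b x₀ r)
      = (𝓛 (Icc a b)).prod (𝓛 (closedBall x₀ r)) :=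
  (Measure.prod_restrict _ _).symm

instance isFiniteMeasure_restrict_cyl (a b : ℝ) (x₀ : Sp N) (r : ℝ) :
    IsFiniteMeasure ((volume : Measure (ℝ × Sp N)).restrict (cyl a b x₀ r)) :=
  ⟨by rw [Measure.restrict_apply_univ]; exact (isCompact_cyl a b x₀ r).measure_lt_top⟩

theorem CylBelow.lt (h : CylBelow T a b x₀ r) {t : ℝ} (ht : t ∈ Icc a b) :
    ∀ x ∈ closedBall x₀ r, t < T x := fun x hx => ht.2.trans_lt (h.below x hx)

theorem CylBelow.subset (h : CylBelow T a b x₀ r) : cyl a b x₀ r ⊆ influenceDomain T :=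
  fun z hz => ⟨h.nonneg.trans hz.1.1, h.lt hz.1 z.2 hz.2⟩

theorem IsSolution.exists_slice_bound (hs : IsSolution p f g T u₀ u₁ u v G)
    (hc : CylBelow T a b x₀ r) : ∃ C : ℝ, 0 ≤ C ∧ ∀ t ∈ Icc a b,
      eLpNorm (u t) 2 (𝓛 (closedBall x₀ r)) ≤ ofReal C ∧
      eLpNorm (G t) 2 (𝓛 (closedBall x₀ r)) ≤ ofReal C ∧
      eLpNorm (v t) 2 (𝓛 (closedBall x₀ r)) ≤ ofReal C := by
  have hK := isCompact_closedBall x₀ r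
  have hsub : ∀ t, 𝓝[Icc a b] t ≤ 𝓝[Ici 0] t := fun t =>
    nhdsWithin_mono t fun s hs => hc.nonneg.trans hs.1
  have hm := fun t (ht : t ∈ Icc a b) => hs.memLp t (hc.nonneg.trans ht.1) _ hK (hc.lt ht)
  have hl := fun t (ht : t ∈ Icc a b) => hs.continuous t (hc.nonneg.trans ht.1) _ hK (hc.lt ht)
  obtain ⟨C1, h10, h1⟩ := exists_bound_of_continuous_L2 (fun t ht => (hm t ht).1)
    (fun t ht => (hl t ht).1.mono_left (hsub t))
  obtain ⟨C2, h20, h2⟩ := exists_bound_of_continuous_L2 (fun t ht => (hm t ht).2.1)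
    (fun t ht => (hl t ht).2.1.mono_left (hsub t))
  obtain ⟨C3, h30, h3⟩ := exists_bound_of_continuous_L2 (fun t ht => (hm t ht).2.2)
    (fun t ht => (hl t ht).2.2.mono_left (hsub t))
  refine ⟨C1 + C2 + C3, by positivity, fun t ht => ⟨(h1 t ht).trans ?_, (h2 t ht).trans ?_,
    (h3 t ht).trans ?_⟩⟩ <;> exact ENNReal.ofReal_le_ofReal (by linarith)

/-- The integrability properties of a solution on a cylinder. -/
structure CylIntegrable (p : ℝ) (f g : ℝ → ℝ) (u v : ℝ → Sp N → ℝ) (G : ℝ → Sp N → Sp N)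
    (a b : ℝ) (x₀ : Sp N) (r : ℝ) : Prop where
  memU : MemLp (fun z : ℝ × Sp N => u z.1 z.2) 2 (𝓛 (cyl a b x₀ r))
  memV : MemLp (fun z : ℝ × Sp N => v z.1 z.2) 2 (𝓛 (cyl a b x₀ r))
  memG : MemLp (fun z : ℝ × Sp N => G z.1 z.2) 2 (𝓛 (cyl a b x₀ r))
  source : Integrable (fun z : ℝ × Sp N => source p f g (u z.1 z.2) (v z.1 z.2))
    (𝓛 (cyl a b x₀ r))
  sourceU : Integrable (fun z : ℝ × Sp N => PerturbedWave.source p f g (u z.1 z.2) (v z.1 z.2)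
    * |u z.1 z.2|) (𝓛 (cyl a b x₀ r))
  sourceV : Integrable (fun z : ℝ × Sp N => PerturbedWave.source p f g (u z.1 z.2) (v z.1 z.2)
    * |v z.1 z.2|) (𝓛 (cyl a b x₀ r))
  sourceG : Integrable (fun z : ℝ × Sp N => PerturbedWave.source p f g (u z.1 z.2) (v z.1 z.2)
    * ‖G z.1 z.2‖) (𝓛 (cyl a b x₀ r))

theorem IsSolution.aestronglyMeasurable_source (hp : 1 < p) (hf : Continuous f) (hg : Continuous g)
    (hs : IsSolution p f g T u₀ u₁ u v G) (hc : CylBelow T a b x₀ r) :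
    AEStronglyMeasurable (fun z : ℝ × Sp N => source p f g (u z.1 z.2) (v z.1 z.2))
      (𝓛 (cyl a b x₀ r)) :=
  (continuous_source hp hf hg).comp_aestronglyMeasurable
    ((hs.meas_u.mono_set hc.subset).prodMk (hs.meas_v.mono_set hc.subset))

theorem IsSolution.source_lt_top (hs : IsSolution p f g T u₀ u₁ u v G)
    (hc : CylBelow T a b x₀ r) (hab : a ≤ b) :
    ∫⁻ t in Icc a b, eLpNorm (fun x => source p f g (u t x) (v t x)) 2
      (𝓛 (closedBall x₀ r)) < ⊤ :=
  lt_of_le_of_lt (lintegral_mono_set (Set.Icc_subset_Icc_left hc.nonneg))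
    (hs.source_mem b (hc.nonneg.trans hab) _ (isCompact_closedBall _ _) hc.below)

theorem IsSolution.cylIntegrable (hp : 1 < p) (hf : Continuous f) (hg : Continuous g)
    (hs : IsSolution p f g T u₀ u₁ u v G) (hc : CylBelow T a b x₀ r) (hab : a ≤ b) :
    CylIntegrable p f g u v G a b x₀ r := by
  obtain ⟨C, hC, hb⟩ := hs.exists_slice_bound hc
  have hfin := hs.source_lt_top hc hab
  have hm := hs.aestronglyMeasurable_source hp hf hg hc
  have hu := hs.meas_u.mono_set hc.subset
  have hv := hs.meas_v.mono_set hc.subset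
  have hG := hs.meas_G.mono_set hc.subset
  rw [restrict_cyl] at hm hu hv hG
  have h1 : ∃ C : ℝ, ∀ t ∈ Icc a b, eLpNorm (fun _ : Sp N => (1 : ℝ)) 2
      (𝓛 (closedBall x₀ r)) ≤ ofReal C := by
    have hfm : IsFiniteMeasure ((volume : Measure (Sp N)).restrict (closedBall x₀ r)) :=
      ⟨by rw [Measure.restrict_apply_univ]; exact (isCompact_closedBall _ _).measure_lt_top⟩
    have : MemLp (fun _ : Sp N => (1 : ℝ)) 2 (𝓛 (closedBall x₀ r)) :=
      memLp_const 1
    exact ⟨_, fun t _ => (ENNReal.ofReal_toReal this.2.ne).ge⟩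
  obtain ⟨C1, hC1⟩ := h1
  constructor <;> rw [restrict_cyl]
  · exact memLp_two_of_slices hu fun t ht => (hb t ht).1
  · exact memLp_two_of_slices hv fun t ht => (hb t ht).2.2
  · exact memLp_two_of_slices hG fun t ht => (hb t ht).2.1
  · simpa using integrable_mul_of_slices (k := fun _ => (1 : ℝ)) hm aestronglyMeasurable_const hfin hC1
  · exact integrable_mul_of_slices hm hu.norm hfin fun t ht =>
      (eLpNorm_norm (u t)).le.trans (hb t ht).1
  · exact integrable_mul_of_slices hm hv.norm hfin fun t ht =>
      (eLpNorm_norm (v t)).le.trans (hb t ht).2.2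
  · exact integrable_mul_of_slices hm hG.norm hfin fun t ht => by
      rw [eLpNorm_norm]
      exact (hb t ht).2.1

theorem CylIntegrable.rpow_mul (hp : 1 < p) (hq : 0 ≤ q) (hqp : q < p) (hM : 0 < M)
    (hf : ∀ a, |f a| ≤ M * (1 + |a| ^ q)) (hg : ∀ a, |g a| ≤ M * (1 + |a|))
    (hc : CylIntegrable p f g u v G a b x₀ r) {k : ℝ × Sp N → ℝ}
    (hk : MemLp k 2 (𝓛 (cyl a b x₀ r)))
    (hsk : Integrable (fun z : ℝ × Sp N => PerturbedWave.source p f g (u z.1 z.2) (v z.1 z.2)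
      * |k z|) (𝓛 (cyl a b x₀ r))) :
    Integrable (fun z : ℝ × Sp N => |u z.1 z.2| ^ p * |k z|) (𝓛 (cyl a b x₀ r)) := by
  obtain ⟨C, hC, h⟩ := exists_rpow_le_source hp hq hqp hM
  have hvk := hc.memV.norm.integrable_mul (q := 2) hk.norm
  have hk1 : Integrable (fun z => |k z|) (𝓛 (cyl a b x₀ r)) :=
    (hk.integrable (by norm_num)).norm
  have hm : AEStronglyMeasurable (fun z : ℝ × Sp N => |u z.1 z.2| ^ p)
      (𝓛 (cyl a b x₀ r)) :=
    ((continuous_abs.rpow_const fun _ => Or.inr (by linarith)).comp_aestronglyMeasurable hc.memU.1)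
  refine (((hk1.add hsk.norm).add hvk).const_mul C).mono' (hm.mul hk1.1)
    (.of_forall fun z => ?_)
  have h1 := h f g hf hg (u z.1 z.2) (v z.1 z.2)
  simp only [Pi.add_apply, Pi.mul_apply, norm_mul, norm_eq_abs, abs_abs]
  rw [abs_of_nonneg (Real.rpow_nonneg (abs_nonneg _) _)]
  refine (mul_le_mul_of_nonneg_right h1 (abs_nonneg (k z))).trans (le_of_eq ?_)
  ring

theorem integral_indicator_mul_test (φ w : ℝ × Sp N → ℝ) :
    ∫ z, (cyl a b x₀ r).indicator w z * φ z = ∫ z in cyl a b x₀ r, w z * φ z := by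
  rw [← integral_indicator (measurableSet_cyl a b x₀ r)]
  refine integral_congr_ae (.of_forall fun z => ?_)
  by_cases hz : z ∈ cyl a b x₀ r <;> simp [hz]

theorem fderiv_slice {φ : ℝ × Sp N → ℝ} (hφ : ContDiff ℝ ∞ φ) (t : ℝ) (x e : Sp N) :
    fderiv ℝ (fun x => φ (t, x)) x e = fderiv ℝ φ (t, x) (0, e) := by
  have h2 : HasFDerivAt (fun x : Sp N => (t, x)) (ContinuousLinearMap.inr ℝ ℝ (Sp N)) x := by
    exact hasFDerivAt_prodMk_right t x
  have := ((hφ.differentiable (by simp) (t, x)).hasFDerivAt.comp x h2).fderiv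
  have h3 : fderiv ℝ (fun x => φ (t, x)) x
      = (fderiv ℝ φ (t, x)).comp (ContinuousLinearMap.inr ℝ ℝ (Sp N)) := this
  rw [h3]; simp

theorem isWeakGradient_slice {t : ℝ} {U : Set (Sp N)} {φ : ℝ × Sp N → ℝ}
    (hw : IsWeakGradientOn U (u t) (G t)) (hU : ∀ x, (t, x) ∈ cylInt a b x₀ r → x ∈ U)
    (hφ : IsTest (cylInt a b x₀ r) φ) (e : Sp N) :
    ∫ x in closedBall x₀ r, u t x * fderiv ℝ φ (t, x) (0, e)
      = - ∫ x in closedBall x₀ r, inner ℝ (G t x) e * φ (t, x) := by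
  have hsupp : tsupport (fun x => φ (t, x)) ⊆ {x | (t, x) ∈ tsupport φ} :=
    closure_minimal (fun x hx => subset_tsupport _ hx)
      ((isClosed_tsupport φ).preimage (Continuous.prodMk_right t))
  have hin : ∀ x ∈ tsupport (fun x => φ (t, x)), (t, x) ∈ cylInt a b x₀ r := fun x hx =>
    hφ.supp (hsupp hx)
  have hzero : ∀ x ∉ closedBall x₀ r, (t, x) ∉ tsupport φ := fun x hx h =>
    hx (cylInt_subset a b x₀ r (hφ.supp h)).2
  have h := hw (fun x => φ (t, x)) (hφ.smooth.comp (contDiff_prodMk_right t)) ?_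
    (fun x hx => hU x (hin x hx)) e
  · simp only [fderiv_slice hφ.smooth] at h
    rw [setIntegral_eq_integral_of_forall_compl_eq_zero,
      setIntegral_eq_integral_of_forall_compl_eq_zero]
    · exact h
    · intro x hx; rw [image_eq_zero_of_notMem_tsupport (hzero x hx), mul_zero]
    · intro x hx; rw [fderiv_of_notMem_tsupport ℝ (hzero x hx)]; simp
  · exact HasCompactSupport.of_support_subset_isCompact (isCompact_closedBall x₀ r) fun x hx => by
      by_contra hn
      exact hx (image_eq_zero_of_notMem_tsupport (hzero x hn))

theorem IsTest.eq_zero {φ : ℝ × Sp N → ℝ} (hφ : IsTest (cylInt a b x₀ r) φ) {z : ℝ × Sp N}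
    (hz : z ∉ cyl a b x₀ r) : φ z = 0 :=
  image_eq_zero_of_notMem_tsupport fun h => hz (cylInt_subset a b x₀ r (hφ.supp h))

theorem IsTest.fderiv_eq_zero {φ : ℝ × Sp N → ℝ} (hφ : IsTest (cylInt a b x₀ r) φ) {z : ℝ × Sp N}
    (hz : z ∉ cyl a b x₀ r) : fderiv ℝ φ z = 0 :=
  fderiv_of_notMem_tsupport ℝ fun h => hz (cylInt_subset a b x₀ r (hφ.supp h))

theorem MemLp.integrable_mul_bounded {X F : Type*} [MeasurableSpace X] [NormedAddCommGroup F]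
    {m : Measure X} [IsFiniteMeasure m] {w : X → ℝ} (hw : MemLp w 2 m)
    {k : X → ℝ} (hk : AEStronglyMeasurable k m) {C : ℝ} (hC : ∀ x, |k x| ≤ C) :
    Integrable (fun x => w x * k x) m :=
  (((hw.integrable (by norm_num)).bdd_mul (c := C) hk
      (.of_forall hC))).congr (.of_forall fun x => mul_comm _ _)

theorem CylIntegrable.integral_mul_test (hu : MemLp (fun z : ℝ × Sp N => u z.1 z.2) 2
    (𝓛 (cyl a b x₀ r))) {k : ℝ × Sp N → ℝ} (hk : Continuous k)
    (hc : HasCompactSupport k) :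
    Integrable (fun z : ℝ × Sp N => u z.1 z.2 * k z) (𝓛 (cyl a b x₀ r)) := by
  obtain ⟨C, hC⟩ := hc.exists_bound_of_continuous hk
  exact MemLp.integrable_mul_bounded (F := ℝ) hu hk.aestronglyMeasurable hC

theorem IsSolution.integral_time (hs : IsSolution p f g T u₀ u₁ u v G)
    (hc : CylBelow T a b x₀ r) (hi : CylIntegrable p f g u v G a b x₀ r) {φ : ℝ × Sp N → ℝ}
    (hφ : IsTest (cylInt a b x₀ r) φ) :
    ∫ z in cyl a b x₀ r, (v z.1 z.2 * φ z + u z.1 z.2 * fderiv ℝ φ z (1, 0)) = 0 := by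
  have hφd := hφ.smooth.continuous_fderiv (by simp)
  have hK := isCompact_closedBall x₀ r
  have hI : Integrable (fun z : ℝ × Sp N => v z.1 z.2 * φ z + u z.1 z.2 * fderiv ℝ φ z (1, 0))
      (𝓛 (cyl a b x₀ r)) :=
    (CylIntegrable.integral_mul_test hi.memV hφ.smooth.continuous hφ.compact).add
      (CylIntegrable.integral_mul_test hi.memU (hφd.clm_apply continuous_const)
        (hφ.compact.fderiv_apply (𝕜 := ℝ) _))
  set P := Prod.fst '' tsupport φ with hP
  have hPc : IsCompact P := hφ.compact.isCompact.image continuous_fst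
  have hPs : P ⊆ Ioo a b := by
    rintro t ⟨z, hz, rfl⟩
    exact (hφ.supp hz).1
  have h0 : ∀ t ∉ P, ∀ x, (t, x) ∉ tsupport φ := fun t ht x hx => ht ⟨(t, x), hx, rfl⟩
  set F : ℝ → ℝ := fun t => ∫ x in closedBall x₀ r, u t x * φ (t, x) with hF
  set F' : ℝ → ℝ := fun t => ∫ x in closedBall x₀ r,
    (v t x * φ (t, x) + u t x * fderiv ℝ φ (t, x) (1, 0)) with hF'
  have hF0 : ∀ t ∉ P, F t = 0 := fun t ht => by
    simp [hF, image_eq_zero_of_notMem_tsupport (h0 t ht _)]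
  have hF'0 : ∀ t ∉ P, F' t = 0 := fun t ht => by
    simp [hF', image_eq_zero_of_notMem_tsupport (h0 t ht _),
      fderiv_of_notMem_tsupport ℝ (h0 t ht _)]
  have hderiv : ∀ t, HasDerivAt F (F' t) t := by
    intro t
    by_cases ht : t ∈ P
    · have ht' := hPs ht
      have htc : t ∈ Icc a b := ⟨ht'.1.le, ht'.2.le⟩
      have ht0 : 0 < t := hc.nonneg.trans_lt ht'.1
      refine hasDerivAt_integral_mul hK ht' (fun s hs' => (hs.memLp s (hc.nonneg.trans hs'.1) _ hK
        (hc.lt hs')).1) (hs.memLp t ht0.le _ hK (hc.lt htc)).2.2 ?_ hφ.smooth hφ.compact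
      refine (hs.time_deriv t ht0.le _ hK (hc.lt htc)).mono_left ?_
      rw [nhdsWithin, nhdsWithin]
      refine le_inf inf_le_left ?_
      rw [le_principal_iff]
      have h2 : ∀ᶠ τ in 𝓝[≠] t, (0 : ℝ) ≤ τ :=
        eventually_nhdsWithin_of_eventually_nhds ((eventually_gt_nhds ht0).mono fun _ h => h.le)
      filter_upwards [h2, eventually_mem_nhdsWithin] with τ h3 h4
      exact ⟨h3, h4⟩
    · rw [hF'0 t ht]
      refine (hasDerivAt_const t (0 : ℝ)).congr_of_eventuallyEq ?_
      filter_upwards [hPc.isClosed.isOpen_compl.mem_nhds ht] with τ hτ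
      exact hF0 τ hτ
  have hFc : Continuous F := continuous_iff_continuousAt.2 fun t => (hderiv t).continuousAt
  have hFi : Integrable F := hFc.integrable_of_hasCompactSupport
    (HasCompactSupport.of_support_subset_isCompact hPc fun t ht => by
      by_contra hn; exact ht (hF0 t hn))
  rw [restrict_cyl] at hI ⊢
  have hz' : ∀ t ∉ Icc a b, F' t = 0 := fun t ht =>
    hF'0 t fun h => ht (Set.Ioo_subset_Icc_self (hPs h))
  have hF'i : Integrable F' := by
    have h3 : IntegrableOn F' (Icc a b) := hI.integral_prod_left
    exact h3.integrable_of_forall_notMem_eq_zero hz'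
  rw [integral_prod _ hI]
  rw [← integral_eq_zero_of_hasDerivAt_of_integrable hderiv hF'i hFi]
  exact setIntegral_eq_integral_of_forall_compl_eq_zero hz'

theorem IsSolution.integral_space (hs : IsSolution p f g T u₀ u₁ u v G)
    (hc : CylBelow T a b x₀ r) (hi : CylIntegrable p f g u v G a b x₀ r) {φ : ℝ × Sp N → ℝ}
    (hφ : IsTest (cylInt a b x₀ r) φ) (e : Sp N) :
    ∫ z in cyl a b x₀ r, u z.1 z.2 * fderiv ℝ φ z (0, e)
      = - ∫ z in cyl a b x₀ r, inner ℝ (G z.1 z.2) e * φ z := by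
  have hφd := hφ.smooth.continuous_fderiv (by simp)
  have i1 : Integrable (fun z : ℝ × Sp N => u z.1 z.2 * fderiv ℝ φ z (0, e))
      (𝓛 (cyl a b x₀ r)) :=
    CylIntegrable.integral_mul_test hi.memU (hφd.clm_apply continuous_const)
        (hφ.compact.fderiv_apply (𝕜 := ℝ) _)
  have hGe : MemLp (fun z : ℝ × Sp N => inner ℝ (G z.1 z.2) e) 2 (𝓛 (cyl a b x₀ r)) :=
    hi.memG.inner_const e
  have i2 : Integrable (fun z : ℝ × Sp N => inner ℝ (G z.1 z.2) e * φ z)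
      (𝓛 (cyl a b x₀ r)) :=
    CylIntegrable.integral_mul_test (u := fun t x => inner ℝ (G t x) e) hGe hφ.smooth.continuous
      hφ.compact
  rw [restrict_cyl] at i1 i2 ⊢
  rw [integral_prod _ i1, integral_prod _ i2, ← integral_neg]
  refine setIntegral_congr_fun measurableSet_Icc fun t ht => ?_
  exact isWeakGradient_slice (hs.gradient t (hc.nonneg.trans ht.1))
    (fun x hx => hc.lt ht x (ball_subset_closedBall hx.2)) hφ e

/-- The derivative of a solution, cut off outside a cylinder. -/
def cutD (a b : ℝ) (x₀ : Sp N) (r : ℝ) (v : ℝ → Sp N → ℝ) (G : ℝ → Sp N → Sp N) :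
    ℝ × Sp N → (ℝ × Sp N) →L[ℝ] ℝ :=
  (cyl a b x₀ r).indicator fun z => dual (v z.1 z.2) (G z.1 z.2)

/-- A function cut off outside a cylinder. -/
def cutU (a b : ℝ) (x₀ : Sp N) (r : ℝ) (u : ℝ → Sp N → ℝ) : ℝ × Sp N → ℝ :=
  (cyl a b x₀ r).indicator fun z => u z.1 z.2

/-- The right-hand side, cut off outside a cylinder. -/
def cutS (p : ℝ) (f g : ℝ → ℝ) (a b : ℝ) (x₀ : Sp N) (r : ℝ) (u v : ℝ → Sp N → ℝ) : ℝ × Sp N → ℝ :=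
  (cyl a b x₀ r).indicator fun z => source p f g (u z.1 z.2) (v z.1 z.2)

theorem cutD_apply (z e : ℝ × Sp N) : cutD a b x₀ r v G z e
    = (cyl a b x₀ r).indicator (fun z => v z.1 z.2 * e.1 + inner ℝ (G z.1 z.2) e.2) z := by
  by_cases hz : z ∈ cyl a b x₀ r
  · simp [cutD, hz, dual_apply]
  · simp [cutD, hz]

theorem IsSolution.isWeakDeriv (hs : IsSolution p f g T u₀ u₁ u v G)
    (hc : CylBelow T a b x₀ r) (hi : CylIntegrable p f g u v G a b x₀ r) :
    IsWeakDeriv volume (cylInt a b x₀ r) (cutU a b x₀ r u) (cutD a b x₀ r v G) := by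
  intro φ hφ e
  have hφd := hφ.smooth.continuous_fderiv (by simp)
  have hGe : MemLp (fun z : ℝ × Sp N => inner ℝ (G z.1 z.2) e.2) 2
      (𝓛 (cyl a b x₀ r)) := hi.memG.inner_const e.2
  have i0 := CylIntegrable.integral_mul_test hi.memV hφ.smooth.continuous hφ.compact
  have i1 := CylIntegrable.integral_mul_test (u := fun t x => inner ℝ (G t x) e.2) hGe
    hφ.smooth.continuous hφ.compact
  have i2 := CylIntegrable.integral_mul_test hi.memU (hφd.clm_apply continuous_const)
        (hφ.compact.fderiv_apply (𝕜 := ℝ) (1, 0))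
  have i3 := CylIntegrable.integral_mul_test hi.memU (hφd.clm_apply continuous_const)
        (hφ.compact.fderiv_apply (𝕜 := ℝ) (0, e.2))
  have h1 := hs.integral_time hc hi hφ
  have h2 := hs.integral_space hc hi hφ e.2
  rw [integral_add i0 i2] at h1
  unfold cutU
  simp only [cutD_apply]
  rw [integral_indicator_mul_test, integral_indicator_mul_test]
  have e1 : ∀ z, fderiv ℝ φ z e = e.1 * fderiv ℝ φ z (1, 0) + fderiv ℝ φ z (0, e.2) := fun z => by
    rw [← smul_eq_mul, ← map_smul, ← map_add]
    congr 1
    ext <;> simp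
  have e2 : ∫ z in cyl a b x₀ r, u z.1 z.2 * fderiv ℝ φ z e
      = e.1 * (∫ z in cyl a b x₀ r, u z.1 z.2 * fderiv ℝ φ z (1, 0))
        + ∫ z in cyl a b x₀ r, u z.1 z.2 * fderiv ℝ φ z (0, e.2) := by
    rw [← integral_const_mul, ← integral_add (i2.const_mul _) i3]
    refine integral_congr_ae (.of_forall fun z => ?_)
    dsimp only
    rw [e1]; ring
  have e3 : ∫ z in cyl a b x₀ r, (v z.1 z.2 * e.1 + inner ℝ (G z.1 z.2) e.2) * φ z
      = e.1 * (∫ z in cyl a b x₀ r, v z.1 z.2 * φ z)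
        + ∫ z in cyl a b x₀ r, inner ℝ (G z.1 z.2) e.2 * φ z := by
    rw [← integral_const_mul, ← integral_add (i0.const_mul _) i1]
    refine integral_congr_ae (.of_forall fun z => ?_)
    dsimp only
    ring
  rw [e2, e3, h2]
  linear_combination e.1 * h1

theorem IsSolution.isWeakDiv (hs : IsSolution p f g T u₀ u₁ u v G) (hc : CylBelow T a b x₀ r) :
    IsWeakDiv volume (cylInt a b x₀ r) (lorentz N) (cutD a b x₀ r v G) (cutS p f g a b x₀ r u v) := by
  intro φ hφ
  have h := hs.equation φ hφ.smooth hφ.compact fun z hz =>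
    ⟨hc.nonneg.trans_lt (hφ.supp hz).1.1,
      (hφ.supp hz).1.2.trans (hc.below z.2 (ball_subset_closedBall (hφ.supp hz).2))⟩
  have e1 : ∫ z, cutS p f g a b x₀ r u v z * φ z
      = ∫ z, source p f g (u z.1 z.2) (v z.1 z.2) * φ z := by
    refine integral_congr_ae (.of_forall fun z => ?_)
    by_cases hz : z ∈ cyl a b x₀ r
    · simp [cutS, hz]
    · simp [hφ.eq_zero hz]
  have e2 : ∫ z, lorentz N (cutD a b x₀ r v G z) (fderiv ℝ φ z)
      = - ∫ z, (- (v z.1 z.2 * fderiv ℝ φ z (1, 0)) + fderiv ℝ φ z (0, G z.1 z.2)) := by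
    rw [← integral_neg]
    refine integral_congr_ae (.of_forall fun z => ?_)
    by_cases hz : z ∈ cyl a b x₀ r
    · simp only [cutD, Set.indicator_of_mem hz, lorentz_dual]; ring
    · simp [hφ.fderiv_eq_zero hz]
  rw [e1, e2, h]

/-- `f` is integrable with vanishing integral. -/
structure NullInt {X : Type*} [MeasurableSpace X] (m : Measure X) (f : X → ℝ) : Prop where
  integrable : Integrable f m
  integral : ∫ x, f x ∂m = 0

namespace NullInt

variable {X : Type*} [MeasurableSpace X] {m : Measure X} {f g : X → ℝ}

theorem add (hf : NullInt m f) (hg : NullInt m g) : NullInt m fun x => f x + g x :=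
  ⟨hf.1.add hg.1, by rw [integral_add hf.1 hg.1, hf.2, hg.2, add_zero]⟩

theorem const_mul (c : ℝ) (hf : NullInt m f) : NullInt m fun x => c * f x :=
  ⟨hf.1.const_mul c, by rw [integral_const_mul, hf.2, mul_zero]⟩

theorem congr (hf : NullInt m f) (h : ∀ x, f x = g x) : NullInt m g := by
  rwa [show g = f from (funext h).symm]

end NullInt

theorem lintegral_slice_indicator {F : Type*} [NormedAddCommGroup F] [NormedSpace ℝ F]
    (k : ℝ × Sp N → F) (t : ℝ) :
    (∫⁻ x, ‖(cyl a b x₀ r).indicator k (t, x)‖ₑ ^ 2) ^ (1 / 2 : ℝ)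
      = (Icc a b).indicator (fun t => eLpNorm (fun x => k (t, x)) 2
        (𝓛 (closedBall x₀ r))) t := by
  by_cases ht : t ∈ Icc a b
  · rw [Set.indicator_of_mem ht, eLpNorm_two_eq_sqrt,
      ← lintegral_indicator isClosed_closedBall.measurableSet]
    congr 1
    refine lintegral_congr fun x => ?_
    by_cases hx : x ∈ closedBall x₀ r
    · rw [Set.indicator_of_mem hx, Set.indicator_of_mem (show (t, x) ∈ cyl a b x₀ r from ⟨ht, hx⟩)]
    · rw [Set.indicator_of_notMem hx,
        Set.indicator_of_notMem (show (t, x) ∉ cyl a b x₀ r from fun h => hx h.2)]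
      simp
  · rw [Set.indicator_of_notMem ht]
    have : ∀ x, (cyl a b x₀ r).indicator k (t, x) = 0 := fun x =>
      Set.indicator_of_notMem (show (t, x) ∉ cyl a b x₀ r from fun h => ht h.1) _
    simp [this]

theorem memLp_indicator_of_restrict {X F : Type*} [MeasurableSpace X] [NormedAddCommGroup F]
    {m : Measure X} {s : Set X} (hs : MeasurableSet s) {k : X → F} (h : MemLp k 2 (m.restrict s)) :
    MemLp (s.indicator k) 2 m :=
  (memLp_indicator_iff_restrict hs).2 h

theorem integrable_indicator_of_restrict {X F : Type*} [MeasurableSpace X] [NormedAddCommGroup F]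
    {m : Measure X} {s : Set X} (hs : MeasurableSet s) {k : X → F}
    (h : Integrable k (m.restrict s)) : Integrable (s.indicator k) m :=
  (integrable_indicator_iff hs).2 h

theorem CylIntegrable.memLp_dual (hi : CylIntegrable p f g u v G a b x₀ r) :
    MemLp (fun z : ℝ × Sp N => dual (v z.1 z.2) (G z.1 z.2)) 2
      (𝓛 (cyl a b x₀ r)) := by
  refine (hi.memV.norm.add hi.memG.norm).mono
    (continuous_dual.comp_aestronglyMeasurable (hi.memV.1.prodMk hi.memG.1))
    (.of_forall fun z => (norm_dual_le _ _).trans ?_)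
  rw [Pi.add_apply, norm_of_nonneg (by positivity), norm_eq_abs]

theorem CylIntegrable.memLp_cutD (hi : CylIntegrable p f g u v G a b x₀ r) :
    MemLp (cutD a b x₀ r v G) 2 volume := by
  exact memLp_indicator_of_restrict (measurableSet_cyl a b x₀ r) hi.memLp_dual

theorem CylIntegrable.integrable_cutD (hi : CylIntegrable p f g u v G a b x₀ r) :
    Integrable (cutD a b x₀ r v G) volume := by
  exact integrable_indicator_of_restrict (measurableSet_cyl a b x₀ r)
    (hi.memLp_dual.integrable (by norm_num))

theorem CylIntegrable.memLp_cutU (hi : CylIntegrable p f g u v G a b x₀ r) :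
    MemLp (cutU a b x₀ r u) 2 volume :=
  (memLp_indicator_iff_restrict (measurableSet_cyl a b x₀ r)).2 hi.memU

theorem CylIntegrable.integrable_cutS (hi : CylIntegrable p f g u v G a b x₀ r) :
    Integrable (cutS p f g a b x₀ r u v) volume :=
  (integrable_indicator_iff (measurableSet_cyl a b x₀ r)).2 hi.source

theorem mixedNorm_cutS_ne_top (hs : IsSolution p f g T u₀ u₁ u v G)
    (hc : CylBelow T a b x₀ r) (hab : a ≤ b) :
    mixedNorm (volume : Measure ℝ) (volume : Measure (Sp N))
      (fun z => ‖cutS p f g a b x₀ r u v z‖ₑ) ≠ ⊤ := by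
  have h := (hs.source_lt_top hc hab).ne
  rw [← lintegral_indicator measurableSet_Icc] at h
  unfold mixedNorm cutS
  simp only [lintegral_slice_indicator]
  exact h

theorem pairingLimit_cutD (hs : IsSolution p f g T u₀ u₁ u v G)
    (hc : CylBelow T a b x₀ r) (hi : CylIntegrable p f g u v G a b x₀ r) (hab : a ≤ b) :
    PairingLimit volume (cutS p f g a b x₀ r u v) (cutD a b x₀ r v G) := by
  obtain ⟨C, hC, hb⟩ := hs.exists_slice_bound hc
  refine pairingLimit_of_mixedNorm (μ := (volume : Measure ℝ)) (ν := (volume : Measure (Sp N)))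
    hi.integrable_cutS hi.memLp_cutD (mixedNorm_cutS_ne_top hs hc hab)
    (K := ofReal C + ofReal C) (by finiteness) (.of_forall fun t => ?_)
  unfold cutD
  rw [lintegral_slice_indicator]
  refine Set.indicator_apply_le' (fun ht => ?_) fun _ => bot_le
  have hm := hs.memLp t (hc.nonneg.trans ht.1) _ (isCompact_closedBall x₀ r) (hc.lt ht)
  have h1 : eLpNorm (fun x => dual (v t x) (G t x)) 2 (𝓛 (closedBall x₀ r))
      ≤ eLpNorm ((fun x => ‖v t x‖) + fun x => ‖G t x‖) 2
        (𝓛 (closedBall x₀ r)) :=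
    eLpNorm_mono fun x => (norm_dual_le _ _).trans (by
      rw [Pi.add_apply, norm_of_nonneg (by positivity), norm_eq_abs])
  refine h1.trans ((eLpNorm_add_le hm.2.2.norm.1 hm.2.1.norm.1 (by norm_num)).trans ?_)
  rw [eLpNorm_norm, eLpNorm_norm]
  exact add_le_add (hb t ht).2.2 (hb t ht).2.1

theorem pairingLimit_cutU (hs : IsSolution p f g T u₀ u₁ u v G)
    (hc : CylBelow T a b x₀ r) (hi : CylIntegrable p f g u v G a b x₀ r) (hab : a ≤ b) :
    PairingLimit volume (cutS p f g a b x₀ r u v) (cutU a b x₀ r u) := by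
  obtain ⟨C, hC, hb⟩ := hs.exists_slice_bound hc
  refine pairingLimit_of_mixedNorm (μ := (volume : Measure ℝ)) (ν := (volume : Measure (Sp N)))
    hi.integrable_cutS hi.memLp_cutU (mixedNorm_cutS_ne_top hs hc hab)
    (K := ofReal C) (by finiteness) (.of_forall fun t => ?_)
  unfold cutU
  rw [lintegral_slice_indicator]
  exact Set.indicator_apply_le' (fun ht => (hb t ht).1) fun _ => bot_le

/-- A function that vanishes outside the cylinder. -/
theorem integrable_of_cyl {k : ℝ × Sp N → ℝ} (hk : Integrable k (𝓛 (cyl a b x₀ r)))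
    (h0 : ∀ z ∉ cyl a b x₀ r, k z = 0) : Integrable k :=
  IntegrableOn.integrable_of_forall_notMem_eq_zero hk h0

/-- The derivative along the scaling vector field `(T₀, x₀) - z`. -/
def scal (T₀ : ℝ) (x₀ : Sp N) (v : ℝ → Sp N → ℝ) (G : ℝ → Sp N → Sp N) (z : ℝ × Sp N) : ℝ :=
  (T₀ - z.1) * v z.1 z.2 - inner ℝ (G z.1 z.2) (z.2 - x₀)

/-- The derivative along `x - x₀`. -/
def radial (x₀ : Sp N) (G : ℝ → Sp N → Sp N) (z : ℝ × Sp N) : ℝ :=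
  inner ℝ (G z.1 z.2) (z.2 - x₀)

theorem dual_scal (T₀ : ℝ) (z : ℝ × Sp N) :
    dual (v z.1 z.2) (G z.1 z.2) ((T₀, x₀) - z) = scal T₀ x₀ v G z := by
  rw [dual_apply, scal, Prod.fst_sub, Prod.snd_sub, ← neg_sub z.2 x₀, inner_neg_right]
  ring

theorem MemLp.mul_bounded {X : Type*} [MeasurableSpace X] {m : Measure X} {w k : X → ℝ}
    (hw : MemLp w 2 m) (hk : AEStronglyMeasurable k m) {C : ℝ} (hC : ∀ᵐ x ∂m, |k x| ≤ C) :
    MemLp (fun x => k x * w x) 2 m := by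
  refine (hw.const_mul |C|).mono (hk.mul hw.1) ?_
  filter_upwards [hC] with x hx
  rw [norm_mul, norm_mul, norm_eq_abs, norm_eq_abs |C|, abs_abs]
  exact mul_le_mul_of_nonneg_right (hx.trans (le_abs_self C)) (norm_nonneg _)

theorem memLp_mul_continuous {w k : ℝ × Sp N → ℝ}
    (hw : MemLp w 2 (𝓛 (cyl a b x₀ r))) (hk : Continuous k) :
    MemLp (fun z => k z * w z) 2 (𝓛 (cyl a b x₀ r)) := by
  obtain ⟨C, hC⟩ := (isCompact_cyl a b x₀ r).exists_bound_of_continuousOn hk.continuousOn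
  refine MemLp.mul_bounded hw hk.aestronglyMeasurable (C := C) ?_
  filter_upwards [ae_restrict_mem (measurableSet_cyl a b x₀ r)] with z hz
  exact hC z hz

theorem CylIntegrable.memLp_clm (hi : CylIntegrable p f g u v G a b x₀ r)
    {l : ℝ × Sp N → Sp N →L[ℝ] ℝ} (hl : Continuous l) :
    MemLp (fun z => l z (G z.1 z.2)) 2 (𝓛 (cyl a b x₀ r)) := by
  obtain ⟨C, hC⟩ := (isCompact_cyl a b x₀ r).exists_bound_of_continuousOn hl.continuousOn
  refine (hi.memG.norm.const_mul |C|).mono (isBoundedBilinearMap_apply.continuous.comp_aestronglyMeasurable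
    (hl.aestronglyMeasurable.prodMk hi.memG.1)) ?_
  filter_upwards [ae_restrict_mem (measurableSet_cyl a b x₀ r)] with z hz
  rw [norm_mul, norm_norm, norm_eq_abs |C|, abs_abs]
  exact (l z).le_of_opNorm_le ((hC z hz).trans (le_abs_self C)) _

theorem CylIntegrable.memLp_radial (hi : CylIntegrable p f g u v G a b x₀ r) :
    MemLp (radial x₀ G) 2 (𝓛 (cyl a b x₀ r)) := by
  have h := hi.memLp_clm (l := fun z => innerSL ℝ (z.2 - x₀))
    ((innerSL ℝ).continuous.comp (by fun_prop))
  refine h.congr_norm (hi.memG.1.inner (Continuous.aestronglyMeasurable (by fun_prop))) ?_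
  exact .of_forall fun z => by
    rw [innerSL_apply_apply, radial, real_inner_comm]

theorem CylIntegrable.memLp_scal (hi : CylIntegrable p f g u v G a b x₀ r) (T₀ : ℝ) :
    MemLp (scal T₀ x₀ v G) 2 (𝓛 (cyl a b x₀ r)) :=
  (memLp_mul_continuous hi.memV (k := fun z => T₀ - z.1) (by fun_prop)).sub hi.memLp_radial

theorem CylIntegrable.memLp_form (hi : CylIntegrable p f g u v G a b x₀ r) {ψ : ℝ × Sp N → ℝ}
    (hψ : IsTest (cylInt a b x₀ r) ψ) :
    MemLp (fun z => v z.1 z.2 * fderiv ℝ ψ z (1, 0) - fderiv ℝ ψ z (0, G z.1 z.2)) 2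
      (𝓛 (cyl a b x₀ r)) := by
  have hψd := hψ.smooth.continuous_fderiv (by simp)
  have h1 := memLp_mul_continuous hi.memV (k := fun z => fderiv ℝ ψ z (1, 0))
    (hψd.clm_apply continuous_const)
  have h2 := hi.memLp_clm (l := fun z => (fderiv ℝ ψ z).comp (ContinuousLinearMap.inr ℝ ℝ (Sp N)))
    (by fun_prop)
  have h3 := h1.sub h2
  refine h3.congr_norm ?_ ?_
  · refine h3.1.congr (.of_forall fun z => ?_)
    simp [mul_comm]
  · refine .of_forall fun z => ?_
    simp [mul_comm]

theorem integrable_test_mul {w k : ℝ × Sp N → ℝ}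
    (hw : Integrable w (𝓛 (cyl a b x₀ r))) (hk : Continuous k) :
    Integrable (fun z => k z * w z) (𝓛 (cyl a b x₀ r)) := by
  obtain ⟨C, hC⟩ := (isCompact_cyl a b x₀ r).exists_bound_of_continuousOn hk.continuousOn
  refine hw.bdd_mul (c := C) hk.aestronglyMeasurable ?_
  filter_upwards [ae_restrict_mem (measurableSet_cyl a b x₀ r)] with z hz
  exact hC z hz

theorem integrable_mul_of_abs {X : Type*} [MeasurableSpace X] {m : Measure X} {h k : X → ℝ}
    (hk : AEStronglyMeasurable k m) (hh : AEStronglyMeasurable h m)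
    (hi : Integrable (fun x => h x * |k x|) m) : Integrable (fun x => h x * k x) m :=
  hi.mono (hh.mul hk) (.of_forall fun x => by simp)

theorem CylIntegrable.source_scal (hi : CylIntegrable p f g u v G a b x₀ r) (T₀ : ℝ) :
    Integrable (fun z => PerturbedWave.source p f g (u z.1 z.2) (v z.1 z.2) * scal T₀ x₀ v G z)
      (𝓛 (cyl a b x₀ r)) := by
  have h1 := integrable_test_mul (integrable_mul_of_abs hi.memV.1 hi.source.1 hi.sourceV)
    (k := fun z => T₀ - z.1) (by fun_prop)
  have h2 := (hi.sourceG.norm.const_mul r)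
  have h3 : Integrable (fun z => PerturbedWave.source p f g (u z.1 z.2) (v z.1 z.2)
      * radial x₀ G z) (𝓛 (cyl a b x₀ r)) := by
    refine h2.mono' (hi.source.1.mul hi.memLp_radial.1) ?_
    filter_upwards [ae_restrict_mem (measurableSet_cyl a b x₀ r)] with z hz
    have h4 : ‖z.2 - x₀‖ ≤ r := by simpa [dist_eq_norm] using hz.2
    have h5 : |radial x₀ G z| ≤ ‖G z.1 z.2‖ * ‖z.2 - x₀‖ := abs_real_inner_le_norm _ _
    rw [norm_mul, norm_mul, norm_norm, norm_eq_abs (radial x₀ G z)]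
    calc _ ≤ ‖PerturbedWave.source p f g (u z.1 z.2) (v z.1 z.2)‖ * (‖G z.1 z.2‖ * r) := by
          gcongr
          exact h5.trans (by gcongr)
      _ = _ := by ring
  refine (h1.sub h3).congr (.of_forall fun z => ?_)
  simp only [scal, radial, Pi.sub_apply]
  ring

theorem CylIntegrable.lor (hi : CylIntegrable p f g u v G a b x₀ r) :
    Integrable (fun z : ℝ × Sp N => v z.1 z.2 ^ 2 - ‖G z.1 z.2‖ ^ 2)
      (𝓛 (cyl a b x₀ r)) :=
  hi.memV.integrable_sq.sub (hi.memG.norm.integrable_sq)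

theorem integral_neg_add {X : Type*} [MeasurableSpace X] {m : Measure X} {h k : X → ℝ}
    (hh : Integrable h m) (hk : Integrable k m) :
    ∫ x, (-(h x) + k x) ∂m = -(∫ x, h x ∂m) + ∫ x, k x ∂m := by
  rw [← integral_neg]
  exact integral_add hh.neg hk

theorem integral_neg_add_neg {X : Type*} [MeasurableSpace X] {m : Measure X} {h k : X → ℝ}
    (hh : Integrable h m) (hk : Integrable k m) :
    ∫ x, (-(h x) + -(k x)) ∂m = -(∫ x, h x ∂m) + -∫ x, k x ∂m := by
  rw [← integral_neg, ← integral_neg]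
  exact integral_add hh.neg hk.neg

theorem integral_add_sub {X : Type*} [MeasurableSpace X] {m : Measure X} {h k l : X → ℝ}
    (hh : Integrable h m) (hk : Integrable k m) (hl : Integrable l m) :
    ∫ x, (h x + k x - l x) ∂m = (∫ x, h x ∂m) + (∫ x, k x ∂m) - ∫ x, l x ∂m := by
  rw [← integral_add hh hk]
  exact integral_sub (hh.add hk) hl

theorem integral_add_add {X : Type*} [MeasurableSpace X] {m : Measure X} {h k l : X → ℝ}
    (hh : Integrable h m) (hk : Integrable k m) (hl : Integrable l m) :
    ∫ x, (h x + k x + l x) ∂m = (∫ x, h x ∂m) + (∫ x, k x ∂m) + ∫ x, l x ∂m := by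
  rw [← integral_add hh hk]
  exact integral_add (hh.add hk) hl

theorem nullInt_scaling (hs : IsSolution p f g T u₀ u₁ u v G)
    (hc : CylBelow T a b x₀ r) (hi : CylIntegrable p f g u v G a b x₀ r) (hab : a ≤ b)
    {ψ : ℝ × Sp N → ℝ} (hψ : IsTest (cylInt a b x₀ r) ψ) (T₀ : ℝ) :
    NullInt volume fun z => source p f g (u z.1 z.2) (v z.1 z.2) * scal T₀ x₀ v G z * ψ z
      + scal T₀ x₀ v G z * (v z.1 z.2 * fderiv ℝ ψ z (1, 0) - fderiv ℝ ψ z (0, G z.1 z.2))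
      - 1 / 2 * (fderiv ℝ ψ z ((T₀, x₀) - z) - (N - 1) * ψ z)
        * (v z.1 z.2 ^ 2 - ‖G z.1 z.2‖ ^ 2) := by
  have hψc := hψ.smooth.continuous
  have hψd := hψ.smooth.continuous_fderiv (by simp)
  have h := scaling_identity (isOpen_cylInt a b x₀ r) lorentz_symm hi.memLp_cutU hi.memLp_cutD
    hi.integrable_cutD hi.integrable_cutS (hs.isWeakDeriv hc hi) (hs.isWeakDiv hc)
    (pairingLimit_cutD hs hc hi hab) hψ (T₀, x₀)
  have i1 : Integrable fun z => source p f g (u z.1 z.2) (v z.1 z.2) * scal T₀ x₀ v G z * ψ z :=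
    integrable_of_cyl ((integrable_test_mul (hi.source_scal T₀) hψc).congr
      (.of_forall fun z => mul_comm _ _)) fun z hz => by rw [hψ.eq_zero hz, mul_zero]
  have i2 : Integrable fun z => scal T₀ x₀ v G z
      * (v z.1 z.2 * fderiv ℝ ψ z (1, 0) - fderiv ℝ ψ z (0, G z.1 z.2)) :=
    integrable_of_cyl ((hi.memLp_scal T₀).integrable_mul (hi.memLp_form hψ)) fun z hz => by
      rw [hψ.fderiv_eq_zero hz]; simp
  have i3 : Integrable fun z => 1 / 2 * (fderiv ℝ ψ z ((T₀, x₀) - z) - (N - 1) * ψ z)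
        * (v z.1 z.2 ^ 2 - ‖G z.1 z.2‖ ^ 2) :=
    integrable_of_cyl (integrable_test_mul hi.lor (continuous_const.mul ((hψd.clm_apply
      (by fun_prop)).sub (continuous_const.mul hψc)))) fun z hz => by
      rw [hψ.fderiv_eq_zero hz, hψ.eq_zero hz]; simp
  refine ⟨(i1.add i2).sub i3, ?_⟩
  have e1 : ∫ z, cutS p f g a b x₀ r u v z * (ψ z * cutD a b x₀ r v G z ((T₀, x₀) - z))
      = ∫ z, source p f g (u z.1 z.2) (v z.1 z.2) * scal T₀ x₀ v G z * ψ z := by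
    refine integral_congr_ae (.of_forall fun z => ?_)
    by_cases hz : z ∈ cyl a b x₀ r
    · simp only [cutS, cutD, Set.indicator_of_mem hz, dual_scal]; ring
    · simp [hψ.eq_zero hz]
  have e2 : ∫ z, (-(cutD a b x₀ r v G z ((T₀, x₀) - z)
        * lorentz N (cutD a b x₀ r v G z) (fderiv ℝ ψ z))
        + 1 / 2 * (fderiv ℝ ψ z ((T₀, x₀) - z) - (Module.finrank ℝ (ℝ × Sp N) - 2) * ψ z)
          * lorentz N (cutD a b x₀ r v G z) (cutD a b x₀ r v G z))
      = ∫ z, (-(scal T₀ x₀ v G z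
        * (v z.1 z.2 * fderiv ℝ ψ z (1, 0) - fderiv ℝ ψ z (0, G z.1 z.2)))
        + 1 / 2 * (fderiv ℝ ψ z ((T₀, x₀) - z) - (N - 1) * ψ z)
        * (v z.1 z.2 ^ 2 - ‖G z.1 z.2‖ ^ 2)) := by
    refine integral_congr_ae (.of_forall fun z => ?_)
    by_cases hz : z ∈ cyl a b x₀ r
    · simp only [cutD, Set.indicator_of_mem hz, dual_scal, lorentz_dual_dual, finrank_spaceTime,
        real_inner_self_eq_norm_sq]
      rw [lorentz_dual]
      push_cast
      ring
    · simp [hψ.eq_zero hz, hψ.fderiv_eq_zero hz]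
  rw [e1, e2, integral_neg_add i2 i3] at h
  rw [integral_add_sub i1 i2 i3, h]
  ring

theorem nullInt_mul (hs : IsSolution p f g T u₀ u₁ u v G)
    (hc : CylBelow T a b x₀ r) (hi : CylIntegrable p f g u v G a b x₀ r) (hab : a ≤ b)
    {ψ : ℝ × Sp N → ℝ} (hψ : IsTest (cylInt a b x₀ r) ψ) :
    NullInt volume fun z => source p f g (u z.1 z.2) (v z.1 z.2) * u z.1 z.2 * ψ z
      + u z.1 z.2 * (v z.1 z.2 * fderiv ℝ ψ z (1, 0) - fderiv ℝ ψ z (0, G z.1 z.2))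
      + ψ z * (v z.1 z.2 ^ 2 - ‖G z.1 z.2‖ ^ 2) := by
  have hψc := hψ.smooth.continuous
  have h := mul_identity (isOpen_cylInt a b x₀ r) hi.memLp_cutU hi.memLp_cutD
    hi.integrable_cutD hi.integrable_cutS (hs.isWeakDeriv hc hi) (hs.isWeakDiv hc)
    (pairingLimit_cutU hs hc hi hab) hψ
  have i1 : Integrable fun z : ℝ × Sp N =>
      source p f g (u z.1 z.2) (v z.1 z.2) * u z.1 z.2 * ψ z :=
    integrable_of_cyl ((integrable_test_mul
      (integrable_mul_of_abs hi.memU.1 hi.source.1 hi.sourceU) hψc).congr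
      (.of_forall fun z => mul_comm _ _)) fun z hz => by rw [hψ.eq_zero hz, mul_zero]
  have i2 : Integrable fun z : ℝ × Sp N => u z.1 z.2
      * (v z.1 z.2 * fderiv ℝ ψ z (1, 0) - fderiv ℝ ψ z (0, G z.1 z.2)) :=
    integrable_of_cyl (hi.memU.integrable_mul (hi.memLp_form hψ)) fun z hz => by
      rw [hψ.fderiv_eq_zero hz]; simp
  have i3 : Integrable fun z : ℝ × Sp N => ψ z * (v z.1 z.2 ^ 2 - ‖G z.1 z.2‖ ^ 2) :=
    integrable_of_cyl (integrable_test_mul hi.lor hψc) fun z hz => by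
      rw [hψ.eq_zero hz]; simp
  refine ⟨(i1.add i2).add i3, ?_⟩
  have e1 : ∫ z, cutS p f g a b x₀ r u v z * (ψ z * cutU a b x₀ r u z)
      = ∫ z : ℝ × Sp N, source p f g (u z.1 z.2) (v z.1 z.2) * u z.1 z.2 * ψ z := by
    refine integral_congr_ae (.of_forall fun z => ?_)
    by_cases hz : z ∈ cyl a b x₀ r
    · simp only [cutS, cutU, Set.indicator_of_mem hz]; ring
    · simp [hψ.eq_zero hz]
  have e2 : ∫ z, (-(cutU a b x₀ r u z * lorentz N (cutD a b x₀ r v G z) (fderiv ℝ ψ z))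
        + -(ψ z * lorentz N (cutD a b x₀ r v G z) (cutD a b x₀ r v G z)))
      = ∫ z : ℝ × Sp N, (-(u z.1 z.2
        * (v z.1 z.2 * fderiv ℝ ψ z (1, 0) - fderiv ℝ ψ z (0, G z.1 z.2)))
        + -(ψ z * (v z.1 z.2 ^ 2 - ‖G z.1 z.2‖ ^ 2))) := by
    refine integral_congr_ae (.of_forall fun z => ?_)
    by_cases hz : z ∈ cyl a b x₀ r
    · simp only [cutD, cutU, Set.indicator_of_mem hz, lorentz_dual_dual,
        real_inner_self_eq_norm_sq]
      rw [lorentz_dual]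
      ring
    · simp [hψ.eq_zero hz, hψ.fderiv_eq_zero hz]
  rw [e1, e2, integral_neg_add_neg i2 i3] at h
  rw [integral_add_add i1 i2 i3, h]
  ring

/-- Integrability of the energy density of the power nonlinearity and related products. -/
structure PowIntegrable (p : ℝ) (u v : ℝ → Sp N → ℝ) (G : ℝ → Sp N → Sp N)
    (a b : ℝ) (x₀ : Sp N) (r : ℝ) : Prop where
  powU : Integrable (fun z : ℝ × Sp N => |u z.1 z.2| ^ p * |u z.1 z.2|)
    (𝓛 (cyl a b x₀ r))
  powV : Integrable (fun z : ℝ × Sp N => |u z.1 z.2| ^ p * |v z.1 z.2|)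
    (𝓛 (cyl a b x₀ r))
  powG : Integrable (fun z : ℝ × Sp N => |u z.1 z.2| ^ p * ‖G z.1 z.2‖)
    (𝓛 (cyl a b x₀ r))

theorem CylIntegrable.powIntegrable (hp : 1 < p) (hq : 0 ≤ q) (hqp : q < p) (hM : 0 < M)
    (hf : ∀ a, |f a| ≤ M * (1 + |a| ^ q)) (hg : ∀ a, |g a| ≤ M * (1 + |a|))
    (hi : CylIntegrable p f g u v G a b x₀ r) : PowIntegrable p u v G a b x₀ r where
  powU := hi.rpow_mul hp hq hqp hM hf hg hi.memU hi.sourceU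
  powV := hi.rpow_mul hp hq hqp hM hf hg hi.memV hi.sourceV
  powG := by
    have := hi.rpow_mul hp hq hqp hM hf hg hi.memG.norm (by simpa using hi.sourceG)
    simpa using this

/-- A primitive and its derivative with growth of order `p`. -/
structure IsPrimitive (p C : ℝ) (Φ φ : ℝ → ℝ) : Prop where
  deriv : ∀ a, HasDerivAt Φ (φ a) a
  cont : Continuous φ
  zero : Φ 0 = 0
  nonneg : 0 ≤ C
  bound : ∀ a, |φ a| ≤ C * (1 + |a| ^ p)

theorem IsPrimitive.bound' {C : ℝ} {Φ φ : ℝ → ℝ} (h : IsPrimitive p C Φ φ) (hp : 0 ≤ p) (a : ℝ) :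
    |Φ a| ≤ C * ((1 + |a| ^ p) * |a|) := by
  rw [← truncPrim_eq h.deriv h.cont h.zero le_rfl]
  exact abs_truncPrim_le hp h.nonneg h.bound (abs_nonneg a) a

theorem IsPrimitive.continuous {C : ℝ} {Φ φ : ℝ → ℝ} (h : IsPrimitive p C Φ φ) : Continuous Φ :=
  continuous_iff_continuousAt.2 fun a => (h.deriv a).continuousAt

theorem PowIntegrable.growth_u (hi : CylIntegrable p f g u v G a b x₀ r)
    (hw : PowIntegrable p u v G a b x₀ r) :
    Integrable (fun z : ℝ × Sp N => (1 + |u z.1 z.2| ^ p) * |u z.1 z.2|)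
      (𝓛 (cyl a b x₀ r)) :=
  ((hi.memU.integrable (by norm_num)).norm.add hw.powU).congr
    (.of_forall fun z => by simp only [Pi.add_apply, norm_eq_abs]; ring)

theorem PowIntegrable.growth_D (hp : 0 ≤ p) (hi : CylIntegrable p f g u v G a b x₀ r)
    (hw : PowIntegrable p u v G a b x₀ r) :
    Integrable (fun z : ℝ × Sp N => (1 + |u z.1 z.2| ^ p) * ‖dual (v z.1 z.2) (G z.1 z.2)‖)
      (𝓛 (cyl a b x₀ r)) := by
  have h1 := ((hi.memV.integrable (by norm_num)).norm.add (hi.memG.integrable (by norm_num)).norm).add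
    (hw.powV.add hw.powG)
  have hm : AEStronglyMeasurable (fun z : ℝ × Sp N => 1 + |u z.1 z.2| ^ p)
      (𝓛 (cyl a b x₀ r)) :=
    (continuous_const.add (continuous_abs.rpow_const fun _ => Or.inr hp)).comp_aestronglyMeasurable
      hi.memU.1
  have h2 := continuous_dual.norm.comp_aestronglyMeasurable (hi.memV.1.prodMk hi.memG.1)
  refine h1.mono' (hm.mul h2) (.of_forall fun z => ?_)
  have h3 : 0 ≤ |u z.1 z.2| ^ p := Real.rpow_nonneg (abs_nonneg _) _
  rw [norm_of_nonneg (by positivity)]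
  refine (mul_le_mul_of_nonneg_left (norm_dual_le _ _) (by positivity)).trans (le_of_eq ?_)
  simp only [Pi.add_apply, norm_eq_abs]
  ring

theorem nullInt_chain (hp : 0 ≤ p) (hs : IsSolution p f g T u₀ u₁ u v G)
    (hc : CylBelow T a b x₀ r) (hi : CylIntegrable p f g u v G a b x₀ r)
    (hw : PowIntegrable p u v G a b x₀ r) {C : ℝ} {Φ φ : ℝ → ℝ} (hΦ : IsPrimitive p C Φ φ)
    {ψ : ℝ × Sp N → ℝ} (hψ : IsTest (cylInt a b x₀ r) ψ)
    (L : (ℝ × Sp N) →L[ℝ] (ℝ × Sp N)) (c : ℝ × Sp N) :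
    NullInt volume fun z => φ (u z.1 z.2) * dual (v z.1 z.2) (G z.1 z.2) (L (z - c)) * ψ z
      + Φ (u z.1 z.2) * (fderiv ℝ ψ z (L (z - c)) + LinearMap.trace ℝ (ℝ × Sp N) L * ψ z) := by
  have hψc := hψ.smooth.continuous
  have hψd := hψ.smooth.continuous_fderiv (by simp)
  have hLc : Continuous fun z : ℝ × Sp N => L (z - c) := by fun_prop
  have hsub : tsupport ψ ⊆ cyl a b x₀ r := hψ.supp.trans (cylInt_subset a b x₀ r)
  have g1 := hw.growth_u hi
  have g2 := hw.growth_D hp hi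
  have h := chain_identity (isOpen_cylInt a b x₀ r) hi.memLp_cutU hi.memLp_cutD
    (hs.isWeakDeriv hc hi) hΦ.deriv hΦ.cont hΦ.zero hp hΦ.nonneg hΦ.bound hψ
    (by
      refine IntegrableOn.congr_fun (IntegrableOn.mono_set g1 hsub) (fun z hz => ?_)
        (isClosed_tsupport ψ).measurableSet
      simp only [cutU, Set.indicator_of_mem (hsub hz)])
    (by
      refine IntegrableOn.congr_fun (IntegrableOn.mono_set g2 hsub) (fun z hz => ?_)
        (isClosed_tsupport ψ).measurableSet
      simp only [cutU, cutD, Set.indicator_of_mem (hsub hz)]) L c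
  have i1 : Integrable fun z : ℝ × Sp N =>
      φ (u z.1 z.2) * dual (v z.1 z.2) (G z.1 z.2) (L (z - c)) * ψ z := by
    refine integrable_of_cyl (a := a) (b := b) (x₀ := x₀) (r := r) ?_ fun z hz => by
      rw [hψ.eq_zero hz, mul_zero]
    have h1 := integrable_test_mul g2 (k := fun z => C * (‖L (z - c)‖ * |ψ z|)) (by fun_prop)
    refine h1.mono' ?_ (.of_forall fun z => ?_)
    · exact ((hΦ.cont.comp_aestronglyMeasurable hi.memU.1).mul
        (isBoundedBilinearMap_apply.continuous.comp_aestronglyMeasurable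
          (hi.memLp_dual.1.prodMk hLc.aestronglyMeasurable))).mul hψc.aestronglyMeasurable
    · rw [norm_mul, norm_mul, norm_eq_abs (ψ z), norm_eq_abs (φ _)]
      have h2 := (dual (v z.1 z.2) (G z.1 z.2)).le_opNorm (L (z - c))
      have h3 := hΦ.nonneg
      have h4 : 0 ≤ |u z.1 z.2| ^ p := Real.rpow_nonneg (abs_nonneg _) _
      calc _ ≤ C * (1 + |u z.1 z.2| ^ p) * (‖dual (v z.1 z.2) (G z.1 z.2)‖ * ‖L (z - c)‖)
            * |ψ z| := by
            gcongr
            exact hΦ.bound _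
        _ = _ := by ring
  have i2 : Integrable fun z : ℝ × Sp N => Φ (u z.1 z.2)
      * (fderiv ℝ ψ z (L (z - c)) + LinearMap.trace ℝ (ℝ × Sp N) L * ψ z) := by
    refine integrable_of_cyl (a := a) (b := b) (x₀ := x₀) (r := r) ?_ fun z hz => by
      rw [hψ.eq_zero hz, hψ.fderiv_eq_zero hz]; simp
    have h0 : Integrable (fun z : ℝ × Sp N => Φ (u z.1 z.2)) (𝓛 (cyl a b x₀ r)) :=
      (g1.const_mul C).mono' (hΦ.continuous.comp_aestronglyMeasurable hi.memU.1)
        (.of_forall fun z => hΦ.bound' hp _)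
    exact (integrable_test_mul h0 ((hψd.clm_apply hLc).add (continuous_const.mul hψc))).congr
      (.of_forall fun z => mul_comm _ _)
  refine ⟨i1.add i2, ?_⟩
  have e1 : ∫ z, φ (cutU a b x₀ r u z) * cutD a b x₀ r v G z (L (z - c)) * ψ z
      = ∫ z : ℝ × Sp N, φ (u z.1 z.2) * dual (v z.1 z.2) (G z.1 z.2) (L (z - c)) * ψ z := by
    refine integral_congr_ae (.of_forall fun z => ?_)
    by_cases hz : z ∈ cyl a b x₀ r
    · simp only [cutU, cutD, Set.indicator_of_mem hz]
    · simp [hψ.eq_zero hz]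
  have e2 : ∫ z, Φ (cutU a b x₀ r u z)
        * (fderiv ℝ ψ z (L (z - c)) + LinearMap.trace ℝ (ℝ × Sp N) L * ψ z)
      = ∫ z : ℝ × Sp N, Φ (u z.1 z.2)
        * (fderiv ℝ ψ z (L (z - c)) + LinearMap.trace ℝ (ℝ × Sp N) L * ψ z) := by
    refine integral_congr_ae (.of_forall fun z => ?_)
    by_cases hz : z ∈ cyl a b x₀ r
    · simp only [cutU, Set.indicator_of_mem hz]
    · simp [hψ.eq_zero hz, hψ.fderiv_eq_zero hz]
  rw [e1, e2] at h
  rw [integral_add i1 i2, h, neg_add_cancel]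

theorem nullInt_chain_scal (hp : 0 ≤ p) (hs : IsSolution p f g T u₀ u₁ u v G)
    (hc : CylBelow T a b x₀ r) (hi : CylIntegrable p f g u v G a b x₀ r)
    (hw : PowIntegrable p u v G a b x₀ r) {C : ℝ} {Φ φ : ℝ → ℝ} (hΦ : IsPrimitive p C Φ φ)
    {ψ : ℝ × Sp N → ℝ} (hψ : IsTest (cylInt a b x₀ r) ψ) (T₀ : ℝ) :
    NullInt volume fun z => φ (u z.1 z.2) * scal T₀ x₀ v G z * ψ z
      + Φ (u z.1 z.2) * (fderiv ℝ ψ z ((T₀, x₀) - z) - (N + 1) * ψ z) := by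
  refine (nullInt_chain hp hs hc hi hw hΦ hψ (-ContinuousLinearMap.id ℝ _) (T₀, x₀)).congr
    fun z => ?_
  have h1 : (-ContinuousLinearMap.id ℝ (ℝ × Sp N)) (z - (T₀, x₀)) = (T₀, x₀) - z := by
    simp
  have h2 : LinearMap.trace ℝ (ℝ × Sp N)
      ((-ContinuousLinearMap.id ℝ (ℝ × Sp N) : (ℝ × Sp N) →L[ℝ] (ℝ × Sp N)) :
        (ℝ × Sp N) →ₗ[ℝ] (ℝ × Sp N)) = -(N + 1) := by
    have : ((-ContinuousLinearMap.id ℝ (ℝ × Sp N) : (ℝ × Sp N) →L[ℝ] (ℝ × Sp N)) :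
        (ℝ × Sp N) →ₗ[ℝ] (ℝ × Sp N)) = -LinearMap.id := by ext <;> simp
    rw [this, map_neg, LinearMap.trace_id, finrank_spaceTime]
    push_cast; ring
  rw [h1, h2, dual_scal]
  ring

theorem nullInt_chain_radial (hp : 0 ≤ p) (hs : IsSolution p f g T u₀ u₁ u v G)
    (hc : CylBelow T a b x₀ r) (hi : CylIntegrable p f g u v G a b x₀ r)
    (hw : PowIntegrable p u v G a b x₀ r) {C : ℝ} {Φ φ : ℝ → ℝ} (hΦ : IsPrimitive p C Φ φ)
    {ψ : ℝ × Sp N → ℝ} (hψ : IsTest (cylInt a b x₀ r) ψ) :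
    NullInt volume fun z => φ (u z.1 z.2) * radial x₀ G z * ψ z
      + Φ (u z.1 z.2) * (fderiv ℝ ψ z (0, z.2 - x₀) + N * ψ z) := by
  refine (nullInt_chain hp hs hc hi hw hΦ hψ ((ContinuousLinearMap.inr ℝ ℝ (Sp N)).comp
    (ContinuousLinearMap.snd ℝ ℝ (Sp N))) (0, x₀)).congr fun z => ?_
  have h2 : LinearMap.trace ℝ (ℝ × Sp N) (((ContinuousLinearMap.inr ℝ ℝ (Sp N)).comp
    (ContinuousLinearMap.snd ℝ ℝ (Sp N)) : (ℝ × Sp N) →L[ℝ] (ℝ × Sp N)) :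
        (ℝ × Sp N) →ₗ[ℝ] (ℝ × Sp N)) = N := by
    have : (((ContinuousLinearMap.inr ℝ ℝ (Sp N)).comp
      (ContinuousLinearMap.snd ℝ ℝ (Sp N)) : (ℝ × Sp N) →L[ℝ] (ℝ × Sp N)) :
        (ℝ × Sp N) →ₗ[ℝ] (ℝ × Sp N))
        = (LinearMap.inr ℝ ℝ (Sp N)) ∘ₗ (LinearMap.snd ℝ ℝ (Sp N)) := by ext <;> simp
    rw [this, LinearMap.trace_comp_comm']
    have h3 : LinearMap.snd ℝ ℝ (Sp N) ∘ₗ LinearMap.inr ℝ ℝ (Sp N) = LinearMap.id := by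
      ext <;> simp
    rw [h3, LinearMap.trace_id]
    simp
  have h1 : ((ContinuousLinearMap.inr ℝ ℝ (Sp N)).comp (ContinuousLinearMap.snd ℝ ℝ (Sp N)))
      (z - (0, x₀)) = (0, z.2 - x₀) := by simp
  rw [h1, h2, dual_apply, radial]
  simp

/-- The function `1 - |y|²` in the variables `(t, x)`. -/
def rvar (T₀ : ℝ) (x₀ : Sp N) (z : ℝ × Sp N) : ℝ := 1 - ‖z.2 - x₀‖ ^ 2 / (T₀ - z.1) ^ 2

/-- The test function `ϑ(t) η(1 - |y|²)`. -/
def coneTest (T₀ : ℝ) (x₀ : Sp N) (ϑ η : ℝ → ℝ) (z : ℝ × Sp N) : ℝ := ϑ z.1 * η (rvar T₀ x₀ z)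

/-- Smooth functions vanishing near `(-∞, 0]`. -/
structure IsProfile (η : ℝ → ℝ) : Prop where
  smooth : ContDiff ℝ ∞ η
  vanish : ∃ ε, 0 < ε ∧ ∀ r ≤ ε, η r = 0

theorem hasFDerivAt_rvar {z : ℝ × Sp N} (hz : z.1 < T₀) :
    HasFDerivAt (rvar T₀ x₀) (dual (-(2 * (1 - rvar T₀ x₀ z) / (T₀ - z.1)))
      (-(2 / (T₀ - z.1) ^ 2) • (z.2 - x₀))) z := by
  have hτ : T₀ - z.1 ≠ 0 := by linarith
  have h1 : HasFDerivAt (fun z : ℝ × Sp N => z.2 - x₀) (ContinuousLinearMap.snd ℝ ℝ (Sp N)) z :=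
    hasFDerivAt_snd.sub_const x₀
  have h2 := h1.norm_sq
  have h3 : HasFDerivAt (fun z : ℝ × Sp N => (T₀ - z.1)) (-ContinuousLinearMap.fst ℝ ℝ (Sp N)) z :=
    hasFDerivAt_fst.const_sub T₀
  have h4 : HasDerivAt (fun s : ℝ => (s ^ 2)⁻¹) (-(2 * (T₀ - z.1)) / ((T₀ - z.1) ^ 2) ^ 2)
      (T₀ - z.1) := by
    have := (hasDerivAt_pow 2 (T₀ - z.1)).fun_inv (pow_ne_zero 2 hτ)
    simpa using this
  have h5 := (h2.mul (h4.comp_hasFDerivAt z h3)).const_sub 1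
  have h6 : (fun w : ℝ × Sp N => 1 - ((fun z : ℝ × Sp N => ‖z.2 - x₀‖ ^ 2)
      * ((fun s : ℝ => (s ^ 2)⁻¹) ∘ fun z : ℝ × Sp N => T₀ - z.1)) w) = rvar T₀ x₀ := by
    funext w
    simp [rvar, div_eq_mul_inv]
  rw [h6] at h5
  refine h5.congr_fderiv ?_
  ext e
  · simp [dual_apply, rvar]
    field_simp
  · simp [dual_apply, inner_smul_left]
    field_simp
    rw [inner_sub_left]

theorem contDiffAt_rvar {z : ℝ × Sp N} (hz : z.1 < T₀) : ContDiffAt ℝ ∞ (rvar T₀ x₀) z := by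
  unfold rvar
  refine contDiffAt_const.sub (ContDiffAt.div ?_ (by fun_prop) (pow_ne_zero 2 (by linarith)))
  exact (contDiffAt_snd.sub contDiffAt_const).norm_sq ℝ

theorem contDiff_of_contDiffAt_tsupport {E : Type*} [NormedAddCommGroup E] [NormedSpace ℝ E]
    {k : E → ℝ} (h : ∀ z ∈ tsupport k, ContDiffAt ℝ ∞ k z) : ContDiff ℝ ∞ k := by
  refine contDiff_iff_contDiffAt.2 fun z => ?_
  by_cases hz : z ∈ tsupport k
  · exact h z hz
  · exact contDiffAt_const.congr_of_eventuallyEq (notMem_tsupport_iff_eventuallyEq.1 hz)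

theorem isTest_coneTest (hb : b ≤ T₀) {ϑ η : ℝ → ℝ} (hϑ : IsTest (Ioo a b) ϑ)
    (hη : IsProfile η) : IsTest (cylInt a b x₀ (T₀ - a)) (coneTest T₀ x₀ ϑ η) := by
  obtain ⟨ε, hε, h0⟩ := hη.vanish
  set S : Set (ℝ × Sp N) := {z | z.1 ∈ tsupport ϑ ∧ ‖z.2 - x₀‖ ^ 2 ≤ (1 - ε) * (T₀ - z.1) ^ 2} with hS
  have hSc : IsClosed S := by
    have h2 : IsClosed {z : ℝ × Sp N | ‖z.2 - x₀‖ ^ 2 ≤ (1 - ε) * (T₀ - z.1) ^ 2} :=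
      isClosed_le (by fun_prop) (by fun_prop)
    exact ((isClosed_tsupport ϑ).preimage continuous_fst).inter h2
  have hsub : S ⊆ cylInt a b x₀ (T₀ - a) := by
    rintro z ⟨h1, h2⟩
    have h3 := hϑ.supp h1
    refine ⟨h3, ?_⟩
    have h4 : 0 < T₀ - z.1 := by linarith [h3.2]
    rw [mem_ball_iff_norm]
    refine lt_of_lt_of_le ?_ (by linarith [h3.1] : T₀ - z.1 ≤ T₀ - a)
    refine lt_of_pow_lt_pow_left₀ 2 h4.le (h2.trans_lt ?_)
    nlinarith [mul_pos hε (pow_pos h4 2)]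
  have htsupp : tsupport (coneTest T₀ x₀ ϑ η) ⊆ S := by
    refine closure_minimal (fun z hz => ?_) hSc
    have h1 : ϑ z.1 ≠ 0 := fun h => hz (by simp [coneTest, h])
    have h2 : η (rvar T₀ x₀ z) ≠ 0 := fun h => hz (by simp [coneTest, h])
    refine ⟨subset_tsupport _ h1, ?_⟩
    have h3 : ε < rvar T₀ x₀ z := by
      by_contra h; exact h2 (h0 _ (not_lt.1 h))
    have h4 : 0 < (T₀ - z.1) ^ 2 := by
      have := (hϑ.supp (subset_tsupport _ h1)).2
      have : 0 < T₀ - z.1 := by linarith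
      positivity
    rw [rvar, lt_sub_comm, div_lt_iff₀ h4] at h3
    exact h3.le
  refine ⟨contDiff_of_contDiffAt_tsupport fun z hz => ?_, ?_, htsupp.trans hsub⟩
  · have h1 := (hsub (htsupp hz)).1.2
    exact (hϑ.smooth.contDiffAt.comp z contDiffAt_fst).mul
      (hη.smooth.contDiffAt.comp z (contDiffAt_rvar (by linarith)))
  · exact (isCompact_cyl a b x₀ (T₀ - a)).of_isClosed_subset (isClosed_tsupport _)
      ((htsupp.trans hsub).trans (cylInt_subset _ _ _ _))

theorem fderiv_coneTest (hb : b ≤ T₀) {ϑ η : ℝ → ℝ} (hϑ : IsTest (Ioo a b) ϑ)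
    (hη : IsProfile η) (z e : ℝ × Sp N) :
    fderiv ℝ (coneTest T₀ x₀ ϑ η) z e = e.1 * (deriv ϑ z.1 * η (rvar T₀ x₀ z)
        - 2 * (1 - rvar T₀ x₀ z) / (T₀ - z.1) * ϑ z.1 * deriv η (rvar T₀ x₀ z))
      - 2 / (T₀ - z.1) ^ 2 * ϑ z.1 * deriv η (rvar T₀ x₀ z) * inner ℝ (z.2 - x₀) e.2 := by
  by_cases hz : z.1 ∈ tsupport ϑ
  · have h1 : z.1 < T₀ := by linarith [(hϑ.supp hz).2]
    have h2 : HasFDerivAt (fun z : ℝ × Sp N => ϑ z.1)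
        (deriv ϑ z.1 • ContinuousLinearMap.fst ℝ ℝ (Sp N)) z :=
      (hϑ.smooth.differentiable (by simp) z.1).hasDerivAt.comp_hasFDerivAt z hasFDerivAt_fst
    have h3 := (hη.smooth.differentiable (by simp) (rvar T₀ x₀ z)).hasDerivAt.comp_hasFDerivAt z
      (hasFDerivAt_rvar (x₀ := x₀) h1)
    have h4 : HasFDerivAt (coneTest T₀ x₀ ϑ η) _ z := h2.mul h3
    rw [h4.fderiv]
    simp [dual_apply, inner_smul_left]
    ring
  · have h1 : ϑ z.1 = 0 := image_eq_zero_of_notMem_tsupport hz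
    have h2 : deriv ϑ z.1 = 0 := by
      by_contra h
      exact hz (support_deriv_subset h)
    have h3 : z ∉ tsupport (coneTest T₀ x₀ ϑ η) := fun h => hz (by
      have : tsupport (coneTest T₀ x₀ ϑ η) ⊆ {z | z.1 ∈ tsupport ϑ} :=
        closure_minimal (fun w hw => subset_tsupport _ fun h => hw (by simp [coneTest, h]))
          ((isClosed_tsupport ϑ).preimage continuous_fst)
      exact this h)
    rw [fderiv_of_notMem_tsupport ℝ h3, h1, h2]
    simp

namespace IsProfile

variable {η ζ : ℝ → ℝ}

theorem mul_smooth (hη : IsProfile η) {k : ℝ → ℝ} (hk : ContDiff ℝ ∞ k) :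
    IsProfile fun r => k r * η r :=
  ⟨hk.mul hη.smooth, by
    obtain ⟨ε, hε, h⟩ := hη.vanish
    exact ⟨ε, hε, fun r hr => by rw [h r hr, mul_zero]⟩⟩

theorem add (hη : IsProfile η) (hζ : IsProfile ζ) : IsProfile fun r => η r + ζ r :=
  ⟨hη.smooth.add hζ.smooth, by
    obtain ⟨ε, hε, h⟩ := hη.vanish
    obtain ⟨ε', hε', h'⟩ := hζ.vanish
    exact ⟨min ε ε', lt_min hε hε', fun r hr => by
      rw [h r (hr.trans (min_le_left _ _)), h' r (hr.trans (min_le_right _ _)), add_zero]⟩⟩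

theorem deriv (hη : IsProfile η) : IsProfile (deriv η) :=
  ⟨(contDiff_infty_iff_deriv.1 hη.smooth).2, by
    obtain ⟨ε, hε, h⟩ := hη.vanish
    refine ⟨ε / 2, by positivity, fun r hr => ?_⟩
    have : η =ᶠ[𝓝 r] fun _ => 0 := by
      filter_upwards [Iio_mem_nhds (by linarith : r < ε)] with s hs
      exact h s (le_of_lt hs)
    rw [this.deriv_eq]; simp⟩

end IsProfile

theorem IsTest.mul_rpow (hb : b ≤ T₀) {ϑ : ℝ → ℝ} (h : IsTest (Ioo a b) ϑ) (k : ℝ) :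
    IsTest (Ioo a b) fun t => ϑ t * (T₀ - t) ^ k := by
  have hs : tsupport (fun t => ϑ t * (T₀ - t) ^ k) ⊆ tsupport ϑ := tsupport_mul_subset_left
  refine ⟨contDiff_of_contDiffAt_tsupport fun t ht => ?_, h.compact.mul_right, hs.trans h.supp⟩
  have h1 := (h.supp (hs ht)).2
  exact h.smooth.contDiffAt.mul (ContDiffAt.rpow_const_of_ne (by fun_prop) (by linarith))

theorem IsTest.deriv_eq_zero {ϑ : ℝ → ℝ} {t : ℝ} (ht : t ∉ tsupport ϑ) : deriv ϑ t = 0 := by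
  by_contra h
  exact ht (support_deriv_subset h)

theorem IsTest.deriv_mul_rpow (hb : b ≤ T₀) {ϑ : ℝ → ℝ} (h : IsTest (Ioo a b) ϑ) (k t : ℝ) :
    deriv (fun t => ϑ t * (T₀ - t) ^ k) t
      = deriv ϑ t * (T₀ - t) ^ k - k * ϑ t * (T₀ - t) ^ (k - 1) := by
  by_cases ht : t ∈ tsupport ϑ
  · have h1 : t < T₀ := (h.supp ht).2.trans_le hb
    have h2 : HasDerivAt (fun t => (T₀ - t) ^ k) (-1 * k * (T₀ - t) ^ (k - 1)) t :=
      ((hasDerivAt_id t).const_sub T₀).rpow_const (Or.inl (by simp; linarith))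
    have h3 := ((h.smooth.differentiable (by simp) t).hasDerivAt.mul h2).deriv
    have h4 : deriv (fun t => ϑ t * (T₀ - t) ^ k) t = _ := h3
    rw [h4]
    ring
  · rw [IsTest.deriv_eq_zero ht, image_eq_zero_of_notMem_tsupport ht, IsTest.deriv_eq_zero]
    · simp
    · exact fun h' => ht (tsupport_mul_subset_left h')

/-- Being zero, together with the derivative, or lying below `T₀`. -/
theorem IsTest.lt_or_zero (hb : b ≤ T₀) {ϑ : ℝ → ℝ} (h : IsTest (Ioo a b) ϑ) (t : ℝ) :
    0 < T₀ - t ∨ (ϑ t = 0 ∧ deriv ϑ t = 0) := by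
  by_cases ht : t ∈ tsupport ϑ
  · left; linarith [(h.supp ht).2]
  · exact Or.inr ⟨image_eq_zero_of_notMem_tsupport ht, IsTest.deriv_eq_zero ht⟩

theorem IsTest.deriv {ϑ : ℝ → ℝ} (h : IsTest (Ioo a b) ϑ) :
    IsTest (Ioo a b) (deriv ϑ) :=
  ⟨(contDiff_infty_iff_deriv.1 h.smooth).2, h.compact.deriv, tsupport_deriv_subset.trans h.supp⟩

/-- A solution on the part of the light cone with vertex `(T₀, x₀)` between the times `a`, `b`. -/
structure OnCone (p : ℝ) (f g : ℝ → ℝ) (T u₀ u₁ : Sp N → ℝ) (u v : ℝ → Sp N → ℝ)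
    (G : ℝ → Sp N → Sp N) (T₀ a b : ℝ) (x₀ : Sp N) : Prop where
  sol : IsSolution p f g T u₀ u₁ u v G
  below : CylBelow T a b x₀ (T₀ - a)
  int : CylIntegrable p f g u v G a b x₀ (T₀ - a)
  pow : PowIntegrable p u v G a b x₀ (T₀ - a)
  one_lt : 1 < p
  lt : a < b
  lt_vertex : b < T₀

theorem rpow_two_mul {τ : ℝ} (h : 0 < τ) (α : ℝ) : τ ^ (2 * α) = τ ^ (2 * α - 1) * τ ∧
    τ ^ (2 * α - 2) = τ ^ (2 * α - 1) / τ ∧ τ ^ (2 * α - 2 - 1) = τ ^ (2 * α - 1) / τ ^ 2 := by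
  have e2 : τ ^ (2 * α - 2) = τ ^ (2 * α - 1) / τ := by
    rw [← Real.rpow_sub_one h.ne']; ring_nf
  refine ⟨?_, e2, ?_⟩
  · rw [Real.rpow_sub_one h.ne']; field_simp
  · rw [Real.rpow_sub_one h.ne', e2]; field_simp

theorem radial_eq (z : ℝ × Sp N) :
    radial x₀ G z = (T₀ - z.1) * v z.1 z.2 - scal T₀ x₀ v G z := by
  rw [radial, scal]; ring

theorem coneTest_scal (hb : b ≤ T₀) {ϑ η : ℝ → ℝ} (hϑ : IsTest (Ioo a b) ϑ)
    (hη : IsProfile η) (z : ℝ × Sp N) :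
    fderiv ℝ (coneTest T₀ x₀ ϑ η) z ((T₀, x₀) - z)
      = (T₀ - z.1) * deriv ϑ z.1 * η (rvar T₀ x₀ z) := by
  rw [fderiv_coneTest hb hϑ hη]
  rcases hϑ.lt_or_zero hb z.1 with h | ⟨h, h'⟩
  · have h1 : inner ℝ (z.2 - x₀) ((T₀, x₀) - z).2 = -‖z.2 - x₀‖ ^ 2 := by
      rw [Prod.snd_sub, ← neg_sub z.2 x₀, inner_neg_right, real_inner_self_eq_norm_sq]
    have h2 : ‖z.2 - x₀‖ ^ 2 = (1 - rvar T₀ x₀ z) * (T₀ - z.1) ^ 2 := by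
      rw [rvar]; field_simp; ring
    rw [h1, h2, Prod.fst_sub]
    field_simp
    ring
  · rw [h, h']; ring

theorem coneTest_radial (hb : b ≤ T₀) {ϑ η : ℝ → ℝ} (hϑ : IsTest (Ioo a b) ϑ)
    (hη : IsProfile η) (z : ℝ × Sp N) :
    fderiv ℝ (coneTest T₀ x₀ ϑ η) z (0, z.2 - x₀)
      = -(2 * (1 - rvar T₀ x₀ z) * ϑ z.1 * deriv η (rvar T₀ x₀ z)) := by
  rw [fderiv_coneTest hb hϑ hη]
  rcases hϑ.lt_or_zero hb z.1 with h | ⟨h, h'⟩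
  · have h2 : ‖z.2 - x₀‖ ^ 2 = (1 - rvar T₀ x₀ z) * (T₀ - z.1) ^ 2 := by
      rw [rvar]; field_simp; ring
    rw [real_inner_self_eq_norm_sq, h2]
    field_simp
    ring
  · rw [h, h']; ring

theorem isPrimitive_half_sq (hp : 1 ≤ p) : IsPrimitive p 1 (fun x => 1 / 2 * x ^ 2) fun x => x where
  deriv x := by simpa using (hasDerivAt_pow 2 x).const_mul (1 / 2 : ℝ)
  cont := continuous_id
  zero := by simp
  nonneg := zero_le_one
  bound x := by
    rw [one_mul]
    rcases le_total |x| 1 with h | h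
    · linarith [Real.rpow_nonneg (abs_nonneg x) p]
    · have := Real.rpow_le_rpow_of_exponent_le h hp
      rw [Real.rpow_one] at this
      linarith

namespace OnCone

variable (H : OnCone p f g T u₀ u₁ u v G T₀ a b x₀)
include H

theorem scaling {ϑ η : ℝ → ℝ} (hϑ : IsTest (Ioo a b) ϑ) (hη : IsProfile η) :
    NullInt volume fun z : ℝ × Sp N =>
      source p f g (u z.1 z.2) (v z.1 z.2) * scal T₀ x₀ v G z * (ϑ z.1 * η (rvar T₀ x₀ z))
      + scal T₀ x₀ v G z * (v z.1 z.2 * (deriv ϑ z.1 * η (rvar T₀ x₀ z)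
          - 2 * (1 - rvar T₀ x₀ z) / (T₀ - z.1) * ϑ z.1 * deriv η (rvar T₀ x₀ z))
        + 2 / (T₀ - z.1) ^ 2 * ϑ z.1 * deriv η (rvar T₀ x₀ z) * radial x₀ G z)
      - 1 / 2 * ((T₀ - z.1) * deriv ϑ z.1 - (N - 1) * ϑ z.1) * η (rvar T₀ x₀ z)
        * (v z.1 z.2 ^ 2 - ‖G z.1 z.2‖ ^ 2) := by
  refine (nullInt_scaling H.sol H.below H.int H.lt.le (isTest_coneTest H.lt_vertex.le hϑ hη)
    T₀).congr fun z => ?_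
  rw [coneTest_scal H.lt_vertex.le hϑ hη, fderiv_coneTest H.lt_vertex.le hϑ hη,
    fderiv_coneTest H.lt_vertex.le hϑ hη]
  have hr : inner ℝ (z.2 - x₀) (G z.1 z.2) = radial x₀ G z := real_inner_comm _ _
  simp only [inner_zero_right, coneTest, hr]
  ring

theorem mul {ϑ η : ℝ → ℝ} (hϑ : IsTest (Ioo a b) ϑ) (hη : IsProfile η) :
    NullInt volume fun z : ℝ × Sp N =>
      source p f g (u z.1 z.2) (v z.1 z.2) * u z.1 z.2 * (ϑ z.1 * η (rvar T₀ x₀ z))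
      + u z.1 z.2 * (v z.1 z.2 * (deriv ϑ z.1 * η (rvar T₀ x₀ z)
          - 2 * (1 - rvar T₀ x₀ z) / (T₀ - z.1) * ϑ z.1 * deriv η (rvar T₀ x₀ z))
        + 2 / (T₀ - z.1) ^ 2 * ϑ z.1 * deriv η (rvar T₀ x₀ z) * radial x₀ G z)
      + ϑ z.1 * η (rvar T₀ x₀ z) * (v z.1 z.2 ^ 2 - ‖G z.1 z.2‖ ^ 2) := by
  refine (nullInt_mul H.sol H.below H.int H.lt.le (isTest_coneTest H.lt_vertex.le hϑ hη)).congr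
    fun z => ?_
  rw [fderiv_coneTest H.lt_vertex.le hϑ hη,
    fderiv_coneTest H.lt_vertex.le hϑ hη]
  have hr : inner ℝ (z.2 - x₀) (G z.1 z.2) = radial x₀ G z := real_inner_comm _ _
  simp only [inner_zero_right, coneTest, hr]
  ring

theorem chain_scal {C : ℝ} {Φ φ : ℝ → ℝ} (hΦ : IsPrimitive p C Φ φ) {ϑ η : ℝ → ℝ}
    (hϑ : IsTest (Ioo a b) ϑ) (hη : IsProfile η) :
    NullInt volume fun z : ℝ × Sp N =>
      φ (u z.1 z.2) * scal T₀ x₀ v G z * (ϑ z.1 * η (rvar T₀ x₀ z))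
      + Φ (u z.1 z.2) * (((T₀ - z.1) * deriv ϑ z.1 - (N + 1) * ϑ z.1) * η (rvar T₀ x₀ z)) := by
  refine (nullInt_chain_scal (by linarith [H.one_lt]) H.sol H.below H.int H.pow hΦ
    (isTest_coneTest H.lt_vertex.le hϑ hη) T₀).congr fun z => ?_
  rw [coneTest_scal H.lt_vertex.le hϑ hη]
  simp only [coneTest]
  ring

theorem chain_radial {C : ℝ} {Φ φ : ℝ → ℝ} (hΦ : IsPrimitive p C Φ φ) {ϑ η : ℝ → ℝ}
    (hϑ : IsTest (Ioo a b) ϑ) (hη : IsProfile η) :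
    NullInt volume fun z : ℝ × Sp N =>
      φ (u z.1 z.2) * radial x₀ G z * (ϑ z.1 * η (rvar T₀ x₀ z))
      + Φ (u z.1 z.2) * (ϑ z.1 * (N * η (rvar T₀ x₀ z)
        - 2 * (1 - rvar T₀ x₀ z) * deriv η (rvar T₀ x₀ z))) := by
  refine (nullInt_chain_radial (by linarith [H.one_lt]) H.sol H.below H.int H.pow hΦ
    (isTest_coneTest H.lt_vertex.le hϑ hη)).congr fun z => ?_
  rw [coneTest_radial H.lt_vertex.le hϑ hη]
  simp only [coneTest]
  ring

/-- The energy identity. -/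
theorem energy_identity {β α : ℝ} (hα : 2 * α = 2 * β - (N - 1)) {ϑ κ : ℝ → ℝ}
    (hϑ : IsTest (Ioo a b) ϑ) (hκ : IsProfile κ) :
    NullInt volume fun z : ℝ × Sp N =>
      deriv ϑ z.1 * (T₀ - z.1) ^ (2 * α - 1) * κ (rvar T₀ x₀ z)
        * (1 / 2 * (scal T₀ x₀ v G z - β * u z.1 z.2) ^ 2
          + 1 / 2 * (T₀ - z.1) ^ 2 * ‖G z.1 z.2‖ ^ 2 - 1 / 2 * radial x₀ G z ^ 2
          + 1 / 2 * β * (β + 1) * u z.1 z.2 ^ 2)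
      + deriv ϑ z.1 * (T₀ - z.1) ^ (2 * α - 1) * β
        * (rvar T₀ x₀ z * deriv κ (rvar T₀ x₀ z) - α * κ (rvar T₀ x₀ z)) * u z.1 z.2 ^ 2
      + ϑ z.1 * ((T₀ - z.1) ^ (2 * α - 1) / (T₀ - z.1))
        * (-(2 * deriv κ (rvar T₀ x₀ z) * (scal T₀ x₀ v G z - β * u z.1 z.2) ^ 2)
          + 2 * (rvar T₀ x₀ z * deriv κ (rvar T₀ x₀ z) - α * κ (rvar T₀ x₀ z))
            * ((T₀ - z.1) * v z.1 z.2) * (scal T₀ x₀ v G z - β * u z.1 z.2)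
          + (T₀ - z.1) ^ 2 * source p f g (u z.1 z.2) (v z.1 z.2) * κ (rvar T₀ x₀ z)
            * (scal T₀ x₀ v G z - β * u z.1 z.2)) := by
  have hb := H.lt_vertex.le
  have hsq := isPrimitive_half_sq H.one_lt.le
  have t1 := hϑ.mul_rpow hb (2 * α)
  have t2 := hϑ.mul_rpow hb (2 * α - 2)
  have t3 := hϑ.deriv.mul_rpow hb (2 * α - 1)
  have k1 := H.scaling t1 hκ
  have k2 := H.mul t1 hκ
  have k3 := H.chain_radial hsq t3 hκ
  have k4 := H.chain_scal hsq t2 hκ.deriv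
  refine (((k1.add (k2.const_mul (-β))).add (k3.const_mul β)).add (k4.const_mul (2 * β))).congr
    fun z => ?_
  rw [hϑ.deriv_mul_rpow hb, hϑ.deriv_mul_rpow hb]
  rcases hϑ.lt_or_zero hb z.1 with h | ⟨h, h'⟩
  · obtain ⟨e1, e2, e3⟩ := rpow_two_mul h α
    have hN : (N : ℝ) = 2 * β - 2 * α + 1 := by linarith
    rw [e1, e2, e3, radial_eq (v := v) (T₀ := T₀), hN]
    generalize (T₀ - z.1) ^ (2 * α - 1) = P
    generalize hτ : T₀ - z.1 = τ at *
    field_simp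
    ring
  · rw [h, h']; ring

end OnCone

section EnergyMul

namespace OnCone

variable (H : OnCone p f g T u₀ u₁ u v G T₀ a b x₀)
include H

/-- The identity for the time derivative of `∫ w wₛ ρ`. -/
theorem mul_energy_identity {β α : ℝ} (hα : 2 * α = 2 * β - (N - 1)) {ϑ κ : ℝ → ℝ}
    (hϑ : IsTest (Ioo a b) ϑ) (hκ : IsProfile κ) :
    NullInt volume fun z : ℝ × Sp N =>
      deriv ϑ z.1 * (T₀ - z.1) ^ (2 * α - 1) * κ (rvar T₀ x₀ z)
        * (u z.1 z.2 * (scal T₀ x₀ v G z - β * u z.1 z.2))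
      + ϑ z.1 * ((T₀ - z.1) ^ (2 * α - 1) / (T₀ - z.1))
        * (κ (rvar T₀ x₀ z) * ((scal T₀ x₀ v G z - β * u z.1 z.2) ^ 2
            + radial x₀ G z ^ 2 - (T₀ - z.1) ^ 2 * ‖G z.1 z.2‖ ^ 2
            + 2 * (scal T₀ x₀ v G z - β * u z.1 z.2) * radial x₀ G z
            - β * (β + 1) * u z.1 z.2 ^ 2)
          + ((N - 2 * α) * κ (rvar T₀ x₀ z)
            - 4 * (1 - rvar T₀ x₀ z) * deriv κ (rvar T₀ x₀ z))
              * u z.1 z.2 * (scal T₀ x₀ v G z - β * u z.1 z.2)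
          + 2 * u z.1 z.2 * radial x₀ G z
            * (rvar T₀ x₀ z * deriv κ (rvar T₀ x₀ z) - α * κ (rvar T₀ x₀ z))
          + (T₀ - z.1) ^ 2 * source p f g (u z.1 z.2) (v z.1 z.2) * κ (rvar T₀ x₀ z)
            * u z.1 z.2) := by
  have hb := H.lt_vertex.le
  have hsq := isPrimitive_half_sq H.one_lt.le
  have t1 := hϑ.mul_rpow hb (2 * α)
  have t2 := hϑ.mul_rpow hb (2 * α - 2)
  have t3 := hϑ.deriv.mul_rpow hb (2 * α - 1)
  have hκ1 : IsProfile fun r => (2 * (β - N / 2)) * κ r + 2 * (1 - r) * deriv κ r :=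
    (hκ.mul_smooth contDiff_const).add (hκ.deriv.mul_smooth (by fun_prop))
  have k1 := H.mul t1 hκ
  have k2 := H.chain_radial hsq t3 hκ
  have k3 := H.chain_radial hsq t2 hκ
  have k4 := H.chain_scal hsq t2 hκ1
  refine (((k1.add (k2.const_mul (-1))).add (k3.const_mul (-(2 * β)))).add
    (k4.const_mul (-1))).congr fun z => ?_
  rw [hϑ.deriv_mul_rpow hb, hϑ.deriv_mul_rpow hb]
  rcases hϑ.lt_or_zero hb z.1 with h | ⟨h, h'⟩
  · obtain ⟨e1, e2, e3⟩ := rpow_two_mul h α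
    have hN : (N : ℝ) = 2 * β - 2 * α + 1 := by linarith
    rw [e1, e2, e3, radial_eq (v := v) (T₀ := T₀), hN]
    generalize (T₀ - z.1) ^ (2 * α - 1) = P
    generalize hτ : T₀ - z.1 = τ at *
    field_simp
    ring
  · rw [h, h']; ring

/-- The identity for the time derivative of the potential energy. -/
theorem potential_identity {β α C : ℝ} (hα : 2 * α = 2 * β - (N - 1)) {Φ φ : ℝ → ℝ}
    (hΦ : IsPrimitive p C Φ φ) {ϑ κ : ℝ → ℝ} (hϑ : IsTest (Ioo a b) ϑ) (hκ : IsProfile κ) :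
    NullInt volume fun z : ℝ × Sp N =>
      deriv ϑ z.1 * (T₀ - z.1) ^ (2 * α - 1) * κ (rvar T₀ x₀ z)
        * ((T₀ - z.1) ^ 2 * Φ (u z.1 z.2))
      + ϑ z.1 * ((T₀ - z.1) ^ (2 * α - 1) / (T₀ - z.1)) * κ (rvar T₀ x₀ z)
        * ((T₀ - z.1) ^ 2 * (φ (u z.1 z.2) * scal T₀ x₀ v G z
          - (2 * β + 2) * Φ (u z.1 z.2))) := by
  have hb := H.lt_vertex.le
  refine (H.chain_scal hΦ (hϑ.mul_rpow hb (2 * α)) hκ).congr fun z => ?_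
  rw [hϑ.deriv_mul_rpow hb]
  rcases hϑ.lt_or_zero hb z.1 with h | ⟨h, h'⟩
  · have hN : (N : ℝ) = 2 * β - 2 * α + 1 := by linarith
    rw [(rpow_two_mul h α).1, hN]
    field_simp
    ring
  · rw [h, h']; ring

end OnCone

/-- The density of the energy `E`, in the variables of `u`. -/
def edens (β Γ τ A g2 R U Ψ : ℝ) : ℝ :=
  1 / 2 * A ^ 2 + 1 / 2 * τ ^ 2 * g2 - 1 / 2 * R ^ 2 + 1 / 2 * β * (β + 1) * U ^ 2 - τ ^ 2 * Ψ
    - Γ * U * A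

/-- The density of the dissipation of the energy `E`. -/
def ddens (N : ℕ) (β α p γ ν Γ τ A g2 R U V k k' r fU gV F : ℝ) : ℝ :=
  -(2 * k' * A ^ 2) + k * τ ^ 2 * (gV * A - β * (fU * U - (p + 1) * F)) + γ * Γ * k * U * A
    - Γ * (k * (A ^ 2 + R ^ 2 - τ ^ 2 * g2 + 2 * A * R - β * (β + 1) * U ^ 2)
      + ((N - 2 * α) * k - 4 * (1 - r) * k') * U * A
      + k * τ ^ 2 * ((|U| ^ (p - 1) * U + fU + gV) * U))
    + ν * Γ ^ 2 * (k * U * R + 1 / 2 * U ^ 2 * (N * k - 2 * (1 - r) * k'))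
    + 2 * (r * k' - α * k) * (τ * V * A - Γ * U * R)

/-- The full potential `|a|^{p+1}/(p+1) + F(a)`. -/
def potential (p : ℝ) (f : ℝ → ℝ) (a : ℝ) : ℝ := 1 / (p + 1) * |a| ^ (p + 1) + primitive f a

variable (H : OnCone p f g T u₀ u₁ u v G T₀ a b x₀)
include H

theorem OnCone.full_identity {β α γ ν C : ℝ} (hα : 2 * α = 2 * β - (N - 1))
    (hβ : β * (p - 1) = 2)
    (hΨ : IsPrimitive p C (potential p f) fun x => |x| ^ (p - 1) * x + f x) {ϑ κ : ℝ → ℝ}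
    (hϑ : IsTest (Ioo a b) ϑ) (hκ : IsProfile κ) :
    NullInt volume fun z : ℝ × Sp N =>
      deriv ϑ z.1 * (T₀ - z.1) ^ (2 * α - 1) * (κ (rvar T₀ x₀ z)
        * edens β ((T₀ - z.1) ^ γ) (T₀ - z.1) (scal T₀ x₀ v G z - β * u z.1 z.2)
          (‖G z.1 z.2‖ ^ 2) (radial x₀ G z) (u z.1 z.2) (potential p f (u z.1 z.2))
        + β * (rvar T₀ x₀ z * deriv κ (rvar T₀ x₀ z) - α * κ (rvar T₀ x₀ z)) * u z.1 z.2 ^ 2)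
      + ϑ z.1 * ((T₀ - z.1) ^ (2 * α - 1) / (T₀ - z.1))
        * ddens N β α p γ ν ((T₀ - z.1) ^ γ) (T₀ - z.1) (scal T₀ x₀ v G z - β * u z.1 z.2)
          (‖G z.1 z.2‖ ^ 2) (radial x₀ G z) (u z.1 z.2) (v z.1 z.2) (κ (rvar T₀ x₀ z))
          (deriv κ (rvar T₀ x₀ z)) (rvar T₀ x₀ z) (f (u z.1 z.2)) (g (v z.1 z.2))
          (primitive f (u z.1 z.2)) := by
  have hb := H.lt_vertex.le
  have t3 := hϑ.mul_rpow hb (2 * γ + (2 * α - 2))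
  have k1 := H.energy_identity hα hϑ hκ
  have k2 := H.mul_energy_identity hα (hϑ.mul_rpow hb γ) hκ
  have k3 := H.chain_radial (isPrimitive_half_sq H.one_lt.le) t3 hκ
  have k4 := H.potential_identity hα hΨ hϑ hκ
  refine (((k1.add (k2.const_mul (-1))).add (k3.const_mul ν)).add (k4.const_mul (-1))).congr
    fun z => ?_
  rw [hϑ.deriv_mul_rpow hb]
  rcases hϑ.lt_or_zero hb z.1 with h | ⟨h, h'⟩
  · have e3 : (T₀ - z.1) ^ (2 * γ + (2 * α - 2))
        = ((T₀ - z.1) ^ γ) ^ 2 * ((T₀ - z.1) ^ (2 * α - 1) / (T₀ - z.1)) := by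
      rw [Real.rpow_add h, (rpow_two_mul h α).2.1, ← Real.rpow_natCast, ← Real.rpow_mul h.le]
      push_cast; ring_nf
    have e4 : (T₀ - z.1) ^ (γ - 1) = (T₀ - z.1) ^ γ / (T₀ - z.1) := Real.rpow_sub_one h.ne' _
    have e5 : |u z.1 z.2| ^ (p + 1) = |u z.1 z.2| ^ (p - 1) * u z.1 z.2 * u z.1 z.2 := by
      rw [mul_assoc, ← sq, ← sq_abs, ← Real.rpow_natCast, ← Real.rpow_add_of_nonneg (abs_nonneg _)
        (by linarith [H.one_lt]) (by norm_num)]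
      push_cast; ring_nf
    have hp1 : p + 1 ≠ 0 := by linarith [H.one_lt]
    have hβ2 : 2 * β + 2 = β * (p + 1) := by linarith
    simp only [edens, ddens, potential, source]
    rw [e3, e4, e5, radial_eq (v := v) (T₀ := T₀), hβ2]
    generalize (T₀ - z.1) ^ (2 * α - 1) = P
    generalize (T₀ - z.1) ^ γ = Γ
    generalize |u z.1 z.2| ^ (p - 1) = W
    generalize hτ : T₀ - z.1 = τ at *
    field_simp
    ring
  · rw [h, h']; ring

end EnergyMul

theorem weighted_young {α k k' r s x y : ℝ} (hα : 0 < α) (hk : 0 ≤ k) (hr : 0 < r) (hs : 0 < s)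
    (hkk : α * k ≤ r * k') : k * (x * y) ≤ 1 / 2 * (s / α * (k' * x ^ 2) + 1 / s * (k * r * y ^ 2)) := by
  have h1 : 0 ≤ k / (r * s) * (s * x - r * y) ^ 2 := by positivity
  have h2 : k / (r * s) * (s * x - r * y) ^ 2
      = s * (k / r) * x ^ 2 - 2 * (k * (x * y)) + 1 / s * (k * r * y ^ 2) := by
    field_simp
    ring
  have h3 : k / r ≤ k' / α := by
    rw [div_le_div_iff₀ hr hα]; linarith
  have h4 : s * (k / r) * x ^ 2 ≤ s * (k' / α) * x ^ 2 := by gcongr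
  have h5 : s / α * (k' * x ^ 2) = s * (k' / α) * x ^ 2 := by field_simp
  rw [h5]
  linarith

theorem exists_small (c d : Fin 4 → ℝ) (hc : ∀ i, 0 ≤ c i) (hd : ∀ i, 0 < d i) :
    ∃ Γ₀ : ℝ, 0 < Γ₀ ∧ Γ₀ ≤ 1 ∧ ∀ Γ, 0 ≤ Γ → Γ ≤ Γ₀ → ∀ i, c i * Γ ≤ d i := by
  have h : ∀ i, ∀ᶠ Γ in 𝓝[>] (0 : ℝ), c i * Γ ≤ d i := fun i => by
    have : Tendsto (fun Γ => c i * Γ) (𝓝[>] (0 : ℝ)) (𝓝 (c i * 0)) :=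
      tendsto_nhdsWithin_of_tendsto_nhds (Continuous.tendsto (by fun_prop) 0)
    rw [mul_zero] at this
    exact (this.eventually_lt_const (hd i)).mono fun _ h => h.le
  have h2 : ∀ᶠ Γ in 𝓝[>] (0 : ℝ), Γ ≤ 1 :=
    eventually_nhdsWithin_of_eventually_nhds ((eventually_lt_nhds one_pos).mono fun _ h => h.le)
  obtain ⟨Γ₀, h3, h4, h5⟩ := ((eventually_all.2 h).and (h2.and eventually_mem_nhdsWithin)).exists
  exact ⟨Γ₀, h5, h4, fun Γ _ h6 i => (mul_le_mul_of_nonneg_left h6 (hc i)).trans (h3 i)⟩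

/-- Absorption of the indefinite terms of the dissipation. -/
theorem exists_absorption {α σ σ' b c₁ C₁ n : ℝ} (hα : 0 < α) (hσ : 0 < σ) (hσ' : 0 < σ')
    (hb : 0 < b) (hc₁ : 0 < c₁) (hC₁ : 0 ≤ C₁) (hn : 0 ≤ n) :
    ∃ Γ₀ : ℝ, 0 < Γ₀ ∧ Γ₀ ≤ 1 ∧ ∀ Γ A R U B k k' r W ϖ : ℝ, 0 ≤ Γ → Γ ≤ Γ₀ → 0 ≤ k → 0 ≤ k' → 0 < r →
      r ≤ 1 → α * k ≤ r * k' → 0 ≤ B → R ^ 2 ≤ (1 - r) * B → 0 ≤ W →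
      -(2 * (k' * A ^ 2)) - σ * Γ * (k * r * B) - b * Γ * (k * U ^ 2) - σ' * Γ * (k * W)
        - 32 * Γ ^ 2 * ((1 - r) * k' * U ^ 2)
        + 2 * Γ * (k * (|A| * |R|)) + c₁ * Γ * (k * (|U| * |A|))
        + 4 * Γ * ((1 - r) * k' * (|U| * |A|))
        + (32 + C₁) * Γ ^ 2 * (k * (|U| * |R|))
        + C₁ * Γ ^ 2 * (k * A ^ 2 + k * (|A| * |R|) + k * U ^ 2 + k * (|U| * |A|) + k * W + k * ϖ)
        + 16 * n * Γ ^ 2 * (k * U ^ 2) ≤ -(k' * A ^ 2) + C₁ * Γ ^ 2 * (k * ϖ) := by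
  obtain ⟨Γ₀, h0, h1, h⟩ := exists_small
    ![4 / (σ * α) + 2 * C₁ / α, (32 + C₁) ^ 2 / (64 * α) + C₁,
      2 * c₁ ^ 2 / α + 2 * C₁ + 16 * n, C₁]
    ![1 / 2, σ / 2, b, σ'] (by intro i; fin_cases i <;> simp <;> positivity)
    (by intro i; fin_cases i <;> simp <;> positivity)
  refine ⟨Γ₀, h0, h1, fun Γ A R U B k k' r W ϖ hΓ hΓ0 hk hk' hr hr1 hkk hB0 hR hW => ?_⟩
  have s1 := h Γ hΓ hΓ0 0
  have s2 := h Γ hΓ hΓ0 1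
  have s3 := h Γ hΓ hΓ0 2
  have s4 := h Γ hΓ hΓ0 3
  simp only [Fin.isValue, Matrix.cons_val_zero, Matrix.cons_val_one, Matrix.cons_val] at s1 s2 s3 s4
  have hΓ1 : Γ ≤ 1 := hΓ0.trans h1
  have hΓ2 : Γ ^ 2 ≤ Γ := by rw [sq]; exact mul_le_of_le_one_left hΓ hΓ1
  have c1 : (0:ℝ) < 32 + C₁ := by linarith
  -- the elementary quadratic quantities
  set X := k' * A ^ 2 with hX
  set Y := k * r * B with hY
  set Z := k * U ^ 2 with hZ
  set Q := (1 - r) * k' * U ^ 2 with hQ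
  have hX0 : 0 ≤ X := by positivity
  have hZ0 : 0 ≤ Z := by positivity
  have hQ0 : 0 ≤ Q := by have : 0 ≤ 1 - r := by linarith
                         positivity
  have b0 : k * A ^ 2 ≤ 1 / α * X := by
    have : α * k ≤ k' := hkk.trans (mul_le_of_le_one_left hk' hr1)
    have h2 : α * k * A ^ 2 ≤ k' * A ^ 2 := by gcongr
    rw [hX, div_mul_eq_mul_div, le_div_iff₀ hα]; linarith
  have b2 : ∀ s, 0 < s → k * (|A| * |R|) ≤ 1 / 2 * (s / α * X + 1 / s * (k * r * R ^ 2)) :=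
    fun s hs => by
      have := weighted_young (x := |A|) (y := |R|) hα hk hr hs hkk
      rwa [sq_abs, sq_abs] at this
  have b3 : ∀ t, 0 < t → Γ * (k * (|U| * |A|)) ≤ 1 / 2 * (t / α * X + Γ ^ 2 / t * Z) :=
    fun t ht => by
      have h2 : 0 ≤ k / t * (t * |A| - Γ * |U|) ^ 2 := by positivity
      have h3 : k / t * (t * |A| - Γ * |U|) ^ 2
          = t * (k * A ^ 2) - 2 * (Γ * (k * (|U| * |A|))) + Γ ^ 2 / t * (k * U ^ 2) := by
        rw [← sq_abs A, ← sq_abs U]; field_simp; ring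
      have h4 : t * (k * A ^ 2) ≤ t * (1 / α * X) := by gcongr
      have h5 : t / α * X = t * (1 / α * X) := by ring
      rw [h5]; linarith
  have b4 : Γ * ((1 - r) * k' * (|U| * |A|)) ≤ 1 / 2 * (1 / 8 * X + 8 * Γ ^ 2 * Q) := by
    have h2 : 0 ≤ (1 - r) * k' * (|A| / 8 - Γ * |U|) ^ 2 := by
      have : 0 ≤ 1 - r := by linarith
      positivity
    have h3 : (1 - r) * k' * A ^ 2 ≤ 1 * k' * A ^ 2 := by gcongr; linarith
    have h4 : (1 - r) * k' * (|A| / 8 - Γ * |U|) ^ 2 = 1 / 64 * ((1 - r) * k' * A ^ 2)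
        - 1 / 4 * (Γ * ((1 - r) * k' * (|U| * |A|))) + Γ ^ 2 * Q := by
      rw [hQ, ← sq_abs A, ← sq_abs U]; ring
    rw [one_mul] at h3
    linarith
  have b5 : k * (|U| * |R|) ≤ 1 / 2 * ((32 / (32 + C₁)) * Q + (32 + C₁) / (32 * α) * Y) := by
    have h2 := weighted_young (x := |U| * Real.sqrt (1 - r)) (y := Real.sqrt B)
      (s := 32 * α / (32 + C₁)) hα hk hr (by positivity) hkk
    rw [mul_pow, sq_abs, Real.sq_sqrt (by linarith), Real.sq_sqrt hB0] at h2
    have h3 : |R| ≤ Real.sqrt (1 - r) * Real.sqrt B := by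
      rw [← Real.sqrt_mul (by linarith)]
      exact Real.abs_le_sqrt hR
    have h4 : k * (|U| * |R|) ≤ k * (|U| * Real.sqrt (1 - r) * Real.sqrt B) := by
      rw [mul_assoc |U|]; gcongr
    refine h4.trans (h2.trans (le_of_eq ?_))
    rw [hQ, hY]
    field_simp
  have hRB : k * r * R ^ 2 ≤ Y := by
    rw [hY]
    gcongr
    exact hR.trans (mul_le_of_le_one_left hB0 (by linarith))
  have hkW : 0 ≤ k * W := mul_nonneg hk hW
  have d1 : 2 * Γ * (k * (|A| * |R|)) ≤ 4 / (σ * α) * Γ * X + σ / 4 * Γ * Y := by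
    have h2 := b2 (4 / σ) (by positivity)
    have h3 : k * (|A| * |R|) ≤ 1 / 2 * (4 / σ / α * X + 1 / (4 / σ) * Y) := h2.trans (by gcongr)
    have h4 := mul_le_mul_of_nonneg_left h3 (by positivity : 0 ≤ 2 * Γ)
    refine h4.trans (le_of_eq ?_)
    field_simp
  have d2 : C₁ * Γ ^ 2 * (k * (|A| * |R|)) ≤ C₁ / (2 * α) * Γ * X + C₁ / 2 * Γ ^ 2 * Y := by
    have h2 : k * (|A| * |R|) ≤ 1 / 2 * (1 / α * X + Y) := by
      refine (b2 1 one_pos).trans ?_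
      rw [div_one, one_mul]
      gcongr
    have h3 : C₁ * Γ ^ 2 * (k * (|A| * |R|)) ≤ C₁ * Γ ^ 2 * (1 / 2 * (1 / α * X + Y)) := by gcongr
    have h4 : C₁ / (2 * α) * Γ ^ 2 * X ≤ C₁ / (2 * α) * Γ * X := by
      gcongr
    have h5 : C₁ * Γ ^ 2 * (1 / 2 * (1 / α * X + Y))
        = C₁ / (2 * α) * Γ ^ 2 * X + C₁ / 2 * Γ ^ 2 * Y := by field_simp
    linarith
  have d3 : c₁ * Γ * (k * (|U| * |A|)) ≤ 1 / 8 * X + 2 * c₁ ^ 2 / α * Γ ^ 2 * Z := by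
    have h2 := mul_le_mul_of_nonneg_left (b3 (α / (4 * c₁)) (by positivity)) hc₁.le
    rw [← mul_assoc] at h2
    refine h2.trans (le_of_eq ?_)
    field_simp
    ring
  have d4 : C₁ * Γ ^ 2 * (k * (|U| * |A|)) ≤ C₁ / (2 * α) * Γ * X + C₁ / 2 * Γ ^ 2 * Z := by
    have h2 := mul_le_mul_of_nonneg_left (b3 1 one_pos) (by positivity : 0 ≤ C₁ * Γ)
    have h3 : C₁ / 2 * (Γ * Γ ^ 2) * Z ≤ C₁ / 2 * (1 * Γ ^ 2) * Z := by gcongr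
    have h4 : C₁ * Γ * (1 / 2 * (1 / α * X + Γ ^ 2 / 1 * Z))
        = C₁ / (2 * α) * Γ * X + C₁ / 2 * (Γ * Γ ^ 2) * Z := by field_simp
    linarith
  have d5 : C₁ * Γ ^ 2 * (k * A ^ 2) ≤ C₁ / α * Γ * X := by
    have h2 : C₁ * Γ ^ 2 * (k * A ^ 2) ≤ C₁ * Γ ^ 2 * (1 / α * X) := by gcongr
    have h4 : C₁ / α * Γ ^ 2 * X ≤ C₁ / α * Γ * X := by
      gcongr
    have h5 : C₁ * Γ ^ 2 * (1 / α * X) = C₁ / α * Γ ^ 2 * X := by field_simp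
    linarith
  have d6 : (32 + C₁) * Γ ^ 2 * (k * (|U| * |R|))
      ≤ 16 * Γ ^ 2 * Q + (32 + C₁) ^ 2 / (64 * α) * Γ ^ 2 * Y := by
    have h2 := mul_le_mul_of_nonneg_left b5 (by positivity : 0 ≤ (32 + C₁) * Γ ^ 2)
    refine h2.trans (le_of_eq ?_)
    field_simp
    ring
  have hY0 : 0 ≤ Y := by positivity
  have f1 := mul_le_mul_of_nonneg_right s1 hX0
  have f2 := mul_le_mul_of_nonneg_right s2 (mul_nonneg hΓ hY0)
  have f3 := mul_le_mul_of_nonneg_right s3 (mul_nonneg hΓ hZ0)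
  have f4 := mul_le_mul_of_nonneg_right s4 (mul_nonneg hΓ hkW)
  have f5 : 0 ≤ C₁ / 2 * (Γ ^ 2 * Y) := by positivity
  have f6 : 0 ≤ C₁ / 2 * (Γ ^ 2 * Z) := by positivity
  have f7 : 0 ≤ σ / 4 * (Γ * Y) := by positivity
  have e1 : C₁ / α = 2 * (C₁ / (2 * α)) := by field_simp
  have e2 : 2 * C₁ / α = 4 * (C₁ / (2 * α)) := by ring
  rw [e2] at f1
  rw [e1] at d5
  generalize C₁ / (2 * α) = y1 at *
  generalize 4 / (σ * α) = y2 at *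
  generalize 2 * c₁ ^ 2 / α = y3 at *
  generalize (32 + C₁) ^ 2 / (64 * α) = y4 at *
  linarith

set_option maxHeartbeats 1600000 in
/-- The pointwise inequality behind the decay of the energy. -/
theorem exists_ddens_le {N : ℕ} {β α p γ M D : ℝ} (hα : 0 < α) (hβ : 0 < β) (hp : 1 < p)
    (hM : 0 ≤ M) (hD : 0 ≤ D) :
    ∃ Γ₀ C : ℝ, 0 < Γ₀ ∧ Γ₀ ≤ 1 ∧ 0 ≤ C ∧ ∀ Γ τ A g2 R U V k k' r fU gV F ϖ : ℝ,
      0 ≤ Γ → Γ ≤ Γ₀ → 0 < τ → τ ≤ Γ ^ 2 → 0 ≤ k → 0 ≤ k' → 0 < r → r ≤ 1 → α * k ≤ r * k' →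
      0 ≤ g2 → R ^ 2 ≤ (1 - r) * (τ ^ 2 * g2) → τ * V = A + R + β * U → |gV| ≤ M * (1 + |V|) →
      1 ≤ ϖ → τ ^ 2 * |fU * U| ≤ D * Γ ^ 2 * (ϖ + τ ^ 2 * |U| ^ (p + 1)) →
      τ ^ 2 * |F| ≤ D * Γ ^ 2 * (ϖ + τ ^ 2 * |U| ^ (p + 1)) →
      ddens N β α p γ 32 Γ τ A g2 R U V k k' r fU gV F
        - (p + 3) / 2 * Γ * (k * edens β Γ τ A g2 R U (1 / (p + 1) * |U| ^ (p + 1) + F))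
      ≤ -(k' * A ^ 2) + C * Γ ^ 2 * (k * ϖ) + 2 * (r * k' - α * k) * (τ * V * A - Γ * U * R) := by
  set C₁ := M * (2 + β) + D * (β * (p + 2) + 1 + (p + 3) / 2) + (p + 3) / 2 with hC₁
  have hC₁0 : 0 ≤ C₁ := by positivity
  obtain ⟨Γ₀, h0, h1, h⟩ := exists_absorption (α := α) (σ := (p - 1) / 4)
    (σ' := (p - 1) / (2 * (p + 1))) (b := (p - 1) / 4 * (β * (β + 1))) (c₁ := |γ - N + 2 * α| + 1)
    (C₁ := C₁) (n := N) hα (by linarith) (div_pos (by linarith) (by linarith))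
    (mul_pos (by linarith) (by positivity)) (by positivity) hC₁0 (by positivity)
  refine ⟨Γ₀, C₁, h0, h1, hC₁0, fun Γ τ A g2 R U V k k' r fU gV F ϖ hΓ hΓ0 hτ hτΓ hk hk' hr hr1
    hkk hg2 hR hV hg hϖ hf hF => ?_⟩
  have hW0 : 0 ≤ τ ^ 2 * |U| ^ (p + 1) := by positivity
  have key := h Γ A R U (τ ^ 2 * g2) k k' r (τ ^ 2 * |U| ^ (p + 1)) ϖ hΓ hΓ0 hk hk' hr hr1 hkk
    (by positivity) hR hW0
  have hΓ1 : Γ ≤ 1 := hΓ0.trans h1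
  have e5 : |U| ^ (p - 1) * U * U = |U| ^ (p + 1) := by
    rw [mul_assoc, ← sq, ← sq_abs, ← Real.rpow_natCast, ← Real.rpow_add_of_nonneg (abs_nonneg _)
      (by linarith) (by norm_num)]
    push_cast; ring_nf
  have hτ1 : τ ≤ 1 := hτΓ.trans (pow_le_one₀ hΓ hΓ1)
  have hgV : τ ^ 2 * |gV| ≤ M * Γ ^ 2 * (1 + |A| + |R| + β * |U|) := by
    have h2 : τ * |V| ≤ |A| + |R| + β * |U| := by
      have : τ * |V| = |τ * V| := by rw [abs_mul, abs_of_pos hτ]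
      rw [this, hV]
      refine (abs_add_le _ _).trans ?_
      rw [abs_mul β, abs_of_pos hβ]
      linarith [abs_add_le A R]
    have h3 : τ * (τ * (1 + |V|)) ≤ Γ ^ 2 * (1 + |A| + |R| + β * |U|) := by
      gcongr
      linarith
    calc τ ^ 2 * |gV| ≤ τ ^ 2 * (M * (1 + |V|)) := by gcongr
      _ = M * (τ * (τ * (1 + |V|))) := by ring
      _ ≤ M * (Γ ^ 2 * (1 + |A| + |R| + β * |U|)) := by gcongr
      _ = _ := by ring
  set W := τ ^ 2 * |U| ^ (p + 1) with hW
  have hkB : k * r * (τ ^ 2 * g2) ≤ k * (τ ^ 2 * g2 - R ^ 2) := by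
    rw [mul_assoc]
    gcongr
    linarith
  have hxx : ∀ x : ℝ, |x| ≤ x ^ 2 + ϖ := fun x => by
    have h2 : 0 ≤ (|x| - 1) ^ 2 := sq_nonneg _
    have h3 : (|x| - 1) ^ 2 = x ^ 2 - 2 * |x| + 1 := by rw [← sq_abs x]; ring
    linarith [abs_nonneg x, sq_nonneg x]
  have p1 : k * (τ ^ 2 * (gV * A)) ≤ M * Γ ^ 2 *
      (2 * (k * A ^ 2) + k * ϖ + k * (|A| * |R|) + β * (k * (|U| * |A|))) := by
    calc k * (τ ^ 2 * (gV * A)) ≤ k * (τ ^ 2 * (|gV| * |A|)) := by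
          have : gV * A ≤ |gV| * |A| := by rw [← abs_mul]; exact le_abs_self _
          gcongr k * (τ ^ 2 * ?_)
      _ = k * |A| * (τ ^ 2 * |gV|) := by ring
      _ ≤ k * |A| * (M * Γ ^ 2 * (1 + |A| + |R| + β * |U|)) := by gcongr
      _ = M * Γ ^ 2 * (k * |A| + k * |A| ^ 2 + k * (|A| * |R|) + β * (k * (|U| * |A|))) := by ring
      _ ≤ M * Γ ^ 2 * (k * (A ^ 2 + ϖ) + k * A ^ 2 + k * (|A| * |R|) + β * (k * (|U| * |A|))) := by
          rw [sq_abs]; gcongr; exact hxx A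
      _ = _ := by ring
  have p2 : -(Γ * (k * (τ ^ 2 * (gV * U)))) ≤ M * Γ ^ 2 *
      ((1 + β) * (k * U ^ 2) + k * ϖ + k * (|U| * |A|) + k * (|U| * |R|)) := by
    calc -(Γ * (k * (τ ^ 2 * (gV * U)))) = Γ * (k * (τ ^ 2 * -(gV * U))) := by ring
      _ ≤ Γ * (k * (τ ^ 2 * (|gV| * |U|))) := by
          have : -(gV * U) ≤ |gV| * |U| := by rw [← abs_mul]; exact neg_le_abs _
          gcongr Γ * (k * (τ ^ 2 * ?_))
      _ ≤ 1 * (k * (τ ^ 2 * (|gV| * |U|))) := by gcongr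
      _ = k * |U| * (τ ^ 2 * |gV|) := by ring
      _ ≤ k * |U| * (M * Γ ^ 2 * (1 + |A| + |R| + β * |U|)) := by gcongr
      _ = M * Γ ^ 2 * (k * |U| + k * (|U| * |A|) + k * (|U| * |R|) + β * (k * |U| ^ 2)) := by ring
      _ ≤ M * Γ ^ 2 * (k * (U ^ 2 + ϖ) + k * (|U| * |A|) + k * (|U| * |R|)
          + β * (k * U ^ 2)) := by
          rw [sq_abs]; gcongr; exact hxx U
      _ = _ := by ring
  have hDW : 0 ≤ k * (D * Γ ^ 2 * (ϖ + W)) := by positivity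
  have n1 : k * (τ ^ 2 * -(fU * U)) ≤ k * (D * Γ ^ 2 * (ϖ + W)) :=
    mul_le_mul_of_nonneg_left (le_trans (by gcongr; exact neg_le_abs _) hf) hk
  have p5 : k * (τ ^ 2 * F) ≤ k * (D * Γ ^ 2 * (ϖ + W)) :=
    mul_le_mul_of_nonneg_left (le_trans (by gcongr; exact le_abs_self _) hF) hk
  have p3 : -(k * (τ ^ 2 * (β * (fU * U)))) ≤ β * (k * (D * Γ ^ 2 * (ϖ + W))) := by
    linarith [mul_le_mul_of_nonneg_left n1 hβ.le]
  have p4 : -(Γ * (k * (τ ^ 2 * (fU * U)))) ≤ k * (D * Γ ^ 2 * (ϖ + W)) := by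
    linarith [mul_le_mul_of_nonneg_left n1 hΓ, mul_le_of_le_one_left hDW hΓ1]
  have p6 : Γ * (k * (τ ^ 2 * F)) ≤ k * (D * Γ ^ 2 * (ϖ + W)) :=
    (mul_le_mul_of_nonneg_left p5 hΓ).trans (mul_le_of_le_one_left hDW hΓ1)
  have q1 : -(Γ * (k * (A * R))) ≤ Γ * (k * (|A| * |R|)) := by
    rw [← abs_mul, ← mul_neg, ← mul_neg]; gcongr; exact neg_le_abs _
  have q2 : (γ - N + 2 * α) * (Γ * (k * (U * A))) ≤ |γ - N + 2 * α| * (Γ * (k * (|U| * |A|))) := by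
    have : |(γ - N + 2 * α) * (Γ * (k * (U * A)))| = |γ - N + 2 * α| * (Γ * (k * (|U| * |A|))) := by
      rw [abs_mul, abs_mul, abs_mul, abs_mul, abs_of_nonneg hΓ, abs_of_nonneg hk]
    rw [← this]; exact le_abs_self _
  have q2' : 0 ≤ Γ * (k * (|U| * |A|)) := by positivity
  have q3 : U * A ≤ |U| * |A| := by rw [← abs_mul]; exact le_abs_self _
  have q4 : U * R ≤ |U| * |R| := by rw [← abs_mul]; exact le_abs_self _
  have q5 : Γ ^ 2 * (k * (U * A)) ≤ Γ ^ 2 * (k * (|U| * |A|)) := by gcongr Γ ^ 2 * (k * ?_)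
  have q6 : Γ ^ 2 * (k * (U * R)) ≤ Γ ^ 2 * (k * (|U| * |R|)) := by gcongr Γ ^ 2 * (k * ?_)
  have hr0 : 0 ≤ 1 - r := by linarith
  have q7 : Γ * ((1 - r) * k' * (U * A)) ≤ Γ * ((1 - r) * k' * (|U| * |A|)) := by
    gcongr Γ * ((1 - r) * k' * ?_)
  have z1 : 0 ≤ Γ ^ 2 * (k * A ^ 2) := by positivity
  have z2 : 0 ≤ Γ ^ 2 * (k * (|A| * |R|)) := by positivity
  have z3 : 0 ≤ Γ ^ 2 * (k * U ^ 2) := by positivity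
  have z4 : 0 ≤ Γ ^ 2 * (k * (|U| * |A|)) := by positivity
  have z5 : 0 ≤ Γ ^ 2 * (k * W) := by positivity
  have z6 : 0 ≤ Γ ^ 2 * (k * ϖ) := by positivity
  have z7 : 0 ≤ Γ ^ 2 * (k * (|U| * |R|)) := by positivity
  have z8 : 0 ≤ Γ * (k * A ^ 2) := by positivity
  have hk5 := mul_le_mul_of_nonneg_left hkB (by have : 0 ≤ (p - 1) / 4 := by linarith
                                                positivity : 0 ≤ (p - 1) / 4 * Γ)
  have ident : ddens N β α p γ 32 Γ τ A g2 R U V k k' r fU gV F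
        - (p + 3) / 2 * Γ * (k * edens β Γ τ A g2 R U (1 / (p + 1) * |U| ^ (p + 1) + F))
      = -(2 * (k' * A ^ 2)) - (p - 1) / 4 * Γ * (k * (τ ^ 2 * g2 - R ^ 2))
        - (p - 1) / 4 * (β * (β + 1)) * Γ * (k * U ^ 2)
        - (p - 1) / (2 * (p + 1)) * Γ * (k * W) - 32 * Γ ^ 2 * ((1 - r) * k' * U ^ 2)
        + 2 * -(Γ * (k * (A * R))) + (γ - N + 2 * α) * (Γ * (k * (U * A)))
        + 4 * (Γ * ((1 - r) * k' * (U * A))) + 32 * (Γ ^ 2 * (k * (U * R)))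
        + 16 * N * Γ ^ 2 * (k * U ^ 2) + (p + 3) / 2 * (Γ ^ 2 * (k * (U * A)))
        - (1 + (p + 3) / 4) * (Γ * (k * A ^ 2))
        + k * (τ ^ 2 * (gV * A)) + -(Γ * (k * (τ ^ 2 * (gV * U))))
        + -(k * (τ ^ 2 * (β * (fU * U)))) + -(Γ * (k * (τ ^ 2 * (fU * U))))
        + β * (p + 1) * (k * (τ ^ 2 * F)) + (p + 3) / 2 * (Γ * (k * (τ ^ 2 * F)))
        + 2 * (r * k' - α * k) * (τ * V * A - Γ * U * R) := by
    have hp1 : p + 1 ≠ 0 := by linarith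
    have e6 : (|U| ^ (p - 1) * U + fU + gV) * U = |U| ^ (p + 1) + fU * U + gV * U := by
      rw [← e5]; ring
    simp only [ddens, edens]
    rw [e6, hW]
    field_simp
    ring
  rw [ident]
  have p5' := mul_le_mul_of_nonneg_left p5 (by positivity : 0 ≤ β * (p + 1))
  have p6' := mul_le_mul_of_nonneg_left p6 (by linarith : 0 ≤ (p + 3) / 2)
  have q5' := mul_le_mul_of_nonneg_left q5 (by linarith : 0 ≤ (p + 3) / 2)
  have hz8 : 0 ≤ (1 + (p + 3) / 4) * (Γ * (k * A ^ 2)) := by positivity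
  have key2 : M * Γ ^ 2 * (2 * (k * A ^ 2) + k * ϖ + k * (|A| * |R|) + β * (k * (|U| * |A|)))
      + M * Γ ^ 2 * ((1 + β) * (k * U ^ 2) + k * ϖ + k * (|U| * |A|) + k * (|U| * |R|))
      + (β * (p + 2) + 1 + (p + 3) / 2) * (k * (D * Γ ^ 2 * (ϖ + W)))
      + (p + 3) / 2 * (Γ ^ 2 * (k * (|U| * |A|)))
      ≤ C₁ * Γ ^ 2 * (k * (|U| * |R|))
        + C₁ * Γ ^ 2 * (k * A ^ 2 + k * (|A| * |R|) + k * U ^ 2 + k * (|U| * |A|) + k * W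
          + k * ϖ) := by
    have hMβ := mul_nonneg hM hβ.le
    have hDD : 0 ≤ D * (β * (p + 2) + 1 + (p + 3) / 2) := by positivity
    have hM2 : M * (2 + β) = 2 * M + M * β := by ring
    have hM3 : M * (1 + β) = M + M * β := by ring
    have m1 : 0 ≤ C₁ - 2 * M := by linarith
    have m2 : 0 ≤ C₁ - M * (1 + β) - (p + 3) / 2 := by linarith
    have m3 : 0 ≤ C₁ - D * (β * (p + 2) + 1 + (p + 3) / 2) - 2 * M := by linarith
    have w1 := mul_nonneg m1 z1
    have w2 := mul_nonneg (by linarith : 0 ≤ C₁ - M) z2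
    have w3 := mul_nonneg (by linarith : 0 ≤ C₁ - M * (1 + β)) z3
    have w4 := mul_nonneg m2 z4
    have w5 := mul_nonneg (by linarith : 0 ≤ C₁ - D * (β * (p + 2) + 1 + (p + 3) / 2)) z5
    have w6 := mul_nonneg m3 z6
    have w7 := mul_nonneg (by linarith : 0 ≤ C₁ - M) z7
    linarith
  linarith

section Subcritical

variable {τ U p q e β γ M : ℝ} {f : ℝ → ℝ}

theorem rpow_subcritical (hτ : 0 < τ) (hτ1 : τ ≤ 1) (hβ : β * (p - 1) = 2) (he : 0 ≤ e)
    (hep : e ≤ p) (hγ : 2 * γ ≤ β * (p - e)) :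
    τ ^ 2 * |U| ^ (e + 1) ≤ (τ ^ γ) ^ 2 * (τ ^ (-(2 * β)) + τ ^ 2 * |U| ^ (p + 1)) := by
  set w := τ ^ β * |U| with hw
  have hw0 : 0 ≤ w := by positivity
  have hU : |U| = τ ^ (-β) * w := by
    rw [hw, ← mul_assoc, ← Real.rpow_add hτ]; simp
  have h2 : ∀ k : ℝ, τ ^ 2 * |U| ^ (k + 1) = τ ^ (-(2 * β)) * τ ^ (β * (p - k)) * w ^ (k + 1) := by
    intro k
    rw [hU, Real.mul_rpow (by positivity) hw0, ← Real.rpow_mul hτ.le, ← Real.rpow_add hτ,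
      ← mul_assoc, ← Real.rpow_natCast, ← Real.rpow_add hτ]
    congr 2
    push_cast
    linarith
  have h3 : w ^ (e + 1) ≤ 1 + w ^ (p + 1) := by
    rcases le_total w 1 with h | h
    · have := Real.rpow_le_one hw0 h (by linarith : 0 ≤ e + 1)
      have h4 : 0 ≤ w ^ (p + 1) := by positivity
      linarith
    · have := Real.rpow_le_rpow_of_exponent_le h (by linarith : e + 1 ≤ p + 1)
      linarith
  have h4 : τ ^ (β * (p - e)) ≤ (τ ^ γ) ^ 2 := by
    rw [← Real.rpow_natCast, ← Real.rpow_mul hτ.le]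
    refine Real.rpow_le_rpow_of_exponent_ge hτ hτ1 ?_
    push_cast
    linarith
  have h5 := h2 p
  rw [sub_self, mul_zero, Real.rpow_zero, mul_one] at h5
  rw [h2 e, h5]
  calc τ ^ (-(2 * β)) * τ ^ (β * (p - e)) * w ^ (e + 1)
      ≤ τ ^ (-(2 * β)) * (τ ^ γ) ^ 2 * (1 + w ^ (p + 1)) := by gcongr
    _ = _ := by ring

theorem isPrimitive_primitive (hf : Continuous f) (hM : 0 ≤ M)
    (hb : ∀ a, |f a| ≤ M * (1 + |a| ^ q)) : IsPrimitive q M (primitive f) f where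
  deriv a := intervalIntegral.integral_hasDerivAt_right (hf.intervalIntegrable _ _)
    (hf.stronglyMeasurableAtFilter _ _) hf.continuousAt
  cont := hf
  zero := by simp [primitive]
  nonneg := hM
  bound := hb

theorem one_add_rpow_le (hq : 0 ≤ q) (hqp : q ≤ p) (a : ℝ) (ha : 0 ≤ a) :
    1 + a ^ q ≤ 2 * (1 + a ^ p) := by
  have h0 : 0 ≤ a ^ p := by positivity
  rcases le_total a 1 with h | h
  · linarith [Real.rpow_le_one ha h hq]
  · linarith [Real.rpow_le_rpow_of_exponent_le h hqp]

theorem hasDerivAt_abs_rpow (hp : 1 < p) (a : ℝ) :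
    HasDerivAt (fun x => 1 / (p + 1) * |x| ^ (p + 1)) (|a| ^ (p - 1) * a) a := by
  have h := (_root_.hasDerivAt_abs_rpow a (by linarith : 1 < p + 1)).const_mul (1 / (p + 1))
  refine h.congr_deriv ?_
  have : p + 1 ≠ 0 := by linarith
  rw [show p + 1 - 2 = p - 1 by ring]
  field_simp

theorem abs_rpow_sub_one_mul (hp : 1 < p) (a : ℝ) : |(|a| ^ (p - 1) * a)| = |a| ^ p := by
  rw [abs_mul, abs_of_nonneg (by positivity), abs_pow_sub_one_mul hp]

theorem isPrimitive_rpow (hp : 1 < p) :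
    IsPrimitive p 1 (fun x => 1 / (p + 1) * |x| ^ (p + 1)) fun x => |x| ^ (p - 1) * x where
  deriv := hasDerivAt_abs_rpow hp
  cont := (continuous_abs.rpow_const fun _ => Or.inr (by linarith)).mul continuous_id
  zero := by simp [Real.zero_rpow (by linarith : p + 1 ≠ 0)]
  nonneg := zero_le_one
  bound a := by rw [abs_rpow_sub_one_mul hp]; linarith

theorem isPrimitive_potential (hp : 1 < p) (hq : 0 ≤ q) (hqp : q < p) (hf : Continuous f)
    (hM : 0 ≤ M) (hb : ∀ a, |f a| ≤ M * (1 + |a| ^ q)) :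
    IsPrimitive p (1 + 2 * M) (potential p f) fun x => |x| ^ (p - 1) * x + f x where
  deriv a := (hasDerivAt_abs_rpow hp a).add ((isPrimitive_primitive hf hM hb).deriv a)
  cont := (isPrimitive_rpow hp).cont.add hf
  zero := by simp [potential, primitive, Real.zero_rpow (by linarith : p + 1 ≠ 0)]
  nonneg := by positivity
  bound a := by
    have h1 := (isPrimitive_rpow hp).bound a
    have h2 := mul_le_mul_of_nonneg_left (one_add_rpow_le hq hqp.le |a| (abs_nonneg a)) hM
    refine (abs_add_le _ _).trans ?_
    linarith [hb a]

theorem perturbation_le (hτ : 0 < τ) (hτ1 : τ ≤ 1) (hβ : β * (p - 1) = 2) (hβ0 : 0 < β)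
    (hq : 0 ≤ q) (hqp : q < p) (hγ : 2 * γ ≤ β * (p - q)) (hM : 0 ≤ M) (X : ℝ)
    (hX : |X| ≤ M * ((1 + |U| ^ q) * |U|)) :
    τ ^ 2 * |X| ≤ 2 * M * (τ ^ γ) ^ 2 * (τ ^ (-(2 * β)) + τ ^ 2 * |U| ^ (p + 1)) := by
  have h1 := rpow_subcritical (U := U) hτ hτ1 hβ le_rfl (hq.trans hqp.le)
    (by nlinarith : 2 * γ ≤ β * (p - 0))
  have h2 := rpow_subcritical (U := U) hτ hτ1 hβ hq hqp.le hγ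
  have h3 : |U| ^ (q + 1) = |U| ^ q * |U| := by
    rw [Real.rpow_add_of_nonneg (abs_nonneg _) hq zero_le_one, Real.rpow_one]
  rw [zero_add, Real.rpow_one] at h1
  rw [h3] at h2
  calc τ ^ 2 * |X| ≤ τ ^ 2 * (M * ((1 + |U| ^ q) * |U|)) := by gcongr
    _ = M * (τ ^ 2 * |U| + τ ^ 2 * (|U| ^ q * |U|)) := by ring
    _ ≤ M * ((τ ^ γ) ^ 2 * (τ ^ (-(2 * β)) + τ ^ 2 * |U| ^ (p + 1))
        + (τ ^ γ) ^ 2 * (τ ^ (-(2 * β)) + τ ^ 2 * |U| ^ (p + 1))) := by gcongr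
    _ = _ := by ring

/-- The pointwise decay inequality for admissible nonlinearities. -/
theorem exists_ddens_le' {N : ℕ} {α : ℝ} (hα : 0 < α) (hp : 1 < p) (hβ : β * (p - 1) = 2)
    (hq : 0 ≤ q) (hqp : q < p) (hM : 0 ≤ M) (hγ0 : 0 < γ) (hγ1 : γ ≤ 1 / 2)
    (hγ : 2 * γ ≤ β * (p - q)) :
    ∃ τ₀ C : ℝ, 0 < τ₀ ∧ τ₀ ≤ 1 ∧ 0 ≤ C ∧ ∀ f g : ℝ → ℝ, Continuous f →
      (∀ a, |f a| ≤ M * (1 + |a| ^ q)) → (∀ a, |g a| ≤ M * (1 + |a|)) →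
      ∀ τ A g2 R U V k k' r : ℝ, 0 < τ → τ ≤ τ₀ → 0 ≤ k → 0 ≤ k' → 0 < r → r ≤ 1 →
      α * k ≤ r * k' → 0 ≤ g2 → R ^ 2 ≤ (1 - r) * (τ ^ 2 * g2) → τ * V = A + R + β * U →
      ddens N β α p γ 32 (τ ^ γ) τ A g2 R U V k k' r (f U) (g V) (primitive f U)
        - (p + 3) / 2 * τ ^ γ * (k * edens β (τ ^ γ) τ A g2 R U (potential p f U))
      ≤ -(k' * A ^ 2) + C * (τ ^ γ) ^ 2 * (k * τ ^ (-(2 * β)))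
        + 2 * (r * k' - α * k) * (τ * V * A - τ ^ γ * U * R) := by
  have hβ0 : 0 < β := by
    by_contra h
    nlinarith
  obtain ⟨Γ₀, C, h0, h1, hC, h⟩ := exists_ddens_le (N := N) (γ := γ) (D := 2 * M) hα hβ0 hp hM
    (by positivity)
  have hΓτ : (Γ₀ ^ (1 / γ)) ^ γ = Γ₀ := by
    rw [← Real.rpow_mul h0.le, one_div_mul_cancel hγ0.ne', Real.rpow_one]
  refine ⟨Γ₀ ^ (1 / γ), C, by positivity, Real.rpow_le_one h0.le h1 (by positivity), hC,
    fun f g hfc hf hg τ A g2 R U V k k' r hτ hτ0 hk hk' hr hr1 hkk hg2 hR hV => ?_⟩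
  have hτ1 : τ ≤ 1 := hτ0.trans (Real.rpow_le_one h0.le h1 (by positivity))
  have hΓ : τ ^ γ ≤ Γ₀ := by
    rw [← hΓτ]; exact Real.rpow_le_rpow hτ.le hτ0 hγ0.le
  have hτΓ : τ ≤ (τ ^ γ) ^ 2 := by
    rw [← Real.rpow_natCast, ← Real.rpow_mul hτ.le]
    conv_lhs => rw [← Real.rpow_one τ]
    refine Real.rpow_le_rpow_of_exponent_ge hτ hτ1 ?_
    push_cast
    linarith
  refine h (τ ^ γ) τ A g2 R U V k k' r (f U) (g V) (primitive f U) (τ ^ (-(2 * β)))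
    (by positivity) hΓ hτ hτΓ hk hk' hr hr1 hkk hg2 hR hV (hg V) ?_ ?_ ?_
  · exact Real.one_le_rpow_of_pos_of_le_one_of_nonpos hτ hτ1 (by linarith)
  · refine perturbation_le hτ hτ1 hβ hβ0 hq hqp hγ hM _ ?_
    rw [abs_mul, ← mul_assoc]
    exact mul_le_mul_of_nonneg_right (hf U) (abs_nonneg U)
  · exact perturbation_le hτ hτ1 hβ hβ0 hq hqp hγ hM _
      ((isPrimitive_primitive hfc hM hf).bound' hq U)

end Subcritical

section Weight

variable {α ε r : ℝ}

/-- The weight `r₊ ^ α`. -/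
def posW (α r : ℝ) : ℝ := max r 0 ^ α

/-- Smooth approximations of `posW`. -/
def kap (α ε r : ℝ) : ℝ := r ^ α * smoothTransition (r / ε - 1)

theorem continuous_posW (hα : 0 < α) : Continuous (posW α) :=
  (continuous_id.max continuous_const).rpow_const fun _ => Or.inr hα.le

theorem posW_nonneg : 0 ≤ posW α r := Real.rpow_nonneg (le_max_right _ _) _

theorem posW_of_nonpos (hα : 0 < α) (hr : r ≤ 0) : posW α r = 0 := by
  rw [posW, max_eq_right hr, Real.zero_rpow hα.ne']

theorem posW_of_pos (hr : 0 < r) : posW α r = r ^ α := by rw [posW, max_eq_left hr.le]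

theorem posW_le_one (hα : 0 < α) (hr : r ≤ 1) : posW α r ≤ 1 :=
  Real.rpow_le_one (le_max_right _ _) (max_le hr zero_le_one) hα.le

theorem kap_of_le (hε : 0 < ε) (hr : r ≤ ε) : kap α ε r = 0 := by
  rw [kap, smoothTransition.zero_of_nonpos, mul_zero]
  rw [sub_nonpos, div_le_one hε]; exact hr

theorem kap_of_ge (hε : 0 < ε) (hr : 2 * ε ≤ r) : kap α ε r = posW α r := by
  rw [kap, smoothTransition.one_of_one_le, mul_one, posW_of_pos (by linarith)]
  rw [le_sub_iff_add_le, le_div_iff₀ hε]; linarith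

theorem kap_nonneg (hε : 0 < ε) : 0 ≤ kap α ε r := by
  rcases le_total r ε with h | h
  · rw [kap_of_le hε h]
  · exact mul_nonneg (Real.rpow_nonneg (hε.le.trans h) _) (smoothTransition.nonneg _)

theorem kap_le_posW (hε : 0 < ε) : kap α ε r ≤ posW α r := by
  rcases le_or_gt r ε with h | h
  · rw [kap_of_le hε h]; exact posW_nonneg
  · rw [posW_of_pos (hε.trans h), kap]
    exact mul_le_of_le_one_right (Real.rpow_nonneg (hε.trans h).le _)
      (smoothTransition.le_one _)

theorem isProfile_kap (hε : 0 < ε) : IsProfile (kap α ε) where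
  vanish := ⟨ε, hε, fun _ => kap_of_le hε⟩
  smooth := by
    refine contDiff_iff_contDiffAt.2 fun r => ?_
    rcases lt_or_ge r ε with h | h
    · refine (contDiffAt_const (c := (0 : ℝ))).congr_of_eventuallyEq ?_
      filter_upwards [Iio_mem_nhds h] with s hs
      exact kap_of_le hε (le_of_lt hs)
    · refine (contDiffAt_id.rpow_const_of_ne (hε.trans_le h).ne').mul ?_
      exact smoothTransition.contDiff.contDiffAt.comp r (by fun_prop)

theorem kap_deriv (hr : 0 < r) :
    r * deriv (kap α ε) r - α * kap α ε r
      = r ^ α * (r / ε * deriv smoothTransition (r / ε - 1)) := by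
  have h1 : HasDerivAt (fun r : ℝ => r ^ α) (α * r ^ (α - 1)) r :=
    Real.hasDerivAt_rpow_const (Or.inl hr.ne')
  have h2 : HasDerivAt (fun r : ℝ => smoothTransition (r / ε - 1))
      (deriv smoothTransition (r / ε - 1) * (1 / ε)) r :=
    HasDerivAt.comp r ((smoothTransition.contDiff (n := 1)).differentiable
      (by simp) _).hasDerivAt (((hasDerivAt_id r).div_const ε).sub_const 1)
  have h3 : deriv (kap α ε) r = _ := (h1.mul h2).deriv
  rw [h3, kap]
  have e1 : r ^ α = r ^ (α - 1) * r := by rw [Real.rpow_sub_one hr.ne']; field_simp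
  rw [e1]
  ring

theorem deriv_smoothTransition_nonneg (x : ℝ) : 0 ≤ deriv smoothTransition x :=
  smoothTransition.monotone.deriv_nonneg

theorem continuous_deriv_smoothTransition : Continuous (deriv smoothTransition) :=
  (smoothTransition.contDiff (n := 1)).continuous_deriv (by simp)

theorem deriv_smoothTransition_of_ge {x : ℝ} (hx : 1 ≤ x) :
    deriv smoothTransition x = 0 := by
  have h : Ici (1 : ℝ) ⊆ {x | deriv smoothTransition x = 0} := by
    rw [← closure_Ioi]
    refine closure_minimal (fun y hy => ?_)
      (isClosed_eq continuous_deriv_smoothTransition continuous_const)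
    have : smoothTransition =ᶠ[𝓝 y] fun _ => 1 := by
      filter_upwards [Ioi_mem_nhds hy] with s hs
      exact smoothTransition.one_of_one_le (le_of_lt hs)
    simp only [Set.mem_ofPred_eq]
    rw [this.deriv_eq, deriv_const]
  exact h hx

theorem deriv_smoothTransition_of_le {x : ℝ} (hx : x ≤ 0) :
    deriv smoothTransition x = 0 := by
  have h : Set.Iic (0 : ℝ) ⊆ {x | deriv smoothTransition x = 0} := by
    rw [← closure_Iio]
    refine closure_minimal (fun y hy => ?_)
      (isClosed_eq continuous_deriv_smoothTransition continuous_const)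
    have : smoothTransition =ᶠ[𝓝 y] fun _ => 0 := by
      filter_upwards [Iio_mem_nhds hy] with s hs
      exact smoothTransition.zero_of_nonpos (le_of_lt hs)
    simp only [Set.mem_ofPred_eq]
    rw [this.deriv_eq, deriv_const]
  exact h hx

/-- The defect of `kap` from homogeneity. -/
theorem exists_kap_defect {α : ℝ} (hα : 0 < α) : ∃ K : ℝ, 0 ≤ K ∧ ∀ ε, 0 < ε → ∀ r, 0 < r → r ≤ 1 →
    0 ≤ r * deriv (kap α ε) r - α * kap α ε r ∧
    r * deriv (kap α ε) r - α * kap α ε r ≤ K ∧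
    (2 * ε ≤ r → r * deriv (kap α ε) r - α * kap α ε r = 0) := by
  obtain ⟨K, hK⟩ := isCompact_Icc.exists_bound_of_continuousOn (s := Icc (0 : ℝ) 1)
    continuous_deriv_smoothTransition.continuousOn
  have hK0 : 0 ≤ K := (norm_nonneg _).trans (hK 0 ⟨le_rfl, zero_le_one⟩)
  refine ⟨2 * K, by positivity, fun ε hε r hr hr1 => ?_⟩
  rw [kap_deriv hr]
  have h0 := deriv_smoothTransition_nonneg (r / ε - 1)
  have h2 : 2 * ε ≤ r → deriv smoothTransition (r / ε - 1) = 0 := fun h =>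
    deriv_smoothTransition_of_ge (by rw [le_sub_iff_add_le, le_div_iff₀ hε]; linarith)
  refine ⟨by positivity, ?_, fun h => by rw [h2 h]; simp⟩
  rcases le_or_gt (2 * ε) r with h | h
  · rw [h2 h]; simp [hK0]
  have h3 : r / ε ≤ 2 := by rw [div_le_iff₀ hε]; exact h.le
  have h4 : deriv smoothTransition (r / ε - 1) ≤ K := by
    rcases le_total (r / ε - 1) 0 with h5 | h5
    · rw [deriv_smoothTransition_of_le h5]; exact hK0
    · exact (le_abs_self _).trans (hK _ ⟨h5, by linarith⟩)
  have h5 : r ^ α ≤ 1 := Real.rpow_le_one hr.le hr1 hα.le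
  calc r ^ α * (r / ε * deriv smoothTransition (r / ε - 1)) ≤ 1 * (2 * K) := by
        gcongr
    _ = 2 * K := one_mul _

/-- The weight of the dissipation, cut off near `r = 0`. -/
def disW (α δ r : ℝ) : ℝ := if δ ≤ r then α * r ^ (α - 1) else 0

theorem disW_nonneg (hα : 0 < α) {δ : ℝ} (hδ : 0 < δ) : 0 ≤ disW α δ r := by
  rw [disW]
  split_ifs with h
  · have : 0 < r := hδ.trans_le h
    positivity
  · exact le_rfl

theorem measurable_disW (α δ : ℝ) : Measurable (disW α δ) :=
  Measurable.ite measurableSet_Ici (by fun_prop) measurable_const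

theorem disW_le (hα : 0 < α) {δ : ℝ} (hδ : 0 < δ) (hr : r ≤ 1) : disW α δ r ≤ α / δ := by
  rw [disW]
  split_ifs with h
  · have : 0 < r := hδ.trans_le h
    rw [Real.rpow_sub_one this.ne', div_eq_mul_inv α, div_eq_mul_inv]
    have h1 : r⁻¹ ≤ δ⁻¹ := inv_anti₀ hδ h
    have h2 : r ^ α ≤ 1 := Real.rpow_le_one this.le hr hα.le
    calc α * (r ^ α * r⁻¹) ≤ α * (1 * δ⁻¹) := by gcongr
      _ = _ := by ring
  · positivity

theorem kap_deriv_nonneg (hα : 0 < α) (hε : 0 < ε) (hr : 0 < r) : 0 ≤ deriv (kap α ε) r := by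
  have h := kap_deriv (α := α) (ε := ε) hr
  have h0 := deriv_smoothTransition_nonneg (r / ε - 1)
  have h1 : 0 ≤ r ^ α * (r / ε * deriv smoothTransition (r / ε - 1)) := by positivity
  have h2 : 0 ≤ α * kap α ε r := mul_nonneg hα.le (kap_nonneg hε)
  have h3 : 0 ≤ r * deriv (kap α ε) r := by linarith
  exact nonneg_of_mul_nonneg_right h3 hr

theorem disW_le_deriv_kap (hα : 0 < α) {δ : ℝ} (hε : 0 < ε) (hεδ : 2 * ε ≤ δ)
    (hr : 0 < r) : disW α δ r ≤ deriv (kap α ε) r := by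
  rw [disW]
  split_ifs with h
  · have h1 := kap_deriv (α := α) (ε := ε) hr
    rw [deriv_smoothTransition_of_ge (by rw [le_sub_iff_add_le, le_div_iff₀ hε]; linarith),
      mul_zero, mul_zero, kap_of_ge hε (by linarith), posW_of_pos hr] at h1
    rw [Real.rpow_sub_one hr.ne', ← mul_div_assoc, div_le_iff₀ hr]
    linarith
  · exact kap_deriv_nonneg hα hε hr

theorem tendsto_kap (hα : 0 < α) {ε : ℕ → ℝ} (h0 : ∀ n, 0 < ε n)
    (hε : Tendsto ε atTop (𝓝 0)) (r : ℝ) :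
    Tendsto (fun n => kap α (ε n) r) atTop (𝓝 (posW α r)) := by
  rcases le_or_gt r 0 with hr | hr
  · rw [posW_of_nonpos hα hr]
    exact tendsto_const_nhds.congr fun n => (kap_of_le (h0 n) (hr.trans (h0 n).le)).symm
  · refine tendsto_const_nhds.congr' ?_
    filter_upwards [hε.eventually_lt_const (by linarith : 0 < r / 2)] with n hn
    exact (kap_of_ge (h0 n) (by linarith)).symm

end Weight

section OneDim

/-- A smooth approximation of the indicator function of `[t₁, t₂]`. -/
def ramp (t₁ t₂ h t : ℝ) : ℝ :=
  smoothTransition ((t - t₁) / h - 1) - smoothTransition ((t - t₂) / h + 2)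

variable {t₁ t₂ h a b : ℝ}

theorem ramp_nonneg (hh : 0 < h) (h3 : 3 * h ≤ t₂ - t₁) (t : ℝ) : 0 ≤ ramp t₁ t₂ h t := by
  refine sub_nonneg.2 (smoothTransition.monotone ?_)
  have : (t - t₁) / h - 1 - ((t - t₂) / h + 2) = (t₂ - t₁) / h - 3 := by ring
  have h4 : 3 ≤ (t₂ - t₁) / h := by rwa [le_div_iff₀ hh]
  linarith

theorem ramp_le_one (t : ℝ) : ramp t₁ t₂ h t ≤ 1 := by
  have h1 := smoothTransition.le_one ((t - t₁) / h - 1)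
  have h2 := smoothTransition.nonneg ((t - t₂) / h + 2)
  rw [ramp]; linarith

theorem ramp_eq_zero (hh : 0 < h) (h3 : 3 * h ≤ t₂ - t₁) {t : ℝ}
    (ht : t ∉ Icc (t₁ + h) (t₂ - h)) : ramp t₁ t₂ h t = 0 := by
  rw [Set.mem_Icc, not_and_or, not_le, not_le] at ht
  rcases ht with ht | ht
  · rw [ramp, smoothTransition.zero_of_nonpos, smoothTransition.zero_of_nonpos, sub_zero]
    · rw [← le_neg_iff_add_nonpos_right, div_le_iff₀ hh]; linarith
    · rw [sub_nonpos, div_le_one hh]; linarith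
  · rw [ramp, smoothTransition.one_of_one_le, smoothTransition.one_of_one_le, sub_self]
    · rw [← sub_le_iff_le_add, le_div_iff₀ hh]; linarith
    · rw [le_sub_iff_add_le, le_div_iff₀ hh]; linarith

theorem isTest_ramp (hh : 0 < h) (h3 : 3 * h ≤ t₂ - t₁) (h1 : a ≤ t₁) (h2 : t₂ ≤ b) :
    IsTest (Ioo a b) (ramp t₁ t₂ h) := by
  have hsub : tsupport (ramp t₁ t₂ h) ⊆ Icc (t₁ + h) (t₂ - h) :=
    closure_minimal (fun t ht => by
      by_contra h4
      exact ht (ramp_eq_zero hh h3 h4)) isClosed_Icc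
  refine ⟨?_, HasCompactSupport.of_support_subset_isCompact isCompact_Icc
    (subset_closure.trans hsub), hsub.trans fun t ht => ⟨by linarith [ht.1], by linarith [ht.2]⟩⟩
  unfold ramp
  exact (smoothTransition.contDiff.comp (by fun_prop)).sub
    (smoothTransition.contDiff.comp (by fun_prop))

theorem deriv_ramp (t : ℝ) : deriv (ramp t₁ t₂ h) t
    = deriv smoothTransition ((t - t₁) / h - 1) / h
      - deriv smoothTransition ((t - t₂) / h + 2) / h := by
  have hd : Differentiable ℝ smoothTransition :=
    (smoothTransition.contDiff (n := 1)).differentiable (by simp)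
  have e1 := HasDerivAt.comp t (hd _).hasDerivAt
    ((((hasDerivAt_id t).sub_const t₁).div_const h).sub_const 1)
  have e2 := HasDerivAt.comp t (hd _).hasDerivAt
    ((((hasDerivAt_id t).sub_const t₂).div_const h).add_const 2)
  refine ((e1.sub e2).congr_deriv ?_).deriv
  simp only [id]
  ring

theorem integral_deriv_smoothTransition_mul {e : ℝ → ℝ} :
    ∫ x, deriv smoothTransition x * e x
      = ∫ x in Icc (0 : ℝ) 1, deriv smoothTransition x * e x := by
  refine (setIntegral_eq_integral_of_forall_compl_eq_zero fun x hx => ?_).symm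
  rw [Set.mem_Icc, not_and_or, not_le, not_le] at hx
  rcases hx with hx | hx
  · rw [deriv_smoothTransition_of_le hx.le, zero_mul]
  · rw [deriv_smoothTransition_of_ge hx.le, zero_mul]

theorem integral_deriv_smoothTransition :
    ∫ x in Icc (0 : ℝ) 1, deriv smoothTransition x = 1 := by
  rw [integral_Icc_eq_integral_Ioc, ← intervalIntegral.integral_of_le zero_le_one,
    intervalIntegral.integral_deriv_eq_sub
    (fun x _ => (smoothTransition.contDiff (n := 1)).differentiable (by simp) x)
    (continuous_deriv_smoothTransition.intervalIntegrable _ _),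
    smoothTransition.one, smoothTransition.zero, sub_zero]

/-- Convolutions of a continuous function against an approximate identity. -/
theorem tendsto_integral_deriv_smoothTransition {e : ℝ → ℝ} (he : ContinuousOn e (Icc a b))
    {c t : ℝ} (ht : t ∈ Icc a b) {hn : ℕ → ℝ} (hn0 : ∀ n, 0 < hn n)
    (hlim : Tendsto hn atTop (𝓝 0))
    (hS : ∀ n, ∀ x ∈ Icc (0 : ℝ) 1, t + hn n * (x + c) ∈ Icc a b) :
    Tendsto (fun n => ∫ s, deriv smoothTransition ((s - t) / hn n - c) / hn n * e s) atTop
      (𝓝 (e t)) := by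
  have key : ∀ n, ∫ s, deriv smoothTransition ((s - t) / hn n - c) / hn n * e s
      = ∫ x in Icc (0 : ℝ) 1, deriv smoothTransition x * e (t + hn n * (x + c)) := by
    intro n
    rw [← integral_deriv_smoothTransition_mul]
    have h2 := Measure.integral_comp_mul_left (fun s : ℝ =>
      deriv smoothTransition ((s - t) / hn n - c) / hn n * e s) (hn n)
    have h3 := integral_add_right_eq_self (μ := (volume : Measure ℝ)) (fun x : ℝ =>
      deriv smoothTransition ((hn n * x - t) / hn n - c) / hn n * e (hn n * x)) (t / hn n + c)
    rw [h2, abs_of_pos (inv_pos.2 (hn0 n)), smul_eq_mul] at h3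
    have hne := (hn0 n).ne'
    rw [eq_comm, inv_mul_eq_div, div_eq_iff hne] at h3
    rw [h3, ← integral_mul_const]
    refine integral_congr_ae (.of_forall fun x => ?_)
    have e1 : (hn n * (x + (t / hn n + c)) - t) / hn n - c = x := by field_simp; ring
    have e2 : hn n * (x + (t / hn n + c)) = t + hn n * (x + c) := by field_simp; ring
    beta_reduce
    rw [e1, e2]
    field_simp
  have h1 : e t = ∫ x in Icc (0 : ℝ) 1, deriv smoothTransition x * e t := by
    rw [integral_mul_const, integral_deriv_smoothTransition, one_mul]
  obtain ⟨C, hC⟩ := isCompact_Icc.exists_bound_of_continuousOn he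
  have hd := continuous_deriv_smoothTransition
  rw [h1]
  simp_rw [key]
  refine tendsto_integral_of_dominated_convergence (fun x => deriv smoothTransition x * C)
    (fun n => (hd.continuousOn.mul (he.comp (by fun_prop) (hS n))).aestronglyMeasurable
      measurableSet_Icc)
    (hd.mul continuous_const).continuousOn.integrableOn_Icc (fun n => ?_) ?_
  · filter_upwards [ae_restrict_mem measurableSet_Icc] with x hx
    rw [norm_mul, norm_of_nonneg (deriv_smoothTransition_nonneg x)]
    exact mul_le_mul_of_nonneg_left (hC _ (hS n x hx)) (deriv_smoothTransition_nonneg x)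
  · filter_upwards [ae_restrict_mem measurableSet_Icc] with x hx
    refine ((he t ht).tendsto.comp (tendsto_nhdsWithin_iff.2
      ⟨?_, .of_forall fun n => hS n x hx⟩)).const_mul _
    simpa using (hlim.mul_const (x + c)).const_add t

/-- A weak differential inequality, integrated. -/
theorem le_of_forall_test {e D : ℝ → ℝ} (he : ContinuousOn e (Icc a b))
    (hD : IntegrableOn D (Icc a b))
    (H : ∀ θ : ℝ → ℝ, IsTest (Ioo a b) θ → (∀ t, 0 ≤ θ t) →
      0 ≤ ∫ t in Icc a b, (deriv θ t * e t - θ t * D t))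
    (h1 : a ≤ t₁) (h12 : t₁ ≤ t₂) (h2 : t₂ ≤ b) :
    e t₂ + ∫ t in t₁..t₂, D t ≤ e t₁ := by
  rcases eq_or_lt_of_le h12 with rfl | hlt
  · simp
  set hn : ℕ → ℝ := fun n => (t₂ - t₁) / 3 * (1 / (n + 1)) with hhn
  have hn0 : ∀ n, 0 < hn n := fun n => by
    have : 0 < t₂ - t₁ := by linarith
    positivity
  have hn3 : ∀ n, 3 * hn n ≤ t₂ - t₁ := fun n => by
    have h4 : (1 : ℝ) / (n + 1) ≤ 1 := by
      rw [div_le_one (by positivity)]; linarith [(n.cast_nonneg : (0 : ℝ) ≤ n)]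
    simp only [hhn]
    nlinarith
  have hlim : Tendsto hn atTop (𝓝 0) := by
    have := (tendsto_one_div_add_atTop_nhds_zero_nat (𝕜 := ℝ)).const_mul ((t₂ - t₁) / 3)
    rwa [mul_zero] at this
  have hde : ∀ n, IntegrableOn (fun t => deriv (ramp t₁ t₂ (hn n)) t * e t) (Icc a b) := fun n =>
    ((((isTest_ramp (hn0 n) (hn3 n) h1 h2).smooth.continuous_deriv (by simp)).continuousOn).mul
      he).integrableOn_compact isCompact_Icc
  have hdD : ∀ n, IntegrableOn (fun t => ramp t₁ t₂ (hn n) t * D t) (Icc a b) := fun n =>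
    hD.bdd_mul (c := 1) (isTest_ramp (hn0 n) (hn3 n) h1 h2).smooth.continuous.aestronglyMeasurable
      (.of_forall fun t => by
        rw [norm_of_nonneg (ramp_nonneg (hn0 n) (hn3 n) t)]; exact ramp_le_one t)
  have hineq : ∀ n, 0 ≤ (∫ t in Icc a b, deriv (ramp t₁ t₂ (hn n)) t * e t)
      - ∫ t in Icc a b, ramp t₁ t₂ (hn n) t * D t := fun n => by
    rw [← integral_sub (hde n) (hdD n)]
    exact H _ (isTest_ramp (hn0 n) (hn3 n) h1 h2) (ramp_nonneg (hn0 n) (hn3 n))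
  have l2 : Tendsto (fun n => ∫ t in Icc a b, ramp t₁ t₂ (hn n) t * D t) atTop
      (𝓝 (∫ t in t₁..t₂, D t)) := by
    have e1 : ∫ t in t₁..t₂, D t = ∫ t in Icc a b, (Ioo t₁ t₂).indicator D t := by
      rw [intervalIntegral.integral_of_le h12, integral_Ioc_eq_integral_Ioo,
        setIntegral_indicator measurableSet_Ioo, Set.inter_eq_self_of_subset_right]
      exact fun t ht => ⟨h1.trans ht.1.le, ht.2.le.trans h2⟩
    rw [e1]
    refine tendsto_integral_of_dominated_convergence (fun t => ‖D t‖)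
      (fun n => (hdD n).1) hD.norm (fun n => .of_forall fun t => ?_)
      (.of_forall fun t => ?_)
    · rw [norm_mul, norm_of_nonneg (ramp_nonneg (hn0 n) (hn3 n) t)]
      exact mul_le_of_le_one_left (norm_nonneg _) (ramp_le_one t)
    · by_cases ht : t ∈ Ioo t₁ t₂
      · rw [Set.indicator_of_mem ht]
        refine tendsto_const_nhds.congr' ?_
        filter_upwards [hlim.eventually_lt_const (by linarith [ht.1] : 0 < (t - t₁) / 2),
          hlim.eventually_lt_const (by linarith [ht.2] : 0 < (t₂ - t) / 2)] with n hn1 hn2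
        have : ramp t₁ t₂ (hn n) t = 1 := by
          rw [ramp, smoothTransition.one_of_one_le, smoothTransition.zero_of_nonpos,
            sub_zero]
          · rw [← le_neg_iff_add_nonpos_right, div_le_iff₀ (hn0 n)]; linarith
          · rw [le_sub_iff_add_le, le_div_iff₀ (hn0 n)]; linarith
        rw [this, one_mul]
      · rw [Set.indicator_of_notMem ht]
        refine tendsto_const_nhds.congr fun n => ?_
        rw [ramp_eq_zero (hn0 n) (hn3 n), zero_mul]
        exact fun h => ht ⟨by linarith [h.1, hn0 n], by linarith [h.2, hn0 n]⟩
  have l1 : Tendsto (fun n => ∫ t in Icc a b, deriv (ramp t₁ t₂ (hn n)) t * e t) atTop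
      (𝓝 (e t₁ - e t₂)) := by
    set e' := (Icc a b).indicator e with he'
    have hce : ContinuousOn e' (Icc a b) := he.congr fun t ht => Set.indicator_of_mem ht _
    have hei : ∀ k : ℝ → ℝ, Continuous k → Integrable fun t => k t * e' t := fun k hk => by
      have : (fun t => k t * e' t) = (Icc a b).indicator fun t => k t * e t := by
        ext t
        by_cases ht : t ∈ Icc a b <;> simp [he', ht]
      rw [this]
      exact ((hk.continuousOn.mul he).integrableOn_compact isCompact_Icc).integrable_indicator
        measurableSet_Icc
    have k1 := tendsto_integral_deriv_smoothTransition hce (c := 1) (t := t₁)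
      ⟨h1, h12.trans h2⟩ hn0 hlim (fun n x hx => by
        have := hn0 n; have := hn3 n
        have h5 : hn n * (x + 1) ≤ hn n * 2 := by gcongr; linarith [hx.2]
        have h6 : 0 ≤ hn n * (x + 1) := mul_nonneg (hn0 n).le (by linarith [hx.1])
        exact ⟨by linarith, by linarith⟩)
    have k2 := tendsto_integral_deriv_smoothTransition hce (c := -2) (t := t₂)
      ⟨h1.trans h12, h2⟩ hn0 hlim (fun n x hx => by
        have := hn0 n; have := hn3 n
        have h5 : hn n * (x + -2) ≤ hn n * 0 := by gcongr; linarith [hx.2]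
        have h6 : hn n * (-2) ≤ hn n * (x + -2) := by gcongr; linarith [hx.1]
        exact ⟨by linarith, by linarith⟩)
    have hv1 : e' t₁ = e t₁ := Set.indicator_of_mem (s := Icc a b) ⟨h1, h12.trans h2⟩ e
    have hv2 : e' t₂ = e t₂ := Set.indicator_of_mem (s := Icc a b) ⟨h1.trans h12, h2⟩ e
    rw [hv1] at k1
    rw [hv2] at k2
    refine (k1.sub k2).congr fun n => ?_
    have hc := continuous_deriv_smoothTransition
    rw [← integral_sub (hei _ (by fun_prop)) (hei _ (by fun_prop)),
      ← integral_indicator measurableSet_Icc]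
    refine integral_congr_ae (.of_forall fun t => ?_)
    by_cases ht : t ∈ Icc a b
    · simp only [he', Set.indicator_of_mem ht, deriv_ramp, sub_neg_eq_add]
      ring
    · simp [he', ht]
  have := ge_of_tendsto' (l1.sub l2) hineq
  linarith

/-- A weak differential equation, integrated. -/
theorem eq_of_forall_test {e c : ℝ → ℝ} (he : ContinuousOn e (Icc a b))
    (hc : IntegrableOn c (Icc a b))
    (H : ∀ θ : ℝ → ℝ, IsTest (Ioo a b) θ →
      ∫ t in Icc a b, (deriv θ t * e t + θ t * c t) = 0)
    (h1 : a ≤ t₁) (h12 : t₁ ≤ t₂) (h2 : t₂ ≤ b) :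
    e t₂ - e t₁ = ∫ t in t₁..t₂, c t := by
  have k1 := le_of_forall_test he hc.neg (fun θ hθ _ => le_of_eq (by
    rw [← H θ hθ]
    refine integral_congr_ae (.of_forall fun t => ?_)
    simp)) h1 h12 h2
  have k2 := le_of_forall_test (e := -e) (D := c) he.neg hc (fun θ hθ _ => le_of_eq (by
    rw [← neg_zero, ← H θ hθ, ← integral_neg]
    refine integral_congr_ae (.of_forall fun t => ?_)
    simp only [Pi.neg_apply]
    ring)) h1 h12 h2
  simp only [Pi.neg_apply, intervalIntegral.integral_neg] at k1 k2
  linarith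

end OneDim

section SliceContinuity

variable {X F : Type*} [MeasurableSpace X] [NormedAddCommGroup F] {m : Measure X} {a b : ℝ}

/-- Continuity in time with values in `L²`. -/
structure L2Cont (m : Measure X) (h : ℝ → X → F) (a b : ℝ) : Prop where
  mem : ∀ t ∈ Icc a b, MemLp (h t) 2 m
  tendsto : ∀ t ∈ Icc a b,
    Tendsto (fun s => eLpNorm (fun x => h s x - h t x) 2 m) (𝓝[Icc a b] t) (𝓝 0)

namespace L2Cont

variable {h : ℝ → X → F} {k l : ℝ → X → ℝ}

theorem sub (hk : L2Cont m k a b) (hl : L2Cont m l a b) :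
    L2Cont m (fun t x => k t x - l t x) a b where
  mem t ht := (hk.mem t ht).sub (hl.mem t ht)
  tendsto t ht := by
    have := (hk.tendsto t ht).add (hl.tendsto t ht)
    rw [add_zero] at this
    refine tendsto_of_tendsto_of_tendsto_of_le_of_le' tendsto_const_nhds this
      (.of_forall fun _ => bot_le) ?_
    filter_upwards [self_mem_nhdsWithin] with s hs
    have e : (fun x => k s x - l s x - (k t x - l t x))
        = (fun x => k s x - k t x) - fun x => l s x - l t x := by
      ext x; simp only [Pi.sub_apply]; ring
    rw [e]
    exact eLpNorm_sub_le ((hk.mem s hs).1.sub (hk.mem t ht).1)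
      ((hl.mem s hs).1.sub (hl.mem t ht).1) (by norm_num)

/-- Images under maps that do not increase distances by more than a constant factor. -/
theorem of_le (hh : L2Cont m h a b) {C : ℝ} (hmem : ∀ t ∈ Icc a b, MemLp (k t) 2 m)
    (hle : ∀ᵐ x ∂m, ∀ s t, |k s x - k t x| ≤ C * ‖h s x - h t x‖) : L2Cont m k a b where
  mem := hmem
  tendsto t ht := by
    have h1 := ENNReal.Tendsto.const_mul (a := ofReal C) (hh.tendsto t ht)
      (Or.inr ENNReal.ofReal_ne_top)
    rw [mul_zero] at h1
    refine tendsto_of_tendsto_of_tendsto_of_le_of_le tendsto_const_nhds h1 (fun _ => bot_le)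
      fun s => ?_
    refine eLpNorm_le_mul_eLpNorm_of_ae_le_mul ?_ 2
    filter_upwards [hle] with x hx
    exact hx s t

theorem mul_time (hk : L2Cont m k a b) {c : ℝ → ℝ} (hc : ContinuousOn c (Icc a b)) :
    L2Cont m (fun t x => c t * k t x) a b where
  mem t ht := (hk.mem t ht).const_mul (c t)
  tendsto t ht := by
    have hl1 : Tendsto (fun s => ‖c s‖ₑ * eLpNorm (fun x => k s x - k t x) 2 m)
        (𝓝[Icc a b] t) (𝓝 (‖c t‖ₑ * 0)) :=
      ENNReal.Tendsto.mul ((continuous_enorm.tendsto _).comp (hc t ht)) (Or.inr ENNReal.zero_ne_top)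
        (hk.tendsto t ht) (Or.inr enorm_ne_top)
    have hl2 : Tendsto (fun s => ‖c s - c t‖ₑ * eLpNorm (k t) 2 m)
        (𝓝[Icc a b] t) (𝓝 (0 * eLpNorm (k t) 2 m)) := by
      refine ENNReal.Tendsto.mul_const ?_ (Or.inr (hk.mem t ht).2.ne)
      have h1 : Tendsto (fun s => c s - c t) (𝓝[Icc a b] t) (𝓝 (c t - c t)) :=
        (hc t ht).sub_const _
      have h2 := (continuous_enorm.tendsto _).comp h1
      rw [sub_self, enorm_zero] at h2
      exact h2
    have := hl1.add hl2
    rw [mul_zero, zero_mul, add_zero] at this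
    refine tendsto_of_tendsto_of_tendsto_of_le_of_le' tendsto_const_nhds this
      (.of_forall fun _ => bot_le) ?_
    filter_upwards [self_mem_nhdsWithin] with s hs
    have e : (fun x => c s * k s x - c t * k t x)
        = c s • (fun x => k s x - k t x) + (c s - c t) • k t := by
      ext x; simp only [Pi.add_apply, Pi.smul_apply, smul_eq_mul]; ring
    rw [e]
    refine (eLpNorm_add_le (((hk.mem s hs).1.sub (hk.mem t ht).1).const_smul _)
      ((hk.mem t ht).1.const_smul _) (by norm_num)).trans ?_
    rw [eLpNorm_const_smul, eLpNorm_const_smul]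
    exact le_rfl

theorem const [IsFiniteMeasure m] (c : ℝ) : L2Cont m (fun _ _ => c) a b where
  mem _ _ := memLp_const c
  tendsto t _ := by simpa using tendsto_const_nhds

/-- Integrals of products are continuous in time. -/
theorem continuousOn_integral (hk : L2Cont m k a b) (hl : L2Cont m l a b) {w : ℝ → X → ℝ} {C : ℝ}
    (hC : 0 ≤ C) (hw : ∀ t ∈ Icc a b, AEStronglyMeasurable (w t) m)
    (hwC : ∀ t ∈ Icc a b, ∀ᵐ x ∂m, |w t x| ≤ C)
    (hwc : ∀ᵐ x ∂m, ContinuousOn (fun t => w t x) (Icc a b)) :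
    ContinuousOn (fun t => ∫ x, w t x * (k t x * l t x) ∂m) (Icc a b) := by
  intro t ht
  have hev : ∀ᶠ s in 𝓝[Icc a b] t, s ∈ Icc a b := self_mem_nhdsWithin
  refine tendsto_integral_bilin (m := m) (B := fun s x c d => w s x * (c * d))
    (B₀ := fun x c d => w t x * (c * d)) hC ?_ ?_ (hev.mono fun s hs => hk.mem s hs) (hk.mem t ht)
    (hev.mono fun s hs => hl.mem s hs) (hl.mem t ht) (hk.tendsto t ht) (hl.tendsto t ht)
  · filter_upwards [hev] with s hs
    refine ⟨fun _ _ _ _ => by ring, fun _ _ _ _ => by ring, ?_, fun f g hf hg =>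
      (hw s hs).mul (hf.mul hg)⟩
    filter_upwards [hwC s hs] with x hx c d
    rw [abs_mul, abs_mul]
    exact mul_le_mul_of_nonneg_right hx (by positivity)
  · filter_upwards [hwc] with x hx
    exact (hx t ht).mul_const _

/-- The integrands are integrable. -/
theorem integrable_mul (hk : L2Cont m k a b) (hl : L2Cont m l a b) {w : X → ℝ} {C t : ℝ}
    (ht : t ∈ Icc a b) (hw : AEStronglyMeasurable w m) (hwC : ∀ᵐ x ∂m, |w x| ≤ C) :
    Integrable (fun x => w x * (k t x * l t x)) m :=
  ((hk.mem t ht).integrable_mul (q := 2) (hl.mem t ht)).bdd_mul (c := C) hw hwC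

end L2Cont

end SliceContinuity

theorem IsSolution.l2Cont (hs : IsSolution p f g T u₀ u₁ u v G) (hc : CylBelow T a b x₀ r) :
    L2Cont (𝓛 (closedBall x₀ r)) u a b ∧
      L2Cont (𝓛 (closedBall x₀ r)) G a b ∧
      L2Cont (𝓛 (closedBall x₀ r)) v a b := by
  have hK := isCompact_closedBall x₀ r
  have hsub : ∀ t, 𝓝[Icc a b] t ≤ 𝓝[Ici 0] t := fun t =>
    nhdsWithin_mono t fun s hs => hc.nonneg.trans hs.1
  have hm := fun t (ht : t ∈ Icc a b) => hs.memLp t (hc.nonneg.trans ht.1) _ hK (hc.lt ht)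
  have hl := fun t (ht : t ∈ Icc a b) => hs.continuous t (hc.nonneg.trans ht.1) _ hK (hc.lt ht)
  exact ⟨⟨fun t ht => (hm t ht).1, fun t ht => (hl t ht).1.mono_left (hsub t)⟩,
    ⟨fun t ht => (hm t ht).2.1, fun t ht => (hl t ht).2.1.mono_left (hsub t)⟩,
    ⟨fun t ht => (hm t ht).2.2, fun t ht => (hl t ht).2.2.mono_left (hsub t)⟩⟩

theorem L2Cont.radial (hG : L2Cont (𝓛 (closedBall x₀ r)) G a b) :
    L2Cont (𝓛 (closedBall x₀ r)) (fun t x => radial x₀ G (t, x)) a b := by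
  have hb : ∀ᵐ x ∂(volume : Measure (Sp N)).restrict (closedBall x₀ r), ‖x - x₀‖ ≤ r := by
    filter_upwards [ae_restrict_mem isClosed_closedBall.measurableSet] with x hx
    simpa [dist_eq_norm] using hx
  refine hG.of_le (C := r) (fun t ht => ?_) ?_
  · refine ((hG.mem t ht).norm.const_mul r).mono ((hG.mem t ht).1.inner
      (Continuous.aestronglyMeasurable (by fun_prop))) ?_
    filter_upwards [hb] with x hx
    have h1 : |PerturbedWave.radial x₀ G (t, x)| ≤ ‖G t x‖ * ‖x - x₀‖ := abs_real_inner_le_norm _ _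
    rw [norm_eq_abs, norm_eq_abs]
    refine h1.trans ((mul_le_mul_of_nonneg_left hx (norm_nonneg _)).trans ?_)
    rw [mul_comm]
    exact le_abs_self _
  · filter_upwards [hb] with x hx s t
    have h1 : PerturbedWave.radial x₀ G (s, x) - PerturbedWave.radial x₀ G (t, x)
        = inner ℝ (G s x - G t x) (x - x₀) := by
      simp only [PerturbedWave.radial, inner_sub_left]
    rw [h1, mul_comm]
    exact (abs_real_inner_le_norm _ _).trans (mul_le_mul_of_nonneg_left hx (norm_nonneg _))

theorem L2Cont.norm (hG : L2Cont (𝓛 (closedBall x₀ r)) G a b) :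
    L2Cont (𝓛 (closedBall x₀ r)) (fun t x => ‖G t x‖) a b :=
  hG.of_le (C := 1) (fun t ht => (hG.mem t ht).norm) (.of_forall fun x s t => by
    rw [one_mul]; exact abs_norm_sub_norm_le _ _)

theorem L2Cont.truncPrim (hu : L2Cont (𝓛 (closedBall x₀ r)) u a b)
    {φ : ℝ → ℝ} (hφ : Continuous φ) {k K : ℝ} (hK : ∀ a, |φ (clamp k a)| ≤ K) :
    L2Cont (𝓛 (closedBall x₀ r)) (fun t x => truncPrim φ k (u t x)) a b := by
  have hl := lipschitz_truncPrim hφ hK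
  have hc : Continuous (PerturbedWave.truncPrim φ k) :=
    continuous_iff_continuousAt.2 fun a => (hasDerivAt_truncPrim hφ k a).continuousAt
  refine hu.of_le (C := K) (fun t ht => ?_) (.of_forall fun x s t => hl _ _)
  refine ((hu.mem t ht).const_mul K).mono (hc.comp_aestronglyMeasurable (hu.mem t ht).1)
    (.of_forall fun x => ?_)
  have h1 := hl (u t x) 0
  rw [truncPrim_zero, sub_zero, sub_zero] at h1
  rw [norm_mul, norm_eq_abs, norm_eq_abs, norm_eq_abs]
  exact h1.trans (mul_le_mul_of_nonneg_right (le_abs_self K) (abs_nonneg _))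

/-- The velocity `wₛ` in similarity variables, up to a power of `T₀ - t`. -/
def wvel (β T₀ : ℝ) (x₀ : Sp N) (u v : ℝ → Sp N → ℝ) (G : ℝ → Sp N → Sp N) (z : ℝ × Sp N) : ℝ :=
  scal T₀ x₀ v G z - β * u z.1 z.2

theorem L2Cont.wvel (hu : L2Cont (𝓛 (closedBall x₀ r)) u a b)
    (hv : L2Cont (𝓛 (closedBall x₀ r)) v a b)
    (hG : L2Cont (𝓛 (closedBall x₀ r)) G a b) (β T₀ : ℝ) :
    L2Cont (𝓛 (closedBall x₀ r))
      (fun t x => wvel β T₀ x₀ u v G (t, x)) a b :=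
  ((hv.mul_time (c := fun t => T₀ - t) (by fun_prop)).sub hG.radial).sub
    (hu.mul_time (c := fun _ => β) continuousOn_const)

/-- The weight of the energy. -/
def coneW (α T₀ : ℝ) (x₀ : Sp N) (z : ℝ × Sp N) : ℝ := posW α (rvar T₀ x₀ z)

theorem rvar_le_one (T₀ : ℝ) (x₀ : Sp N) (z : ℝ × Sp N) : rvar T₀ x₀ z ≤ 1 := by
  rw [rvar]
  have : 0 ≤ ‖z.2 - x₀‖ ^ 2 / (T₀ - z.1) ^ 2 := by positivity
  linarith

theorem continuousOn_rvar : ContinuousOn (rvar T₀ x₀) {z | z.1 < T₀} := fun z hz =>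
  (contDiffAt_rvar (x₀ := x₀) hz).continuousAt.continuousWithinAt

theorem measurable_rvar : Measurable (rvar T₀ x₀ : ℝ × Sp N → ℝ) := by
  unfold rvar
  fun_prop

theorem abs_coneW_le (hα : 0 < α) (z : ℝ × Sp N) : |coneW α T₀ x₀ z| ≤ 1 := by
  rw [coneW, abs_of_nonneg posW_nonneg]
  exact posW_le_one hα (rvar_le_one _ _ _)

theorem coneW_nonneg {z : ℝ × Sp N} : 0 ≤ coneW α T₀ x₀ z := posW_nonneg (r := rvar T₀ x₀ z)

theorem measurable_coneW (hα : 0 < α) : Measurable (coneW α T₀ x₀ : ℝ × Sp N → ℝ) :=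
  (continuous_posW hα).measurable.comp measurable_rvar

theorem continuousOn_coneW (hα : 0 < α) (hb : b < T₀) (x : Sp N) :
    ContinuousOn (fun t => coneW α T₀ x₀ (t, x)) (Icc a b) :=
  (continuous_posW hα).comp_continuousOn (continuousOn_rvar.comp (by fun_prop)
    fun _ ht => lt_of_le_of_lt ht.2 hb)

theorem coneW_eq_zero (hα : 0 < α) {z : ℝ × Sp N} (hz : z.1 < T₀) (h : T₀ - z.1 ≤ ‖z.2 - x₀‖) :
    coneW α T₀ x₀ z = 0 := by
  refine posW_of_nonpos hα ?_
  have h1 : 0 < T₀ - z.1 := by linarith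
  rw [rvar, sub_nonpos, one_le_div (by positivity)]
  gcongr

theorem continuousOn_rpow_sub (hb : b < T₀) (k : ℝ) :
    ContinuousOn (fun t => (T₀ - t) ^ k) (Icc a b) :=
  ContinuousOn.rpow_const (by fun_prop) fun t ht => Or.inl (by linarith [ht.2])

theorem continuousOn_rpow_sub_div (hb : b < T₀) (k : ℝ) :
    ContinuousOn (fun t => (T₀ - t) ^ k / (T₀ - t)) (Icc a b) :=
  (continuousOn_rpow_sub hb k).div (by fun_prop) fun t ht => by
    have := ht.2
    exact ne_of_gt (by linarith)

theorem integrable_time_mul {w : ℝ × Sp N → ℝ} {c : ℝ → ℝ} (hc : ContinuousOn c (Icc a b))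
    (hw : Integrable w (𝓛 (cyl a b x₀ r))) :
    Integrable (fun z => c z.1 * w z) (𝓛 (cyl a b x₀ r)) := by
  obtain ⟨C, hC⟩ := isCompact_Icc.exists_bound_of_continuousOn hc
  have h1 : ContinuousOn (fun z : ℝ × Sp N => c z.1) (cyl a b x₀ r) :=
    hc.comp continuousOn_fst fun z hz => hz.1
  refine hw.bdd_mul (c := C) (h1.aestronglyMeasurable (measurableSet_cyl a b x₀ r)) ?_
  filter_upwards [ae_restrict_mem (measurableSet_cyl a b x₀ r)] with z hz
  exact hC _ hz.1

theorem integral_cyl_split {X Y : ℝ × Sp N → ℝ} {c d : ℝ → ℝ} (hc : ContinuousOn c (Icc a b))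
    (hd : ContinuousOn d (Icc a b)) (hX : Integrable X (𝓛 (cyl a b x₀ r)))
    (hY : Integrable Y (𝓛 (cyl a b x₀ r))) :
    ∫ z in cyl a b x₀ r, (c z.1 * X z + d z.1 * Y z)
      = ∫ t in Icc a b, (c t * (∫ x in closedBall x₀ r, X (t, x))
        + d t * ∫ x in closedBall x₀ r, Y (t, x)) := by
  have hI := (integrable_time_mul hc hX).add (integrable_time_mul hd hY)
  rw [restrict_cyl] at *
  refine (integral_prod _ hI).trans (integral_congr_ae ?_)
  filter_upwards [hX.prod_right_ae, hY.prod_right_ae] with t h1 h2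
  rw [← integral_const_mul, ← integral_const_mul]
  exact integral_add (h1.const_mul (c t)) (h2.const_mul (d t))

theorem integrableOn_slice {X : ℝ × Sp N → ℝ} (hX : Integrable X (𝓛 (cyl a b x₀ r))) :
    IntegrableOn (fun t => ∫ x in closedBall x₀ r, X (t, x)) (Icc a b) := by
  rw [restrict_cyl] at hX
  exact hX.integral_prod_left

theorem ae_integrable_slice {X : ℝ × Sp N → ℝ}
    (hX : Integrable X (𝓛 (cyl a b x₀ r))) :
    ∀ᵐ t ∂(𝓛 (Icc a b)),
      Integrable (fun x => X (t, x)) (𝓛 (closedBall x₀ r)) := by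
  rw [restrict_cyl] at hX
  exact hX.prod_right_ae

theorem IsTest.zero_of_notMem {ϑ : ℝ → ℝ} (h : IsTest (Ioo a b) ϑ) {t : ℝ}
    (ht : t ∉ Icc a b) : ϑ t = 0 :=
  image_eq_zero_of_notMem_tsupport fun h1 => ht (Set.Ioo_subset_Icc_self (h.supp h1))

theorem rvar_nonpos {z : ℝ × Sp N} (hz : z.1 < T₀) (h : T₀ - z.1 ≤ ‖z.2 - x₀‖) :
    rvar T₀ x₀ z ≤ 0 := by
  have h1 : 0 < T₀ - z.1 := by linarith
  rw [rvar, sub_nonpos, one_le_div (by positivity)]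
  gcongr

theorem integral_coneW_eq_zero {m : Measure (ℝ × Sp N)} {α : ℝ} (hα0 : 0 < α) {Y : ℝ × Sp N → ℝ}
    (hY : Integrable Y m) (h : ∀ ε, 0 < ε → ∫ z, kap α ε (rvar T₀ x₀ z) * Y z ∂m = 0) :
    ∫ z, coneW α T₀ x₀ z * Y z ∂m = 0 := by
  have hε0 : ∀ n : ℕ, (0 : ℝ) < 1 / (n + 1) := fun n => by positivity
  have hlim := tendsto_integral_of_dominated_convergence (G := ℝ) (μ := m)
    (F := fun (n : ℕ) z => kap α (1 / (n + 1)) (rvar T₀ x₀ z) * Y z)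
    (f := fun z => coneW α T₀ x₀ z * Y z)
    _ (fun n => ((isProfile_kap (α := α) (hε0 n)).smooth.continuous.measurable.comp
      measurable_rvar).aestronglyMeasurable.mul hY.1) hY.norm (fun n => .of_forall fun z => by
        rw [norm_mul, norm_of_nonneg (kap_nonneg (hε0 n))]
        exact mul_le_of_le_one_left (norm_nonneg _) ((kap_le_posW (hε0 n)).trans
          (posW_le_one hα0 (rvar_le_one _ _ _))))
    (.of_forall fun z => (tendsto_kap hα0 hε0
      tendsto_one_div_add_atTop_nhds_zero_nat _).mul_const _)
  simp only [h _ (hε0 _)] at hlim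
  exact tendsto_nhds_unique hlim tendsto_const_nhds

namespace OnCone

variable (H : OnCone p f g T u₀ u₁ u v G T₀ a b x₀)
include H

/-- Outside the cylinder, cone test functions vanish. -/
theorem zero_or_rvar {ϑ : ℝ → ℝ} (hϑ : IsTest (Ioo a b) ϑ) {z : ℝ × Sp N}
    (hz : z ∉ cyl a b x₀ (T₀ - a)) : (ϑ z.1 = 0 ∧ deriv ϑ z.1 = 0) ∨ rvar T₀ x₀ z ≤ 0 := by
  by_cases ht : z.1 ∈ Icc a b
  · right
    have h1 : z.1 < T₀ := ht.2.trans_lt H.lt_vertex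
    refine rvar_nonpos h1 ?_
    have h2 : z.2 ∉ closedBall x₀ (T₀ - a) := fun h => hz ⟨ht, h⟩
    rw [mem_closedBall, dist_eq_norm, not_le] at h2
    linarith [ht.1]
  · exact Or.inl ⟨hϑ.zero_of_notMem ht, hϑ.deriv.zero_of_notMem ht⟩

theorem growth_scal : Integrable (fun z : ℝ × Sp N => (1 + |u z.1 z.2| ^ p) * |scal T₀ x₀ v G z|)
    (𝓛 (cyl a b x₀ (T₀ - a))) := by
  have hp : 0 ≤ p := by linarith [H.one_lt]
  obtain ⟨C, hC⟩ := (isCompact_cyl a b x₀ (T₀ - a)).exists_bound_of_continuousOn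
    (f := fun z : ℝ × Sp N => (T₀, x₀) - z) (by fun_prop)
  have hm : AEStronglyMeasurable (fun z : ℝ × Sp N => 1 + |u z.1 z.2| ^ p)
      (𝓛 (cyl a b x₀ (T₀ - a))) :=
    (continuous_const.add (continuous_abs.rpow_const fun _ => Or.inr hp)).comp_aestronglyMeasurable
      H.int.memU.1
  refine ((H.pow.growth_D hp H.int).mul_const C).mono' (hm.mul (H.int.memLp_scal T₀).1.norm) ?_
  filter_upwards [ae_restrict_mem (measurableSet_cyl a b x₀ (T₀ - a))] with z hz
  have h1 : |scal T₀ x₀ v G z| ≤ ‖dual (v z.1 z.2) (G z.1 z.2)‖ * C := by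
    rw [← dual_scal]
    exact (dual (v z.1 z.2) (G z.1 z.2)).le_of_opNorm_le_of_le le_rfl (hC z hz)
  have h2 : 0 ≤ 1 + |u z.1 z.2| ^ p := by positivity
  rw [norm_of_nonneg (by positivity), mul_assoc]
  exact mul_le_mul_of_nonneg_left h1 h2

theorem integrable_prim {C : ℝ} {Φ φ : ℝ → ℝ} (hΦ : IsPrimitive p C Φ φ) :
    Integrable (fun z : ℝ × Sp N => Φ (u z.1 z.2)) (𝓛 (cyl a b x₀ (T₀ - a))) := by
  refine ((H.pow.growth_u H.int).const_mul C).mono' (hΦ.continuous.comp_aestronglyMeasurable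
    H.int.memU.1) (.of_forall fun z => hΦ.bound' (by linarith [H.one_lt]) _)

theorem integrable_prim_scal {C : ℝ} {Φ φ : ℝ → ℝ} (hΦ : IsPrimitive p C Φ φ) :
    Integrable (fun z : ℝ × Sp N => φ (u z.1 z.2) * scal T₀ x₀ v G z)
      (𝓛 (cyl a b x₀ (T₀ - a))) := by
  refine (H.growth_scal.const_mul C).mono' ((hΦ.cont.comp_aestronglyMeasurable
    H.int.memU.1).mul (H.int.memLp_scal T₀).1) (.of_forall fun z => ?_)
  rw [norm_mul, ← mul_assoc]
  exact mul_le_mul_of_nonneg_right (hΦ.bound _) (abs_nonneg _)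

theorem integrable_coneW_mul (hα0 : 0 < α) {w : ℝ × Sp N → ℝ}
    (hw : Integrable w (𝓛 (cyl a b x₀ (T₀ - a)))) :
    Integrable (fun z => coneW α T₀ x₀ z * w z) (𝓛 (cyl a b x₀ (T₀ - a))) :=
  hw.bdd_mul (c := 1) (measurable_coneW hα0).aestronglyMeasurable
    (.of_forall fun z => abs_coneW_le hα0 z)

/-- The balance of the potential energy in the light cone. -/
theorem potential_balance (hα0 : 0 < α) (hα : 2 * α = 2 * β - (N - 1)) {C : ℝ} {Φ φ : ℝ → ℝ}
    (hΦ : IsPrimitive p C Φ φ) {ϑ : ℝ → ℝ} (hϑ : IsTest (Ioo a b) ϑ) :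
    ∫ t in Icc a b, (deriv ϑ t *
        (∫ x in closedBall x₀ (T₀ - a), (T₀ - t) ^ (2 * α - 1) * (T₀ - t) ^ 2
          * coneW α T₀ x₀ (t, x) * Φ (u t x))
      + ϑ t * ∫ x in closedBall x₀ (T₀ - a), (T₀ - t) ^ (2 * α - 1) / (T₀ - t)
          * (T₀ - t) ^ 2 * coneW α T₀ x₀ (t, x)
          * (φ (u t x) * scal T₀ x₀ v G (t, x) - (2 * β + 2) * Φ (u t x))) = 0 := by
  have c1 : ContinuousOn (fun t => (T₀ - t) ^ (2 * α - 1) * (T₀ - t) ^ 2) (Icc a b) :=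
    (continuousOn_rpow_sub H.lt_vertex _).mul (by fun_prop)
  have c2 : ContinuousOn (fun t => (T₀ - t) ^ (2 * α - 1) / (T₀ - t) * (T₀ - t) ^ 2)
      (Icc a b) := (continuousOn_rpow_sub_div H.lt_vertex _).mul (by fun_prop)
  have j1 := H.integrable_prim hΦ
  have j2 := (H.integrable_prim_scal hΦ).sub (j1.const_mul (2 * β + 2))
  have i1 := integrable_time_mul c1 j1
  have i2 := integrable_time_mul c2 j2
  have d1 : ContinuousOn (deriv ϑ) (Icc a b) := hϑ.deriv.smooth.continuous.continuousOn
  have d2 : ContinuousOn ϑ (Icc a b) := hϑ.smooth.continuous.continuousOn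
  have iY := (integrable_time_mul d1 i1).add (integrable_time_mul d2 i2)
  have h0 := integral_coneW_eq_zero (T₀ := T₀) (x₀ := x₀) hα0 iY fun ε hε => by
    have h1 := (H.potential_identity hα hΦ hϑ (isProfile_kap (α := α) hε)).integral
    have h2 := (setIntegral_eq_integral_of_forall_compl_eq_zero (s := cyl a b x₀ (T₀ - a))
      fun z hz => ?_).trans h1
    · rw [← h2]
      refine integral_congr_ae (.of_forall fun z => ?_)
      simp only [Pi.add_apply, Pi.sub_apply]
      ring
    · rcases H.zero_or_rvar hϑ hz with ⟨h, h'⟩ | h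
      · rw [h, h']; ring
      · rw [kap_of_le hε (h.trans hε.le)]; ring
  have k1 := H.integrable_coneW_mul hα0 i1
  have k2 := H.integrable_coneW_mul hα0 i2
  rw [← h0]
  refine Eq.trans ?_ ((integral_cyl_split d1 d2 k1 k2).symm.trans ?_)
  · refine integral_congr_ae (.of_forall fun t => ?_)
    beta_reduce
    congr 2
    · refine integral_congr_ae (.of_forall fun x => ?_)
      beta_reduce
      ring
    · refine integral_congr_ae (.of_forall fun x => ?_)
      simp only [Pi.sub_apply]
      ring
  · refine integral_congr_ae (.of_forall fun z => ?_)
    simp only [Pi.add_apply, Pi.sub_apply]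
    ring

/-- The potential energy in the light cone. -/
def _root_.PerturbedWave.coneInt (α T₀ a : ℝ) (x₀ : Sp N) (Φ : ℝ → ℝ) (u : ℝ → Sp N → ℝ) (t : ℝ) :
    ℝ :=
  ∫ x in closedBall x₀ (T₀ - a),
    (T₀ - t) ^ (2 * α - 1) * (T₀ - t) ^ 2 * coneW α T₀ x₀ (t, x) * Φ (u t x)

theorem isPrimitive_trunc {C : ℝ} {Φ φ : ℝ → ℝ} (hΦ : IsPrimitive p C Φ φ) {k : ℝ} (hk : 0 ≤ k) :
    IsPrimitive p C (truncPrim φ k) fun x => φ (clamp k x) where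
  deriv := hasDerivAt_truncPrim hΦ.cont k
  cont := hΦ.cont.comp (continuous_clamp k)
  zero := truncPrim_zero φ k
  nonneg := hΦ.nonneg
  bound := abs_trunc_le (by linarith [H.one_lt]) hΦ.nonneg hΦ.bound hk

theorem l2 : L2Cont (𝓛 (closedBall x₀ (T₀ - a))) u a b ∧
      L2Cont (𝓛 (closedBall x₀ (T₀ - a))) G a b ∧
      L2Cont (𝓛 (closedBall x₀ (T₀ - a))) v a b :=
  H.sol.l2Cont H.below

theorem finite_ball :
    IsFiniteMeasure ((volume : Measure (Sp N)).restrict (closedBall x₀ (T₀ - a))) :=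
  ⟨by rw [Measure.restrict_apply_univ]; exact (isCompact_closedBall _ _).measure_lt_top⟩

theorem continuousOn_weighted {c : ℝ → ℝ} (hα0 : 0 < α) (hc : ContinuousOn c (Icc a b))
    {k l : ℝ → Sp N → ℝ}
    (hk : L2Cont (𝓛 (closedBall x₀ (T₀ - a))) k a b)
    (hl : L2Cont (𝓛 (closedBall x₀ (T₀ - a))) l a b) :
    ContinuousOn (fun t => ∫ x in closedBall x₀ (T₀ - a),
      c t * coneW α T₀ x₀ (t, x) * (k t x * l t x)) (Icc a b) := by
  obtain ⟨C, hC⟩ := isCompact_Icc.exists_bound_of_continuousOn hc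
  have hC0 : 0 ≤ C := (norm_nonneg _).trans (hC a ⟨le_rfl, H.lt.le⟩)
  refine hk.continuousOn_integral hl hC0 (fun t _ => ?_) (fun t ht => .of_forall fun x => ?_)
    (.of_forall fun x => ?_)
  · exact (((measurable_coneW hα0).comp measurable_prodMk_left).const_mul _).aestronglyMeasurable
  · rw [abs_mul]
    have h1 := hC t ht
    rw [norm_eq_abs] at h1
    calc |c t| * |coneW α T₀ x₀ (t, x)| ≤ C * 1 :=
          mul_le_mul h1 (abs_coneW_le hα0 _) (abs_nonneg _) hC0
      _ = C := mul_one C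
  · exact hc.mul (continuousOn_coneW hα0 H.lt_vertex x)

theorem continuousOn_coneInt_trunc (hα0 : 0 < α) {C : ℝ} {Φ φ : ℝ → ℝ} (hΦ : IsPrimitive p C Φ φ)
    {k : ℝ} (hk : 0 ≤ k) :
    ContinuousOn (coneInt α T₀ a x₀ (truncPrim φ k) u) (Icc a b) := by
  have hfin := H.finite_ball
  have h1 := H.l2.1.truncPrim hΦ.cont
    (abs_trunc_le_const (by linarith [H.one_lt]) hΦ.nonneg hΦ.bound hk)
  have h2 := H.continuousOn_weighted hα0 (c := fun t => (T₀ - t) ^ (2 * α - 1) * (T₀ - t) ^ 2)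
    ((continuousOn_rpow_sub H.lt_vertex _).mul (by fun_prop)) h1 (L2Cont.const 1)
  simp only [mul_one] at h2
  exact h2

theorem coneInt_trunc_bound (hα0 : 0 < α) (hα : 2 * α = 2 * β - (N - 1)) {C : ℝ} {Φ φ : ℝ → ℝ}
    (hΦ : IsPrimitive p C Φ φ) : ∃ s : ℝ → ℝ, IntegrableOn s (Icc a b) ∧ ∀ k : ℝ, 0 ≤ k →
      ∀ t₁ t₂, a ≤ t₁ → t₁ ≤ t₂ → t₂ ≤ b → |coneInt α T₀ a x₀ (truncPrim φ k) u t₂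
        - coneInt α T₀ a x₀ (truncPrim φ k) u t₁| ≤ ∫ t in t₁..t₂, s t := by
  have hp : 0 ≤ p := by linarith [H.one_lt]
  have c2 : ContinuousOn (fun t => (T₀ - t) ^ (2 * α - 1) / (T₀ - t) * (T₀ - t) ^ 2)
      (Icc a b) := (continuousOn_rpow_sub_div H.lt_vertex _).mul (by fun_prop)
  have j := (H.growth_scal.const_mul C).add
    ((H.pow.growth_u H.int).const_mul (|2 * β + 2| * C))
  have js := integrable_time_mul c2 j
  refine ⟨fun t => ∫ x in closedBall x₀ (T₀ - a), _, integrableOn_slice js,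
    fun k hk t₁ t₂ h1 h12 h2 => ?_⟩
  have hΦk := H.isPrimitive_trunc hΦ hk
  have j2 := (H.integrable_prim_scal hΦk).sub ((H.integrable_prim hΦk).const_mul (2 * β + 2))
  have k2 := H.integrable_coneW_mul hα0 (integrable_time_mul c2 j2)
  have hint : IntegrableOn (fun t => ∫ x in closedBall x₀ (T₀ - a),
      (T₀ - t) ^ (2 * α - 1) / (T₀ - t)
          * (T₀ - t) ^ 2 * coneW α T₀ x₀ (t, x)
          * (φ (clamp k (u t x)) * scal T₀ x₀ v G (t, x) - (2 * β + 2) * truncPrim φ k (u t x)))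
      (Icc a b) := by
    refine (integrableOn_slice k2).congr (.of_forall fun t => ?_)
    refine integral_congr_ae (.of_forall fun x => ?_)
    simp only [Pi.sub_apply]
    ring
  have heq := eq_of_forall_test (H.continuousOn_coneInt_trunc hα0 hΦ hk) hint
    (fun θ hθ => H.potential_balance hα0 hα hΦk hθ) h1 h12 h2
  rw [heq, ← norm_eq_abs]
  have hsub : Set.Ioc t₁ t₂ ⊆ Icc a b := fun t ht => ⟨h1.trans ht.1.le, ht.2.trans h2⟩
  refine intervalIntegral.norm_integral_le_of_norm_le h12 ?_
    ((intervalIntegrable_iff_integrableOn_Ioc_of_le h12).2 ((integrableOn_slice js).mono_set hsub))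
  have hae := ae_integrable_slice js
  rw [ae_restrict_iff' measurableSet_Icc] at hae
  filter_upwards [hae] with t ht htI
  refine norm_integral_le_of_norm_le (ht (hsub htI)) (.of_forall fun x => ?_)
  have htT : 0 < T₀ - t := by linarith [(hsub htI).2, H.lt_vertex]
  have hP : 0 ≤ (T₀ - t) ^ (2 * α - 1) / (T₀ - t) * (T₀ - t) ^ 2 := by positivity
  have b1 := hΦk.bound (u t x)
  have b2 := hΦk.bound' hp (u t x)
  simp only [Pi.add_apply]
  rw [norm_mul, norm_mul, norm_of_nonneg hP, norm_eq_abs (coneW _ _ _ _), mul_assoc]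
  refine mul_le_mul_of_nonneg_left ?_ hP
  refine (mul_le_of_le_one_left (norm_nonneg _) (abs_coneW_le hα0 _)).trans ?_
  refine (norm_sub_le _ _).trans ?_
  rw [norm_mul, norm_mul, norm_eq_abs, norm_eq_abs, norm_eq_abs, norm_eq_abs]
  refine add_le_add ?_ ?_
  · rw [← mul_assoc]; exact mul_le_mul_of_nonneg_right b1 (abs_nonneg _)
  · rw [mul_assoc]; exact mul_le_mul_of_nonneg_left b2 (abs_nonneg _)

end OnCone

theorem truncPrim_nonneg {φ : ℝ → ℝ} (h1 : ∀ a, 0 ≤ a → 0 ≤ φ a) (h2 : ∀ a, a ≤ 0 → φ a ≤ 0) {k : ℝ}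
    (hk : 0 ≤ k) (a : ℝ) : 0 ≤ truncPrim φ k a := by
  rcases le_total 0 a with h | h
  · refine intervalIntegral.integral_nonneg h fun x hx => h1 _ ?_
    exact le_max_of_le_right (le_min hk hx.1)
  · rw [truncPrim, intervalIntegral.integral_symm, ← intervalIntegral.integral_neg]
    refine intervalIntegral.integral_nonneg h fun x hx => neg_nonneg.2 (h2 _ ?_)
    exact max_le (by linarith) ((min_le_right _ _).trans hx.2)

theorem tendsto_truncPrim {p C : ℝ} {Φ φ : ℝ → ℝ} (hΦ : IsPrimitive p C Φ φ) (a : ℝ) :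
    Tendsto (fun n : ℕ => truncPrim φ n a) atTop (𝓝 (Φ a)) := by
  refine tendsto_const_nhds.congr' ?_
  filter_upwards [tendsto_natCast_atTop_atTop.eventually_ge_atTop |a|] with n hn
  exact (truncPrim_eq hΦ.deriv hΦ.cont hΦ.zero hn).symm

/-- Fatou's lemma for functions with bounded integrals. -/
theorem integrable_of_tendsto_of_bound {X : Type*} [MeasurableSpace X] {m : Measure X}
    {F : ℕ → X → ℝ} {f : X → ℝ} (h0 : ∀ n x, 0 ≤ F n x) (hi : ∀ n, Integrable (F n) m)
    (hlim : ∀ x, Tendsto (fun n => F n x) atTop (𝓝 (f x))) {B : ℝ} (hB : ∀ n, ∫ x, F n x ∂m ≤ B) :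
    Integrable f m := by
  have hf0 : ∀ x, 0 ≤ f x := fun x => ge_of_tendsto' (hlim x) fun n => h0 n x
  refine ⟨aestronglyMeasurable_of_tendsto_ae atTop (fun n => (hi n).1) (.of_forall hlim), ?_⟩
  rw [hasFiniteIntegral_iff_ofReal (.of_forall hf0)]
  have h1 : ∀ x, liminf (fun n => ofReal (F n x)) atTop = ofReal (f x) := fun x =>
    ((ENNReal.continuous_ofReal.tendsto _).comp (hlim x)).liminf_eq
  calc ∫⁻ x, ofReal (f x) ∂m = ∫⁻ x, liminf (fun n => ofReal (F n x)) atTop ∂m := by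
        simp only [h1]
    _ ≤ liminf (fun n => ∫⁻ x, ofReal (F n x) ∂m) atTop :=
        lintegral_liminf_le' fun n => (hi n).1.aemeasurable.ennreal_ofReal
    _ ≤ ofReal B := by
        refine liminf_le_of_frequently_le' (Eventually.frequently (.of_forall fun n => ?_))
        rw [← ofReal_integral_eq_lintegral_ofReal (hi n) (.of_forall (h0 n))]
        exact ENNReal.ofReal_le_ofReal (hB n)
    _ < ⊤ := ENNReal.ofReal_lt_top

namespace OnCone

variable (H : OnCone p f g T u₀ u₁ u v G T₀ a b x₀)
include H

theorem exists_mem_of_ae {P : ℝ → Prop} (h : ∀ᵐ t ∂(𝓛 (Icc a b)), P t) :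
    ∃ t ∈ Icc a b, P t := by
  have h1 : (volume : Measure ℝ).restrict (Icc a b) ≠ 0 := by
    rw [Ne, Measure.restrict_eq_zero, Real.volume_Icc, ENNReal.ofReal_eq_zero, not_le]
    linarith [H.lt]
  have := ae_neBot.2 h1
  obtain ⟨t, ht, ht'⟩ := ((ae_restrict_mem measurableSet_Icc).and h).exists
  exact ⟨t, ht, ht'⟩

theorem integrable_slice_trunc (hα0 : 0 < α) {C : ℝ} {Φ φ : ℝ → ℝ} (hΦ : IsPrimitive p C Φ φ)
    {k : ℝ} (hk : 0 ≤ k) {t : ℝ} (ht : t ∈ Icc a b) (c : ℝ) :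
    Integrable (fun x => c * coneW α T₀ x₀ (t, x) * truncPrim φ k (u t x))
      (𝓛 (closedBall x₀ (T₀ - a))) := by
  have hfin := H.finite_ball
  have h1 := (H.l2.1.truncPrim hΦ.cont
    (abs_trunc_le_const (by linarith [H.one_lt]) hΦ.nonneg hΦ.bound hk)).mem t ht
  refine (h1.integrable (by norm_num)).bdd_mul (c := |c|) ((((measurable_coneW hα0).comp
    measurable_prodMk_left).const_mul _).aestronglyMeasurable) (.of_forall fun x => ?_)
  rw [norm_mul, norm_eq_abs]
  exact mul_le_of_le_one_right (abs_nonneg _) (abs_coneW_le hα0 _)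

/-- The power `|u|^{p+1}` is integrable in the light cone at every time. -/
theorem integrable_slice_pow (hα0 : 0 < α) (hα : 2 * α = 2 * β - (N - 1)) {t : ℝ}
    (ht : t ∈ Icc a b) :
    Integrable (fun x => coneW α T₀ x₀ (t, x) * ((1 + |u t x| ^ p) * |u t x|))
      (𝓛 (closedBall x₀ (T₀ - a))) := by
  have hfin := H.finite_ball
  have hp := H.one_lt
  have hΦ := isPrimitive_rpow hp
  obtain ⟨s, hs, hb⟩ := H.coneInt_trunc_bound hα0 hα hΦ
  obtain ⟨t', ht', hi⟩ := H.exists_mem_of_ae (ae_integrable_slice (H.pow.growth_u H.int))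
  have hτ : ∀ t ∈ Icc a b, 0 < (T₀ - t) ^ (2 * α - 1) * (T₀ - t) ^ 2 := fun t ht => by
    have : 0 < T₀ - t := by linarith [ht.2, H.lt_vertex]
    positivity
  set φ : ℝ → ℝ := fun x => |x| ^ (p - 1) * x
  have hB : ∃ B, ∀ n : ℕ, coneInt α T₀ a x₀ (truncPrim φ n) u t ≤ B := by
    refine ⟨(∫ x in closedBall x₀ (T₀ - a), (T₀ - t') ^ (2 * α - 1) * (T₀ - t') ^ 2
      * (1 * ((1 + |u t' x| ^ p) * |u t' x|))) + (|∫ x in t..t', s x| + |∫ x in t'..t, s x|),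
      fun n => ?_⟩
    have h1 : ‖coneInt α T₀ a x₀ (truncPrim φ n) u t'‖ ≤ _ :=
      norm_integral_le_of_norm_le ((hi.const_mul 1).const_mul
        ((T₀ - t') ^ (2 * α - 1) * (T₀ - t') ^ 2)) (.of_forall fun x => by
          rw [norm_mul, norm_mul, norm_of_nonneg (hτ t' ht').le, mul_assoc]
          refine mul_le_mul_of_nonneg_left ?_ (hτ t' ht').le
          exact (mul_le_of_le_one_left (norm_nonneg _) (abs_coneW_le hα0 _)).trans
            (abs_truncPrim_le (by linarith) zero_le_one hΦ.bound n.cast_nonneg _))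
    have h2 : |coneInt α T₀ a x₀ (truncPrim φ n) u t - coneInt α T₀ a x₀ (truncPrim φ n) u t'|
        ≤ |∫ x in t..t', s x| + |∫ x in t'..t, s x| := by
      rcases le_total t t' with h | h
      · rw [abs_sub_comm]
        have := hb n n.cast_nonneg t t' ht.1 h ht'.2
        linarith [le_abs_self (∫ x in t..t', s x), abs_nonneg (∫ x in t'..t, s x)]
      · have := hb n n.cast_nonneg t' t ht'.1 h ht.2
        linarith [le_abs_self (∫ x in t'..t, s x), abs_nonneg (∫ x in t..t', s x)]
    have h3 := (le_abs_self _).trans h2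
    have h4 := (le_abs_self _).trans h1
    linarith
  obtain ⟨B, hB⟩ := hB
  have key : Integrable (fun x => (T₀ - t) ^ (2 * α - 1) * (T₀ - t) ^ 2 * coneW α T₀ x₀ (t, x)
      * (1 / (p + 1) * |u t x| ^ (p + 1))) (𝓛 (closedBall x₀ (T₀ - a))) := by
    refine integrable_of_tendsto_of_bound (fun n x => ?_)
      (fun n : ℕ => H.integrable_slice_trunc hα0 hΦ n.cast_nonneg ht _)
      (fun x => (tendsto_truncPrim hΦ (u t x)).const_mul _) hB
    refine mul_nonneg (mul_nonneg (hτ t ht).le coneW_nonneg) (truncPrim_nonneg ?_ ?_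
      n.cast_nonneg _)
    · intro c hc; positivity
    · intro c hc; exact mul_nonpos_of_nonneg_of_nonpos (by positivity) hc
  have h1 := (H.l2.1.mem t ht).integrable (by norm_num)
  have h2 : Integrable (fun x => coneW α T₀ x₀ (t, x) * ‖u t x‖)
      (𝓛 (closedBall x₀ (T₀ - a))) :=
    h1.norm.bdd_mul (c := 1) ((measurable_coneW hα0).comp
      measurable_prodMk_left).aestronglyMeasurable (.of_forall fun x => abs_coneW_le hα0 _)
  refine (h2.add (key.const_mul ((p + 1) / ((T₀ - t) ^ (2 * α - 1) * (T₀ - t) ^ 2)))).congr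
    (.of_forall fun x => ?_)
  have e1 : |u t x| ^ (p + 1) = |u t x| ^ p * |u t x| := by
    rw [Real.rpow_add_of_nonneg (abs_nonneg _) (by linarith) zero_le_one, Real.rpow_one]
  have e2 := (hτ t ht).ne'
  simp only [Pi.add_apply, norm_eq_abs]
  rw [e1]
  generalize (T₀ - t) ^ (2 * α - 1) * (T₀ - t) ^ 2 = c at *
  have e3 : p + 1 ≠ 0 := by linarith
  field_simp

theorem integrable_slice_prim (hα0 : 0 < α) (hα : 2 * α = 2 * β - (N - 1)) {C : ℝ} {Φ φ : ℝ → ℝ}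
    (hΦ : IsPrimitive p C Φ φ) {t : ℝ} (ht : t ∈ Icc a b) :
    Integrable (fun x => coneW α T₀ x₀ (t, x) * Φ (u t x))
      (𝓛 (closedBall x₀ (T₀ - a))) := by
  refine ((H.integrable_slice_pow hα0 hα ht).const_mul C).mono' (((measurable_coneW hα0).comp
    measurable_prodMk_left).aestronglyMeasurable.mul (hΦ.continuous.comp_aestronglyMeasurable
      (H.l2.1.mem t ht).1)) (.of_forall fun x => ?_)
  rw [norm_mul, norm_of_nonneg coneW_nonneg, mul_left_comm]
  exact mul_le_mul_of_nonneg_left (hΦ.bound' (by linarith [H.one_lt]) _) coneW_nonneg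

/-- The potential energy in the light cone is continuous in time. -/
theorem continuousOn_coneInt (hα0 : 0 < α) (hα : 2 * α = 2 * β - (N - 1)) {C : ℝ} {Φ φ : ℝ → ℝ}
    (hΦ : IsPrimitive p C Φ φ) : ContinuousOn (coneInt α T₀ a x₀ Φ u) (Icc a b) := by
  obtain ⟨s, hs, hb⟩ := H.coneInt_trunc_bound hα0 hα hΦ
  have hp : 0 ≤ p := by linarith [H.one_lt]
  have hlim : ∀ t ∈ Icc a b, Tendsto (fun n : ℕ => coneInt α T₀ a x₀ (truncPrim φ n) u t) atTop
      (𝓝 (coneInt α T₀ a x₀ Φ u t)) := fun t ht => by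
    have hτ : 0 < (T₀ - t) ^ (2 * α - 1) * (T₀ - t) ^ 2 := by
      have : 0 < T₀ - t := by linarith [ht.2, H.lt_vertex]
      positivity
    refine tendsto_integral_of_dominated_convergence _
      (fun n : ℕ => (H.integrable_slice_trunc hα0 hΦ n.cast_nonneg ht _).1)
      (((H.integrable_slice_pow hα0 hα ht).const_mul C).const_mul
        ((T₀ - t) ^ (2 * α - 1) * (T₀ - t) ^ 2))
      (fun n => .of_forall fun x => ?_)
      (.of_forall fun x => (tendsto_truncPrim hΦ (u t x)).const_mul _)
    rw [norm_mul, norm_mul, norm_of_nonneg hτ.le, norm_of_nonneg coneW_nonneg, mul_assoc,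
      mul_left_comm C]
    exact mul_le_mul_of_nonneg_left (mul_le_mul_of_nonneg_left
      (abs_truncPrim_le hp hΦ.nonneg hΦ.bound n.cast_nonneg _) coneW_nonneg) hτ.le
  set S : ℝ → ℝ := fun t => ∫ x in a..t, s x with hS
  have hint : ∀ t ∈ Icc a b, ∀ t' ∈ Icc a b, IntervalIntegrable s volume t t' :=
    fun t ht t' ht' => (hs.mono_set (Set.uIcc_subset_Icc ht ht')).intervalIntegrable
  have haI : a ∈ Icc a b := ⟨le_rfl, H.lt.le⟩
  have hle : ∀ t ∈ Icc a b, ∀ t' ∈ Icc a b, t ≤ t' →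
      |coneInt α T₀ a x₀ Φ u t' - coneInt α T₀ a x₀ Φ u t| ≤ |S t' - S t| := by
    intro t ht t' ht' htt
    have h1 : ∫ x in t..t', s x = S t' - S t :=
      (intervalIntegral.integral_interval_sub_left (hint a haI t' ht') (hint a haI t ht)).symm
    refine le_trans (le_of_tendsto' ((hlim t' ht').sub (hlim t ht)).abs fun n => ?_) (le_abs_self _)
    rw [← h1]
    exact hb n n.cast_nonneg t t' ht.1 htt ht'.2
  have hle' : ∀ t ∈ Icc a b, ∀ t' ∈ Icc a b,
      |coneInt α T₀ a x₀ Φ u t' - coneInt α T₀ a x₀ Φ u t| ≤ |S t' - S t| := by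
    intro t ht t' ht'
    rcases le_total t t' with h | h
    · exact hle t ht t' ht' h
    · rw [abs_sub_comm, abs_sub_comm (S t')]
      exact hle t' ht' t ht h
  have hSc : ContinuousOn S (Icc a b) := by
    have := intervalIntegral.continuousOn_primitive_interval (μ := volume) (f := s) (a := a) (b := b)
      (by rwa [Set.uIcc_of_le H.lt.le])
    rwa [Set.uIcc_of_le H.lt.le] at this
  intro t ht
  have h1 : Tendsto (fun t' => |S t' - S t|) (𝓝[Icc a b] t) (𝓝 0) := by
    have := ((hSc t ht).sub_const (S t)).abs
    rwa [sub_self, abs_zero] at this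
  refine tendsto_iff_norm_sub_tendsto_zero.2 (tendsto_of_tendsto_of_tendsto_of_le_of_le'
    tendsto_const_nhds h1 (.of_forall fun _ => norm_nonneg _) ?_)
  filter_upwards [self_mem_nhdsWithin] with t' ht'
  exact hle' t ht t' ht'

end OnCone

theorem kap_of_nonpos {α ε r : ℝ} (hε : 0 < ε) (hr : r ≤ 0) :
    kap α ε r = 0 ∧ deriv (kap α ε) r = 0 := by
  refine ⟨kap_of_le hε (hr.trans hε.le), ?_⟩
  have : kap α ε =ᶠ[𝓝 r] fun _ => 0 := by
    filter_upwards [Iio_mem_nhds (hr.trans_lt hε)] with s hs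
    exact kap_of_le hε (le_of_lt hs)
  rw [this.deriv_eq, deriv_const]

/-- The pointwise decay inequality, as a property of the nonlinearities. -/
def DecayBound (N : ℕ) (α β γ p : ℝ) (f g : ℝ → ℝ) (τ₀ C : ℝ) : Prop :=
  ∀ τ A g2 R U V k k' r : ℝ, 0 < τ → τ ≤ τ₀ → 0 ≤ k → 0 ≤ k' → 0 < r → r ≤ 1 →
      α * k ≤ r * k' → 0 ≤ g2 → R ^ 2 ≤ (1 - r) * (τ ^ 2 * g2) → τ * V = A + R + β * U →
      ddens N β α p γ 32 (τ ^ γ) τ A g2 R U V k k' r (f U) (g V) (primitive f U)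
        - (p + 3) / 2 * τ ^ γ * (k * edens β (τ ^ γ) τ A g2 R U (potential p f U))
      ≤ -(k' * A ^ 2) + C * (τ ^ γ) ^ 2 * (k * τ ^ (-(2 * β)))
        + 2 * (r * k' - α * k) * (τ * V * A - τ ^ γ * U * R)

/-- The integrating factor of the energy. -/
def expW (p γ τ : ℝ) : ℝ := exp ((p + 3) / 2 / γ * τ ^ γ)

theorem expW_pos (p γ τ : ℝ) : 0 < expW p γ τ := Real.exp_pos _

theorem continuous_expW {p γ : ℝ} (hγ : 0 < γ) : Continuous (expW p γ) :=
  Real.continuous_exp.comp (continuous_const.mul (continuous_id.rpow_const fun _ => Or.inr hγ.le))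

theorem IsTest.mul_expW {a b T₀ p γ : ℝ} (hb : b ≤ T₀) {θ : ℝ → ℝ}
    (h : IsTest (Ioo a b) θ) : IsTest (Ioo a b) fun t => θ t * expW p γ (T₀ - t) := by
  have hs : tsupport (fun t => θ t * expW p γ (T₀ - t)) ⊆ tsupport θ := tsupport_mul_subset_left
  refine ⟨contDiff_of_contDiffAt_tsupport fun t ht => ?_, h.compact.mul_right, hs.trans h.supp⟩
  have h1 := (h.supp (hs ht)).2
  exact h.smooth.contDiffAt.mul (ContDiffAt.exp (contDiffAt_const.mul
    (ContDiffAt.rpow_const_of_ne (by fun_prop) (by linarith))))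

theorem IsTest.deriv_mul_expW {a b T₀ p γ : ℝ} (hγ : 0 < γ) (hb : b ≤ T₀) {θ : ℝ → ℝ}
    (h : IsTest (Ioo a b) θ) (t : ℝ) :
    _root_.deriv (fun t => θ t * expW p γ (T₀ - t)) t
      = _root_.deriv θ t * expW p γ (T₀ - t)
        - (p + 3) / 2 * (T₀ - t) ^ (γ - 1) * (θ t * expW p γ (T₀ - t)) := by
  by_cases ht : t ∈ tsupport θ
  · have h1 : t < T₀ := (h.supp ht).2.trans_le hb
    have h2 : HasDerivAt (fun t => (T₀ - t) ^ γ) (-1 * γ * (T₀ - t) ^ (γ - 1)) t :=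
      ((hasDerivAt_id t).const_sub T₀).rpow_const (Or.inl (by simp; linarith))
    have h3 := ((h.smooth.differentiable (by simp) t).hasDerivAt.mul
      (h2.const_mul ((p + 3) / 2 / γ)).exp).deriv
    have h4 : _root_.deriv (fun t => θ t * expW p γ (T₀ - t)) t = _ := h3
    rw [h4, expW]
    field_simp
    ring
  · rw [IsTest.deriv_eq_zero ht, image_eq_zero_of_notMem_tsupport ht, IsTest.deriv_eq_zero]
    · simp
    · exact fun h' => ht (tsupport_mul_subset_left h')

/-- The density of the energy. -/
def enerD (p β γ T₀ : ℝ) (f : ℝ → ℝ) (x₀ : Sp N) (u v : ℝ → Sp N → ℝ) (G : ℝ → Sp N → Sp N)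
    (z : ℝ × Sp N) : ℝ :=
  edens β ((T₀ - z.1) ^ γ) (T₀ - z.1) (wvel β T₀ x₀ u v G z) (‖G z.1 z.2‖ ^ 2) (radial x₀ G z)
    (u z.1 z.2) (potential p f (u z.1 z.2))

theorem sq_radial_le {z : ℝ × Sp N} (hz : T₀ - z.1 ≠ 0) :
    radial x₀ G z ^ 2 ≤ (1 - rvar T₀ x₀ z) * ((T₀ - z.1) ^ 2 * ‖G z.1 z.2‖ ^ 2) := by
  have h1 : |radial x₀ G z| ≤ ‖G z.1 z.2‖ * ‖z.2 - x₀‖ := abs_real_inner_le_norm _ _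
  have h2 : (1 - rvar T₀ x₀ z) * ((T₀ - z.1) ^ 2 * ‖G z.1 z.2‖ ^ 2)
      = (‖G z.1 z.2‖ * ‖z.2 - x₀‖) ^ 2 := by
    rw [rvar]; field_simp; ring
  rw [h2, ← sq_abs]
  gcongr

theorem mul_vel_eq (z : ℝ × Sp N) : (T₀ - z.1) * v z.1 z.2
    = wvel β T₀ x₀ u v G z + radial x₀ G z + β * u z.1 z.2 := by
  rw [wvel, scal, radial]; ring

namespace OnCone

variable (H : OnCone p f g T u₀ u₁ u v G T₀ a b x₀)
include H

theorem memLp_wvel (β : ℝ) :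
    MemLp (wvel β T₀ x₀ u v G) 2 (𝓛 (cyl a b x₀ (T₀ - a))) :=
  (H.int.memLp_scal T₀).sub (H.int.memU.const_mul β)

theorem integrable_enerD (hΨ : IsPrimitive p K (potential p f) fun x => |x| ^ (p - 1) * x + f x)
    (β γ : ℝ) : Integrable (enerD p β γ T₀ f x₀ u v G)
      (𝓛 (cyl a b x₀ (T₀ - a))) := by
  have hA := H.memLp_wvel β
  have c0 : ContinuousOn (fun t => (T₀ - t) ^ 2) (Icc a b) := by fun_prop
  have i1 := hA.integrable_sq.const_mul (1 / 2)
  have i2 := (integrable_time_mul c0 H.int.memG.norm.integrable_sq).const_mul (1 / 2)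
  have i3 := H.int.memLp_radial.integrable_sq.const_mul (1 / 2)
  have i4 := H.int.memU.integrable_sq.const_mul (1 / 2 * β * (β + 1))
  have i5 := integrable_time_mul c0 (H.integrable_prim hΨ)
  have i6 := integrable_time_mul (continuousOn_rpow_sub H.lt_vertex γ)
    (H.int.memU.integrable_mul (q := 2) hA)
  refine (((((i1.add i2).sub i3).add i4).sub i5).sub i6).congr (.of_forall fun z => ?_)
  simp only [Pi.add_apply, Pi.sub_apply, Pi.mul_apply, enerD, edens]
  ring

theorem integrable_weighted (hα0 : 0 < α) {k l : ℝ → Sp N → ℝ}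
    (hk : L2Cont (𝓛 (closedBall x₀ (T₀ - a))) k a b)
    (hl : L2Cont (𝓛 (closedBall x₀ (T₀ - a))) l a b) {t : ℝ}
    (ht : t ∈ Icc a b) (c : ℝ) : Integrable (fun x => c * coneW α T₀ x₀ (t, x)
      * (k t x * l t x)) (𝓛 (closedBall x₀ (T₀ - a))) := by
  refine hk.integrable_mul hl (C := |c|) ht ((((measurable_coneW hα0).comp
    measurable_prodMk_left).const_mul _).aestronglyMeasurable) (.of_forall fun x => ?_)
  rw [abs_mul]
  exact mul_le_of_le_one_right (abs_nonneg _) (abs_coneW_le hα0 _)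

/-- The energy in the light cone at a fixed time. -/
def _root_.PerturbedWave.coneE (α p β γ T₀ a : ℝ) (f : ℝ → ℝ) (x₀ : Sp N) (u v : ℝ → Sp N → ℝ)
    (G : ℝ → Sp N → Sp N) (t : ℝ) : ℝ :=
  ∫ x in closedBall x₀ (T₀ - a),
    (T₀ - t) ^ (2 * α - 1) * (coneW α T₀ x₀ (t, x) * enerD p β γ T₀ f x₀ u v G (t, x))

theorem continuousOn_coneE (hα0 : 0 < α) (hα : 2 * α = 2 * β - (N - 1))
    (hΨ : IsPrimitive p K (potential p f) fun x => |x| ^ (p - 1) * x + f x) (γ : ℝ) :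
    ContinuousOn (coneE α p β γ T₀ a f x₀ u v G) (Icc a b) := by
  obtain ⟨hu, hG, hv⟩ := H.l2
  have hA := L2Cont.wvel hu hv hG β T₀
  have cP := continuousOn_rpow_sub (a := a) H.lt_vertex (2 * α - 1)
  have c1 : ∀ c : ℝ, ContinuousOn (fun t => c * (T₀ - t) ^ (2 * α - 1)) (Icc a b) :=
    fun c => continuousOn_const.mul cP
  have c2 : ContinuousOn (fun t => 1 / 2 * (T₀ - t) ^ (2 * α - 1) * (T₀ - t) ^ 2) (Icc a b) :=
    (continuousOn_const.mul cP).mul (by fun_prop)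
  have c5 : ContinuousOn (fun t => -((T₀ - t) ^ γ * (T₀ - t) ^ (2 * α - 1))) (Icc a b) :=
    ((continuousOn_rpow_sub H.lt_vertex γ).mul cP).neg
  have j1 := H.continuousOn_weighted hα0 (c1 (1 / 2)) hA hA
  have j2 := H.continuousOn_weighted hα0 c2 hG.norm hG.norm
  have j3 := H.continuousOn_weighted hα0 (c1 (-(1 / 2)))
    hG.radial hG.radial
  have j4 := H.continuousOn_weighted hα0 (c1 (1 / 2 * β * (β + 1))) hu hu
  have j5 := H.continuousOn_weighted hα0 c5 hu hA
  refine (((((j1.add j2).add j3).add j4).add j5).sub (H.continuousOn_coneInt hα0 hα hΨ)).congr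
    fun t ht => ?_
  have i1 := H.integrable_weighted hα0 hA hA ht (1 / 2 * (T₀ - t) ^ (2 * α - 1))
  have i2 := H.integrable_weighted hα0 hG.norm hG.norm ht
    (1 / 2 * (T₀ - t) ^ (2 * α - 1) * (T₀ - t) ^ 2)
  have i3 := H.integrable_weighted hα0 hG.radial hG.radial ht (-(1 / 2) * (T₀ - t) ^ (2 * α - 1))
  have i4 := H.integrable_weighted hα0 hu hu ht (1 / 2 * β * (β + 1) * (T₀ - t) ^ (2 * α - 1))
  have i5 := H.integrable_weighted hα0 hu hA ht (-((T₀ - t) ^ γ * (T₀ - t) ^ (2 * α - 1)))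
  have i6 := (H.integrable_slice_prim hα0 hα hΨ ht).const_mul
    ((T₀ - t) ^ (2 * α - 1) * (T₀ - t) ^ 2)
  have e6 : coneInt α T₀ a x₀ (potential p f) u t
      = ∫ x in closedBall x₀ (T₀ - a), (T₀ - t) ^ (2 * α - 1) * (T₀ - t) ^ 2
        * (coneW α T₀ x₀ (t, x) * potential p f (u t x)) :=
    integral_congr_ae (.of_forall fun x => mul_assoc _ _ _)
  simp only [Pi.add_apply, Pi.sub_apply]
  rw [e6, ← integral_add i1 i2]
  erw [← integral_add (i1.add i2) i3, ← integral_add ((i1.add i2).add i3) i4,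
    ← integral_add (((i1.add i2).add i3).add i4) i5,
    ← integral_sub ((((i1.add i2).add i3).add i4).add i5) i6]
  refine integral_congr_ae (.of_forall fun x => ?_)
  simp only [Pi.add_apply, enerD, edens]
  ring

theorem integrable_slice_enerD (hα0 : 0 < α) (hα : 2 * α = 2 * β - (N - 1))
    (hΨ : IsPrimitive p K (potential p f) fun x => |x| ^ (p - 1) * x + f x) (γ : ℝ) {t : ℝ}
    (ht : t ∈ Icc a b) :
    Integrable (fun x => coneW α T₀ x₀ (t, x) * enerD p β γ T₀ f x₀ u v G (t, x))
      (𝓛 (closedBall x₀ (T₀ - a))) := by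
  obtain ⟨hu, hG, hv⟩ := H.l2
  have hA := L2Cont.wvel hu hv hG β T₀
  have i1 := H.integrable_weighted hα0 hA hA ht (1 / 2)
  have i2 := H.integrable_weighted hα0 hG.norm hG.norm ht (1 / 2 * (T₀ - t) ^ 2)
  have i3 := H.integrable_weighted hα0 hG.radial hG.radial ht (-(1 / 2))
  have i4 := H.integrable_weighted hα0 hu hu ht (1 / 2 * β * (β + 1))
  have i5 := H.integrable_weighted hα0 hu hA ht (-((T₀ - t) ^ γ))
  have i6 := (H.integrable_slice_prim hα0 hα hΨ ht).const_mul ((T₀ - t) ^ 2)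
  refine (((((i1.add i2).add i3).add i4).add i5).sub i6).congr (.of_forall fun x => ?_)
  simp only [Pi.add_apply, Pi.sub_apply, enerD, edens]
  ring

/-- The weak form of the energy inequality, with a smooth profile. -/
theorem decay_profile (hα0 : 0 < α) (hα : 2 * α = 2 * β - (N - 1)) (hβ : β * (p - 1) = 2)
    (hγ : 0 < γ) (hΨ : IsPrimitive p K (potential p f) fun x => |x| ^ (p - 1) * x + f x)
    (hdec : DecayBound N α β γ p f g τ₀ C) (hτ₀ : T₀ - a ≤ τ₀) {θ : ℝ → ℝ}
    (hθ : IsTest (Ioo a b) θ) (hθ0 : ∀ t, 0 ≤ θ t) {δ ε : ℝ} (hε : 0 < ε)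
    (hεδ : 2 * ε ≤ δ)
    {X : ℝ × Sp N → ℝ} (hX : ∀ z, X z = kap α ε (rvar T₀ x₀ z)
        * (deriv θ z.1 * (expW p γ (T₀ - z.1) * (T₀ - z.1) ^ (2 * α - 1)
            * enerD p β γ T₀ f x₀ u v G z)
          + θ z.1 * (expW p γ (T₀ - z.1) * ((T₀ - z.1) ^ (2 * α - 1) / (T₀ - z.1))
            * (C * ((T₀ - z.1) ^ γ) ^ 2 * (T₀ - z.1) ^ (-(2 * β)))))
      + (rvar T₀ x₀ z * deriv (kap α ε) (rvar T₀ x₀ z) - α * kap α ε (rvar T₀ x₀ z))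
        * (deriv θ z.1 * (expW p γ (T₀ - z.1) * (T₀ - z.1) ^ (2 * α - 1)
            * (β * u z.1 z.2 ^ 2))
          + θ z.1 * (expW p γ (T₀ - z.1) * ((T₀ - z.1) ^ (2 * α - 1) / (T₀ - z.1))
            * (2 * ((T₀ - z.1) * v z.1 z.2 * wvel β T₀ x₀ u v G z
                - (T₀ - z.1) ^ γ * u z.1 z.2 * radial x₀ G z)
              - (p + 3) / 2 * (T₀ - z.1) ^ γ * (β * u z.1 z.2 ^ 2))))
      - disW α δ (rvar T₀ x₀ z) * (θ z.1 * (expW p γ (T₀ - z.1)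
          * ((T₀ - z.1) ^ (2 * α - 1) / (T₀ - z.1)) * wvel β T₀ x₀ u v G z ^ 2)))
    (hI : Integrable X (𝓛 (cyl a b x₀ (T₀ - a)))) :
    0 ≤ ∫ z in cyl a b x₀ (T₀ - a), X z := by
  have hb := H.lt_vertex.le
  have hϑ := hθ.mul_expW (p := p) (γ := γ) hb
  have hn := H.full_identity (γ := γ) (ν := 32) hα hβ hΨ hϑ (isProfile_kap (α := α) hε)
  have h2 := (setIntegral_eq_integral_of_forall_compl_eq_zero (s := cyl a b x₀ (T₀ - a))
      fun z hz => ?_).trans hn.integral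
  · rw [← h2]
    refine setIntegral_mono_on hn.integrable.integrableOn hI (measurableSet_cyl _ _ _ _)
      fun z hz => ?_
    rw [hX, hθ.deriv_mul_expW hγ hb]
    rcases hθ.lt_or_zero hb z.1 with h | ⟨h, h'⟩
    · rcases le_or_gt (rvar T₀ x₀ z) 0 with hr | hr
      · obtain ⟨e1, e2⟩ := kap_of_nonpos (α := α) hε hr
        have e3 : disW α δ (rvar T₀ x₀ z) = 0 := by
          rw [disW, if_neg (by linarith)]
        rw [e1, e2, e3]
        simp only [ddens]
        refine le_of_eq ?_
        ring
      · have hα1 : 0 ≤ rvar T₀ x₀ z * deriv (kap α ε) (rvar T₀ x₀ z)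
            - α * kap α ε (rvar T₀ x₀ z) := by
          rw [kap_deriv hr]
          have := deriv_smoothTransition_nonneg (rvar T₀ x₀ z / ε - 1)
          positivity
        have key := hdec (T₀ - z.1) (wvel β T₀ x₀ u v G z) (‖G z.1 z.2‖ ^ 2) (radial x₀ G z)
          (u z.1 z.2) (v z.1 z.2) (kap α ε (rvar T₀ x₀ z)) (deriv (kap α ε) (rvar T₀ x₀ z))
          (rvar T₀ x₀ z) h (by linarith [hz.1.1]) (kap_nonneg hε) (kap_deriv_nonneg hα0 hε hr) hr
          (rvar_le_one _ _ _) (by linarith) (by positivity) (sq_radial_le h.ne') (mul_vel_eq z)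
        have hdis := mul_le_mul_of_nonneg_right (disW_le_deriv_kap hα0 hε hεδ hr)
          (sq_nonneg (wvel β T₀ x₀ u v G z))
        have hP : 0 ≤ θ z.1 * (expW p γ (T₀ - z.1)
            * ((T₀ - z.1) ^ (2 * α - 1) / (T₀ - z.1))) := by
          have := hθ0 z.1
          have := expW_pos p γ (T₀ - z.1)
          positivity
        have key2 := mul_le_mul_of_nonneg_left
          ((add_le_add_left key ((disW α δ (rvar T₀ x₀ z)
            - deriv (kap α ε) (rvar T₀ x₀ z)) * wvel β T₀ x₀ u v G z ^ 2)).trans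
            (le_refl _)) hP
        have hdis2 := mul_le_mul_of_nonneg_left hdis hP
        have e4 : (T₀ - z.1) ^ (γ - 1) = (T₀ - z.1) ^ γ / (T₀ - z.1) := Real.rpow_sub_one h.ne' _
        rw [e4]
        simp only [wvel, enerD] at *
        generalize ddens N β α p γ 32 _ _ _ _ _ _ _ _ _ _ _ _ _ = dd at *
        generalize edens β _ _ _ _ _ _ _ = ee at *
        generalize deriv (kap α ε) (rvar T₀ x₀ z) = k' at *
        generalize kap α ε (rvar T₀ x₀ z) = k at *
        generalize disW α δ (rvar T₀ x₀ z) = dw at *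
        generalize (T₀ - z.1) ^ γ = Γ at *
        generalize (T₀ - z.1) ^ (2 * α - 1) = P at *
        generalize (T₀ - z.1) ^ (-(2 * β)) = ϖ at *
        have e5 : P = P / (T₀ - z.1) * (T₀ - z.1) := by field_simp
        generalize hPτ : P / (T₀ - z.1) = Pτ at *
        have e6 : Γ / (T₀ - z.1) * P = Γ * Pτ := by rw [← hPτ]; ring
        have e7 : ∀ X, (p + 3) / 2 * (Γ / (T₀ - z.1)) * (θ z.1 * expW p γ (T₀ - z.1)) * P * X
            = (p + 3) / 2 * (θ z.1 * expW p γ (T₀ - z.1)) * (Γ * Pτ) * X := fun X => by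
          rw [← e6]; ring
        rw [sub_mul, sub_mul, e7]
        linarith
    · rw [h, h']
      refine le_of_eq ?_
      ring
  · rcases H.zero_or_rvar hϑ hz with ⟨h, h'⟩ | h
    · rw [h, h']; ring
    · obtain ⟨e1, e2⟩ := kap_of_nonpos (α := α) hε h
      rw [e1, e2]
      simp only [ddens]
      ring

end OnCone

theorem tendsto_kap_defect (hα : 0 < α) {ε : ℕ → ℝ} (h0 : ∀ n, 0 < ε n)
    (hε : Tendsto ε atTop (𝓝 0)) {r : ℝ} (hr1 : r ≤ 1) :
    Tendsto (fun n => r * deriv (kap α (ε n)) r - α * kap α (ε n) r) atTop (𝓝 0) := by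
  refine tendsto_const_nhds.congr' ?_
  rcases le_or_gt r 0 with hr | hr
  · refine .of_forall fun n => ?_
    obtain ⟨e1, e2⟩ := kap_of_nonpos (α := α) (h0 n) hr
    beta_reduce
    rw [e1, e2]; ring
  · obtain ⟨K, hK, h⟩ := exists_kap_defect hα
    filter_upwards [hε.eventually_lt_const (by linarith : 0 < r / 2)] with n hn
    exact ((h (ε n) (h0 n) r hr hr1).2.2 (by linarith)).symm

theorem exists_abs_kap_defect (hα : 0 < α) : ∃ K : ℝ, 0 ≤ K ∧ ∀ ε, 0 < ε → ∀ r, r ≤ 1 →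
    |r * deriv (kap α ε) r - α * kap α ε r| ≤ K := by
  obtain ⟨K, hK, h⟩ := exists_kap_defect hα
  refine ⟨K, hK, fun ε hε r hr1 => ?_⟩
  rcases le_or_gt r 0 with hr | hr
  · obtain ⟨e1, e2⟩ := kap_of_nonpos (α := α) hε hr
    rw [e1, e2]; simpa using hK
  · obtain ⟨h1, h2, -⟩ := h ε hε r hr hr1
    rwa [abs_of_nonneg h1]

theorem continuousOn_expW_mul (hγ : 0 < γ) (hb : b < T₀) (p k : ℝ) :
    ContinuousOn (fun t => expW p γ (T₀ - t) * (T₀ - t) ^ k) (Icc a b) :=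
  ((continuous_expW hγ).comp (continuous_const.sub continuous_id)).continuousOn.mul
    (continuousOn_rpow_sub hb k)

theorem continuousOn_expW_mul_div (hγ : 0 < γ) (hb : b < T₀) (p k : ℝ) :
    ContinuousOn (fun t => expW p γ (T₀ - t) * ((T₀ - t) ^ k / (T₀ - t))) (Icc a b) :=
  ((continuous_expW hγ).comp (continuous_const.sub continuous_id)).continuousOn.mul
    (continuousOn_rpow_sub_div hb k)

namespace OnCone

variable (H : OnCone p f g T u₀ u₁ u v G T₀ a b x₀)
include H

theorem integrable_disW_mul (hα0 : 0 < α) {δ : ℝ} (hδ : 0 < δ) {w : ℝ × Sp N → ℝ}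
    (hw : Integrable w (𝓛 (cyl a b x₀ (T₀ - a)))) :
    Integrable (fun z => disW α δ (rvar T₀ x₀ z) * w z)
      (𝓛 (cyl a b x₀ (T₀ - a))) :=
  hw.bdd_mul (c := α / δ) ((measurable_disW α δ).comp measurable_rvar).aestronglyMeasurable
    (.of_forall fun z => by
      rw [norm_of_nonneg (disW_nonneg hα0 hδ)]
      exact disW_le hα0 hδ (rvar_le_one _ _ _))

theorem decay_balance (hα0 : 0 < α) (hα : 2 * α = 2 * β - (N - 1)) (hβ : β * (p - 1) = 2)
    (hγ : 0 < γ) (hΨ : IsPrimitive p K (potential p f) fun x => |x| ^ (p - 1) * x + f x)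
    (hdec : DecayBound N α β γ p f g τ₀ C) (hτ₀ : T₀ - a ≤ τ₀) {δ : ℝ} (hδ : 0 < δ) {t₁ t₂ : ℝ}
    (h1 : a ≤ t₁) (h12 : t₁ ≤ t₂) (h2 : t₂ ≤ b) :
    IntegrableOn (fun t => ∫ x in closedBall x₀ (T₀ - a),
        disW α δ (rvar T₀ x₀ (t, x)) * (expW p γ (T₀ - t)
          * ((T₀ - t) ^ (2 * α - 1) / (T₀ - t)) * wvel β T₀ x₀ u v G (t, x) ^ 2)) (Icc a b) ∧
    expW p γ (T₀ - t₂) * coneE α p β γ T₀ a f x₀ u v G t₂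
      + ∫ t in t₁..t₂, ((∫ x in closedBall x₀ (T₀ - a),
        disW α δ (rvar T₀ x₀ (t, x)) * (expW p γ (T₀ - t)
          * ((T₀ - t) ^ (2 * α - 1) / (T₀ - t)) * wvel β T₀ x₀ u v G (t, x) ^ 2))
        - ∫ x in closedBall x₀ (T₀ - a), coneW α T₀ x₀ (t, x) * (expW p γ (T₀ - t)
          * ((T₀ - t) ^ (2 * α - 1) / (T₀ - t)) * (C * ((T₀ - t) ^ γ) ^ 2
            * (T₀ - t) ^ (-(2 * β)))))
      ≤ expW p γ (T₀ - t₁) * coneE α p β γ T₀ a f x₀ u v G t₁ := by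
  have hb := H.lt_vertex
  have hA := H.memLp_wvel β
  have m1 := continuousOn_expW_mul (a := a) hγ hb p (2 * α - 1)
  have m2 := continuousOn_expW_mul_div (a := a) hγ hb p (2 * α - 1)
  have cΓ := continuousOn_rpow_sub (a := a) hb γ
  have iE := integrable_time_mul m1 (H.integrable_enerD hΨ β γ)
  have i1 : Integrable (fun _ : ℝ × Sp N => (1 : ℝ)) (𝓛 (cyl a b x₀ (T₀ - a))) :=
    integrable_const _
  have iC := integrable_time_mul (m2.mul ((continuousOn_const.mul (cΓ.pow 2)).mul
    (continuousOn_rpow_sub (a := a) hb (-(2 * β))) (f := fun t => C * ((T₀ - t) ^ γ) ^ 2))) i1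
  have iA := integrable_time_mul m2 hA.integrable_sq
  have iU := integrable_time_mul m1 (H.int.memU.integrable_sq.const_mul β)
  have iV := integrable_time_mul (c := fun t => T₀ - t) (by fun_prop)
    (H.int.memV.integrable_mul (q := 2) hA)
  have iR := integrable_time_mul cΓ (H.int.memU.integrable_mul (q := 2) H.int.memLp_radial)
  have iU2 := integrable_time_mul (continuousOn_const.mul cΓ (f := fun _ => (p + 3) / 2))
    (H.int.memU.integrable_sq.const_mul β)
  have iX := integrable_time_mul m2 (((iV.sub iR).const_mul 2).sub iU2)
  have kE := H.integrable_coneW_mul hα0 iE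
  have kC := H.integrable_coneW_mul hα0 iC
  have kA := H.integrable_disW_mul hα0 hδ iA
  have sA := integrableOn_slice kA
  have sC := integrableOn_slice kC
  simp only [Pi.mul_apply, mul_one] at iC kC sC
  refine ⟨sA, ?_⟩
  have hcE := ((continuous_expW (p := p) hγ).comp
    (continuous_const.sub continuous_id : Continuous fun t => T₀ - t)).continuousOn.mul
      (H.continuousOn_coneE hα0 hα hΨ γ)
  refine le_of_forall_test hcE (sA.sub sC) (fun θ hθ hθ0 => ?_) h1 h12 h2
  have d1 : ContinuousOn (deriv θ) (Icc a b) := hθ.deriv.smooth.continuous.continuousOn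
  have d2 : ContinuousOn θ (Icc a b) := hθ.smooth.continuous.continuousOn
  have y1 := (integrable_time_mul d1 iE).add (integrable_time_mul d2 iC)
  have y2 := (integrable_time_mul d1 iU).add (integrable_time_mul d2 iX)
  have y3 := integrable_time_mul d2 iA
  set ε : ℕ → ℝ := fun n => δ / 2 * (1 / (n + 1)) with hε
  have hε0 : ∀ n, 0 < ε n := fun n => by positivity
  have hεδ : ∀ n, 2 * ε n ≤ δ := fun n => by
    have h4 : (1 : ℝ) / (n + 1) ≤ 1 := by
      rw [div_le_one (by positivity)]; linarith [(n.cast_nonneg : (0 : ℝ) ≤ n)]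
    simp only [hε]
    nlinarith
  have hεl : Tendsto ε atTop (𝓝 0) := by
    have := (tendsto_one_div_add_atTop_nhds_zero_nat (𝕜 := ℝ)).const_mul (δ / 2)
    rwa [mul_zero] at this
  obtain ⟨B, hB0, hB⟩ := exists_abs_kap_defect hα0
  have q3 := H.integrable_disW_mul hα0 hδ y3
  have hkm : ∀ n, Measurable fun z : ℝ × Sp N => kap α (ε n) (rvar T₀ x₀ z) := fun n =>
    (isProfile_kap (α := α) (hε0 n)).smooth.continuous.measurable.comp measurable_rvar
  have q1 := fun n => y1.bdd_mul (c := 1) (hkm n).aestronglyMeasurable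
    (.of_forall fun z => by
      rw [norm_of_nonneg (kap_nonneg (hε0 n))]
      exact (kap_le_posW (hε0 n)).trans (posW_le_one hα0 (rvar_le_one _ _ _)))
  have q2 := fun n => y2.bdd_mul (c := B) ((measurable_rvar.mul
      ((measurable_deriv (kap α (ε n))).comp measurable_rvar)).sub
        ((hkm n).const_mul α)).aestronglyMeasurable
    (.of_forall fun z => hB (ε n) (hε0 n) _ (rvar_le_one T₀ x₀ z))
  have hI := fun n => ((q1 n).add (q2 n)).sub q3
  have hlim := tendsto_integral_of_dominated_convergence (G := ℝ) _ (fun n => (hI n).1)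
    ((y1.norm.add (y2.norm.const_mul B)).add q3.norm)
    (fun n => .of_forall fun z => by
      simp only [Pi.sub_apply]
      refine (norm_sub_le _ _).trans (add_le_add ((norm_add_le _ _).trans (add_le_add ?_ ?_)) le_rfl)
      · rw [norm_mul, norm_of_nonneg (kap_nonneg (hε0 n))]
        exact mul_le_of_le_one_left (norm_nonneg _)
          ((kap_le_posW (hε0 n)).trans (posW_le_one hα0 (rvar_le_one _ _ _)))
      · rw [norm_mul]
        exact mul_le_mul_of_nonneg_right (hB (ε n) (hε0 n) _ (rvar_le_one T₀ x₀ z))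
          (norm_nonneg _))
    (.of_forall fun z => (((tendsto_kap hα0 hε0 hεl (rvar T₀ x₀ z)).mul_const _).add
      ((tendsto_kap_defect hα0 hε0 hεl (rvar_le_one T₀ x₀ z)).mul_const _)).sub tendsto_const_nhds)
  have h0 := ge_of_tendsto' (b := (0 : ℝ)) hlim fun n => ?_
  · refine h0.trans (le_of_eq ?_)
    refine Eq.trans ?_ ((integral_cyl_split d1 d2 kE (kC.sub kA)).trans ?_)
    · refine integral_congr_ae (.of_forall fun z => ?_)
      simp only [Pi.add_apply, Pi.sub_apply, coneW]
      ring
    · refine integral_congr_ae ?_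
      filter_upwards [ae_integrable_slice kC, ae_integrable_slice kA] with t ht1 ht2
      have e1 : ∫ x in closedBall x₀ (T₀ - a), coneW α T₀ x₀ (t, x)
          * (expW p γ (T₀ - t) * (T₀ - t) ^ (2 * α - 1) * enerD p β γ T₀ f x₀ u v G (t, x))
          = expW p γ (T₀ - t) * coneE α p β γ T₀ a f x₀ u v G t := by
        rw [coneE, ← integral_const_mul]
        refine integral_congr_ae (.of_forall fun x => ?_)
        beta_reduce
        ring
      have e2 := integral_sub ht1 ht2
      simp only [Pi.sub_apply, Pi.mul_apply, Function.comp_apply] at e1 e2 ⊢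
      rw [e1, e2]
      ring
  · exact H.decay_profile hα0 hα hβ hγ hΨ hdec hτ₀ hθ hθ0 (hε0 n) (hεδ n) (δ := δ) (fun z => by
      simp only [Pi.add_apply, Pi.sub_apply, Pi.mul_apply, Function.comp_apply]; ring) (hI n)

end OnCone

/-- The energy in the light cone. -/
def lightE (α p β γ T₀ : ℝ) (f : ℝ → ℝ) (x₀ : Sp N) (u v : ℝ → Sp N → ℝ)
    (G : ℝ → Sp N → Sp N) (t : ℝ) : ℝ :=
  (T₀ - t) ^ (2 * α - 1) * ∫ x in ball x₀ (T₀ - t),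
    coneW α T₀ x₀ (t, x) * enerD p β γ T₀ f x₀ u v G (t, x)

/-- The dissipation in the light cone, cut off near its boundary. -/
def lightD (α β δ T₀ : ℝ) (x₀ : Sp N) (u v : ℝ → Sp N → ℝ)
    (G : ℝ → Sp N → Sp N) (t : ℝ) : ℝ :=
  (T₀ - t) ^ (2 * α - 1) / (T₀ - t) * ∫ x in ball x₀ (T₀ - t),
    disW α δ (rvar T₀ x₀ (t, x)) * wvel β T₀ x₀ u v G (t, x) ^ 2

/-- The nonincreasing modification of the energy. -/
def corrE (α p β γ B T₀ : ℝ) (f : ℝ → ℝ) (x₀ : Sp N) (u v : ℝ → Sp N → ℝ)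
    (G : ℝ → Sp N → Sp N) (t : ℝ) : ℝ :=
  expW p γ (T₀ - t) * lightE α p β γ T₀ f x₀ u v G t + B * (T₀ - t) ^ (2 * γ)

theorem setIntegral_light {t r : ℝ} (hr : T₀ - t ≤ r) (h : Sp N → ℝ)
    (h0 : ∀ x, T₀ - t ≤ ‖x - x₀‖ → h x = 0) :
    ∫ x in closedBall x₀ r, h x = ∫ x in ball x₀ (T₀ - t), h x := by
  refine setIntegral_eq_of_subset_of_forall_sdiff_eq_zero
    isClosed_closedBall.measurableSet
    (ball_subset_closedBall.trans (closedBall_subset_closedBall hr)) fun x hx => ?_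
  refine h0 x ?_
  have := hx.2
  rwa [mem_ball, dist_eq_norm, not_lt] at this

theorem disW_eq_zero (hδ : 0 < δ) {z : ℝ × Sp N} (hz : z.1 < T₀) (h : T₀ - z.1 ≤ ‖z.2 - x₀‖) :
    disW α δ (rvar T₀ x₀ z) = 0 := by
  rw [disW, if_neg]
  linarith [rvar_nonpos hz h]

theorem one_le_expW (hp : 1 < p) (hγ : 0 < γ) {τ : ℝ} (hτ : 0 ≤ τ) : 1 ≤ expW p γ τ :=
  Real.one_le_exp (by
    have : 0 < p + 3 := by linarith
    positivity)

theorem expW_le (hp : 1 < p) (hγ : 0 < γ) {τ : ℝ} (hτ : 0 ≤ τ) (hτ1 : τ ≤ 1) :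
    expW p γ τ ≤ expW p γ 1 := by
  refine Real.exp_le_exp.2 (mul_le_mul_of_nonneg_left (Real.rpow_le_rpow hτ hτ1 hγ.le) ?_)
  have : 0 < p + 3 := by linarith
  positivity

theorem measureReal_ball_sp (x : Sp N) {r : ℝ} (hr : 0 < r) :
    volume.real (ball x r) = r ^ N * volume.real (ball (0 : Sp N) 1) := by
  rw [measureReal_def, Measure.addHaar_ball_of_pos _ _ hr, ENNReal.toReal_mul,
    ENNReal.toReal_ofReal (by positivity), measureReal_def, finrank_euclideanSpace_fin]

theorem integral_coneW_le (hα0 : 0 < α) {t : ℝ} (ht : t < T₀) :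
    0 ≤ ∫ x in ball x₀ (T₀ - t), coneW α T₀ x₀ (t, x) ∧
    ∫ x in ball x₀ (T₀ - t), coneW α T₀ x₀ (t, x)
      ≤ (T₀ - t) ^ N * volume.real (ball (0 : Sp N) 1) := by
  refine ⟨integral_nonneg fun x => coneW_nonneg, ?_⟩
  have h : ‖∫ x in ball x₀ (T₀ - t), coneW α T₀ x₀ (t, x)‖
      ≤ 1 * volume.real (ball x₀ (T₀ - t)) :=
    norm_setIntegral_le_of_norm_le_const measure_ball_lt_top fun x _ => abs_coneW_le hα0 _
  rw [one_mul, measureReal_ball_sp x₀ (by linarith : 0 < T₀ - t)] at h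
  exact (le_abs_self _).trans h

theorem lightD_nonneg (hα0 : 0 < α) (hδ : 0 < δ) {t : ℝ} (ht : t < T₀) :
    0 ≤ lightD α β δ T₀ x₀ u v G t := by
  have h1 : 0 < T₀ - t := by linarith
  refine mul_nonneg (by positivity) (integral_nonneg fun x => ?_)
  exact mul_nonneg (disW_nonneg hα0 hδ) (sq_nonneg _)

theorem integral_rpow_sub {t₁ t₂ : ℝ} (hγ : 0 < γ) (h12 : t₁ ≤ t₂) (h2 : t₂ < T₀) :
    ∫ t in t₁..t₂, (T₀ - t) ^ (2 * γ - 1)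
      = ((T₀ - t₁) ^ (2 * γ) - (T₀ - t₂) ^ (2 * γ)) / (2 * γ) := by
  have h : ∀ t ∈ Set.uIcc t₁ t₂, HasDerivAt (fun t => -((T₀ - t) ^ (2 * γ) / (2 * γ)))
      ((T₀ - t) ^ (2 * γ - 1)) t := fun t ht => by
    rw [Set.uIcc_of_le h12] at ht
    have h3 := (((hasDerivAt_id t).const_sub T₀).rpow_const (p := 2 * γ)
      (Or.inl (by simp; linarith [ht.2]))).div_const (2 * γ) |>.neg
    refine h3.congr_deriv ?_
    simp only [id]
    field_simp
  rw [intervalIntegral.integral_eq_sub_of_hasDerivAt h]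
  · ring
  · refine ContinuousOn.intervalIntegrable ?_
    rw [Set.uIcc_of_le h12]
    exact continuousOn_rpow_sub h2 _

namespace OnCone

variable (H : OnCone p f g T u₀ u₁ u v G T₀ a b x₀)
include H

theorem coneE_eq (hα0 : 0 < α) {t : ℝ} (ht : t ∈ Icc a b) :
    coneE α p β γ T₀ a f x₀ u v G t = lightE α p β γ T₀ f x₀ u v G t := by
  have h1 : t < T₀ := ht.2.trans_lt H.lt_vertex
  rw [coneE, lightE, integral_const_mul, setIntegral_light (T₀ := T₀) (t := t) (by linarith [ht.1])]
  intro x hx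
  rw [coneW_eq_zero hα0 h1 hx, zero_mul]

/-- The energy inequality on a time interval. -/
theorem energy_window (hα0 : 0 < α) (hα : 2 * α = 2 * β - (N - 1)) (hβ : β * (p - 1) = 2)
    (hγ : 0 < γ) (hΨ : IsPrimitive p K (potential p f) fun x => |x| ^ (p - 1) * x + f x)
    (hdec : DecayBound N α β γ p f g τ₀ C) (hC : 0 ≤ C) (hτ₀ : T₀ - a ≤ τ₀) (hτ₁ : τ₀ ≤ 1)
    (hδ : 0 < δ) {B : ℝ}
    (hB : C * expW p γ 1 * volume.real (ball (0 : Sp N) 1) ≤ B * (2 * γ)) {t₁ t₂ : ℝ}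
    (h1 : a ≤ t₁) (h12 : t₁ ≤ t₂) (h2 : t₂ ≤ b) :
    IntegrableOn (lightD α β δ T₀ x₀ u v G) (Icc t₁ t₂) ∧
    corrE α p β γ B T₀ f x₀ u v G t₂ + ∫ t in t₁..t₂, lightD α β δ T₀ x₀ u v G t
      ≤ corrE α p β γ B T₀ f x₀ u v G t₁ := by
  have hb := H.lt_vertex
  have hp := H.one_lt
  obtain ⟨iA, hD⟩ := H.decay_balance hα0 hα hβ hγ hΨ hdec hτ₀ hδ h1 h12 h2
  have hm1 : t₁ ∈ Icc a b := ⟨h1, h12.trans h2⟩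
  have hm2 : t₂ ∈ Icc a b := ⟨h1.trans h12, h2⟩
  rw [H.coneE_eq hα0 hm1, H.coneE_eq hα0 hm2] at hD
  set V := volume.real (ball (0 : Sp N) 1) with hV
  have hsub : Icc t₁ t₂ ⊆ Icc a b := Set.Icc_subset_Icc h1 h2
  have eA : ∀ t ∈ Icc a b, ∫ x in closedBall x₀ (T₀ - a),
        disW α δ (rvar T₀ x₀ (t, x)) * (expW p γ (T₀ - t)
          * ((T₀ - t) ^ (2 * α - 1) / (T₀ - t)) * wvel β T₀ x₀ u v G (t, x) ^ 2)
      = expW p γ (T₀ - t) * lightD α β δ T₀ x₀ u v G t := fun t ht => by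
    rw [setIntegral_light (T₀ := T₀) (t := t) (by linarith [ht.1]), lightD, ← mul_assoc,
      ← integral_const_mul]
    · refine integral_congr_ae (.of_forall fun x => ?_)
      beta_reduce
      ring
    · intro x hx
      rw [disW_eq_zero hδ (ht.2.trans_lt hb) hx, zero_mul]
  have eC : ∀ t ∈ Icc a b, ∫ x in closedBall x₀ (T₀ - a),
        coneW α T₀ x₀ (t, x) * (expW p γ (T₀ - t)
          * ((T₀ - t) ^ (2 * α - 1) / (T₀ - t)) * (C * ((T₀ - t) ^ γ) ^ 2
            * (T₀ - t) ^ (-(2 * β)))) ≤ B * (2 * γ) * (T₀ - t) ^ (2 * γ - 1) := fun t ht => by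
    have hτ : 0 < T₀ - t := by linarith [ht.2]
    have hμ := expW_le hp hγ hτ.le (by linarith [ht.1] : T₀ - t ≤ 1)
    obtain ⟨hW0, hW⟩ := integral_coneW_le (N := N) (x₀ := x₀) hα0 (ht.2.trans_lt hb)
    rw [setIntegral_light (T₀ := T₀) (t := t) (by linarith [ht.1]), integral_mul_const]
    · have e1 : (T₀ - t) ^ (2 * α - 1) / (T₀ - t) * (((T₀ - t) ^ γ) ^ 2
          * (T₀ - t) ^ (-(2 * β))) * (T₀ - t) ^ N = (T₀ - t) ^ (2 * γ - 1) := by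
        rw [← Real.rpow_sub_one hτ.ne', ← Real.rpow_natCast, ← Real.rpow_natCast,
          ← Real.rpow_mul hτ.le, ← Real.rpow_add hτ, ← Real.rpow_add hτ, ← Real.rpow_add hτ]
        congr 1
        push_cast
        linarith
      calc _ ≤ ((T₀ - t) ^ N * V) * (expW p γ 1
          * ((T₀ - t) ^ (2 * α - 1) / (T₀ - t)) * (C * ((T₀ - t) ^ γ) ^ 2
            * (T₀ - t) ^ (-(2 * β)))) := by
            have := expW_pos p γ (T₀ - t)
            gcongr
        _ = C * expW p γ 1 * V * ((T₀ - t) ^ (2 * α - 1) / (T₀ - t) * (((T₀ - t) ^ γ) ^ 2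
          * (T₀ - t) ^ (-(2 * β))) * (T₀ - t) ^ N) := by ring
        _ ≤ _ := by rw [e1]; gcongr
    · intro x hx
      rw [coneW_eq_zero hα0 (ht.2.trans_lt hb) hx, zero_mul]
  have hLi : IntegrableOn (lightD α β δ T₀ x₀ u v G) (Icc a b) := by
    have k1 := H.integrable_disW_mul hα0 hδ (integrable_time_mul
      (continuousOn_rpow_sub_div (a := a) hb (2 * α - 1)) (H.memLp_wvel β).integrable_sq)
    refine (integrableOn_slice k1).congr_fun (fun t ht => ?_) measurableSet_Icc
    beta_reduce
    rw [setIntegral_light (T₀ := T₀) (t := t) (by linarith [ht.1]), lightD, ← integral_const_mul]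
    · refine integral_congr_ae (.of_forall fun x => ?_)
      beta_reduce
      ring
    · intro x hx
      rw [disW_eq_zero hδ (ht.2.trans_lt hb) hx, zero_mul]
  refine ⟨hLi.mono_set hsub, ?_⟩
  have iL : IntervalIntegrable (lightD α β δ T₀ x₀ u v G) volume t₁ t₂ :=
    (hLi.mono_set (by rwa [Set.uIcc_of_le h12])).intervalIntegrable
  have cR : ContinuousOn (fun t => B * (2 * γ) * (T₀ - t) ^ (2 * γ - 1)) (Icc a b) :=
    continuousOn_const.mul (continuousOn_rpow_sub hb _)
  have iR : IntervalIntegrable (fun t => B * (2 * γ) * (T₀ - t) ^ (2 * γ - 1)) volume t₁ t₂ :=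
    (cR.mono (by rwa [Set.uIcc_of_le h12])).intervalIntegrable
  by_cases hCi : IntervalIntegrable (fun t => (∫ x in closedBall x₀ (T₀ - a),
        disW α δ (rvar T₀ x₀ (t, x)) * (expW p γ (T₀ - t)
          * ((T₀ - t) ^ (2 * α - 1) / (T₀ - t)) * wvel β T₀ x₀ u v G (t, x) ^ 2))
        - ∫ x in closedBall x₀ (T₀ - a), coneW α T₀ x₀ (t, x) * (expW p γ (T₀ - t)
          * ((T₀ - t) ^ (2 * α - 1) / (T₀ - t)) * (C * ((T₀ - t) ^ γ) ^ 2
            * (T₀ - t) ^ (-(2 * β))))) volume t₁ t₂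
  · have hmono := intervalIntegral.integral_mono_on h12 (iL.sub iR) hCi fun t ht => by
      have hb1 := eA t (hsub ht)
      have hb2 := eC t (hsub ht)
      have h3 := lightD_nonneg (β := β) (x₀ := x₀) (u := u) (v := v) (G := G) hα0 hδ
        ((hsub ht).2.trans_lt hb)
      have h4 := one_le_expW hp hγ (by linarith [(hsub ht).2] : 0 ≤ T₀ - t)
      rw [hb1]
      have h5 := le_mul_of_one_le_left h3 h4
      linarith
    rw [intervalIntegral.integral_sub iL iR, intervalIntegral.integral_const_mul,
      integral_rpow_sub hγ h12 (h2.trans_lt hb), mul_assoc, mul_div_cancel₀ _ (by positivity)] at hmono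
    simp only [corrE]
    linarith
  · exfalso
    apply hCi
    have k1 := H.integrable_coneW_mul hα0 (integrable_time_mul
      (((continuousOn_expW_mul_div (a := a) hγ hb p (2 * α - 1))).mul
        ((continuousOn_const.mul ((continuousOn_rpow_sub (a := a) hb γ).pow 2)).mul
    (continuousOn_rpow_sub (a := a) hb (-(2 * β))) (f := fun t => C * ((T₀ - t) ^ γ) ^ 2)))
      (integrable_const (1 : ℝ) (μ := 𝓛 (cyl a b x₀ (T₀ - a)))))
    simp only [Pi.mul_apply, mul_one] at k1
    have k2 := integrableOn_slice k1
    exact ((iA.sub k2).mono_set (by rwa [Set.uIcc_of_le h12])).intervalIntegrable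

end OnCone

/-- The cone condition provides solutions in truncated light cones. -/
theorem IsSolution.onCone (hp : 1 < p) (hq : 0 ≤ q) (hqp : q < p) (hM : 0 < M)
    (hfc : Continuous f) (hgc : Continuous g) (hf : ∀ a, |f a| ≤ M * (1 + |a| ^ q))
    (hg : ∀ a, |g a| ≤ M * (1 + |a|)) (hs : IsSolution p f g T u₀ u₁ u v G) {δ₀ : ℝ} (hδ₀ : 0 < δ₀)
    (hcone : cone x₀ (T x₀) δ₀ ⊆ influenceDomain T) (hT : T₀ ≤ T x₀) (ha : 0 ≤ a) (hab : a < b)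
    (hb : b < T₀) (hw : δ₀ * (T₀ - a) ≤ T₀ - b) : OnCone p f g T u₀ u₁ u v G T₀ a b x₀ := by
  have hbel : CylBelow T a b x₀ (T₀ - a) := ⟨ha, fun x hx => by
    have h1 : (b, x) ∈ cone x₀ (T x₀) δ₀ := by
      rw [mem_closedBall, dist_eq_norm] at hx
      refine ⟨fun h => ?_, ha.trans hab.le, ?_⟩
      · have := congrArg Prod.fst h
        simp only at this
        linarith
      · have := mul_le_mul_of_nonneg_left hx hδ₀.le
        show b ≤ T x₀ - δ₀ * ‖x - x₀‖
        linarith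
    exact (hcone h1).2⟩
  have hint := hs.cylIntegrable hp hfc hgc hbel hab.le
  exact ⟨hs, hbel, hint, hint.powIntegrable hp hq hqp hM hf hg, hp, hab, hb⟩

/-- A local monotonicity property in the light cone holds globally. -/
theorem chain_windows {δ₀ : ℝ} (hδ₀ : 0 < δ₀) (hδ₁ : δ₀ < 1) {e D : ℝ → ℝ} {s : ℝ}
    (h : ∀ t₁ t₂, s ≤ t₁ → t₁ < t₂ → t₂ < T₀ → δ₀ * (T₀ - t₁) ≤ T₀ - t₂ →
      IntegrableOn D (Icc t₁ t₂) ∧ e t₂ + ∫ t in t₁..t₂, D t ≤ e t₁) {t₁ t₂ : ℝ} (h1 : s ≤ t₁)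
    (h12 : t₁ ≤ t₂) (h2 : t₂ < T₀) :
    IntegrableOn D (Icc t₁ t₂) ∧ e t₂ + ∫ t in t₁..t₂, D t ≤ e t₁ := by
  have htriv : ∀ t, IntegrableOn D (Icc t t) ∧ e t + ∫ t in t..t, D t ≤ e t := fun t => by simp
  have key : ∀ n : ℕ, ∀ t₂, t₁ ≤ t₂ → t₂ < T₀ → δ₀ ^ n * (T₀ - t₁) ≤ T₀ - t₂ →
      IntegrableOn D (Icc t₁ t₂) ∧ e t₂ + ∫ t in t₁..t₂, D t ≤ e t₁ := by
    intro n
    induction n with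
    | zero =>
      intro t₂ h12 h2 hn
      rw [pow_zero, one_mul] at hn
      obtain rfl : t₁ = t₂ := by linarith
      exact htriv _
    | succ n ih =>
      intro t₂ h12 h2 hn
      set t' := max t₁ (T₀ - (T₀ - t₂) / δ₀) with ht'
      have hle : T₀ - t₂ ≤ (T₀ - t₂) / δ₀ := by
        rw [le_div_iff₀ hδ₀]
        exact mul_le_of_le_one_right (by linarith) hδ₁.le
      have h3 : t' ≤ t₂ := max_le h12 (by linarith)
      have h4 : t₁ ≤ t' := le_max_left _ _
      have h5 : δ₀ * (T₀ - t') ≤ T₀ - t₂ := by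
        have : T₀ - t' ≤ (T₀ - t₂) / δ₀ := by
          have := le_max_right t₁ (T₀ - (T₀ - t₂) / δ₀)
          linarith
        rw [le_div_iff₀ hδ₀] at this
        linarith
      have h6 : δ₀ ^ n * (T₀ - t₁) ≤ T₀ - t' := by
        have h7 : δ₀ ^ n * (T₀ - t₁) ≤ T₀ - t₁ :=
          mul_le_of_le_one_left (by linarith) (pow_le_one₀ hδ₀.le hδ₁.le)
        have h8 : δ₀ ^ n * (T₀ - t₁) ≤ (T₀ - t₂) / δ₀ := by
          rw [le_div_iff₀ hδ₀]
          rw [pow_succ] at hn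
          linarith
        rcases max_choice t₁ (T₀ - (T₀ - t₂) / δ₀) with h9 | h9 <;> rw [ht', h9] <;> linarith
      obtain ⟨i1, k1⟩ := ih t' h4 (h3.trans_lt h2) h6
      have h9 : IntegrableOn D (Icc t' t₂) ∧ e t₂ + ∫ t in t'..t₂, D t ≤ e t' := by
        rcases eq_or_lt_of_le h3 with h10 | h10
        · rw [h10]; exact htriv _
        · exact h t' t₂ (h1.trans h4) h10 h2 h5
      obtain ⟨i2, k2⟩ := h9
      have hi : IntegrableOn D (Icc t₁ t₂) := by
        rw [← Set.Icc_union_Icc_eq_Icc h4 h3]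
        exact i1.union i2
      refine ⟨hi, ?_⟩
      rw [← intervalIntegral.integral_add_adjacent_intervals
        (i1.mono_set (by rw [Set.uIcc_of_le h4])).intervalIntegrable
        (i2.mono_set (by rw [Set.uIcc_of_le h3])).intervalIntegrable]
      linarith
  obtain ⟨n, hn⟩ := exists_pow_lt_of_lt_one (show 0 < (T₀ - t₂) / (T₀ - t₁) by
    have : 0 < T₀ - t₂ := by linarith
    have : 0 < T₀ - t₁ := by linarith
    positivity) hδ₁
  refine key n t₂ h12 h2 ?_
  rw [lt_div_iff₀ (by linarith)] at hn
  exact hn.le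

section Pointwise

variable {p β τ Γ A g2 R U V Ψ K : ℝ}

theorem neg_le_edens (hp : 1 < p) (hβ : β * (p - 1) = 2) (hτ : 0 < τ) (hτ1 : τ ≤ 1) (hΓ0 : 0 ≤ Γ)
    (hΓ1 : Γ ≤ 1) (hK : 0 ≤ K) (hR : R ^ 2 ≤ τ ^ 2 * g2) (hΨ : |Ψ| ≤ K * ((1 + |U| ^ p) * |U|)) :
    -((2 * K + 1) * (τ ^ (-(2 * β)) + τ ^ 2 * (|U| ^ p * |U|))) ≤ edens β Γ τ A g2 R U Ψ := by
  have hβ0 : 0 < β := by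
    by_contra h
    nlinarith
  have hpow : |U| ^ (p + 1) = |U| ^ p * |U| := by
    rw [Real.rpow_add_one' (abs_nonneg _) (by linarith)]
  have h1 := rpow_subcritical (U := U) (e := 1) (γ := 1) hτ hτ1 hβ zero_le_one hp.le (by linarith)
  have h0 := rpow_subcritical (U := U) (e := 0) (γ := 0) hτ hτ1 hβ le_rfl (by linarith)
    (by nlinarith)
  rw [hpow] at h0 h1
  rw [zero_add, Real.rpow_one, Real.rpow_zero, one_pow, one_mul] at h0
  rw [Real.rpow_one, show (1 : ℝ) + 1 = 2 by norm_num, Real.rpow_two, sq_abs] at h1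
  have h2 := le_of_mul_le_mul_left h1 (by positivity)
  set X := τ ^ (-(2 * β)) + τ ^ 2 * (|U| ^ p * |U|) with hX
  have hX1 : τ ^ 2 * (|U| ^ p * |U|) ≤ X := le_add_of_nonneg_left (by positivity)
  have h3 : τ ^ 2 * Ψ ≤ 2 * K * X := by
    calc τ ^ 2 * Ψ ≤ τ ^ 2 * (K * ((1 + |U| ^ p) * |U|)) := by
          gcongr
          exact (le_abs_self _).trans hΨ
      _ = K * (τ ^ 2 * |U| + τ ^ 2 * (|U| ^ p * |U|)) := by ring
      _ ≤ K * (X + X) := by gcongr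
      _ = 2 * K * X := by ring
  have h4 : Γ * U * A ≤ 1 / 2 * A ^ 2 + 1 / 2 * X := by
    have h5 : (Γ * U) ^ 2 ≤ X := by
      rw [mul_pow]
      refine le_trans ?_ h2
      exact mul_le_of_le_one_left (sq_nonneg _) (pow_le_one₀ hΓ0 hΓ1)
    nlinarith [sq_nonneg (Γ * U - A)]
  have h5 : 0 ≤ 1 / 2 * β * (β + 1) * U ^ 2 := by positivity
  have h6 : 0 ≤ X := by positivity
  simp only [edens]
  linarith

theorem abs_edens_add_le (hβ : 0 ≤ β) (hτ : 0 ≤ τ) (hτ1 : τ ≤ 1) (hΓ0 : 0 ≤ Γ) (hΓ1 : Γ ≤ 1)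
    (hg : 0 ≤ g2) (hR : R ^ 2 ≤ τ ^ 2 * g2) (hA : τ * V = A + R + β * U) :
    |edens β Γ τ A g2 R U Ψ + τ ^ 2 * Ψ| ≤ (4 + β + 4 * β ^ 2) * (U ^ 2 + g2 + V ^ 2) := by
  have hτ2 : τ ^ 2 ≤ 1 := pow_le_one₀ hτ hτ1
  have hg' : τ ^ 2 * g2 ≤ g2 := mul_le_of_le_one_left hg hτ2
  have hg0 : 0 ≤ τ ^ 2 * g2 := by positivity
  have hV : τ ^ 2 * V ^ 2 ≤ V ^ 2 := mul_le_of_le_one_left (sq_nonneg _) hτ2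
  have hA2 : A ^ 2 ≤ 3 * (V ^ 2 + g2 + β ^ 2 * U ^ 2) := by
    obtain rfl : A = τ * V - R - β * U := by linarith
    nlinarith [sq_nonneg (τ * V + R), sq_nonneg (τ * V + β * U), sq_nonneg (R - β * U)]
  have hΓ : |Γ * U * A| ≤ 1 / 2 * U ^ 2 + 1 / 2 * A ^ 2 := by
    rw [mul_assoc, abs_mul, abs_of_nonneg hΓ0]
    calc Γ * |U * A| ≤ 1 * |U * A| := by gcongr
      _ ≤ _ := by
        rw [one_mul, abs_mul]
        nlinarith [sq_nonneg (|U| - |A|), sq_abs U, sq_abs A]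
  have h0 : 0 ≤ β * g2 := by positivity
  have h1 : 0 ≤ β * V ^ 2 := by positivity
  have h2 : 0 ≤ β * U ^ 2 := by positivity
  have h3 : 0 ≤ β ^ 2 * g2 := by positivity
  have h4 : 0 ≤ β ^ 2 * V ^ 2 := by positivity
  have h5 : 0 ≤ β ^ 2 * U ^ 2 := by positivity
  have := abs_le.1 hΓ
  have := sq_nonneg R
  have := sq_nonneg A
  have := sq_nonneg U
  have := sq_nonneg V
  simp only [edens]
  rw [abs_le]
  constructor <;> nlinarith

end Pointwise

section Setting

/-- The constants in the energy estimates. -/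
structure Constants (N : ℕ) (p q M α β γ τ₀ C : ℝ) : Prop where
  alpha_pos : 0 < α
  alpha_eq : 2 * α = 2 * β - (N - 1)
  beta_eq : β * (p - 1) = 2
  gamma_pos : 0 < γ
  one_lt : 1 < p
  q_nonneg : 0 ≤ q
  q_lt : q < p
  M_pos : 0 < M
  tau_le : τ₀ ≤ 1
  C_nonneg : 0 ≤ C

/-- The setting of the energy estimates. -/
structure Setting (p q M : ℝ) (f g : ℝ → ℝ) (T u₀ u₁ : Sp N → ℝ) (u v : ℝ → Sp N → ℝ)
    (G : ℝ → Sp N → Sp N) (x₀ : Sp N) (α β γ C τ₀ δ₀ : ℝ) : Prop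
    extends Constants N p q M α β γ τ₀ C where
  continuous_f : Continuous f
  continuous_g : Continuous g
  growth_f : ∀ a, |f a| ≤ M * (1 + |a| ^ q)
  growth_g : ∀ a, |g a| ≤ M * (1 + |a|)
  sol : IsSolution p f g T u₀ u₁ u v G
  pos : 0 < δ₀
  lt_one : δ₀ < 1
  subset : cone x₀ (T x₀) δ₀ ⊆ influenceDomain T
  decay : DecayBound N α β γ p f g τ₀ C

/-- The constant of the correction term in the energy. -/
def corrB (N : ℕ) (p γ C : ℝ) : ℝ :=
  C * expW p γ 1 * volume.real (ball (0 : Sp N) 1) / (2 * γ)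

theorem Constants.beta_pos (h : Constants N p q M α β γ τ₀ C) : 0 < β := by
  have := h.one_lt
  have := h.beta_eq
  by_contra h
  nlinarith

theorem Constants.corrB_nonneg (h : Constants N p q M α β γ τ₀ C) : 0 ≤ corrB N p γ C := by
  have := h.C_nonneg
  have := h.gamma_pos
  have := expW_pos p γ 1
  unfold corrB
  positivity

namespace Setting

variable (H : Setting p q M f g T u₀ u₁ u v G x₀ α β γ C τ₀ δ₀)
include H

theorem isPrimitive :
    IsPrimitive p (1 + 2 * M) (potential p f) fun x => |x| ^ (p - 1) * x + f x :=
  isPrimitive_potential H.one_lt H.q_nonneg H.q_lt H.continuous_f H.M_pos.le H.growth_f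

theorem onCone (hT : T₀ ≤ T x₀) {t : ℝ} (ht : 0 ≤ t) (ht' : t < T₀) :
    OnCone p f g T u₀ u₁ u v G T₀ t (T₀ - δ₀ * (T₀ - t)) x₀ := by
  have h1 : 0 < δ₀ * (T₀ - t) := mul_pos H.pos (by linarith)
  have h2 : δ₀ * (T₀ - t) < 1 * (T₀ - t) := mul_lt_mul_of_pos_right H.lt_one (by linarith)
  exact H.sol.onCone H.one_lt H.q_nonneg H.q_lt H.M_pos H.continuous_f H.continuous_g H.growth_f
    H.growth_g H.pos H.subset hT ht (by linarith) (by linarith) (by linarith)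

/-- The energy inequality. -/
theorem energy_le {δ : ℝ} (hδ : 0 < δ) (hT : T₀ ≤ T x₀) {t₁ t₂ : ℝ} (h0 : 0 ≤ t₁)
    (hτ : T₀ - t₁ ≤ τ₀) (h12 : t₁ ≤ t₂) (h2 : t₂ < T₀) :
    IntegrableOn (lightD α β δ T₀ x₀ u v G) (Icc t₁ t₂) ∧
    corrE α p β γ (corrB N p γ C) T₀ f x₀ u v G t₂ + ∫ t in t₁..t₂, lightD α β δ T₀ x₀ u v G t
      ≤ corrE α p β γ (corrB N p γ C) T₀ f x₀ u v G t₁ := by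
  refine chain_windows H.pos H.lt_one (s := t₁) (fun r₁ r₂ h3 h4 h5 h6 => ?_) le_rfl h12 h2
  have hc := H.sol.onCone H.one_lt H.q_nonneg H.q_lt H.M_pos H.continuous_f H.continuous_g
    H.growth_f H.growth_g H.pos H.subset hT (h0.trans h3) h4 h5 h6
  refine hc.energy_window H.alpha_pos H.alpha_eq H.beta_eq H.gamma_pos H.isPrimitive H.decay
    H.C_nonneg (by linarith) H.tau_le hδ (le_of_eq ?_) le_rfl h4.le le_rfl
  have := H.gamma_pos
  rw [corrB]
  field_simp

theorem corrE_anti (hT : T₀ ≤ T x₀) {t₁ t₂ : ℝ} (h0 : 0 ≤ t₁)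
    (hτ : T₀ - t₁ ≤ τ₀) (h12 : t₁ ≤ t₂) (h2 : t₂ < T₀) :
    corrE α p β γ (corrB N p γ C) T₀ f x₀ u v G t₂
      ≤ corrE α p β γ (corrB N p γ C) T₀ f x₀ u v G t₁ := by
  have h3 := (H.energy_le zero_lt_one hT h0 hτ h12 h2).2
  have h4 : 0 ≤ ∫ t in t₁..t₂, lightD α β 1 T₀ x₀ u v G t :=
    intervalIntegral.integral_nonneg h12 fun t ht =>
      lightD_nonneg H.alpha_pos zero_lt_one (ht.2.trans_lt h2)
  linarith

/-- A lower bound of the energy at times of integrability. -/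
theorem neg_le_lightE (hT : T₀ ≤ T x₀) {t : ℝ} (ht : 0 ≤ t) (ht' : t < T₀) (hτ : T₀ - t ≤ 1)
    (hi : IntegrableOn (fun x => |u t x| ^ p * |u t x|) (closedBall x₀ (T₀ - t)))
    (hS : (T₀ - t) * ∫ x in closedBall x₀ (T₀ - t), |u t x| ^ p * |u t x| ≤ 1) :
    -((2 * (1 + 2 * M) + 1) * (volume.real (ball (0 : Sp N) 1) + 1))
      ≤ lightE α p β γ T₀ f x₀ u v G t := by
  have hτ0 : 0 < T₀ - t := by linarith
  have hK : (0 : ℝ) ≤ 1 + 2 * M := by linarith [H.M_pos]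
  have hc := H.onCone hT ht ht'
  have hm : t ∈ Icc t (T₀ - δ₀ * (T₀ - t)) := ⟨le_rfl, hc.lt.le⟩
  have hI := hc.integrable_slice_enerD H.alpha_pos H.alpha_eq H.isPrimitive γ hm
  set V := volume.real (ball (0 : Sp N) 1) with hV
  set S := ∫ x in closedBall x₀ (T₀ - t), |u t x| ^ p * |u t x| with hSdef
  set k := 2 * (1 + 2 * M) + 1 with hk
  have hk0 : 0 ≤ k := by positivity
  have hfin : volume (ball x₀ (T₀ - t)) < ⊤ := measure_ball_lt_top
  have hi' := hi.mono_set (ball_subset_closedBall (x := x₀) (ε := T₀ - t))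
  have hSle : ∫ x in ball x₀ (T₀ - t), |u t x| ^ p * |u t x| ≤ S :=
    setIntegral_mono_set hi (.of_forall fun x => by positivity)
      ball_subset_closedBall.eventuallyLE
  have i2 : IntegrableOn (fun x => -(k * ((T₀ - t) ^ (-(2 * β))
      + (T₀ - t) ^ 2 * (|u t x| ^ p * |u t x|)))) (ball x₀ (T₀ - t)) :=
    (((integrableOn_const (C := (T₀ - t) ^ (-(2 * β))) hfin.ne).add
      (hi'.const_mul ((T₀ - t) ^ 2))).const_mul k).neg
  have hmono : ∫ x in ball x₀ (T₀ - t), -(k * ((T₀ - t) ^ (-(2 * β))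
      + (T₀ - t) ^ 2 * (|u t x| ^ p * |u t x|))) ≤ ∫ x in ball x₀ (T₀ - t),
        coneW α T₀ x₀ (t, x) * enerD p β γ T₀ f x₀ u v G (t, x) := by
    refine setIntegral_mono_on i2 (hI.mono_measure (Measure.restrict_mono
      ball_subset_closedBall le_rfl)) measurableSet_ball fun x hx => ?_
    have hr : ‖x - x₀‖ < T₀ - t := by rwa [mem_ball, dist_eq_norm] at hx
    have hr0 : 0 ≤ rvar T₀ x₀ (t, x) := by
      rw [rvar, sub_nonneg, div_le_one (by positivity)]
      gcongr
    have hR := sq_radial_le (T₀ := T₀) (x₀ := x₀) (G := G) (z := (t, x)) hτ0.ne'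
    have h1 := neg_le_edens (A := wvel β T₀ x₀ u v G (t, x)) (U := u t x) H.one_lt H.beta_eq hτ0 hτ
      (Real.rpow_nonneg hτ0.le γ) (Real.rpow_le_one hτ0.le hτ H.gamma_pos.le) hK
      (hR.trans (mul_le_of_le_one_left (by positivity) (by linarith)))
      (H.isPrimitive.bound' (by linarith [H.one_lt]) (u t x))
    have h2 : 0 ≤ k * ((T₀ - t) ^ (-(2 * β)) + (T₀ - t) ^ 2 * (|u t x| ^ p * |u t x|)) := by
      positivity
    have h3 := mul_le_mul_of_nonneg_left h1 (coneW_nonneg (α := α) (T₀ := T₀) (x₀ := x₀)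
      (z := (t, x)))
    have h4 := (le_abs_self _).trans (abs_coneW_le (T₀ := T₀) (x₀ := x₀) H.alpha_pos (t, x))
    have h5 := mul_le_of_le_one_left h2 h4
    refine le_trans ?_ h3
    linarith
  have hval : ∫ x in ball x₀ (T₀ - t), -(k * ((T₀ - t) ^ (-(2 * β))
      + (T₀ - t) ^ 2 * (|u t x| ^ p * |u t x|))) = -(k * ((T₀ - t) ^ (-(2 * β)) * ((T₀ - t) ^ N * V)
      + (T₀ - t) ^ 2 * ∫ x in ball x₀ (T₀ - t), |u t x| ^ p * |u t x|)) := by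
    rw [integral_neg, integral_const_mul, integral_add (f := fun _ => (T₀ - t) ^ (-(2 * β)))
      (integrableOn_const hfin.ne) (hi'.const_mul _), setIntegral_const, integral_const_mul, measureReal_ball_sp x₀ hτ0,
      smul_eq_mul, mul_comm ((T₀ - t) ^ (-(2 * β)))]
  rw [hval] at hmono
  have hP : 0 ≤ (T₀ - t) ^ (2 * α - 1) := by positivity
  have e1 : (T₀ - t) ^ (2 * α - 1) * ((T₀ - t) ^ (-(2 * β)) * (T₀ - t) ^ N) = 1 := by
    rw [← Real.rpow_natCast, ← Real.rpow_add hτ0, ← Real.rpow_add hτ0,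
      show 2 * α - 1 + (-(2 * β) + (N : ℝ)) = 0 by linarith [H.alpha_eq], Real.rpow_zero]
  have e2 : (T₀ - t) ^ (2 * α - 1) * (T₀ - t) ^ 2 ≤ T₀ - t := by
    rw [← Real.rpow_natCast, ← Real.rpow_add hτ0]
    calc _ ≤ (T₀ - t) ^ (1 : ℝ) := Real.rpow_le_rpow_of_exponent_ge hτ0 hτ (by
          push_cast; linarith [H.alpha_pos])
      _ = _ := Real.rpow_one _
  have hS0 : 0 ≤ ∫ x in ball x₀ (T₀ - t), |u t x| ^ p * |u t x| :=
    integral_nonneg fun x => by positivity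
  calc -(k * (V + 1)) ≤ -(k * (V + (T₀ - t) ^ (2 * α - 1) * (T₀ - t) ^ 2
        * ∫ x in ball x₀ (T₀ - t), |u t x| ^ p * |u t x|)) := by
        have h6 : (T₀ - t) ^ (2 * α - 1) * (T₀ - t) ^ 2
            * ∫ x in ball x₀ (T₀ - t), |u t x| ^ p * |u t x| ≤ 1 := by
          refine le_trans ?_ hS
          gcongr
        have := mul_le_mul_of_nonneg_left (add_le_add_right h6 V) hk0
        linarith
    _ = (T₀ - t) ^ (2 * α - 1) * -(k * ((T₀ - t) ^ (-(2 * β)) * ((T₀ - t) ^ N * V)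
      + (T₀ - t) ^ 2 * ∫ x in ball x₀ (T₀ - t), |u t x| ^ p * |u t x|)) := by
        linear_combination k * V * e1
    _ ≤ _ := mul_le_mul_of_nonneg_left hmono hP

/-- The lower bound of the corrected energy. -/
def _root_.PerturbedWave.lowC (N : ℕ) (p γ M : ℝ) : ℝ :=
  expW p γ 1 * ((2 * (1 + 2 * M) + 1) * (volume.real (ball (0 : Sp N) 1) + 1))

theorem lowC_nonneg : 0 ≤ lowC N p γ M := by
  have := expW_pos p γ 1
  have := H.M_pos
  unfold lowC
  positivity

theorem neg_le_corrE_of_lt (hT : T₀ < T x₀) {t₁ : ℝ} (h0 : 0 ≤ t₁) (hτ : T₀ - t₁ ≤ τ₀)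
    (h2 : t₁ < T₀) : -lowC N p γ M ≤ corrE α p β γ (corrB N p γ C) T₀ f x₀ u v G t₁ := by
  set r := (T x₀ - T₀) / δ₀ with hr
  have hr0 : 0 < r := div_pos (by linarith) H.pos
  have hT0 : 0 ≤ T₀ := by linarith
  have hbel : CylBelow T 0 T₀ x₀ r := ⟨le_rfl, fun x hx => by
    have h1 : (T₀, x) ∈ cone x₀ (T x₀) δ₀ := by
      rw [mem_closedBall, dist_eq_norm] at hx
      refine ⟨fun h => ?_, hT0, ?_⟩
      · have := congrArg Prod.fst h
        simp only at this
        linarith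
      · have := mul_le_mul_of_nonneg_left hx H.pos.le
        rw [hr, mul_div_cancel₀ _ H.pos.ne'] at this
        show T₀ ≤ T x₀ - δ₀ * ‖x - x₀‖
        linarith
    exact (H.subset h1).2⟩
  have hpw := (H.sol.cylIntegrable H.one_lt H.continuous_f H.continuous_g hbel hT0).powIntegrable
    H.one_lt H.q_nonneg H.q_lt H.M_pos H.growth_f H.growth_g |>.powU
  have hS := integrableOn_slice hpw
  have hae := ae_integrable_slice hpw
  beta_reduce at hS hae
  set S := fun t => ∫ x in closedBall x₀ r, |u t x| ^ p * |u t x| with hSdef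
  set s := max t₁ (T₀ - r) with hs
  have hsT : s < T₀ := max_lt h2 (by linarith)
  have hst : t₁ ≤ s := le_max_left _ _
  have hex : ∃ t ∈ Ioo s T₀, IntegrableOn (fun x => |u t x| ^ p * |u t x|)
      (closedBall x₀ r) ∧ (T₀ - t) * S t ≤ 1 := by
    by_contra! hcon
    have h3 : IntervalIntegrable (fun t => (t - T₀)⁻¹) volume s T₀ := by
      rw [intervalIntegrable_iff_integrableOn_Ioo_of_le hsT.le]
      refine (hS.mono_set (t := Icc 0 T₀) fun t ht => ⟨?_, ht.2.le⟩).mono' (by fun_prop) ?_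
      · linarith [ht.1]
      have h4 : ∀ᵐ t ∂(𝓛 (Ioo s T₀)),
          Integrable (fun x => |u t x| ^ p * |u t x|) (𝓛 (closedBall x₀ r)) :=
        ae_restrict_of_ae_restrict_of_subset (t := Icc 0 T₀)
          (fun t ht => ⟨by linarith [ht.1], ht.2.le⟩) hae
      filter_upwards [h4, ae_restrict_mem measurableSet_Ioo] with t h5 h6
      have h7 := hcon t h6 h5
      have h8 : 0 < T₀ - t := by linarith [h6.2]
      rw [← neg_sub T₀ t, inv_neg, norm_neg, norm_inv, norm_of_nonneg h8.le,
        inv_le_iff_one_le_mul₀' h8]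
      exact h7.le
    rw [intervalIntegrable_sub_inv_iff] at h3
    rcases h3 with h3 | h3
    · linarith
    · exact h3 Set.right_mem_uIcc
  obtain ⟨t, ht, hi, hle⟩ := hex
  have hsub : closedBall x₀ (T₀ - t) ⊆ closedBall x₀ r :=
    closedBall_subset_closedBall (by linarith [ht.1, le_max_right t₁ (T₀ - r)])
  have htT : 0 < T₀ - t := by linarith [ht.2]
  have hτ1 : T₀ - t ≤ 1 := by linarith [ht.1, H.tau_le]
  have hl := H.neg_le_lightE hT.le (t := t) (by linarith [ht.1]) ht.2 hτ1 (hi.mono_set hsub)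
    (le_trans (mul_le_mul_of_nonneg_left (setIntegral_mono_set hi
      (.of_forall fun x => by positivity) hsub.eventuallyLE) htT.le) hle)
  have h3 := H.corrE_anti hT.le h0 hτ (by linarith [ht.1] : t₁ ≤ t) ht.2
  refine le_trans ?_ h3
  have h4 := expW_le H.one_lt H.gamma_pos htT.le hτ1
  have h5 := expW_pos p γ (T₀ - t)
  have h6 : 0 ≤ corrB N p γ C * (T₀ - t) ^ (2 * γ) := by
    have := H.corrB_nonneg
    positivity
  have h7 := mul_le_mul_of_nonneg_left hl h5.le
  have h8 : 0 ≤ (2 * (1 + 2 * M) + 1) * (volume.real (ball (0 : Sp N) 1) + 1) := by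
    have := H.M_pos
    positivity
  have h9 := mul_le_mul_of_nonneg_right h4 h8
  rw [corrE, lowC]
  linarith

end Setting

end Setting

/-- The quadratic part of the energy density is controlled by the local norm. -/
theorem abs_coneW_mul_enerD_add_le (hα : 0 < α) (hβ : 0 ≤ β) (hγ : 0 ≤ γ) (ht : t < T₀)
    (hτ : T₀ - t ≤ 1) (x : Sp N) :
    |coneW α T₀ x₀ (t, x) * (enerD p β γ T₀ f x₀ u v G (t, x)
        + (T₀ - t) ^ 2 * potential p f (u t x))|
      ≤ (4 + β + 4 * β ^ 2) * (u t x ^ 2 + ‖G t x‖ ^ 2 + v t x ^ 2) := by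
  have hτ0 : 0 < T₀ - t := by linarith
  rcases lt_or_ge ‖x - x₀‖ (T₀ - t) with h | h
  · have hr0 : 0 ≤ rvar T₀ x₀ (t, x) := by
      rw [rvar, sub_nonneg, div_le_one (by positivity)]
      gcongr
    have hR := sq_radial_le (T₀ := T₀) (x₀ := x₀) (G := G) (z := (t, x)) hτ0.ne'
    have h1 := abs_edens_add_le (Ψ := potential p f (u t x)) hβ hτ0.le hτ (Real.rpow_nonneg hτ0.le γ)
      (Real.rpow_le_one hτ0.le hτ hγ) (sq_nonneg ‖G t x‖)
      (hR.trans (mul_le_of_le_one_left (by positivity) (by linarith)))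
      (mul_vel_eq (T₀ := T₀) (x₀ := x₀) (u := u) (v := v) (G := G) (β := β) (t, x))
    rw [abs_mul]
    calc _ ≤ 1 * _ := mul_le_mul_of_nonneg_right (abs_coneW_le hα _) (abs_nonneg _)
      _ ≤ _ := by rw [one_mul]; exact h1
  · rw [coneW_eq_zero hα ht h, zero_mul, abs_zero]
    positivity

theorem aestronglyMeasurable_enerD {m : Measure (Sp N)} (hΨ : Continuous (potential p f))
    (hu : AEStronglyMeasurable (u t) m) (hv : AEStronglyMeasurable (v t) m)
    (hG : AEStronglyMeasurable (G t) m) :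
    AEStronglyMeasurable (fun x => enerD p β γ T₀ f x₀ u v G (t, x)) m := by
  have hR : AEStronglyMeasurable (fun x => radial x₀ G (t, x)) m :=
    hG.inner (continuous_id.sub continuous_const).aestronglyMeasurable
  have hA : AEStronglyMeasurable (fun x => wvel β T₀ x₀ u v G (t, x)) m :=
    ((hv.const_mul (T₀ - t)).sub hR).sub (hu.const_mul β)
  have hp := hΨ.comp_aestronglyMeasurable hu
  exact ((((((hA.pow 2).const_mul (1 / 2)).add ((hG.norm.pow 2).const_mul
    (1 / 2 * (T₀ - t) ^ 2))).sub ((hR.pow 2).const_mul (1 / 2))).add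
    ((hu.pow 2).const_mul (1 / 2 * β * (β + 1)))).sub (hp.const_mul ((T₀ - t) ^ 2))).sub
    ((hu.const_mul ((T₀ - t) ^ γ)).mul hA)

theorem coneW_mono (hα : 0 < α) {θ : ℝ} (ht : t < θ) (hθ : θ ≤ T₀) (x : Sp N) :
    coneW α θ x₀ (t, x) ≤ coneW α T₀ x₀ (t, x) := by
  refine Real.rpow_le_rpow (le_max_right _ _) (max_le_max ?_ le_rfl) hα.le
  have h1 : 0 < θ - t := by linarith
  simp only [rvar]
  gcongr

theorem tendsto_coneW_mul_enerD (hα : 0 < α) (ht : t < T₀) (x : Sp N) :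
    Tendsto (fun θ => coneW α θ x₀ (t, x) * enerD p β γ θ f x₀ u v G (t, x)) (𝓝 T₀)
      (𝓝 (coneW α T₀ x₀ (t, x) * enerD p β γ T₀ f x₀ u v G (t, x))) := by
  have h0 : T₀ - t ≠ 0 := by linarith
  have h1 : ContinuousAt (fun θ => θ - t) T₀ := by fun_prop
  have h2 : ContinuousAt (fun θ => (θ - t) ^ γ) T₀ := h1.rpow_const (Or.inl h0)
  have h3 : ContinuousAt (fun θ => coneW α θ x₀ (t, x)) T₀ :=
    (continuous_posW hα).continuousAt.comp
      (continuousAt_const.sub (continuousAt_const.div (h1.pow 2) (by positivity)))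
  have h4 : ContinuousAt (fun θ => enerD p β γ θ f x₀ u v G (t, x)) T₀ := by
    have h5 : ContinuousAt (fun θ => wvel β θ x₀ u v G (t, x)) T₀ := by
      unfold wvel scal
      fun_prop
    exact (((((continuousAt_const.mul (h5.pow 2)).add ((continuousAt_const.mul (h1.pow 2)).mul
      continuousAt_const)).sub continuousAt_const).add continuousAt_const).sub
      ((h1.pow 2).mul continuousAt_const)).sub ((h2.mul continuousAt_const).mul h5)
  exact h3.mul h4

namespace Setting

variable (H : Setting p q M f g T u₀ u₁ u v G x₀ α β γ C τ₀ δ₀)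
include H

theorem tendsto_corrE (hT : T₀ ≤ T x₀) (h0 : 0 ≤ t) (hτ : T₀ - t ≤ τ₀) (ht : t < T₀) (B : ℝ) :
    Tendsto (fun θ => corrE α p β γ B θ f x₀ u v G t) (𝓝[<] T₀)
      (𝓝 (corrE α p β γ B T₀ f x₀ u v G t)) := by
  have hτ0 : T₀ - t ≠ 0 := by linarith
  have hc := H.onCone hT h0 ht
  have hm : t ∈ Icc t (T₀ - δ₀ * (T₀ - t)) := ⟨le_rfl, hc.lt.le⟩
  obtain ⟨hu, hG, hv⟩ := hc.l2
  replace hu := hu.mem t hm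
  replace hG := hG.mem t hm
  replace hv := hv.mem t hm
  have hK : (0 : ℝ) ≤ 1 + 2 * M := by linarith [H.M_pos]
  have hint : Tendsto (fun θ => ∫ x in closedBall x₀ (T₀ - t),
      coneW α θ x₀ (t, x) * enerD p β γ θ f x₀ u v G (t, x)) (𝓝[<] T₀)
      (𝓝 (∫ x in closedBall x₀ (T₀ - t),
        coneW α T₀ x₀ (t, x) * enerD p β γ T₀ f x₀ u v G (t, x))) := by
    refine tendsto_integral_filter_of_dominated_convergence (G := ℝ) (fun x =>
      (4 + β + 4 * β ^ 2) * (u t x ^ 2 + ‖G t x‖ ^ 2 + v t x ^ 2)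
        + (1 + 2 * M) * (coneW α T₀ x₀ (t, x) * ((1 + |u t x| ^ p) * |u t x|))) ?_ ?_ ?_ ?_
    · refine .of_forall fun θ => ?_
      exact ((measurable_coneW H.alpha_pos).comp measurable_prodMk_left).aestronglyMeasurable.mul
        (aestronglyMeasurable_enerD H.isPrimitive.continuous hu.1 hv.1 hG.1)
    · filter_upwards [Ioo_mem_nhdsLT ht] with θ hθ
      refine .of_forall fun x => ?_
      have hθ1 : θ - t ≤ 1 := by linarith [hθ.2, H.tau_le]
      have hθ0 : 0 < θ - t := by linarith [hθ.1]
      have h1 := abs_coneW_mul_enerD_add_le (p := p) (f := f) (x₀ := x₀) (u := u) (v := v) (G := G)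
        H.alpha_pos H.beta_pos.le H.gamma_pos.le hθ.1 hθ1 x
      have h2 : |coneW α θ x₀ (t, x) * ((θ - t) ^ 2 * potential p f (u t x))|
          ≤ (1 + 2 * M) * (coneW α T₀ x₀ (t, x) * ((1 + |u t x| ^ p) * |u t x|)) := by
        rw [abs_mul, abs_mul, abs_of_nonneg coneW_nonneg, abs_of_nonneg (sq_nonneg (θ - t)),
          mul_left_comm]
        have h3 := H.isPrimitive.bound' (by linarith [H.one_lt]) (u t x)
        have h4 := coneW_mono (x₀ := x₀) H.alpha_pos hθ.1 hθ.2.le x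
        have h5 : (θ - t) ^ 2 ≤ 1 := pow_le_one₀ hθ0.le hθ1
        calc _ ≤ 1 * (coneW α T₀ x₀ (t, x) * ((1 + 2 * M) * ((1 + |u t x| ^ p) * |u t x|))) := by
              have := coneW_nonneg (α := α) (T₀ := θ) (x₀ := x₀) (z := (t, x))
              gcongr
              exact coneW_nonneg
          _ = _ := by ring
      rw [norm_eq_abs]
      calc _ = |coneW α θ x₀ (t, x) * (enerD p β γ θ f x₀ u v G (t, x)
            + (θ - t) ^ 2 * potential p f (u t x))
            - coneW α θ x₀ (t, x) * ((θ - t) ^ 2 * potential p f (u t x))| := by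
            congr 1; ring
        _ ≤ _ := (abs_sub _ _).trans (add_le_add h1 h2)
    · exact (((hu.integrable_sq.add hG.norm.integrable_sq).add hv.integrable_sq).const_mul _).add
        ((hc.integrable_slice_pow H.alpha_pos H.alpha_eq hm).const_mul _)
    · exact .of_forall fun x =>
        (tendsto_coneW_mul_enerD H.alpha_pos ht x).mono_left nhdsWithin_le_nhds
  have hl : Tendsto (fun θ => θ - t) (𝓝[<] T₀) (𝓝 (T₀ - t)) :=
    (tendsto_id.sub_const t).mono_left nhdsWithin_le_nhds
  have hlight : Tendsto (fun θ => (θ - t) ^ (2 * α - 1) * ∫ x in closedBall x₀ (T₀ - t),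
      coneW α θ x₀ (t, x) * enerD p β γ θ f x₀ u v G (t, x)) (𝓝[<] T₀)
      (𝓝 ((T₀ - t) ^ (2 * α - 1) * ∫ x in closedBall x₀ (T₀ - t),
        coneW α T₀ x₀ (t, x) * enerD p β γ T₀ f x₀ u v G (t, x))) :=
    (hl.rpow_const (Or.inl hτ0)).mul hint
  have h := (((continuous_expW (p := p) H.gamma_pos).tendsto _).comp hl).mul hlight |>.add
    ((hl.rpow_const (p := 2 * γ) (Or.inl hτ0)).const_mul B)
  have key : ∀ θ ∈ Set.Ioc t T₀, corrE α p β γ B θ f x₀ u v G t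
      = expW p γ (θ - t) * ((θ - t) ^ (2 * α - 1) * ∫ x in closedBall x₀ (T₀ - t),
      coneW α θ x₀ (t, x) * enerD p β γ θ f x₀ u v G (t, x)) + B * (θ - t) ^ (2 * γ) := by
    intro θ hθ
    rw [corrE, lightE, setIntegral_light (T₀ := θ) (t := t) (by linarith [hθ.2])]
    intro x hx
    rw [coneW_eq_zero H.alpha_pos hθ.1 hx, zero_mul]
  rw [key T₀ ⟨ht, le_rfl⟩]
  refine h.congr' ?_
  filter_upwards [Ioo_mem_nhdsLT ht] with θ hθ
  exact (key θ ⟨hθ.1, hθ.2.le⟩).symm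

theorem neg_le_corrE (hT : T₀ ≤ T x₀) (h0 : 0 ≤ t) (hτ : T₀ - t ≤ τ₀) (ht : t < T₀) :
    -lowC N p γ M ≤ corrE α p β γ (corrB N p γ C) T₀ f x₀ u v G t := by
  refine ge_of_tendsto (H.tendsto_corrE hT h0 hτ ht _) ?_
  filter_upwards [Ioo_mem_nhdsLT ht] with θ hθ
  exact H.neg_le_corrE_of_lt (hθ.2.trans_le hT) h0 (by linarith [hθ.2]) hθ.1

end Setting

theorem exists_neg_potential_le (hp : 1 < p) (hq : 0 ≤ q) (hqp : q < p) (hM : 0 < M) :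
    ∃ K, 0 ≤ K ∧ ∀ f : ℝ → ℝ, Continuous f → (∀ a, |f a| ≤ M * (1 + |a| ^ q)) →
      ∀ a, -potential p f a ≤ K * (1 + a ^ 2) := by
  have hε : 0 < 1 / (p + 1) := by
    have : 0 < p + 1 := by linarith
    positivity
  obtain ⟨K, hK, h⟩ := exists_absorb (q := q + 1) (p := p + 1) (by linarith) (by linarith) hM hε
  refine ⟨M + K, by positivity, fun f hf hb a => ?_⟩
  have h1 := (isPrimitive_primitive hf hM.le hb).bound' hq a
  have h2 := h |a| (abs_nonneg a)
  rw [Real.rpow_add_one' (abs_nonneg a) (by linarith : q + 1 ≠ 0)] at h2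
  have h3 : |a| ≤ 1 + a ^ 2 := by nlinarith [sq_abs a, sq_nonneg (|a| - 1)]
  have h4 := mul_le_mul_of_nonneg_left h3 hM.le
  have h5 : 0 ≤ K * a ^ 2 := by positivity
  have h6 := neg_le_of_abs_le h1
  rw [potential]
  linarith

/-- The upper bound of the corrected energy. -/
def upE (N : ℕ) (p α β γ C K τ n : ℝ) : ℝ :=
  expW p γ 1 * (τ ^ (2 * α - 1) * ((4 + β + 4 * β ^ 2 + K) * n ^ 2
    + K * volume.real (ball (0 : Sp N) 1))) + corrB N p γ C

theorem upE_nonneg (h : Constants N p q M α β γ τ₀ C) (hK : 0 ≤ K) {τ n : ℝ} (hτ : 0 ≤ τ) :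
    0 ≤ upE N p α β γ C K τ n := by
  have := h.corrB_nonneg
  have := h.beta_pos
  have := expW_pos p γ 1
  unfold upE
  positivity

namespace Setting

variable (H : Setting p q M f g T u₀ u₁ u v G x₀ α β γ C τ₀ δ₀)
include H

theorem integrableOn_localNorm (hT : T₀ ≤ T x₀) (h0 : 0 ≤ t) (ht : t < T₀) :
    IntegrableOn (fun x => u t x ^ 2 + ‖G t x‖ ^ 2 + v t x ^ 2)
      (closedBall x₀ ((T₀ - t) / δ₀)) := by
  have h1 := H.sol.memLp t h0 (closedBall x₀ ((T₀ - t) / δ₀)) (isCompact_closedBall _ _)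
    fun x hx => ?_
  · obtain ⟨hu, hG, hv⟩ := h1
    exact (hu.integrable_sq.add hG.norm.integrable_sq).add hv.integrable_sq
  · have h1 : (t, x) ∈ cone x₀ (T x₀) δ₀ := by
      rw [mem_closedBall, dist_eq_norm] at hx
      refine ⟨fun h => ?_, h0, ?_⟩
      · have := congrArg Prod.fst h
        simp only at this
        linarith
      · have := mul_le_mul_of_nonneg_left hx H.pos.le
        rw [mul_div_cancel₀ _ H.pos.ne'] at this
        show t ≤ T x₀ - δ₀ * ‖x - x₀‖
        linarith
    exact (H.subset h1).2

theorem corrE_le (hK : 0 ≤ K) (hKf : ∀ a, -potential p f a ≤ K * (1 + a ^ 2)) (hT : T₀ ≤ T x₀)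
    (h0 : 0 ≤ t) (hτ : T₀ - t ≤ τ₀) (ht : t < T₀) :
    corrE α p β γ (corrB N p γ C) T₀ f x₀ u v G t
      ≤ upE N p α β γ C K (T₀ - t) (localNorm u v G t x₀ ((T₀ - t) / δ₀)) := by
  have hτ0 : 0 < T₀ - t := by linarith
  have hτ1 : T₀ - t ≤ 1 := hτ.trans H.tau_le
  have hβ := H.beta_pos
  have hc := H.onCone hT h0 ht
  have hm : t ∈ Icc t (T₀ - δ₀ * (T₀ - t)) := ⟨le_rfl, hc.lt.le⟩
  have hI := hc.integrable_slice_enerD H.alpha_pos H.alpha_eq H.isPrimitive γ hm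
  have hn := H.integrableOn_localNorm hT h0 ht
  set Q := fun x => u t x ^ 2 + ‖G t x‖ ^ 2 + v t x ^ 2 with hQ
  have hQ0 : ∀ x, 0 ≤ Q x := fun x => by positivity
  set k := 4 + β + 4 * β ^ 2 with hk
  have hk0 : 0 ≤ k := by positivity
  set V := volume.real (ball (0 : Sp N) 1) with hV
  have hsub : ball x₀ (T₀ - t) ⊆ ball x₀ ((T₀ - t) / δ₀) :=
    ball_subset_ball (by rw [le_div_iff₀ H.pos]; nlinarith [H.lt_one])
  have hn1 := hn.mono_set (ball_subset_closedBall (x := x₀))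
  have hn2 := hn1.mono_set hsub
  have hfin : volume (ball x₀ (T₀ - t)) < ⊤ := measure_ball_lt_top
  have hnorm : ∫ x in ball x₀ (T₀ - t), Q x
      ≤ localNorm u v G t x₀ ((T₀ - t) / δ₀) ^ 2 := by
    rw [localNorm, Real.sq_sqrt (integral_nonneg hQ0)]
    exact setIntegral_mono_set hn1 (.of_forall hQ0) hsub.eventuallyLE
  have hmono : ∫ x in ball x₀ (T₀ - t), coneW α T₀ x₀ (t, x)
      * enerD p β γ T₀ f x₀ u v G (t, x) ≤ ∫ x in ball x₀ (T₀ - t), ((k + K) * Q x + K) := by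
    refine integral_mono (hI.mono_measure (Measure.restrict_mono
      ball_subset_closedBall le_rfl)) ((hn2.const_mul (k + K)).add
        (integrableOn_const hfin.ne)) fun x => ?_
    have h1 := (le_abs_self _).trans (abs_coneW_mul_enerD_add_le (p := p) (f := f) (x₀ := x₀)
      (u := u) (v := v) (G := G) H.alpha_pos hβ.le H.gamma_pos.le ht hτ1 x)
    have h2 : coneW α T₀ x₀ (t, x) * ((T₀ - t) ^ 2 * -potential p f (u t x)) ≤ K * Q x + K := by
      have h3 : 0 ≤ K * (1 + u t x ^ 2) := by positivity
      calc _ ≤ coneW α T₀ x₀ (t, x) * ((T₀ - t) ^ 2 * (K * (1 + u t x ^ 2))) := by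
            refine mul_le_mul_of_nonneg_left (mul_le_mul_of_nonneg_left (hKf _) (sq_nonneg _))
              coneW_nonneg
        _ ≤ 1 * (1 * (K * (1 + u t x ^ 2))) := by
            refine mul_le_mul ((le_abs_self _).trans (abs_coneW_le H.alpha_pos _))
              (mul_le_mul_of_nonneg_right (pow_le_one₀ hτ0.le hτ1) h3) (by positivity) zero_le_one
        _ ≤ K * Q x + K := by
            have : K * u t x ^ 2 ≤ K * Q x := by
              refine mul_le_mul_of_nonneg_left ?_ hK
              simp only [hQ]
              linarith [sq_nonneg ‖G t x‖, sq_nonneg (v t x)]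
            linarith
    linarith
  have hval : ∫ x in ball x₀ (T₀ - t), ((k + K) * Q x + K)
      = (k + K) * (∫ x in ball x₀ (T₀ - t), Q x) + K * ((T₀ - t) ^ N * V) := by
    rw [integral_add (hn2.const_mul _) (integrableOn_const hfin.ne), integral_const_mul,
      setIntegral_const, measureReal_ball_sp x₀ hτ0, smul_eq_mul, mul_comm K]
  have hpow : (T₀ - t) ^ N * V ≤ V :=
    mul_le_of_le_one_left measureReal_nonneg (pow_le_one₀ hτ0.le hτ1)
  have hX : ∫ x in ball x₀ (T₀ - t), coneW α T₀ x₀ (t, x)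
      * enerD p β γ T₀ f x₀ u v G (t, x)
      ≤ (k + K) * localNorm u v G t x₀ ((T₀ - t) / δ₀) ^ 2 + K * V := by
    rw [hval] at hmono
    refine hmono.trans ?_
    gcongr
  have he := expW_pos p γ (T₀ - t)
  have he1 := expW_le H.one_lt H.gamma_pos hτ0.le hτ1
  have hB := H.corrB_nonneg
  rw [corrE, lightE, upE]
  refine add_le_add ?_ (mul_le_of_le_one_right hB (Real.rpow_le_one hτ0.le hτ1
    (by linarith [H.gamma_pos])))
  calc _ ≤ expW p γ (T₀ - t) * ((T₀ - t) ^ (2 * α - 1)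
        * ((k + K) * localNorm u v G t x₀ ((T₀ - t) / δ₀) ^ 2 + K * V)) := by gcongr
    _ ≤ _ := by gcongr

/-- The bounds of the energy and of the dissipation. -/
theorem light_bounds (hK : 0 ≤ K) (hKf : ∀ a, -potential p f a ≤ K * (1 + a ^ 2))
    (hT : T₀ ≤ T x₀) {t₃ : ℝ} (h0 : 0 ≤ t₃) (hτ : T₀ - t₃ ≤ τ₀) {n : ℝ}
    (hn : n = localNorm u v G t₃ x₀ ((T₀ - t₃) / δ₀)) :
    (∀ t, t₃ ≤ t → t < T₀ →
      -(lowC N p γ M + corrB N p γ C) ≤ lightE α p β γ T₀ f x₀ u v G t ∧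
      lightE α p β γ T₀ f x₀ u v G t ≤ upE N p α β γ C K (T₀ - t₃) n) ∧
    ∀ δ, 0 < δ → ∀ t₁ t₂, t₃ ≤ t₁ → t₁ ≤ t₂ → t₂ < T₀ →
      IntegrableOn (lightD α β δ T₀ x₀ u v G) (Icc t₁ t₂) ∧
      ∫ t in t₁..t₂, lightD α β δ T₀ x₀ u v G t
        ≤ upE N p α β γ C K (T₀ - t₃) n + lowC N p γ M := by
  have hB := H.corrB_nonneg
  have hL := H.lowC_nonneg
  have up : ∀ t, t₃ ≤ t → t < T₀ → corrE α p β γ (corrB N p γ C) T₀ f x₀ u v G t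
      ≤ upE N p α β γ C K (T₀ - t₃) n := fun t h1 h2 => by
    rw [hn]
    exact (H.corrE_anti hT h0 hτ h1 h2).trans
      (H.corrE_le hK hKf hT h0 hτ (h1.trans_lt h2))
  have low : ∀ t, t₃ ≤ t → t < T₀ → -lowC N p γ M
      ≤ corrE α p β γ (corrB N p γ C) T₀ f x₀ u v G t := fun t h1 h2 =>
    H.neg_le_corrE hT (h0.trans h1) (by linarith) h2
  refine ⟨fun t h1 h2 => ?_, fun δ hδ t₁ t₂ h1 h12 h2 => ?_⟩
  · have hτ0 : 0 < T₀ - t := by linarith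
    have k1 := up t h1 h2
    have k2 := low t h1 h2
    have he := one_le_expW H.one_lt H.gamma_pos hτ0.le
    have hr : (T₀ - t) ^ (2 * γ) ≤ 1 := Real.rpow_le_one hτ0.le (by linarith [H.tau_le])
      (by linarith [H.gamma_pos])
    have hr0 : 0 ≤ (T₀ - t) ^ (2 * γ) := by positivity
    rw [corrE] at k1 k2
    have hb1 : corrB N p γ C * (T₀ - t) ^ (2 * γ) ≤ corrB N p γ C := mul_le_of_le_one_right hB hr
    have hb0 : 0 ≤ corrB N p γ C * (T₀ - t) ^ (2 * γ) := by positivity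
    have hup := upE_nonneg (n := n) H.toConstants hK (by linarith : 0 ≤ T₀ - t₃)
    constructor
    · rcases le_total 0 (lightE α p β γ T₀ f x₀ u v G t) with h | h
      · linarith
      · have := mul_le_mul_of_nonneg_right he (neg_nonneg.2 h)
        linarith
    · rcases le_total 0 (lightE α p β γ T₀ f x₀ u v G t) with h | h
      · have := mul_le_mul_of_nonneg_right he h
        linarith
      · linarith
  · obtain ⟨i, k⟩ := H.energy_le hδ hT (h0.trans h1) (by linarith) h12 h2
    exact ⟨i, by linarith [up t₁ h1 (h12.trans_lt h2), low t₂ (h1.trans h12) h2]⟩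

end Setting

theorem measurableEmbedding_similarity (x₀ : Sp N) (hτ : 0 < τ) :
    MeasurableEmbedding fun y : Sp N => x₀ + τ • y :=
  (measurableEmbedding_addLeft x₀).comp (measurableEmbedding_const_smul₀ hτ.ne')

theorem map_similarity (x₀ : Sp N) (hτ : 0 < τ) :
    (𝓛 (ball (0 : Sp N) 1)).map (fun y => x₀ + τ • y)
      = ofReal (τ ^ N)⁻¹ • 𝓛 (ball x₀ τ) := by
  have hpre : (fun y : Sp N => x₀ + τ • y) ⁻¹' ball x₀ τ = ball 0 1 := by
    ext y
    rw [Set.mem_preimage, mem_ball, dist_eq_norm, add_sub_cancel_left, norm_smul,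
      norm_of_nonneg hτ.le, mem_ball_zero_iff]
    exact ⟨fun h => by nlinarith, fun h => by nlinarith⟩
  have hmap : (volume : Measure (Sp N)).map (fun y => x₀ + τ • y)
      = ofReal (τ ^ N)⁻¹ • volume := by
    have h1 := Measure.map_addHaar_smul (volume : Measure (Sp N)) hτ.ne'
    have h2 : (fun y : Sp N => x₀ + τ • y) = (fun z => x₀ + z) ∘ (fun y => τ • y) := rfl
    rw [h2, ← Measure.map_map (measurable_const_add x₀) (measurable_const_smul τ), h1,
      Measure.map_smul, map_add_left_eq_self, finrank_euclideanSpace_fin,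
      abs_of_nonneg (by positivity)]
  rw [← hpre, ← (measurableEmbedding_similarity x₀ hτ).restrict_map, hmap, Measure.restrict_smul]

theorem integral_similarity (x₀ : Sp N) (hτ : 0 < τ) (h : Sp N → ℝ) :
    ∫ y in ball (0 : Sp N) 1, h (x₀ + τ • y)
      = (τ ^ N)⁻¹ * ∫ x in ball x₀ τ, h x := by
  rw [← (measurableEmbedding_similarity x₀ hτ).integral_map, map_similarity x₀ hτ,
    integral_smul_measure, ENNReal.toReal_ofReal (by positivity), smul_eq_mul]

theorem lintegral_similarity (x₀ : Sp N) (hτ : 0 < τ) (h : Sp N → ℝ≥0∞) :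
    ∫⁻ y in ball (0 : Sp N) 1, h (x₀ + τ • y)
      = ofReal (τ ^ N)⁻¹ * ∫⁻ x in ball x₀ τ, h x := by
  rw [← (measurableEmbedding_similarity x₀ hτ).lintegral_map, map_similarity x₀ hτ,
    lintegral_smul_measure, smul_eq_mul]

theorem integrableOn_similarity (x₀ : Sp N) (hτ : 0 < τ) {h : Sp N → ℝ}
    (hi : IntegrableOn h (ball x₀ τ)) :
    IntegrableOn (fun y => h (x₀ + τ • y)) (ball (0 : Sp N) 1) := by
  have h1 := (measurableEmbedding_similarity x₀ hτ).integrable_map_iff (g := h)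
    (μ := 𝓛 (ball (0 : Sp N) 1))
  refine h1.1 ?_
  rw [map_similarity x₀ hτ]
  exact hi.smul_measure ENNReal.ofReal_ne_top

theorem integral_add_mul_add_mul {X : Type*} [MeasurableSpace X] {m : Measure X} {h k l : X → ℝ}
    (hh : Integrable h m) (hk : Integrable k m) (hl : Integrable l m) (c d : ℝ) :
    ∫ x, (h x + c * k x + d * l x) ∂m = ∫ x, h x ∂m + c * ∫ x, k x ∂m + d * ∫ x, l x ∂m := by
  have h1 := integral_add (hh.add (hk.const_mul c)) (hl.const_mul d)
  have h2 := integral_add hh (hk.const_mul c)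
  simp only [Pi.add_apply] at h1
  rw [h1, h2, integral_const_mul, integral_const_mul]

theorem exp_neg_mul_div (s c p : ℝ) : exp (-(c * s / (p - 1))) = exp (-s) ^ (c / (p - 1)) := by
  rw [← Real.exp_mul]
  congr 1
  ring

theorem rvar_similarity (T₀ : ℝ) (x₀ : Sp N) (s : ℝ) (y : Sp N) :
    rvar T₀ x₀ (T₀ - exp (-s), x₀ + exp (-s) • y) = 1 - ‖y‖ ^ 2 := by
  have := Real.exp_pos (-s)
  rw [rvar, add_sub_cancel_left, sub_sub_cancel, norm_smul, norm_of_nonneg this.le]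
  field_simp

theorem coneW_similarity (T₀ : ℝ) (x₀ : Sp N) (s : ℝ) {y : Sp N} (hy : ‖y‖ < 1) :
    coneW (alpha N p) T₀ x₀ (T₀ - exp (-s), x₀ + exp (-s) • y) = rho p y := by
  rw [coneW, rvar_similarity, posW_of_pos (by nlinarith [norm_nonneg y]), rho]

theorem simWs_eq (s : ℝ) (y : Sp N) : simWs p x₀ T₀ u v G s y = exp (-s) ^ (2 / (p - 1))
    * wvel (2 / (p - 1)) T₀ x₀ u v G (T₀ - exp (-s), x₀ + exp (-s) • y) := by
  rw [simWs, exp_neg_mul_div, wvel, scal]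
  simp only [add_sub_cancel_left, sub_sub_cancel, inner_smul_right]
  rw [real_inner_comm]
  ring

theorem simW_eq (s : ℝ) (y : Sp N) : simW p x₀ T₀ u s y
    = exp (-s) ^ (2 / (p - 1)) * u (T₀ - exp (-s)) (x₀ + exp (-s) • y) := by
  rw [simW, exp_neg_mul_div]

theorem mul_rho_simW (s : ℝ) {y : Sp N} (hy : ‖y‖ < 1) :
    simW p x₀ T₀ u s y * simWs p x₀ T₀ u v G s y * rho p y
      = exp (-s) ^ (2 * (2 / (p - 1))) * (coneW (alpha N p) T₀ x₀
        (T₀ - exp (-s), x₀ + exp (-s) • y)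
        * (u (T₀ - exp (-s)) (x₀ + exp (-s) • y)
        * wvel (2 / (p - 1)) T₀ x₀ u v G (T₀ - exp (-s), x₀ + exp (-s) • y))) := by
  rw [coneW_similarity T₀ x₀ s hy, simW_eq, simWs_eq, two_mul, Real.rpow_add (Real.exp_pos _)]
  ring

theorem primitive_simW (s : ℝ) {y : Sp N} (hy : ‖y‖ < 1) :
    primitive f (exp (2 * s / (p - 1)) * simW p x₀ T₀ u s y) * rho p y
      = coneW (alpha N p) T₀ x₀ (T₀ - exp (-s), x₀ + exp (-s) • y)
        * primitive f (u (T₀ - exp (-s)) (x₀ + exp (-s) • y)) := by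
  rw [coneW_similarity T₀ x₀ s hy, simW, ← mul_assoc, ← Real.exp_add, add_neg_cancel, Real.exp_zero,
    one_mul, mul_comm]

theorem density₀_sim (hp : 1 < p) (s : ℝ) {y : Sp N} (hy : ‖y‖ < 1) :
    density₀ p (simW p x₀ T₀ u s) (simWs p x₀ T₀ u v G s) (simGrad p x₀ T₀ G s) y
      = exp (-s) ^ (2 * (2 / (p - 1))) * (coneW (alpha N p) T₀ x₀
          (T₀ - exp (-s), x₀ + exp (-s) • y) * enerD p (2 / (p - 1)) γ T₀ f x₀ u v G
            (T₀ - exp (-s), x₀ + exp (-s) • y)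
        + exp (-s) ^ 2 * (coneW (alpha N p) T₀ x₀
            (T₀ - exp (-s), x₀ + exp (-s) • y)
          * primitive f (u (T₀ - exp (-s)) (x₀ + exp (-s) • y)))
        + exp (-s) ^ γ * (coneW (alpha N p) T₀ x₀
            (T₀ - exp (-s), x₀ + exp (-s) • y)
          * (u (T₀ - exp (-s)) (x₀ + exp (-s) • y)
          * wvel (2 / (p - 1)) T₀ x₀ u v G
            (T₀ - exp (-s), x₀ + exp (-s) • y)))) := by
  have hp1 : p - 1 ≠ 0 := by linarith
  have hτ := Real.exp_pos (-s)
  rw [density₀, coneW_similarity T₀ x₀ s hy, simW_eq, simWs_eq, simGrad, exp_neg_mul_div]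
  simp only [enerD, edens, radial, potential, sub_sub_cancel, add_sub_cancel_left, norm_smul,
    inner_smul_right, abs_mul]
  generalize exp (-s) = τ at *
  have e1 : |τ ^ (2 / (p - 1))| ^ (p + 1) = (τ ^ (2 / (p - 1))) ^ 2 * τ ^ 2 := by
    rw [abs_of_pos (by positivity), ← Real.rpow_mul hτ.le, ← Real.rpow_natCast, ← Real.rpow_natCast,
      ← Real.rpow_mul hτ.le, ← Real.rpow_add hτ]
    congr 1
    push_cast
    field_simp
    ring
  have e2 : τ ^ (2 * (2 / (p - 1))) = (τ ^ (2 / (p - 1))) ^ 2 := by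
    rw [mul_comm, Real.rpow_mul hτ.le, Real.rpow_two]
  have e3 : (p + 1) / (p - 1) ^ 2 = 1 / 2 * (2 / (p - 1)) * (2 / (p - 1) + 1) := by
    field_simp
    ring
  rw [Real.mul_rpow (abs_nonneg _) (abs_nonneg _), e1, e2, e3, norm_of_nonneg (by positivity),
    real_inner_comm y]
  ring

namespace Setting

theorem isPrimitive_mono (hq : 0 ≤ q) (hqp : q ≤ p) {Φ φ : ℝ → ℝ} {K : ℝ} (h : IsPrimitive q K Φ φ) :
    IsPrimitive p (2 * K) Φ φ where
  deriv := h.deriv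
  cont := h.cont
  zero := h.zero
  nonneg := by linarith [h.nonneg]
  bound a := by
    have := mul_le_mul_of_nonneg_left (one_add_rpow_le hq hqp |a| (abs_nonneg a)) h.nonneg
    linarith [h.bound a]

variable (H : Setting p q M f g T u₀ u₁ u v G x₀ (alpha N p) (2 / (p - 1)) (gam p q) C τ₀ δ₀)
include H

/-- The energy in similarity variables. -/
theorem energy_eq (hT : T₀ ≤ T x₀) (hs : exp (-s) ≤ T₀) :
    EnergyConverges p f s (simW p x₀ T₀ u s) (simWs p x₀ T₀ u v G s) (simGrad p x₀ T₀ G s) ∧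
    energy p q f s (simW p x₀ T₀ u s) (simWs p x₀ T₀ u v G s) (simGrad p x₀ T₀ G s)
      = lightE (alpha N p) p (2 / (p - 1)) (gam p q) T₀ f x₀ u v G (T₀ - exp (-s)) := by
  have hp := H.one_lt
  have hp1 : p - 1 ≠ 0 := by linarith
  have hτ := Real.exp_pos (-s)
  have hc := H.onCone hT (by linarith : 0 ≤ T₀ - exp (-s)) (by linarith)
  have hm : T₀ - exp (-s) ∈ Icc (T₀ - exp (-s))
    (T₀ - δ₀ * (T₀ - (T₀ - exp (-s)))) := ⟨le_rfl, hc.lt.le⟩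
  obtain ⟨hu, hG, hv⟩ := hc.l2
  have I1 := hc.integrable_slice_enerD H.alpha_pos H.alpha_eq H.isPrimitive (gam p q) hm
  have I2 := hc.integrable_slice_prim H.alpha_pos H.alpha_eq (isPrimitive_mono H.q_nonneg H.q_lt.le
    (isPrimitive_primitive H.continuous_f H.M_pos.le H.growth_f)) hm
  have I3 := hc.integrable_weighted H.alpha_pos hu (L2Cont.wvel hu hv hG (2 / (p - 1)) T₀) hm 1
  simp only [one_mul] at I3
  have hsub : ball x₀ (exp (-s))
      ⊆ closedBall x₀ (T₀ - (T₀ - exp (-s))) := by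
    rw [sub_sub_cancel]
    exact ball_subset_closedBall
  replace I1 := I1.mono_measure (Measure.restrict_mono hsub le_rfl)
  replace I2 := I2.mono_measure (Measure.restrict_mono hsub le_rfl)
  replace I3 := I3.mono_measure (Measure.restrict_mono hsub le_rfl)
  have J1 := integrableOn_similarity x₀ hτ (((I1.add (I2.const_mul (exp (-s) ^ 2))).add
    (I3.const_mul (exp (-s) ^ gam p q))).const_mul (exp (-s) ^ (2 * (2 / (p - 1)))))
  have J2 := integrableOn_similarity x₀ hτ I2
  have J3 := integrableOn_similarity x₀ hτ (I3.const_mul (exp (-s) ^ (2 * (2 / (p - 1)))))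
  have e1 : ∀ y ∈ ball (0 : Sp N) 1, _ := fun y hy =>
    density₀_sim (p := p) (x₀ := x₀) (T₀ := T₀) (u := u) (v := v) (G := G) (f := f)
      (γ := gam p q) hp s (mem_ball_zero_iff.1 hy)
  have e2 : ∀ y ∈ ball (0 : Sp N) 1, _ := fun y hy =>
    primitive_simW (p := p) (x₀ := x₀) (T₀ := T₀) (u := u) (f := f) s (mem_ball_zero_iff.1 hy)
  have e3 : ∀ y ∈ ball (0 : Sp N) 1, _ := fun y hy =>
    mul_rho_simW (p := p) (x₀ := x₀) (T₀ := T₀) (u := u) (v := v) (G := G) s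
      (mem_ball_zero_iff.1 hy)
  refine ⟨⟨J1.congr_fun (fun y hy => (e1 y hy).symm) measurableSet_ball,
    J2.congr_fun (fun y hy => (e2 y hy).symm) measurableSet_ball,
    J3.congr_fun (fun y hy => (e3 y hy).symm) measurableSet_ball⟩, ?_⟩
  rw [energy, energy₀, termI, termJ, setIntegral_congr_fun measurableSet_ball e1,
    setIntegral_congr_fun measurableSet_ball e2, setIntegral_congr_fun measurableSet_ball e3,
    integral_similarity x₀ hτ (fun x => exp (-s) ^ (2 * (2 / (p - 1)))
      * (coneW (alpha N p) T₀ x₀ (T₀ - exp (-s), x) * enerD p (2 / (p - 1)) (gam p q) T₀ f x₀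
          u v G (T₀ - exp (-s), x)
        + exp (-s) ^ 2 * (coneW (alpha N p) T₀ x₀ (T₀ - exp (-s), x)
          * primitive f (u (T₀ - exp (-s)) x))
        + exp (-s) ^ gam p q * (coneW (alpha N p) T₀ x₀ (T₀ - exp (-s), x)
          * (u (T₀ - exp (-s)) x
          * wvel (2 / (p - 1)) T₀ x₀ u v G (T₀ - exp (-s), x))))),
    integral_similarity x₀ hτ (fun x => coneW (alpha N p) T₀ x₀ (T₀ - exp (-s), x)
          * primitive f (u (T₀ - exp (-s)) x)),
    integral_similarity x₀ hτ (fun x => exp (-s) ^ (2 * (2 / (p - 1)))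
      * (coneW (alpha N p) T₀ x₀ (T₀ - exp (-s), x)
          * (u (T₀ - exp (-s)) x
          * wvel (2 / (p - 1)) T₀ x₀ u v G (T₀ - exp (-s), x)))),
    integral_const_mul, integral_const_mul, integral_add_mul_add_mul I1 I2 I3, lightE,
    sub_sub_cancel]
  have k1 : exp (-(2 * (p + 1) * s / (p - 1)))
      = exp (-s) ^ (2 * (2 / (p - 1))) * exp (-s) ^ 2 := by
    rw [exp_neg_mul_div, ← Real.rpow_natCast, ← Real.rpow_add hτ]
    congr 1
    push_cast
    field_simp
    ring
  have k2 : exp (-(gam p q * s)) = exp (-s) ^ gam p q := by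
    rw [← Real.exp_mul]
    congr 1
    ring
  have k3 : exp (-s) ^ (2 * alpha N p - 1)
      = (exp (-s) ^ N)⁻¹ * exp (-s) ^ (2 * (2 / (p - 1))) := by
    rw [← Real.rpow_natCast, ← Real.rpow_neg hτ.le, ← Real.rpow_add hτ]
    congr 1
    linarith [H.alpha_eq]
  rw [k1, k2, k3]
  ring

end Setting

theorem disW_le_rpow {δ r : ℝ} (hα : 0 < α) (hr : 0 < r) : disW α δ r ≤ α * r ^ (α - 1) := by
  rw [disW]
  split_ifs
  · exact le_rfl
  · positivity

theorem disW_anti {δ δ' r : ℝ} (hα : 0 < α) (hδ : 0 < δ) (h : δ ≤ δ') :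
    disW α δ' r ≤ disW α δ r := by
  by_cases h1 : δ' ≤ r
  · rw [disW, disW, if_pos h1, if_pos (h.trans h1)]
  · rw [disW, if_neg h1]
    exact disW_nonneg hα hδ

theorem iSup_disW {r c : ℝ} (hα : 0 < α) (hr : 0 < r) (hc : 0 ≤ c) :
    ⨆ k : ℕ, ofReal (c * disW α (1 / ((k : ℝ) + 1)) r) = ofReal (c * (α * r ^ (α - 1))) := by
  refine le_antisymm (iSup_le fun k => ENNReal.ofReal_le_ofReal
    (mul_le_mul_of_nonneg_left (disW_le_rpow hα hr) hc)) ?_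
  obtain ⟨k, hk⟩ := exists_nat_one_div_lt hr
  refine le_iSup_of_le k (le_of_eq ?_)
  rw [disW, if_pos hk.le]

namespace Setting

section Slices

variable (H : Setting p q M f g T u₀ u₁ u v G x₀ α β γ C τ₀ δ₀)
include H

theorem integrable_slice_disW (hT : T₀ ≤ T x₀) {t : ℝ} (h0 : 0 ≤ t) (ht : t < T₀) {δ : ℝ}
    (hδ : 0 < δ) : IntegrableOn (fun x => disW α δ (rvar T₀ x₀ (t, x))
      * wvel β T₀ x₀ u v G (t, x) ^ 2) (ball x₀ (T₀ - t)) := by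
  have hc := H.onCone hT h0 ht
  obtain ⟨hu, hG, hv⟩ := hc.l2
  have hA := (L2Cont.wvel hu hv hG β T₀).mem t ⟨le_rfl, hc.lt.le⟩
  refine Integrable.mono_measure ?_ (Measure.restrict_mono ball_subset_closedBall le_rfl)
  refine hA.integrable_sq.bdd_mul (c := α / δ) ((measurable_disW α δ).comp
    (measurable_rvar.comp measurable_prodMk_left)).aestronglyMeasurable
    (.of_forall fun x => ?_)
  rw [norm_of_nonneg (disW_nonneg H.alpha_pos hδ)]
  exact disW_le H.alpha_pos hδ (rvar_le_one _ _ _)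

theorem lightD_anti (hT : T₀ ≤ T x₀) {t : ℝ} (h0 : 0 ≤ t) (ht : t < T₀) {δ δ' : ℝ}
    (hδ : 0 < δ) (h : δ ≤ δ') :
    lightD α β δ' T₀ x₀ u v G t ≤ lightD α β δ T₀ x₀ u v G t := by
  have h1 : 0 < T₀ - t := by linarith
  refine mul_le_mul_of_nonneg_left (setIntegral_mono (H.integrable_slice_disW hT h0 ht
    (hδ.trans_le h)) (H.integrable_slice_disW hT h0 ht hδ) fun x => ?_) (by positivity)
  exact mul_le_mul_of_nonneg_right (disW_anti H.alpha_pos hδ h) (sq_nonneg _)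

theorem lintegral_iSup_lightD (hT : T₀ ≤ T x₀) {t₁ t₂ K : ℝ} (h0 : 0 ≤ t₁)
    (h12 : t₁ ≤ t₂) (h2 : t₂ < T₀)
    (hK : ∀ δ, 0 < δ → IntegrableOn (lightD α β δ T₀ x₀ u v G) (Icc t₁ t₂) ∧
      ∫ t in t₁..t₂, lightD α β δ T₀ x₀ u v G t ≤ K) :
    ∫⁻ t in Icc t₁ t₂, ⨆ k : ℕ,
        ofReal (lightD α β (1 / ((k : ℝ) + 1)) T₀ x₀ u v G t / α)
      ≤ ofReal (K / α) := by
  have hpos : ∀ k : ℕ, (0 : ℝ) < 1 / ((k : ℝ) + 1) := fun k => by positivity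
  have hα := H.alpha_pos
  rw [lintegral_iSup']
  · refine iSup_le fun k => ?_
    obtain ⟨hi, hk⟩ := hK _ (hpos k)
    rw [← ofReal_integral_eq_lintegral_ofReal (hi.div_const α), integral_div]
    · refine ENNReal.ofReal_le_ofReal ?_
      rw [intervalIntegral.integral_of_le h12, ← integral_Icc_eq_integral_Ioc] at hk
      gcongr
    · filter_upwards [ae_restrict_mem measurableSet_Icc] with t ht
      exact div_nonneg (lightD_nonneg hα (hpos k) (ht.2.trans_lt h2)) hα.le
  · exact fun k => ((hK _ (hpos k)).1.div_const α).1.aemeasurable.ennreal_ofReal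
  · filter_upwards [ae_restrict_mem measurableSet_Icc] with t ht
    intro k l hkl
    refine ENNReal.ofReal_le_ofReal (div_le_div_of_nonneg_right
      (H.lightD_anti hT (h0.trans ht.1) (ht.2.trans_lt h2) (hpos l) ?_) hα.le)
    exact one_div_le_one_div_of_le (by positivity) (by gcongr)

end Slices

variable (H : Setting p q M f g T u₀ u₁ u v G x₀ (alpha N p) (2 / (p - 1)) γ C τ₀ δ₀)
include H

theorem lintegral_simWs (hT : T₀ ≤ T x₀) (hs : exp (-s) ≤ T₀) :
    ∫⁻ y in ball (0 : Sp N) 1,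
        ofReal (simWs p x₀ T₀ u v G s y ^ 2 * (rho p y / (1 - ‖y‖ ^ 2)))
      = ofReal |exp (-s)| * ⨆ k : ℕ, ofReal
        (lightD (alpha N p) (2 / (p - 1)) (1 / ((k : ℝ) + 1)) T₀ x₀ u v G (T₀ - exp (-s))
          / alpha N p) := by
  have hτ := Real.exp_pos (-s)
  have hα := H.alpha_pos
  have hpos : ∀ k : ℕ, (0 : ℝ) < 1 / ((k : ℝ) + 1) := fun k => by positivity
  set t := T₀ - exp (-s) with ht
  have h0 : 0 ≤ t := by linarith
  have htT : t < T₀ := by linarith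
  have hTt : T₀ - t = exp (-s) := by rw [ht]; ring
  have e2 : exp (-s) ^ (2 * (2 / (p - 1))) = (exp (-s) ^ (2 / (p - 1))) ^ 2 := by
    rw [mul_comm, Real.rpow_mul hτ.le, Real.rpow_two]
  set c := exp (-s) ^ (2 * (2 / (p - 1))) / alpha N p with hc
  have hc0 : 0 ≤ c := by positivity
  have hint : ∀ k : ℕ, Integrable (fun x => c * (disW (alpha N p) (1 / ((k : ℝ) + 1))
      (rvar T₀ x₀ (t, x)) * wvel (2 / (p - 1)) T₀ x₀ u v G (t, x) ^ 2))
      (𝓛 (ball x₀ (exp (-s)))) := fun k => by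
    have := (H.integrable_slice_disW hT h0 htT (hpos k)).const_mul c
    rwa [hTt] at this
  have e1 : ∀ y ∈ ball (0 : Sp N) 1,
      ofReal (simWs p x₀ T₀ u v G s y ^ 2 * (rho p y / (1 - ‖y‖ ^ 2)))
      = ⨆ k : ℕ, ofReal (c * (disW (alpha N p) (1 / ((k : ℝ) + 1))
        (rvar T₀ x₀ (t, x₀ + exp (-s) • y))
        * wvel (2 / (p - 1)) T₀ x₀ u v G (t, x₀ + exp (-s) • y) ^ 2)) := fun y hy => by
    have hy1 := mem_ball_zero_iff.1 hy
    have hr : 0 < 1 - ‖y‖ ^ 2 := by nlinarith [norm_nonneg y]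
    rw [ht, rvar_similarity, ← ht]
    have h1 := iSup_disW (c := c * wvel (2 / (p - 1)) T₀ x₀ u v G (t, x₀ + exp (-s) • y) ^ 2)
      hα hr (by positivity)
    have h2 : ∀ k : ℕ, c * (disW (alpha N p) (1 / ((k : ℝ) + 1)) (1 - ‖y‖ ^ 2)
        * wvel (2 / (p - 1)) T₀ x₀ u v G (t, x₀ + exp (-s) • y) ^ 2)
        = c * wvel (2 / (p - 1)) T₀ x₀ u v G (t, x₀ + exp (-s) • y) ^ 2
          * disW (alpha N p) (1 / ((k : ℝ) + 1)) (1 - ‖y‖ ^ 2) := fun k => by ring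
    simp only [h2]
    rw [h1, simWs_eq, rho, ← Real.rpow_sub_one hr.ne', mul_pow, ← e2, hc, ht]
    congr 1
    field_simp
  rw [setLIntegral_congr_fun measurableSet_ball e1, lintegral_similarity x₀ hτ (fun x => ⨆ k : ℕ,
    ofReal (c * (disW (alpha N p) (1 / ((k : ℝ) + 1)) (rvar T₀ x₀ (t, x))
        * wvel (2 / (p - 1)) T₀ x₀ u v G (t, x) ^ 2))), lintegral_iSup', ENNReal.mul_iSup,
    ENNReal.mul_iSup]
  · refine iSup_congr fun k => ?_
    rw [← ofReal_integral_eq_lintegral_ofReal (hint k), ← ENNReal.ofReal_mul (by positivity),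
      ← ENNReal.ofReal_mul (abs_nonneg _), integral_const_mul, lightD, hTt]
    · congr 1
      have k3 : exp (-s) ^ (2 * alpha N p - 1)
          = (exp (-s) ^ N)⁻¹ * exp (-s) ^ (2 * (2 / (p - 1))) := by
        rw [← Real.rpow_natCast, ← Real.rpow_neg hτ.le, ← Real.rpow_add hτ]
        congr 1
        linarith [H.alpha_eq]
      rw [k3, abs_of_pos hτ, hc]
      field_simp
    · exact .of_forall fun x => mul_nonneg hc0
        (mul_nonneg (disW_nonneg hα (hpos k)) (sq_nonneg _))
  · exact fun k => (hint k).1.aemeasurable.ennreal_ofReal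
  · refine .of_forall fun x k l hkl => ENNReal.ofReal_le_ofReal ?_
    refine mul_le_mul_of_nonneg_left (mul_le_mul_of_nonneg_right (disW_anti hα (hpos l) ?_)
      (sq_nonneg _)) hc0
    exact one_div_le_one_div_of_le (by positivity) (by gcongr)

/-- The dissipation in similarity variables. -/
theorem lintegral_dissipation_le (hT : T₀ ≤ T x₀) {s₁ s₂ K : ℝ} (hs : exp (-s₁) ≤ T₀)
    (h12 : s₁ ≤ s₂) (hK : ∀ δ, 0 < δ →
      IntegrableOn (lightD (alpha N p) (2 / (p - 1)) δ T₀ x₀ u v G)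
        (Icc (T₀ - exp (-s₁)) (T₀ - exp (-s₂))) ∧
      ∫ t in (T₀ - exp (-s₁))..(T₀ - exp (-s₂)),
        lightD (alpha N p) (2 / (p - 1)) δ T₀ x₀ u v G t ≤ K) :
    ∫⁻ s in Icc s₁ s₂, ∫⁻ y in ball (0 : Sp N) 1,
        ofReal (simWs p x₀ T₀ u v G s y ^ 2 * (rho p y / (1 - ‖y‖ ^ 2)))
      ≤ ofReal (K / alpha N p) := by
  have hmono : ∀ {r s : ℝ}, r ≤ s → T₀ - exp (-r) ≤ T₀ - exp (-s) := fun h =>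
    sub_le_sub_left (Real.exp_le_exp.2 (neg_le_neg h)) _
  rw [setLIntegral_congr_fun measurableSet_Icc fun s hs' => H.lintegral_simWs (s := s) hT
    (by linarith [hmono hs'.1]), ← lintegral_image_eq_lintegral_abs_deriv_mul
      (f := fun s => T₀ - exp (-s)) (f' := fun s => exp (-s)) measurableSet_Icc
      (fun s _ => ?_) (fun r _ s _ h => ?_) (fun t => ⨆ k : ℕ, ofReal
        (lightD (alpha N p) (2 / (p - 1)) (1 / ((k : ℝ) + 1)) T₀ x₀ u v G t / alpha N p))]
  · refine (lintegral_mono_set ?_).trans (H.lintegral_iSup_lightD hT (by linarith) (hmono h12)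
      (by linarith [Real.exp_pos (-s₂)]) hK)
    rintro _ ⟨s, hs', rfl⟩
    exact ⟨hmono hs'.1, hmono hs'.2⟩
  · have := ((hasDerivAt_neg s).exp.const_sub T₀).hasDerivWithinAt (s := Icc s₁ s₂)
    simpa using this
  · have h1 : exp (-r) = exp (-s) := by
      beta_reduce at h
      linarith
    linarith [Real.exp_injective h1]

end Setting

theorem alpha_pos {N : ℕ} (hN : 1 ≤ N) {p : ℝ} (hp : 1 < p)
    (hpc : 2 ≤ N → p < 1 + 4 / ((N : ℝ) - 1)) : 0 < alpha N p := by
  have h1 : 0 < p - 1 := by linarith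
  rw [alpha]
  rcases eq_or_lt_of_le hN with h | h
  · rw [← h]
    simp only [Nat.cast_one, sub_self, zero_div, sub_zero]
    positivity
  · have h2 : (0 : ℝ) < (N : ℝ) - 1 := by
      have : (1 : ℝ) < N := by exact_mod_cast h
      linarith
    have h3 : p - 1 < 4 / ((N : ℝ) - 1) := by linarith [hpc h]
    rw [lt_div_iff₀ h2] at h3
    rw [sub_pos, div_lt_div_iff₀ (by norm_num) h1]
    linarith

theorem exists_constants {N : ℕ} (hN : 1 ≤ N) {p q M : ℝ} (hp : 1 < p)
    (hpc : 2 ≤ N → p < 1 + 4 / ((N : ℝ) - 1)) (hq : 0 ≤ q) (hqp : q < p) (hM : 0 < M) :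
    ∃ τ₀ C, 0 < τ₀ ∧ Constants N p q M (alpha N p) (2 / (p - 1)) (gam p q) τ₀ C ∧
      ∀ f g : ℝ → ℝ, Continuous f → (∀ a, |f a| ≤ M * (1 + |a| ^ q)) →
        (∀ a, |g a| ≤ M * (1 + |a|)) →
        DecayBound N (alpha N p) (2 / (p - 1)) (gam p q) p f g τ₀ C := by
  have hα := alpha_pos hN hp hpc
  have h1 : 0 < p - 1 := by linarith
  have h2 : 0 < p - q := by linarith
  have hγ : 0 < gam p q := lt_min (by norm_num) (div_pos h2 h1)
  have hβ : 2 / (p - 1) * (p - 1) = 2 := div_mul_cancel₀ _ h1.ne'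
  obtain ⟨τ₀, C, k1, k2, k3, k4⟩ := exists_ddens_le' (N := N) hα hp hβ hq hqp hM.le hγ
    (min_le_left _ _) (by
      have := min_le_right (1 / 2) ((p - q) / (p - 1))
      rw [div_mul_eq_mul_div, mul_div_assoc]
      exact mul_le_mul_of_nonneg_left this zero_le_two)
  exact ⟨τ₀, C, k1, ⟨hα, by rw [alpha]; ring, hβ, hγ, hp, hq, hqp, hM, k2, k3⟩, k4⟩

end Wave

end PerturbedWave

end

theorem corollary3p1 (N : ℕ) (hN : 1 ≤ N) (p q M : ℝ) (hp : 1 < p)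
    (hpc : 2 ≤ N → p < 1 + 4 / ((N : ℝ) - 1)) (hq : 0 ≤ q) (hqp : q < p) (hM : 0 < M) :
    ∃ (S₃ C : ℝ) (M₀ : ℝ → ℝ → ℝ),
      ∀ (f g : ℝ → ℝ), LocallyLipschitz f → LocallyLipschitz g →
      (∀ a, |f a| ≤ M * (1 + |a| ^ q)) → (∀ a, |g a| ≤ M * (1 + |a|)) →
      ∀ (T : PerturbedWave.Sp N → ℝ), LipschitzWith 1 T → (∀ x, 0 < T x) →
      ∀ (u₀ u₁ : PerturbedWave.Sp N → ℝ),
      PerturbedWave.MemH1LocUnif u₀ → PerturbedWave.MemL2LocUnif u₁ →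
      ∀ (u v : ℝ → PerturbedWave.Sp N → ℝ) (G : ℝ → PerturbedWave.Sp N → PerturbedWave.Sp N),
      PerturbedWave.IsSolution p f g T u₀ u₁ u v G →
      ∀ (x₀ : PerturbedWave.Sp N) (δ₀ : ℝ), 0 < δ₀ → δ₀ < 1 →
      PerturbedWave.cone x₀ (T x₀) δ₀ ⊆ PerturbedWave.influenceDomain T →
      ∀ T₀ : ℝ, 0 < T₀ → T₀ ≤ T x₀ →
      ∀ s₃ t₃ m : ℝ, s₃ = max S₃ (-Real.log T₀) → t₃ = T₀ - Real.exp (-s₃) →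
      m = M₀ s₃ (PerturbedWave.localNorm u v G t₃ x₀ (Real.exp (-s₃) / δ₀)) →
      (∀ s : ℝ, s₃ ≤ s →
        PerturbedWave.EnergyConverges p f s (PerturbedWave.simW p x₀ T₀ u s)
            (PerturbedWave.simWs p x₀ T₀ u v G s) (PerturbedWave.simGrad p x₀ T₀ G s) ∧
        -C ≤ PerturbedWave.energy p q f s (PerturbedWave.simW p x₀ T₀ u s)
            (PerturbedWave.simWs p x₀ T₀ u v G s) (PerturbedWave.simGrad p x₀ T₀ G s) ∧
        PerturbedWave.energy p q f s (PerturbedWave.simW p x₀ T₀ u s)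
            (PerturbedWave.simWs p x₀ T₀ u v G s) (PerturbedWave.simGrad p x₀ T₀ G s) ≤ m) ∧
      (∀ s₁ s₂ : ℝ, s₃ ≤ s₁ → s₁ ≤ s₂ →
        ∫⁻ s in Set.Icc s₁ s₂, ∫⁻ y in Metric.ball (0 : PerturbedWave.Sp N) 1,
          ENNReal.ofReal (PerturbedWave.simWs p x₀ T₀ u v G s y ^ 2
            * (PerturbedWave.rho p y / (1 - ‖y‖ ^ 2)))
          ≤ ENNReal.ofReal m) := by
  obtain ⟨τ₀, C, hτ₀, hC, hdec⟩ := PerturbedWave.exists_constants hN hp hpc hq hqp hM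
  obtain ⟨K, hK, hKf⟩ := PerturbedWave.exists_neg_potential_le hp hq hqp hM
  refine ⟨-Real.log τ₀, PerturbedWave.lowC N p (PerturbedWave.gam p q) M
    + PerturbedWave.corrB N p (PerturbedWave.gam p q) C, fun s n =>
    (1 + 1 / PerturbedWave.alpha N p) * (PerturbedWave.upE N p (PerturbedWave.alpha N p)
      (2 / (p - 1)) (PerturbedWave.gam p q) C K (Real.exp (-s)) n
      + PerturbedWave.lowC N p (PerturbedWave.gam p q) M), ?_⟩
  intro f g hfl hgl hf hg T _ _ u₀ u₁ _ _ u v G hsol x₀ δ₀ hδ₀ hδ₁ hcone T₀ hT₀ hT s₃ t₃ m hs₃ ht₃ hm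
  have H : PerturbedWave.Setting p q M f g T u₀ u₁ u v G x₀ (PerturbedWave.alpha N p)
      (2 / (p - 1)) (PerturbedWave.gam p q) C τ₀ δ₀ :=
    { hC with
      continuous_f := hfl.continuous
      continuous_g := hgl.continuous
      growth_f := hf
      growth_g := hg
      sol := hsol
      pos := hδ₀
      lt_one := hδ₁
      subset := hcone
      decay := hdec f g hfl.continuous hf hg }
  have hα := H.alpha_pos
  have hL := H.lowC_nonneg
  have hexp : ∀ s, s₃ ≤ s → Real.exp (-s) ≤ τ₀ ∧ Real.exp (-s) ≤ T₀ := fun s hs => by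
    have h1 : -Real.log τ₀ ≤ s := (le_max_left _ _).trans (hs₃.symm.le.trans hs)
    have h2 : -Real.log T₀ ≤ s := (le_max_right _ _).trans (hs₃.symm.le.trans hs)
    exact ⟨(Real.le_log_iff_exp_le hτ₀).1 (by linarith), (Real.le_log_iff_exp_le hT₀).1
      (by linarith)⟩
  have hmono : ∀ {r s : ℝ}, r ≤ s → T₀ - Real.exp (-r) ≤ T₀ - Real.exp (-s) := fun h =>
    sub_le_sub_left (Real.exp_le_exp.2 (neg_le_neg h)) _
  have htτ : T₀ - t₃ = Real.exp (-s₃) := by rw [ht₃]; ring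
  obtain ⟨hlight, hdiss⟩ := H.light_bounds hK (hKf f hfl.continuous hf) hT
    (t₃ := t₃) (by linarith [(hexp s₃ le_rfl).2]) (by linarith [(hexp s₃ le_rfl).1]) rfl
  rw [htτ] at hlight hdiss
  set n := PerturbedWave.localNorm u v G t₃ x₀ (Real.exp (-s₃) / δ₀)
  have hU := PerturbedWave.upE_nonneg (n := n) hC hK (Real.exp_pos (-s₃)).le
  beta_reduce at hm
  set U := PerturbedWave.upE N p (PerturbedWave.alpha N p) (2 / (p - 1)) (PerturbedWave.gam p q) C K
    (Real.exp (-s₃)) n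
  have hUL : 0 ≤ U + PerturbedWave.lowC N p (PerturbedWave.gam p q) M := by linarith
  have hm1 : U + PerturbedWave.lowC N p (PerturbedWave.gam p q) M ≤ m := by
    rw [hm]
    exact le_mul_of_one_le_left hUL (le_add_of_nonneg_right (by positivity))
  have hm2 : (U + PerturbedWave.lowC N p (PerturbedWave.gam p q) M) / PerturbedWave.alpha N p
      ≤ m := by
    rw [hm, div_eq_inv_mul, ← one_div]
    exact mul_le_mul_of_nonneg_right (le_add_of_nonneg_left zero_le_one) hUL
  refine ⟨fun s hs => ?_, fun s₁ s₂ h1 h12 => ?_⟩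
  · obtain ⟨k1, k2⟩ := H.energy_eq hT (hexp s hs).2
    obtain ⟨k3, k4⟩ := hlight (T₀ - Real.exp (-s)) (by rw [ht₃]; exact hmono hs)
      (by linarith [Real.exp_pos (-s)])
    rw [k2]
    exact ⟨k1, k3, by linarith⟩
  · refine (H.lintegral_dissipation_le hT (hexp s₁ h1).2 h12 fun δ hδ => ?_).trans
      (ENNReal.ofReal_le_ofReal hm2)
    exact hdiss δ hδ _ _ (by rw [ht₃]; exact hmono h1) (hmono h12)
      (by linarith [Real.exp_pos (-s₂)])
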